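/- Let $n\ge 4$, let $\mathfrak g$ be the affine Kac–Moody algebra of type $D_n^{(1)}$, $I=\{0,\dots,n\}$, with simple roots $\alpha_i$, simple coroots $h_i$, fundamental weights $\Lambda_i$, null root $\delta$ and weight lattice $P=\bigoplus_{i\in I}\mathbb Z\Lambda_i\oplus\mathbb Z\delta$. Let $\lambda=\sum_{i\in I}a_i\Lambda_i$ with $a_i\in\mathbb Z_{\ge0}$, and let $l=a_0+a_1+2(a_2+\dots+a_{n-2})+a_{n-1}+a_n$ be its level. *Layers.* Blocks of colours $0,\dots,n$ and unit height are stacked in columns of unit depth, following the periodic pattern of rows (from bottom to top) $\{0,1\},2,\dots,n-2,\{n-1,n\},n-2,\dots,2$. The rows $\{0,1\}$ and $\{n-1,n\}$ consist of two blocks of half-unit depth, one in the rear and one in front; the other blocks have unit depth. The rear blocks are $0$ and $n-1$ in the first pattern, $1$ and $n$ in the second. A layer is a stack following one of the patterns in which nothing lies on an incompletely filled row; $c+\delta$ is the layer $c$ with one more cycle (rows are numbered by $\mathbb Z$, so that cycles may also be removed). The $i$-blocks in the rows $2,\dots,n-2$ below a row $\{n-1,n\}$ and above the preceding row $\{0,1\}$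 are *supporting*, those in the rows $n-2,\dots,2$ above it are *covering*; the rows $\{0,1\}$ and $\{n-1,n\}$ are both. A *whole block* is a block of unit depth or a glued pair $01$ or $(n-1)n$. An *$i$-slot* is the top of a layer where an $i$-block may be added. *Slices.* A level-$l$ *pre-slice* is an $l$-tuple $(c_1,\dots,c_l)$ of layers ($c_1$ being in front) following one pattern with $c_1\subset c_2\subset\dots\subset c_l\subset c_1+\delta$. *Splitting* a block of kind $i\in\{01,2,\dots,n-2,(n-1)n\}$ means: if some layers have a covering whole $i$-block at the top and some have a supporting whole $i$-slot at the top, break off the top half of the fore-most among the highest such blocks and put it in the rear-most among the lowest such slots; or the same with covering and supporting exchanged. A level-$l$ *slice* is any result of successively splitting blocks of a pre-slice that allows no more splitting; it is then called a *split form* of that pre-slice. Halves of $01$- and of $(n-1)n$-blocks can be un-split in a unique way, so each of them is an upper or a lower half. *Operators on slices.* Let $2\le i\le n-2$. If the slice $C$ has full $i$-slots both covering and supporting, $\tilde f_iC$ is obtained by putting half an $i$-block in the rear-most of the lowest full covering $i$-slots and another half in the rear-most of the lowest full supporting ones. If it has full $i$-slots of one type only, one half is put in the rear-most of the lowest of them,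 and then the other half in the rear-most of the lowest half-slots of the same type. If it has no full $i$-slot but has half-slots, one half is put in the rear-most of the lowest covering half-slots and one in the rear-most of the lowest supporting half-slots. Otherwise $\tilde f_iC=0$. For $i=0,1$ (resp. $i=n-1,n$): un-split all $01$-blocks (resp. $(n-1)n$-blocks), put an $i$-block in the rear-most of the lowest $i$-slots, and split every possible block of this kind again; $\tilde f_iC=0$ if there is no $i$-slot. The operator $\tilde e_i$ is defined likewise with the $i$-blocks at the top of layers in place of $i$-slots, removing blocks (the upper halves of full blocks, resp. half blocks, when $2\le i\le n-2$) from the fore-most among the highest. Put $\varphi_i(C)=\max\{m\mid\tilde f_i^mC\ne0\}$ and $\varepsilon_i(C)=\max\{m\mid\tilde e_i^mC\ne0\}$. *Walls.* A level-$l$ *Young wall* is a sequence $\mathbf Y=(\mathbf Y(k))_{k\ge0}$ of level-$l$ slices, $\mathbf Y(k+1)$ standing immediately to the left of $\mathbf Y(k)$, where even columns follow the first pattern and odd ones the second, such that in each layer there is no free space to the right of any block. Here, in a row $\{0,1\}$ or $\{n-1,n\}$, a single block of half-unit depth on the left with a broken half on the right is allowed exactly if that half is a lower half; a broken half on the left with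 a single block of half-unit depth on the right is allowed exactly if that half is an upper half; two broken halves in the same row are always allowed; a whole block next to a broken half in the same row on its right is not. It is *proper* if in no layer two different columns of integer height with top of unit depth (that is, two layers without a single block of half-unit depth and without a broken half at the top) have the same height. The columns of the *ground-state wall* $\mathbf Y_\lambda$ all have the following shape; listed from front to rear, with rows counted from $0$ (a row $\{0,1\}$), and each layer being full below its indicated top part: $\min(a_0,a_1)$ layers with a half block in row $0$; $|a_0-a_1|$ layers with a single block of half-unit depth in row $0$, in the rear if $a_1>a_0$ and in front if $a_0>a_1$; $\min(a_0,a_1)$ layers with a half block in row $0$; for $i=2,\dots,n-2$ in this order, $a_i$ layers with a half block in row $i-1$; $\min(a_{n-1},a_n)$ layers with a half block in row $n-2$; $|a_{n-1}-a_n|$ layers with a single block of half-unit depth in row $n-2$, in front if $a_{n-1}>a_n$ and in the rear if $a_n>a_{n-1}$; $\min(a_{n-1},a_n)$ layers with a half block in row $n-2$; and for $i=n-2,\dots,2$ in this order, $a_i$ layers with a half block in row $2n-3-i$. Let $\mathcal P(\lambda)$ be the set of all level-$l$ proper Young walls built on $\mathbf Y_\lambda$, i.e. obtained from $\mathbf Y_\lambda$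 by adding finitely many blocks: only finitely many columns differ from those of $\mathbf Y_\lambda$, and each column is a split form of a pre-slice that contains, layer by layer, a pre-slice of which the corresponding column of $\mathbf Y_\lambda$ is a split form. For $\mathbf Y\in\mathcal P(\lambda)$ and $i\in I$, write under each column $C$ of $\mathbf Y$ first $\varepsilon_i(C)$ letters $1$ and then $\varphi_i(C)$ letters $0$, and successively cancel all pairs $(0,1)$, read from left to right; what remains is the $i$-signature of $\mathbf Y$. Let $\tilde f_i\mathbf Y$ be obtained by applying $\tilde f_i$ to the column of the left-most $0$ of the $i$-signature, $\tilde e_i\mathbf Y$ by applying $\tilde e_i$ to the column of its right-most $1$ (and $0$ if there is no such letter). Let $\varphi_i(\mathbf Y)$ and $\varepsilon_i(\mathbf Y)$ be the numbers of letters $0$ and $1$ in the $i$-signature, and let $\mathrm{wt}(\mathbf Y)=\lambda-\sum_{i\in I}k_i\alpha_i$, where $k_i$ is the number of $i$-blocks that have been added to $\mathbf Y_\lambda$ (a half of a glued pair counting as half a block of each of its two colours). **Proposition.** For all $\mathbf Y\in\mathcal P(\lambda)$ and $i\in I$ the $i$-signature of $\mathbf Y$ is finite, $k_i$ is a non-negative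 integer, and $\tilde e_i\mathbf Y,\tilde f_i\mathbf Y\in\mathcal P(\lambda)\cup\{0\}$. Together with $\tilde e_i,\tilde f_i,\varepsilon_i,\varphi_i$ $(i\in I)$ and $\mathrm{wt}$, the set $\mathcal P(\lambda)$ is a $U_q(\mathfrak g)$-crystal: $\varphi_i(\mathbf Y)=\varepsilon_i(\mathbf Y)+\langle h_i,\mathrm{wt}(\mathbf Y)\rangle$; if $\mathbf Y'=\tilde e_i\mathbf Y\neq0$, then $\mathrm{wt}(\mathbf Y')=\mathrm{wt}(\mathbf Y)+\alpha_i$, $\varepsilon_i(\mathbf Y')=\varepsilon_i(\mathbf Y)-1$ and $\varphi_i(\mathbf Y')=\varphi_i(\mathbf Y)+1$; if $\mathbf Y'=\tilde f_i\mathbf Y\neq0$, then $\mathrm{wt}(\mathbf Y')=\mathrm{wt}(\mathbf Y)-\alpha_i$, $\varepsilon_i(\mathbf Y')=\varepsilon_i(\mathbf Y)+1$ and $\varphi_i(\mathbf Y')=\varphi_i(\mathbf Y)-1$; and $\tilde f_i\mathbf Y=\mathbf Y'$ if and only if $\tilde e_i\mathbf Y'=\mathbf Y$, for $\mathbf Y,\mathbf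 Y'\in\mathcal P(\lambda)$. -/

import Mathlib

/-!
# Level-`l` Young walls of type `D_n^(1)` and affine crystals

Blocks are stacked in columns of unit depth.  One cycle of the stacking pattern has `2 n - 4` rows
of unit height; from bottom to top they hold
`{0,1}, 2, 3, ..., n-2, {n-1,n}, n-2, ..., 3, 2`,
where the rows `{0,1}` and `{n-1,n}` are made of two blocks of half-unit depth, one in the rear and
one in front, and every other row is one block of unit depth.

Rows are numbered by integers, the pattern being continued periodically downwards; a layer contains
everything below its top.  So adding and removing a cycle `δ` is always possible.  Blocks of a Young
wall are counted above the ground level, the bottom of row `0`.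
-/

namespace YoungWallD

open Relation

/-! ### The stacking pattern -/

/-- Number of rows in a cycle. -/
def period (n : ℕ) : ℤ := 2 * (n : ℤ) - 4

/-- Position of the row `r` in its cycle, in `{0, ..., 2 n - 5}`. -/
def pos (n : ℕ) (r : ℤ) : ℕ := (r % period n).toNat

/-- The rows that are made of two blocks of half-unit depth. -/
def IsThin (n : ℕ) (r : ℤ) : Prop := pos n r = 0 ∨ pos n r = n - 2

/-- The kind of whole block that fills row `r`: kind `i`, for `2 ≤ i ≤ n - 2`, is the `i`-block,
kind `1` is the glued pair of a `0`-block and a `1`-block, and kind `n - 1` is the glued pair of an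
`(n-1)`-block and an `n`-block. -/
def kind (n : ℕ) (r : ℤ) : ℕ := if pos n r ≤ n - 2 then pos n r + 1 else 2 * n - 3 - pos n r

/-- The two names of positions in the pattern. -/
inductive Side
  | covering
  | supporting

/-- The other name. -/
def Side.other : Side → Side
  | .covering => .supporting
  | .supporting => .covering

/-- Supporting positions are those closer to the `{n-1,n}`-row above, covering ones are those closer
to the `{n-1,n}`-row below; the rows `{0,1}` and `{n-1,n}` are both. -/
def OnSide (n : ℕ) : Side → ℤ → Prop
  | .covering, r => pos n r = 0 ∨ n - 2 ≤ pos n r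
  | .supporting, r => pos n r ≤ n - 2

/-- Colour of the rear block of a thin row `r` in the column number `k`: in even columns `0` and
`n - 1` are in the rear, in odd columns `1` and `n` are. -/
def rearColor (n k : ℕ) (r : ℤ) : ℕ :=
  if pos n r = 0 then (if Even k then 0 else 1) else (if Even k then n - 1 else n)

/-- Colour of the front block of a thin row `r` in the column number `k`. -/
def frontColor (n k : ℕ) (r : ℤ) : ℕ :=
  if pos n r = 0 then (if Even k then 1 else 0) else (if Even k then n else n - 1)

/-! ### Layers and pre-slices -/

/-- What is present of the first row of a layer that is not full: nothing, only the rear block, only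
the front block, or a broken half (of half-unit height) of the whole block. -/
inductive Top
  | flat
  | rear
  | front
  | half

/-- A layer: all rows below `row` are full, and `top` is what is present of `row`. -/
structure Layer where
  row : ℤ
  top : Top

/-- Only thin rows contain blocks of half-unit depth. -/
def Layer.Valid (n : ℕ) (c : Layer) : Prop :=
  (c.top = Top.rear ∨ c.top = Top.front) → IsThin n c.row

/-- `c ⊂ c'`, for layers without broken blocks: `c'` contains all blocks of `c`. -/
def Layer.Sub (c c' : Layer) : Prop :=
  c.row < c'.row ∨ (c.row = c'.row ∧ (c.top = Top.flat ∨ c.top = c'.top))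

/-- `c + δ`. -/
def Layer.addDelta (n : ℕ) (c : Layer) : Layer := ⟨c.row + period n, c.top⟩

/-- An `l`-tuple of layers; smaller indices are further in front. -/
abbrev Layers (l : ℕ) : Type := Fin l → Layer

/-- Level-`l` pre-slices: `c₁ ⊂ c₂ ⊂ ⋯ ⊂ c_l ⊂ c₁ + δ`, all blocks being unbroken. -/
def IsPreSlice (n : ℕ) {l : ℕ} (C : Layers l) : Prop :=
  (∀ j, (C j).Valid n ∧ (C j).top ≠ Top.half) ∧
    ∀ i j, i ≤ j → (C i).Sub (C j) ∧ (C j).Sub ((C i).addDelta n)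

/-! ### Splitting of blocks, slices -/

/-- The top of the layer is a whole (unbroken) block of kind `t` on the side `s`. -/
def WholeBlock (n : ℕ) (s : Side) (t : ℕ) (c : Layer) : Prop :=
  c.top = Top.flat ∧ kind n (c.row - 1) = t ∧ OnSide n s (c.row - 1)

/-- The top of the layer is a whole slot of kind `t` on the side `s`. -/
def WholeSlot (n : ℕ) (s : Side) (t : ℕ) (c : Layer) : Prop :=
  c.top = Top.flat ∧ kind n c.row = t ∧ OnSide n s c.row

/-- The top of the layer is a broken half of a block of kind `t` on the side `s`; this is a half
block, and the free half above it is a half slot. -/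
def HalfPiece (n : ℕ) (s : Side) (t : ℕ) (c : Layer) : Prop :=
  c.top = Top.half ∧ kind n c.row = t ∧ OnSide n s c.row

/-- The row of the block or piece of a block at the top of the layer. -/
def Layer.topRow (c : Layer) : ℤ :=
  match c.top with
  | .flat => c.row - 1
  | _ => c.row

/-- `b` is the rear-most among the lowest slots of the type `p`. -/
def IsRearLow {l : ℕ} (p : Layer → Prop) (C : Layers l) (b : Fin l) : Prop :=
  p (C b) ∧ ∀ b', p (C b') → (C b).row < (C b').row ∨ ((C b).row = (C b').row ∧ b' ≤ b)

/-- `a` is the fore-most among the highest top blocks of the type `p`. -/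
def IsForeHigh {l : ℕ} (p : Layer → Prop) (C : Layers l) (a : Fin l) : Prop :=
  p (C a) ∧ ∀ a', p (C a') →
    (C a').topRow < (C a).topRow ∨ ((C a').topRow = (C a).topRow ∧ a ≤ a')

open Classical in
/-- The chosen slot, if there is one. -/
noncomputable def rearLow {l : ℕ} (p : Layer → Prop) (C : Layers l) : Option (Fin l) :=
  if h : ∃ b, IsRearLow p C b then some h.choose else none

open Classical in
/-- The chosen top block, if there is one. -/
noncomputable def foreHigh {l : ℕ} (p : Layer → Prop) (C : Layers l) : Option (Fin l) :=
  if h : ∃ a, IsForeHigh p C a then some h.choose else none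

/-- Put a half block on top of a layer (in a whole slot or in a half slot). -/
def Layer.putHalf (c : Layer) : Layer :=
  match c.top with
  | .half => ⟨c.row + 1, .flat⟩
  | _ => ⟨c.row, .half⟩

/-- Remove the upper half of the whole block, or the half block, at the top of a layer. -/
def Layer.takeHalf (c : Layer) : Layer :=
  match c.top with
  | .half => ⟨c.row, .flat⟩
  | _ => ⟨c.row - 1, .half⟩

/-- Split a block of kind `t`: the top half of the chosen block on the side `s` is broken off and
placed in the chosen slot on the other side. -/
noncomputable def splitOnce (n : ℕ) {l : ℕ} (s : Side) (t : ℕ) (C : Layers l) :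
    Option (Layers l) :=
  match foreHigh (WholeBlock n s t) C, rearLow (WholeSlot n s.other t) C with
  | some a, some b =>
      some (Function.update (Function.update C a (C a).takeHalf) b (C b).putHalf)
  | _, _ => none

/-- `C'` arises from `C` by splitting one block. -/
def SplitStep (n : ℕ) {l : ℕ} (C C' : Layers l) : Prop :=
  ∃ s t, splitOnce n s t C = some C'

/-- `C` is a split form of the pre-slice `D`: a result of splitting that allows no more
splitting. -/
def IsSplitForm (n : ℕ) {l : ℕ} (D C : Layers l) : Prop :=
  IsPreSlice n D ∧ ReflTransGen (SplitStep n) D C ∧ ∀ C', ¬ SplitStep n C C'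

/-- Level-`l` slices. -/
def IsSlice (n : ℕ) {l : ℕ} (C : Layers l) : Prop := ∃ D, IsSplitForm n D C

/-! ### Un-splitting the `01`-blocks or the `(n-1)n`-blocks -/

/-- Split every possible block of kind `t`, for `t = 1` or `t = n - 1`, so that covering and
supporting positions agree.  Every splitting uses up two unbroken layers, so that `l` rounds
suffice. -/
noncomputable def splitAll (n : ℕ) {l : ℕ} (t : ℕ) (C : Layers l) : Layers l :=
  (fun X => (splitOnce n .covering t X).getD X)^[l] C

/-- `D` is the result of un-splitting all blocks of kind `t` in `C`: it arises from a pre-slice by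
splittings, has no broken block of kind `t`, and becomes `C` when its blocks of kind `t` are
split. -/
def IsUnsplit (n : ℕ) {l : ℕ} (t : ℕ) (C D : Layers l) : Prop :=
  (∃ D₀, IsPreSlice n D₀ ∧ ReflTransGen (SplitStep n) D₀ D) ∧
    (∀ j, (D j).top = Top.half → kind n (D j).row ≠ t) ∧ splitAll n t D = C

open Classical in
/-- The result of un-splitting all blocks of kind `t`. -/
noncomputable def unsplit (n : ℕ) {l : ℕ} (t : ℕ) (C : Layers l) : Option (Layers l) :=
  if h : ∃ D, IsUnsplit n t C D then some h.choose else none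

/-! ### Kashiwara operators on slices -/

/-- Two half blocks of colour `i` are added, `2 ≤ i ≤ n - 2`. -/
noncomputable def fUnit (n : ℕ) {l : ℕ} (i : ℕ) (C : Layers l) : Option (Layers l) :=
  let both (a b : Fin l) : Layers l :=
    Function.update (Function.update C a (C a).putHalf) b (C b).putHalf
  let oneSided (s : Side) (a : Fin l) : Option (Layers l) :=
    let C₁ := Function.update C a (C a).putHalf
    (rearLow (HalfPiece n s i) C₁).map fun b => Function.update C₁ b (C₁ b).putHalf
  match rearLow (WholeSlot n .covering i) C, rearLow (WholeSlot n .supporting i) C with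
  | some a, some b => some (both a b)
  | some a, none => oneSided .covering a
  | none, some b => oneSided .supporting b
  | none, none =>
    match rearLow (HalfPiece n .covering i) C, rearLow (HalfPiece n .supporting i) C with
    | some a, some b => some (both a b)
    | _, _ => none

/-- Two half blocks of colour `i` are removed, `2 ≤ i ≤ n - 2`. -/
noncomputable def eUnit (n : ℕ) {l : ℕ} (i : ℕ) (C : Layers l) : Option (Layers l) :=
  let both (a b : Fin l) : Layers l :=
    Function.update (Function.update C a (C a).takeHalf) b (C b).takeHalf
  let oneSided (s : Side) (a : Fin l) : Option (Layers l) :=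
    let C₁ := Function.update C a (C a).takeHalf
    (foreHigh (HalfPiece n s i) C₁).map fun b => Function.update C₁ b (C₁ b).takeHalf
  match foreHigh (WholeBlock n .covering i) C, foreHigh (WholeBlock n .supporting i) C with
  | some a, some b => some (both a b)
  | some a, none => oneSided .covering a
  | none, some b => oneSided .supporting b
  | none, none =>
    match foreHigh (HalfPiece n .covering i) C, foreHigh (HalfPiece n .supporting i) C with
    | some a, some b => some (both a b)
    | _, _ => none

/-- In column `k`, a block of half-unit depth and colour `i` may be put on the layer `c`. -/
def ThinSlot (n k i : ℕ) (c : Layer) : Prop :=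
  IsThin n c.row ∧
    match c.top with
    | .flat => i = rearColor n k c.row ∨ i = frontColor n k c.row
    | .rear => i = frontColor n k c.row
    | .front => i = rearColor n k c.row
    | .half => False

/-- In column `k`, an unbroken block of half-unit depth and colour `i` may be removed from the top
of the layer `c`. -/
def ThinBlock (n k i : ℕ) (c : Layer) : Prop :=
  IsThin n c.topRow ∧
    match c.top with
    | .flat => i = rearColor n k c.topRow ∨ i = frontColor n k c.topRow
    | .rear => i = rearColor n k c.topRow
    | .front => i = frontColor n k c.topRow
    | .half => False

/-- Put a block of half-unit depth and colour `i` in its slot. -/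
def Layer.putThin (n k i : ℕ) (c : Layer) : Layer :=
  match c.top with
  | .flat => ⟨c.row, if i = rearColor n k c.row then .rear else .front⟩
  | _ => ⟨c.row + 1, .flat⟩

/-- Remove the block of half-unit depth and colour `i`. -/
def Layer.takeThin (n k i : ℕ) (c : Layer) : Layer :=
  match c.top with
  | .flat => ⟨c.topRow, if i = rearColor n k c.topRow then .front else .rear⟩
  | _ => ⟨c.row, .flat⟩

/-- The kind of whole block that contains the blocks of colour `i = 0, 1, n - 1, n`. -/
def thinKind (n i : ℕ) : ℕ := if i ≤ 1 then 1 else n - 1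

/-- Un-split, add a block of colour `i = 0, 1, n - 1, n`, split. -/
noncomputable def fThin (n k : ℕ) {l : ℕ} (i : ℕ) (C : Layers l) : Option (Layers l) :=
  (unsplit n (thinKind n i) C).bind fun D =>
    (rearLow (ThinSlot n k i) D).map fun b =>
      splitAll n (thinKind n i) (Function.update D b ((D b).putThin n k i))

/-- Un-split, remove a block of colour `i = 0, 1, n - 1, n`, split. -/
noncomputable def eThin (n k : ℕ) {l : ℕ} (i : ℕ) (C : Layers l) : Option (Layers l) :=
  (unsplit n (thinKind n i) C).bind fun D =>
    (foreHigh (ThinBlock n k i) D).map fun a =>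
      splitAll n (thinKind n i) (Function.update D a ((D a).takeThin n k i))

/-- The Kashiwara operator `f̃_i` on slices stacked in the pattern of column `k`; `none` is `0`. -/
noncomputable def sliceF (n k : ℕ) {l : ℕ} (i : ℕ) (C : Layers l) : Option (Layers l) :=
  if 2 ≤ i ∧ i ≤ n - 2 then fUnit n i C else fThin n k i C

/-- The Kashiwara operator `ẽ_i` on slices stacked in the pattern of column `k`; `none` is `0`. -/
noncomputable def sliceE (n k : ℕ) {l : ℕ} (i : ℕ) (C : Layers l) : Option (Layers l) :=
  if 2 ≤ i ∧ i ≤ n - 2 then eUnit n i C else eThin n k i C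

/-- `φ_i(C) = max {m | f̃_i^m C ≠ 0}`. -/
noncomputable def slicePhi (n k : ℕ) {l : ℕ} (i : ℕ) (C : Layers l) : ℕ :=
  sSup {m : ℕ | (fun x => x.bind (sliceF n k i))^[m] (some C) ≠ none}

/-- `ε_i(C) = max {m | ẽ_i^m C ≠ 0}`. -/
noncomputable def sliceEps (n k : ℕ) {l : ℕ} (i : ℕ) (C : Layers l) : ℕ :=
  sSup {m : ℕ | (fun x => x.bind (sliceE n k i))^[m] (some C) ≠ none}

/-! ### Young walls -/

/-- A sequence of columns; column `0` is the right-most one, column `k + 1` is immediately to the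
left of column `k`. -/
abbrev Columns (l : ℕ) : Type := ℕ → Layers l

/-- The `j`-th layer of `C` has at its top the upper half of a broken `01`- or `(n-1)n`-block. -/
def IsUpperHalf (n : ℕ) {l : ℕ} (C : Layers l) (j : Fin l) : Prop :=
  ∃ D, IsUnsplit n (kind n (C j).row) C D ∧ D j = ⟨(C j).row, .flat⟩

/-- The `j`-th layer of `C` has at its top the lower half of a broken `01`- or `(n-1)n`-block. -/
def IsLowerHalf (n : ℕ) {l : ℕ} (C : Layers l) (j : Fin l) : Prop :=
  ∃ D, IsUnsplit n (kind n (C j).row) C D ∧ D j = ⟨(C j).row + 1, .flat⟩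

/-- In the `j`-th layer of the consecutive columns `A` (left) and `B` (right), there is no free
space to the right of any block of `A`. -/
def NoFreeSpace (n : ℕ) {l : ℕ} (A B : Layers l) (j : Fin l) : Prop :=
  (A j).row < (B j).row ∨
    ((A j).row = (B j).row ∧
      match (A j).top, (B j).top with
      | .flat, _ => True
      | .rear, .rear => True
      | .front, .front => True
      | .half, .half => True
      | .half, .rear => IsUpperHalf n A j
      | .half, .front => IsUpperHalf n A j
      | .rear, .half => IsLowerHalf n B j
      | .front, .half => IsLowerHalf n B j
      | _, _ => False)

/-- Level-`l` Young walls. -/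
def IsYoungWall (n : ℕ) {l : ℕ} (Y : Columns l) : Prop :=
  (∀ k, IsSlice n (Y k)) ∧ ∀ k j, NoFreeSpace n (Y (k + 1)) (Y k) j

/-- Level-`l` proper Young walls: in no layer do two columns of integer height with top of unit
depth have the same height. -/
def IsProper (n : ℕ) {l : ℕ} (Y : Columns l) : Prop :=
  IsYoungWall n Y ∧ ∀ j k k', k ≠ k' →
    (Y k j).top = Top.flat → (Y k' j).top = Top.flat → (Y k j).row ≠ (Y k' j).row

/-! ### Kashiwara operators on Young walls -/

/-- A place for a letter: `(k, s)` is the `s`-th letter from the left under column `k`. -/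
abbrev Place : Type := ℕ × ℕ

/-- `p` is to the left of `q`. -/
def LeftOf (p q : Place) : Prop := q.1 < p.1 ∨ (p.1 = q.1 ∧ p.2 < q.2)

/-- The letter at this place is `1`: under column `k` there are `ε k` letters `1` ... -/
def IsOne (ε : ℕ → ℕ) (p : Place) : Prop := p.2 < ε p.1

/-- ... followed by `φ k` letters `0`. -/
def IsZero (ε φ : ℕ → ℕ) (p : Place) : Prop := ε p.1 ≤ p.2 ∧ p.2 < ε p.1 + φ p.1

/-- `p` holds a `0`, `q` holds a `1`, and `q` is the next letter of `S` to the right of `p`. -/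
def IsPair (ε φ : ℕ → ℕ) (S : Set Place) (p q : Place) : Prop :=
  p ∈ S ∧ q ∈ S ∧ IsZero ε φ p ∧ IsOne ε q ∧ LeftOf p q ∧
    ∀ r ∈ S, ¬ (LeftOf p r ∧ LeftOf r q)

/-- The places that are left after `m` rounds; each round cancels all `(0,1)`-pairs of letters that
have become adjacent. -/
def remaining (ε φ : ℕ → ℕ) : ℕ → Set Place
  | 0 => {p | IsOne ε p ∨ IsZero ε φ p}
  | m + 1 => {p | p ∈ remaining ε φ m ∧
      ∀ q, ¬ IsPair ε φ (remaining ε φ m) p q ∧ ¬ IsPair ε φ (remaining ε φ m) q p}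

/-- The places of the letters `1` of the `i`-signature of `Y`. -/
def sigOnes (n : ℕ) {l : ℕ} (i : ℕ) (Y : Columns l) : Set Place :=
  {p | IsOne (fun k => sliceEps n k i (Y k)) p ∧
    ∀ m, p ∈ remaining (fun k => sliceEps n k i (Y k)) (fun k => slicePhi n k i (Y k)) m}

/-- The places of the letters `0` of the `i`-signature of `Y`. -/
def sigZeros (n : ℕ) {l : ℕ} (i : ℕ) (Y : Columns l) : Set Place :=
  {p | IsZero (fun k => sliceEps n k i (Y k)) (fun k => slicePhi n k i (Y k)) p ∧
    ∀ m, p ∈ remaining (fun k => sliceEps n k i (Y k)) (fun k => slicePhi n k i (Y k)) m}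

open Classical in
/-- `f̃_i Y`: the column of the left-most `0` of the `i`-signature is acted on; `none` is `0`. -/
noncomputable def wallF (n : ℕ) {l : ℕ} (i : ℕ) (Y : Columns l) : Option (Columns l) :=
  if h : ∃ p ∈ sigZeros n i Y, ∀ q ∈ sigZeros n i Y, q ≠ p → LeftOf p q then
    (sliceF n h.choose.1 i (Y h.choose.1)).map (Function.update Y h.choose.1)
  else none

open Classical in
/-- `ẽ_i Y`: the column of the right-most `1` of the `i`-signature is acted on; `none` is `0`. -/
noncomputable def wallE (n : ℕ) {l : ℕ} (i : ℕ) (Y : Columns l) : Option (Columns l) :=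
  if h : ∃ p ∈ sigOnes n i Y, ∀ q ∈ sigOnes n i Y, q ≠ p → LeftOf q p then
    (sliceE n h.choose.1 i (Y h.choose.1)).map (Function.update Y h.choose.1)
  else none

/-! ### Ground-state walls -/

/-- The coefficient `a_i` of the dominant weight `a_0 Λ_0 + ⋯ + a_n Λ_n`. -/
def coeff {n : ℕ} (a : Fin (n + 1) → ℕ) (i : ℕ) : ℕ := if h : i < n + 1 then a ⟨i, h⟩ else 0

/-- The level `a_0 + a_1 + 2 (a_2 + ⋯ + a_{n-2}) + a_{n-1} + a_n`. -/
def level {n : ℕ} (a : Fin (n + 1) → ℕ) : ℕ :=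
  coeff a 0 + coeff a 1 + 2 * ∑ i ∈ Finset.Icc 2 (n - 2), coeff a i +
    coeff a (n - 1) + coeff a n

/-- The layers of a ground-state column, from front to rear. -/
def groundList {n : ℕ} (a : Fin (n + 1) → ℕ) : List Layer :=
  List.replicate (min (coeff a 0) (coeff a 1)) ⟨0, .half⟩ ++
  List.replicate (coeff a 1 - coeff a 0) ⟨0, .rear⟩ ++
  List.replicate (coeff a 0 - coeff a 1) ⟨0, .front⟩ ++
  List.replicate (min (coeff a 0) (coeff a 1)) ⟨0, .half⟩ ++
  (List.range (n - 3)).flatMap (fun m => List.replicate (coeff a (m + 2)) ⟨(m : ℤ) + 1, .half⟩) ++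
  List.replicate (min (coeff a (n - 1)) (coeff a n)) ⟨(n : ℤ) - 2, .half⟩ ++
  List.replicate (coeff a (n - 1) - coeff a n) ⟨(n : ℤ) - 2, .front⟩ ++
  List.replicate (coeff a n - coeff a (n - 1)) ⟨(n : ℤ) - 2, .rear⟩ ++
  List.replicate (min (coeff a (n - 1)) (coeff a n)) ⟨(n : ℤ) - 2, .half⟩ ++
  (List.range (n - 3)).reverse.flatMap
    (fun m => List.replicate (coeff a (m + 2)) ⟨2 * (n : ℤ) - 5 - (m : ℤ), .half⟩)

/-- The list has exactly `level a` members. -/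
theorem length_groundList {n : ℕ} (hn : 4 ≤ n) (a : Fin (n + 1) → ℕ) :
    (groundList a).length = level a := by
  obtain ⟨m, rfl⟩ : ∃ m, n = m + 4 := ⟨n - 4, by omega⟩
  have h : ∑ i ∈ Finset.Icc 2 (m + 4 - 2), coeff a i = ∑ i ∈ Finset.range (m + 1),
      coeff a (i + 2) := by
    rw [Finset.range_eq_Ico, Finset.sum_Ico_add' (fun i => coeff a i) 0 (m + 1) 2]
    rfl
  have h2 : ((List.range (m + 1)).map fun i => coeff a (i + 2)).sum =
      ∑ i ∈ Finset.range (m + 1), coeff a (i + 2) := rfl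
  simp only [groundList, level, h, List.length_append, List.length_replicate,
    List.length_flatMap, List.map_reverse, List.sum_reverse]
  have h3 : m + 4 - 3 = m + 1 := by omega
  rw [h3, h2]
  omega

/-- The ground-state wall `Y_λ`, `λ = ∑ a_i Λ_i`: all columns have the same shape (their colours
alternate). -/
def groundWall {n : ℕ} (l : ℕ) (a : Fin (n + 1) → ℕ) : Columns l :=
  fun _ j => (groundList a).getD j ⟨0, .flat⟩

/-- `Y` is obtained by adding finitely many blocks to `Y_λ`: only finitely many columns are changed,
and, before splitting, each column contains the corresponding column of `Y_λ`. -/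
def IsBuiltOn {n l : ℕ} (a : Fin (n + 1) → ℕ) (Y : Columns l) : Prop :=
  {k | Y k ≠ groundWall l a k}.Finite ∧
    ∀ k, ∃ D₀ D : Layers l, IsSplitForm n D₀ (groundWall l a k) ∧ IsSplitForm n D (Y k) ∧
      ∀ j, (D₀ j).Sub (D j)

/-- The set of all level-`l` proper Young walls built on `Y_λ`. -/
def ProperWallsOn {n : ℕ} (l : ℕ) (a : Fin (n + 1) → ℕ) : Set (Columns l) :=
  {Y | IsProper n Y ∧ IsBuiltOn a Y}

/-! ### Counting blocks -/

/-- Number of blocks of colour `i` in the full row `r`. -/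
def rowCount (n i : ℕ) (r : ℤ) : ℕ :=
  if pos n r = 0 then (if i = 0 ∨ i = 1 then 1 else 0)
  else if pos n r = n - 2 then (if i = n - 1 ∨ i = n then 1 else 0)
  else if kind n r = i then 1 else 0

/-- Number of halves of `i`-blocks above the ground level in a layer of column `k`.  A broken half of
a glued pair consists of one half of each of the two blocks. -/
noncomputable def layerHalves (n k i : ℕ) (c : Layer) : ℤ :=
  2 * (∑ r ∈ Finset.Ico 0 c.row, (rowCount n i r : ℤ)) +
    match c.top with
    | .flat => 0
    | .rear => if i = rearColor n k c.row then 2 else 0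
    | .front => if i = frontColor n k c.row then 2 else 0
    | .half => rowCount n i c.row

/-- Number of halves of `i`-blocks that have been added to `Y_λ` to obtain `Y`. -/
noncomputable def addedHalves {n l : ℕ} (a : Fin (n + 1) → ℕ) (i : ℕ) (Y : Columns l) : ℤ :=
  ∑ᶠ k : ℕ, ∑ j : Fin l, (layerHalves n k i (Y k j) - layerHalves n k i (groundWall l a k j))

/-! ### Affine weights and crystals -/

/-- The weight lattice `P = ⨁ ℤ Λ_i ⊕ ℤ δ`. -/
abbrev Weight (n : ℕ) : Type := (Fin (n + 1) → ℤ) × ℤ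

/-- The edges `i — j` with `i < j` of the Dynkin diagram of type `D_n^(1)`. -/
def Edge (n i j : ℕ) : Prop :=
  (i = 0 ∧ j = 2) ∨ (1 ≤ i ∧ i + 1 = j ∧ j ≤ n - 1) ∨ (i = n - 2 ∧ j = n)

open Classical in
/-- The generalized Cartan matrix of type `D_n^(1)`. -/
noncomputable def cartan (n i j : ℕ) : ℤ :=
  if i = j then 2 else if Edge n i j ∨ Edge n j i then -1 else 0

/-- The simple root `α_i = ∑_j a_{ji} Λ_j + δ_{i0} δ`. -/
noncomputable def simpleRoot (n : ℕ) (i : Fin (n + 1)) : Weight n :=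
  (fun j => cartan n j i, if i = 0 then 1 else 0)

/-- `⟨h_i, μ⟩`. -/
def pairing {n : ℕ} (i : Fin (n + 1)) (μ : Weight n) : ℤ := μ.1 i

/-- The weight `∑ a_i Λ_i`. -/
def dominantWeight {n : ℕ} (a : Fin (n + 1) → ℕ) : Weight n := (fun i => a i, 0)

/-- A `U_q(𝔤)`-crystal structure on `B`, for `𝔤` of type `D_n^(1)`; `none` is `0`, and `⊥` is
`-∞`. -/
structure AffineCrystal (n : ℕ) (B : Type) where
  wt : B → Weight n
  e : Fin (n + 1) → B → Option B
  f : Fin (n + 1) → B → Option B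
  eps : Fin (n + 1) → B → WithBot ℤ
  phi : Fin (n + 1) → B → WithBot ℤ
  phi_eq : ∀ i b, phi i b = eps i b + (pairing i (wt b) : ℤ)
  wt_e : ∀ i b b', e i b = some b' → wt b' = wt b + simpleRoot n i
  wt_f : ∀ i b b', f i b = some b' → wt b' = wt b - simpleRoot n i
  eps_e : ∀ i b b', e i b = some b' → eps i b' + 1 = eps i b
  phi_e : ∀ i b b', e i b = some b' → phi i b' = phi i b + 1
  eps_f : ∀ i b b', f i b = some b' → eps i b' = eps i b + 1
  phi_f : ∀ i b b', f i b = some b' → phi i b' + 1 = phi i b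
  f_iff_e : ∀ i b b', f i b = some b' ↔ e i b' = some b
  of_bot : ∀ i b, phi i b = ⊥ → e i b = none ∧ f i b = none

end YoungWallD

namespace YoungWallD

open Relation

/-! ### Arithmetic of rows -/

/-! A slice is replaced by the positions of the boundaries between its layers. In the cyclic
extension `c_{j+l} = c_j + δ`, each row `r` gets two numbers `G r ≤ F r`: the layers `j < G r`
contain nothing of the row, the layers `j ≥ F r` fill it. A thin row has moreover two thresholds `T
true r` and `T false r`, the indices from which the rear and the front block are present once broken
pairs are un-split. Since a row `{0,1}` has number `0`, the reflection `r ↦ -r` exchanges covering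
and supporting rows modulo the period, and splitting a block of row `r` raises `F` by one at `r` and
lowers `G` by one at `-r`. The configurations that splitting can reach are therefore the states with
`F (-r) - G (-r) = F r - G r` (as many halves covering as supporting) and `T true + T false = F + G`
in thin rows (as many upper as lower halves). Slices are the states in which, for each `r`, row `r`
or row `1 - r` has no flat layer. See `isSlice_iff` and `State.Encodes.state_unique`.

In this language the operators on slices move a few boundaries by one, `φ_i` and `ε_i` are sums of
differences of boundaries, and `f̃_i`, `ẽ_i` are visibly inverse to each other (`IsSliceState.f`,
`IsSliceState.e`). The difference `φ_i - ε_i` is, up to a constant, the combination with the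
coefficients of the Cartan matrix of the numbers of missing blocks (`phi_sub_eps`).

A column `A` may stand to the left of `B` in a proper wall exactly if `G_B r ≤ F_A (r - 1)` for all
`r` and `T_B ≤ T_A` in thin rows (`State.Rel`). So a proper wall on `Y_λ` is a sequence of slice
states, consecutive ones being in this relation, that finally equals the ground state
(`mem_properWallsOn`); that it contains `Y_λ` is automatic. Adding a block to `A` can only disturb
the relation with its right neighbour `B`, and does not if `φ_i(A) > ε_i(B)` (`State.Rel.f_left`);
dually for removing a block from `B` (`State.Rel.e_right`).

Signatures are read as a walk from right to left: each column goes up by `φ` and then down by `ε`.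
Cancelled pairs are matching brackets of this walk; a surviving `0` is a new record level, a
surviving `1` a level that is never reached again (`mem_survivingZeros`, `mem_survivingOnes`). So
`φ_i(Y)` is the maximal height, `φ_i(Y) - ε_i(Y)` the final height, `f̃_i` acts on the first column
of maximal height and `ẽ_i` on the last. Being the first (last) maximum gives just the strict
inequality that keeps the wall proper, and acting by `f̃_i` turns the first maximum into the last
one of the new walk, so that `ẽ_i` acts on the same column. The final height is `⟨h_i, wt⟩` by
telescoping `phi_sub_eps` against the ground state (`IsWall.height_eq`). -/

theorem period_eq {n : ℕ} (hn : 4 ≤ n) : period n = 2 * ((n - 2 : ℕ) : ℤ) := by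
  unfold period; omega

theorem period_pos {n : ℕ} (hn : 4 ≤ n) : 4 ≤ period n := by unfold period; omega

theorem pos_cast {n : ℕ} (hn : 4 ≤ n) (r : ℤ) : (pos n r : ℤ) = r % period n := by
  have := period_pos hn
  exact Int.toNat_of_nonneg (Int.emod_nonneg _ (by omega))

theorem pos_lt {n : ℕ} (hn : 4 ≤ n) (r : ℤ) : (pos n r : ℤ) < period n := by
  have := period_pos hn
  rw [pos_cast hn]
  exact Int.emod_lt_of_pos _ (by omega)

/-- The row, up to cycles, that holds blocks of kind `t` on the side `s`. -/
def rowOf (s : Side) (t : ℕ) : ℤ :=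
  match s with
  | .supporting => (t : ℤ) - 1
  | .covering => 1 - (t : ℤ)

/-- The numbering is chosen for this: exchanging covering and supporting is the reflection of rows,
and all symmetry arguments are about `r ↦ -r`. -/
theorem rowOf_other (s : Side) (t : ℕ) : rowOf s.other t = -rowOf s t := by
  cases s <;> simp [rowOf, Side.other]

theorem dvd_sub_iff_pos {n : ℕ} (hn : 4 ≤ n) (x a : ℤ) (h0 : 0 ≤ a) (h1 : a < period n) :
    period n ∣ x - a ↔ (pos n x : ℤ) = a := by
  rw [pos_cast hn, ← Int.emod_emod_of_dvd x (dvd_refl (period n)),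
    ← Int.emod_eq_emod_iff_emod_sub_eq_zero.trans (Int.dvd_iff_emod_eq_zero).symm,
    Int.emod_eq_of_lt h0 h1, Int.emod_emod_of_dvd x (dvd_refl (period n))]

/-- Thin rows are the multiples of half the period, hence exactly the rows congruent to their own
mirror image. -/
theorem isThin_iff {n : ℕ} (hn : 4 ≤ n) (r : ℤ) : IsThin n r ↔ ((n - 2 : ℕ) : ℤ) ∣ r := by
  have hP := period_eq hn
  have hp := pos_lt hn r
  have hpc := pos_cast hn r
  have hr := Int.emod_add_mul_ediv r (period n)
  rw [← hpc, hP] at hr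
  unfold IsThin
  rw [hP] at hp
  generalize pos n r = p at *
  constructor
  · rintro (h | h)
    · rw [← hr, h]; exact Dvd.intro (2 * (r / (2 * ((n - 2 : ℕ) : ℤ)))) (by push_cast; ring)
    · rw [← hr, h]; exact Dvd.intro (1 + 2 * (r / (2 * ((n - 2 : ℕ) : ℤ)))) (by ring)
  · intro h
    have h2 : ((n - 2 : ℕ) : ℤ) ∣ (p : ℤ) := by
      have : (p : ℤ) = r - ((n - 2 : ℕ) : ℤ) * (2 * (r / (2 * ((n - 2 : ℕ) : ℤ)))) := by
        linarith
      rw [this]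
      exact dvd_sub h (Dvd.intro _ rfl)
    obtain ⟨c, hc⟩ := h2
    have hq : 0 < ((n - 2 : ℕ) : ℤ) := by omega
    have hc0 : 0 ≤ c := by by_contra h; push Not at h; nlinarith
    have hc2 : c < 2 := by by_contra h; push Not at h; nlinarith
    have : c = 0 ∨ c = 1 := by omega
    rcases this with rfl | rfl
    · left; omega
    · right; omega

/-- This turns conditions on kinds and sides into congruences modulo the period; afterwards `kind`
and `OnSide` hardly occur. -/
theorem kind_side_iff {n : ℕ} (hn : 4 ≤ n) (s : Side) (t : ℕ) (x : ℤ) :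
    (kind n x = t ∧ OnSide n s x) ↔ (1 ≤ t ∧ t ≤ n - 1) ∧ period n ∣ x - rowOf s t := by
  have hP := period_eq hn
  have hp := pos_lt hn x
  cases s with
  | supporting =>
    by_cases ht : 1 ≤ t ∧ t ≤ n - 1
    · have h := dvd_sub_iff_pos hn x (rowOf .supporting t)
        (by simp only [rowOf]; omega) (by simp only [rowOf]; omega)
      rw [h]
      simp only [kind, OnSide, rowOf]
      split_ifs <;> omega
    · simp only [kind, OnSide, ht, false_and, iff_false]
      split_ifs <;> omega
  | covering =>
    by_cases ht : 1 ≤ t ∧ t ≤ n - 1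
    · by_cases h1 : t = 1
      · subst h1
        have h := dvd_sub_iff_pos hn x (rowOf .covering 1)
          (by simp only [rowOf]; omega) (by simp only [rowOf]; omega)
        rw [h]
        simp only [kind, OnSide, rowOf]
        split_ifs <;> omega
      -- For `t ≥ 2` the row `1 - t` is negative, and its position in the cycle is obtained by
      -- adding one period.
      · have h := dvd_sub_iff_pos hn x (rowOf .covering t + period n)
          (by simp only [rowOf]; omega) (by simp only [rowOf]; omega)
        have h2 : period n ∣ x - rowOf .covering t ↔
            period n ∣ x - (rowOf .covering t + period n) := by
          rw [← sub_sub]; exact (dvd_sub_self_right).symm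
        rw [h2, h]
        simp only [kind, OnSide, rowOf]
        split_ifs <;> omega
    · simp only [kind, OnSide, ht, false_and, iff_false]
      split_ifs <;> omega

/-- Every row belongs to some kind, on some side. -/
theorem exists_rowOf {n : ℕ} (hn : 4 ≤ n) (x : ℤ) :
    ∃ s t, (1 ≤ t ∧ t ≤ n - 1) ∧ period n ∣ x - rowOf s t := by
  by_cases h : OnSide n .supporting x
  · exact ⟨_, _, (kind_side_iff hn _ _ x).1 ⟨rfl, h⟩⟩
  · refine ⟨.covering, _, (kind_side_iff hn _ _ x).1 ⟨rfl, ?_⟩⟩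
    simp only [OnSide] at h ⊢
    omega

theorem isThin_congr {n : ℕ} (hn : 4 ≤ n) {r x : ℤ} (h : period n ∣ x - r) :
    IsThin n x ↔ IsThin n r := by
  rw [isThin_iff hn, isThin_iff hn]
  have h2 : ((n - 2 : ℕ) : ℤ) ∣ x - r := (Dvd.intro_left _ (period_eq hn).symm).trans h
  exact dvd_iff_dvd_of_dvd_sub h2

theorem isThin_neg {n : ℕ} (hn : 4 ≤ n) {r : ℤ} : IsThin n (-r) ↔ IsThin n r := by
  rw [isThin_iff hn, isThin_iff hn, dvd_neg]

theorem dvd_of_isThin {n : ℕ} (hn : 4 ≤ n) {r : ℤ} (h : IsThin n r) : period n ∣ -r - r := by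
  obtain ⟨c, hc⟩ := (isThin_iff hn r).1 h
  exact ⟨-c, by rw [period_eq hn]; linarith⟩

/-- A row and the one above a mirror image have different positions. -/
theorem not_dvd_odd {n : ℕ} (hn : 4 ≤ n) (r : ℤ) : ¬ period n ∣ 2 * r + 1 := by
  rintro ⟨c, hc⟩
  have := period_eq hn
  rw [this] at hc
  have : 2 * ((n - 2 : ℕ) : ℤ) * c = 2 * (((n - 2 : ℕ) : ℤ) * c) := by ring
  omega

theorem not_dvd_one {n : ℕ} (hn : 4 ≤ n) : ¬ period n ∣ 1 := by
  have := not_dvd_odd hn 0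
  simpa using this

theorem isThin_of_dvd_neg {n : ℕ} (hn : 4 ≤ n) {r : ℤ} (h : period n ∣ -r - r) : IsThin n r := by
  rw [isThin_iff hn]
  obtain ⟨c, hc⟩ := h
  rw [period_eq hn] at hc
  have : 2 * ((n - 2 : ℕ) : ℤ) * c = 2 * (((n - 2 : ℕ) : ℤ) * c) := by ring
  exact ⟨-c, by rw [mul_neg]; omega⟩

/-- Indicator of the rows at the same position as `r`. -/
noncomputable def ind (n : ℕ) (r x : ℤ) : ℤ := by
  classical exact if period n ∣ x - r then 1 else 0

theorem ind_of_dvd {n : ℕ} {r x : ℤ} (h : period n ∣ x - r) : ind n r x = 1 := by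
  simp [ind, h]

theorem ind_of_not_dvd {n : ℕ} {r x : ℤ} (h : ¬ period n ∣ x - r) : ind n r x = 0 := by
  simp [ind, h]

theorem ind_self {n : ℕ} (r : ℤ) : ind n r r = 1 := ind_of_dvd (by simp)

theorem ind_cases {n : ℕ} (r x : ℤ) :
    (period n ∣ x - r ∧ ind n r x = 1) ∨ (¬ period n ∣ x - r ∧ ind n r x = 0) := by
  by_cases h : period n ∣ x - r
  · exact .inl ⟨h, ind_of_dvd h⟩
  · exact .inr ⟨h, ind_of_not_dvd h⟩

theorem ind_add_period {n : ℕ} (r x : ℤ) : ind n r (x + period n) = ind n r x := by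
  have : period n ∣ x + period n - r ↔ period n ∣ x - r := by
    rw [add_sub_right_comm]; exact dvd_add_self_right
  simp [ind, this]

theorem ind_neg {n : ℕ} (r x : ℤ) : ind n (-r) (-x) = ind n r x := by
  have : period n ∣ -x - -r ↔ period n ∣ x - r := by
    rw [← dvd_neg]; ring_nf
  simp only [ind, this]

theorem ind_neg_right {n : ℕ} (r x : ℤ) : ind n r (-x) = ind n (-r) x := by
  rw [← ind_neg (-r) x, neg_neg]

/-! ### Quasi-periodic functions -/

/-- `f (r + period) = f r + l`. -/
def QuasiPeriodic (n l : ℕ) (f : ℤ → ℤ) : Prop := ∀ r, f (r + period n) = f r + l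

theorem QuasiPeriodic.add_mul {n l : ℕ} {f : ℤ → ℤ} (h : QuasiPeriodic n l f) (r k : ℤ) :
    f (r + k * period n) = f r + k * l := by
  induction k using Int.induction_on with
  | zero => simp
  | succ i ih => rw [_root_.add_mul, one_mul, ← add_assoc, h, ih]; ring
  | pred i ih =>
    have := h (r + (-(i : ℤ) - 1) * period n)
    rw [show r + (-(i : ℤ) - 1) * period n + period n = r + -(i : ℤ) * period n by ring, ih] at this
    linarith

theorem QuasiPeriodic.of_dvd {n l : ℕ} {f g : ℤ → ℤ} (hf : QuasiPeriodic n l f)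
    (hg : QuasiPeriodic n l g) {x r : ℤ} (h : period n ∣ x - r) : f x - g x = f r - g r := by
  obtain ⟨k, hk⟩ := h
  obtain rfl : x = r + k * period n := by linarith
  have h1 := hf.add_mul r k
  have h2 := hg.add_mul r k
  rw [h1, h2]; ring

theorem QuasiPeriodic.shift {n l : ℕ} {f : ℤ → ℤ} (hf : QuasiPeriodic n l f) (a : ℤ) :
    QuasiPeriodic n l (fun x => f (x + a)) := by
  intro r
  show f (r + period n + a) = _
  rw [add_right_comm, hf]

/-! ### States -/

/-- The boundaries between the layers, in the cyclic extension `c_{j + l} = c_j + δ`, by the row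
`r` that they concern: `F r` layers do not fill the row `r`, and `G r` have no part of it; for a row
of two blocks of half-unit depth `T true r` layers are without the rear block and `T false r`
without the front one, after un-splitting. -/
@[ext]
structure State where
  F : ℤ → ℤ
  G : ℤ → ℤ
  T : Bool → ℤ → ℤ

/-- A single block of half-unit depth: in the rear for `true`, in front for `false`. -/
def single : Bool → Top
  | true => .rear
  | false => .front

/-- The boundaries are in their natural order. -/
structure IsLoose (n l : ℕ) (m : State) : Prop where
  perF : QuasiPeriodic n l m.F
  perG : QuasiPeriodic n l m.G
  perT : ∀ b r, IsThin n r → m.T b (r + period n) = m.T b r + l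
  F_le_G : ∀ r, m.F (r - 1) ≤ m.G r
  G_le_F : ∀ r, m.G r ≤ m.F r
  G_le_T : ∀ b r, IsThin n r → m.G r ≤ m.T b r
  T_le_F : ∀ b r, IsThin n r → m.T b r ≤ m.F r

/-- The boundaries come from a configuration that can be reached by splitting. -/
structure IsConfig (n l : ℕ) (m : State) : Prop extends IsLoose n l m where
  mirror : ∀ r, m.F (-r) - m.G (-r) = m.F r - m.G r
  T_add : ∀ r, IsThin n r → m.T true r + m.T false r = m.F r + m.G r
  T_eq_zero : ∀ b r, ¬ IsThin n r → m.T b r = 0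
  F_eq_zero : l = 0 → ∀ r, m.F r = 0

/-- No more splitting is possible. -/
def State.Terminal (m : State) : Prop :=
  ∀ r, m.G r = m.F (r - 1) ∨ m.G (1 - r) = m.F (-r)

/-- The layer number `j` of the cyclic extension is `c`. -/
structure State.At (n : ℕ) (m : State) (j : ℤ) (c : Layer) : Prop where
  ge : m.F (c.row - 1) ≤ j
  lt : j < m.F c.row
  flat : c.top = .flat ↔ j < m.G c.row
  single : ∀ b, c.top = single b ↔ IsThin n c.row ∧ m.T b c.row ≤ j ∧ j < m.T (!b) c.row

/-- The layers `C` have the boundaries `m`. -/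
def State.Encodes (n : ℕ) {l : ℕ} (m : State) (C : Layers l) : Prop :=
  ∀ j : Fin l, m.At n j (C j)

namespace IsLoose

variable {n l : ℕ} {m m' : State}

theorem F_succ (h : IsLoose n l m) (r : ℤ) : m.F r ≤ m.G (r + 1) := by
  simpa using h.F_le_G (r + 1)

theorem F_mono (h : IsLoose n l m) : Monotone m.F := by
  apply monotone_int_of_le_succ
  intro r
  exact (h.F_succ r).trans (h.G_le_F _)

theorem T_per_mul (hn : 4 ≤ n) (h : IsLoose n l m) (b : Bool) {r : ℤ} (hr : IsThin n r) (k : ℤ) :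
    m.T b (r + k * period n) = m.T b r + k * l := by
  -- `T` is only periodic on thin rows; restricted to the class of `r` and made constant on each
  -- cycle it becomes quasi-periodic everywhere.
  have hq : QuasiPeriodic n l (fun x => m.T b (r + (x / period n) * period n)) := by
    intro x
    have := period_pos hn
    show m.T b (r + (x + period n) / period n * period n) = _
    rw [Int.add_ediv_of_dvd_right (dvd_refl _), Int.ediv_self (by omega), add_mul, one_mul,
      ← add_assoc]
    apply h.perT
    rw [isThin_congr hn (r := r) (by simp)]
    exact hr
  have := hq.add_mul 0 k
  have hp := period_pos hn
  simpa [Int.mul_ediv_cancel _ (show period n ≠ 0 by omega)] using this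

end IsLoose

theorem IsConfig.T_add' {n l : ℕ} {m : State} (h : IsConfig n l m) (b : Bool) {r : ℤ} (hr : IsThin n r) :
    m.T b r + m.T (!b) r = m.F r + m.G r := by
  have := h.T_add r hr
  cases b <;> simp <;> omega


/-! ### Reading a layer off the boundaries -/

namespace State.At

variable {n l : ℕ} {m m' : State}

theorem row_le_iff (h : IsLoose n l m) {j : ℤ} {c : Layer} (hc : m.At n j c) (r : ℤ) :
    c.row ≤ r ↔ j < m.F r := by
  constructor
  · intro hr; exact hc.lt.trans_le (h.F_mono hr)
  · intro hr
    by_contra hlt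
    have := h.F_mono (show r ≤ c.row - 1 by omega)
    have := hc.ge
    omega

theorem row_eq_of {j : ℤ} (h : IsLoose n l m) {c : Layer} (hc : m.At n j c) {r : ℤ}
    (h1 : m.F (r - 1) ≤ j) (h2 : j < m.F r) : c.row = r := by
  have a := (hc.row_le_iff h r).2 h2
  have b := mt (hc.row_le_iff h (r - 1)).1 (by omega)
  omega

theorem top_half {j : ℤ} {c : Layer} (hc : m.At n j c) :
    c.top = .half ↔ m.G c.row ≤ j ∧
      (IsThin n c.row → ∀ b, m.T b c.row ≤ j → m.T (!b) c.row ≤ j) := by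
  have h1 := hc.flat
  have h2 := hc.single true
  have h3 := hc.single false
  simp only [YoungWallD.single, Bool.forall_bool, Bool.not_true, Bool.not_false] at *
  by_cases ht : IsThin n c.row
  · cases hcc : c.top <;> simp_all
  · cases hcc : c.top <;> simp_all

theorem unique (h : IsLoose n l m) {j : ℤ} {c c' : Layer} (hc : m.At n j c)
    (hc' : m.At n j c') : c = c' := by
  have hr : c.row = c'.row := hc.row_eq_of h hc'.ge hc'.lt
  have h1 := hc.flat
  have h2 := hc.single true
  have h3 := hc.single false
  have h1' := hc'.flat
  have h2' := hc'.single true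
  have h3' := hc'.single false
  rw [← hr] at h1' h2' h3'
  rw [← h1'] at h1
  rw [← h2'] at h2
  rw [← h3'] at h3
  obtain ⟨r, t⟩ := c
  obtain ⟨r', t'⟩ := c'
  simp only [YoungWallD.single] at *
  cases t <;> cases t' <;> simp_all

theorem shift (hn : 4 ≤ n) (h : IsLoose n l m) {j : ℤ} {c : Layer} (hc : m.At n j c) (k : ℤ) :
    m.At n (j + k * l) ⟨c.row + k * period n, c.top⟩ := by
  have hd : period n ∣ c.row + k * period n - c.row := by simp
  refine ⟨?_, ?_, ?_, fun b => ?_⟩ <;> dsimp only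
  · have := hc.ge
    rw [add_sub_right_comm, h.perF.add_mul]; omega
  · have := hc.lt
    rw [h.perF.add_mul]; omega
  · rw [h.perG.add_mul, hc.flat]; omega
  · rw [hc.single b, isThin_congr hn hd]
    refine and_congr_right fun ht => ?_
    rw [h.T_per_mul hn _ ht, h.T_per_mul hn _ ht]; omega

end State.At

/-- The row of the layer is the least `r` with `j < F r`. It exists because at positive level `F` is
unbounded in both directions. -/
theorem IsLoose.exists_at {n l : ℕ} {m : State} (h : IsLoose n l m) (hl : 0 < l) (j : ℤ) :
    ∃ c, m.At n j c := by
  classical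
  have hlow : ∃ b : ℤ, ∀ z, j < m.F z → b ≤ z := by
    -- The first summand is zero. Going down `|j - F 0|` cycles lowers `F` by `|j - F 0| * l`, which
    -- suffices as `l ≥ 1`.
    refine ⟨(j - m.F 0) / 1 * 0 + (-(|j - m.F 0|)) * period n, fun z hz => ?_⟩
    by_contra hlt
    have hm := h.F_mono (show z ≤ 0 + (-(|j - m.F 0|)) * period n by omega)
    rw [h.perF.add_mul] at hm
    have : (1 : ℤ) ≤ l := by exact_mod_cast hl
    have h3 := neg_abs_le (j - m.F 0)
    have h4 := abs_nonneg (j - m.F 0)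
    nlinarith
  have hex : ∃ z, j < m.F z := by
    refine ⟨0 + (|j - m.F 0| + 1) * period n, ?_⟩
    rw [h.perF.add_mul]
    have : (1 : ℤ) ≤ l := by exact_mod_cast hl
    have h3 := le_abs_self (j - m.F 0)
    have h4 := abs_nonneg (j - m.F 0)
    nlinarith
  obtain ⟨r, hr, hmin⟩ := Int.exists_least_of_bdd hlow hex
  have hge : m.F (r - 1) ≤ j := by
    by_contra hlt
    have := hmin _ (not_le.1 hlt)
    omega
  by_cases h1 : j < m.G r
  · refine ⟨⟨r, .flat⟩, hge, hr, by simpa using h1, fun b => ?_⟩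
    simp only [single]
    constructor
    · cases b <;> simp
    · rintro ⟨ht, h2, -⟩
      have := h.G_le_T b r ht
      omega
  by_cases h2 : IsThin n r ∧ ∃ b, m.T b r ≤ j ∧ j < m.T (!b) r
  · obtain ⟨ht, b, h2, h3⟩ := h2
    refine ⟨⟨r, single b⟩, hge, hr, ?_, fun b' => ?_⟩
    · cases b <;> simp [single] <;> omega
    · cases b <;> cases b' <;> simp [single, ht] at * <;> omega
  · refine ⟨⟨r, .half⟩, hge, hr, by simpa using h1, fun b => ?_⟩
    constructor
    · cases b <;> simp [single]
    · rintro ⟨ht, h3⟩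
      exact (h2 ⟨ht, b, h3⟩).elim

theorem IsLoose.exists_encodes {n l : ℕ} {m : State} (h : IsLoose n l m) :
    ∃ C : Layers l, m.Encodes n C := by
  rcases Nat.eq_zero_or_pos l with rfl | hl
  · exact ⟨fun j => j.elim0, fun j => j.elim0⟩
  · choose f hf using h.exists_at hl
    exact ⟨fun j => f j, fun j => hf j⟩

theorem State.Encodes.ext {n l : ℕ} {m : State} (h : IsLoose n l m) {C C' : Layers l}
    (hC : m.Encodes n C) (hC' : m.Encodes n C') : C = C' :=
  funext fun j => (hC j).unique h (hC' j)


theorem State.Encodes.exists_at {n l : ℕ} (hn : 4 ≤ n) {m : State} (h : IsLoose n l m)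
    {C : Layers l} (hC : m.Encodes n C) (hl : 0 < l) (j : ℤ) :
    ∃ (j₀ : Fin l) (k : ℤ), j = j₀ + k * l ∧
      m.At n j ⟨(C j₀).row + k * period n, (C j₀).top⟩ := by
  have hl' : (0 : ℤ) < l := by exact_mod_cast hl
  have h0 := Int.emod_nonneg j hl'.ne'
  have h1 := Int.emod_lt_of_pos j hl'
  have h2 := Int.emod_add_mul_ediv j l
  obtain ⟨i, hi⟩ := Int.eq_ofNat_of_zero_le h0
  have e : j = ((⟨i, by omega⟩ : Fin l) : ℕ) + (j / l) * l := by
    simp only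
    rw [mul_comm, ← hi, h2]
  refine ⟨⟨i, by omega⟩, j / l, e, ?_⟩
  have := (hC ⟨i, by omega⟩).shift hn h (j / l)
  rwa [← e] at this

theorem State.At.lt_G_iff {n l : ℕ} {m : State} (h : IsLoose n l m) {j : ℤ} {c : Layer}
    (hc : m.At n j c) (r : ℤ) : j < m.G r ↔ c.row < r ∨ (c.row = r ∧ c.top = .flat) := by
  constructor
  · intro hj
    have h1 := (hc.row_le_iff h r).2 (hj.trans_le (h.G_le_F r))
    rcases h1.lt_or_eq with h2 | h2
    · exact .inl h2
    · exact .inr ⟨h2, hc.flat.2 (h2 ▸ hj)⟩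
  · rintro (h1 | ⟨rfl, h2⟩)
    · exact ((hc.row_le_iff h (r - 1)).1 (by omega)).trans_le (h.F_le_G r)
    · exact hc.flat.1 h2

/-- `F` and `G` are determined because the layers decide `j < F r` and `j < G r` for every `j`. The
thresholds `T` are visible only where single blocks lie between them; the sum prescribed by `T_add`
supplies the rest. Without layers everything is fixed by `F_eq_zero`. -/
theorem State.Encodes.state_unique {n l : ℕ} (hn : 4 ≤ n) {m m' : State} (h : IsConfig n l m)
    (h' : IsConfig n l m') {C : Layers l} (hC : m.Encodes n C) (hC' : m'.Encodes n C) : m = m' := by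
  have key : m.F = m'.F ∧ m.G = m'.G ∧ ∀ b r, IsThin n r → m.T b r = m'.T b r := by
    rcases Nat.eq_zero_or_pos l with hl | hl
    · have hF := h.F_eq_zero hl
      have hF' := h'.F_eq_zero hl
      have hG : ∀ r, m.G r = 0 := fun r => by
        have := h.F_le_G r; have := h.G_le_F r; rw [hF] at *; omega
      have hG' : ∀ r, m'.G r = 0 := fun r => by
        have := h'.F_le_G r; have := h'.G_le_F r; rw [hF'] at *; omega
      refine ⟨funext fun r => by rw [hF, hF'], funext fun r => by rw [hG, hG'], fun b r hr => ?_⟩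
      have a1 := h.G_le_T b r hr
      have a2 := h.T_le_F b r hr
      have a3 := h'.G_le_T b r hr
      have a4 := h'.T_le_F b r hr
      rw [hF, hG, hF', hG'] at *
      omega
    · have both : ∀ j : ℤ, ∃ c, m.At n j c ∧ m'.At n j c := by
        intro j
        obtain ⟨j₀, k, hj, hat⟩ := hC.exists_at hn h.toIsLoose hl j
        refine ⟨_, hat, ?_⟩
        have := (hC' j₀).shift hn h'.toIsLoose k
        rwa [← hj] at this
      have hF : ∀ j r, j < m.F r ↔ j < m'.F r := fun j r => by
        obtain ⟨c, h1, h2⟩ := both j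
        rw [← h1.row_le_iff h.toIsLoose, h2.row_le_iff h'.toIsLoose]
      have hG : ∀ j r, j < m.G r ↔ j < m'.G r := fun j r => by
        obtain ⟨c, h1, h2⟩ := both j
        rw [h1.lt_G_iff h.toIsLoose, h2.lt_G_iff h'.toIsLoose]
      have eF : m.F = m'.F := funext fun r => by
        have := hF (m.F r) r; have := hF (m'.F r) r; omega
      have eG : m.G = m'.G := funext fun r => by
        have := hG (m.G r) r; have := hG (m'.G r) r; omega
      -- Used for both bits and for both orders of the two states: if the thresholds differed, the
      -- equal sums would force one pair to enclose the other strictly, and the enclosing pair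
      -- violates one of the four instances.
      have le : ∀ b r, IsThin n r → ∀ (m m' : State), IsConfig n l m → IsConfig n l m' →
          m.F = m'.F → m.G = m'.G → (∀ j, ∃ c, m.At n j c ∧ m'.At n j c) →
          m.T b r ≤ m'.T b r ∨ m.T b r < m.T (!b) r := by
        intro b r hr m m' h h' eF eG both
        by_contra hcon
        push Not at hcon
        obtain ⟨h1, h2⟩ := hcon
        have s1 := h.T_add' b hr
        have s2 := h'.T_add' b hr
        have eFr := congrFun eF r
        have eGr := congrFun eG r
        have g1 := h'.F_le_G r
        have g5 := h.F_le_G r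
        have g2 := h.G_le_T (!b) r hr
        have g3 := h.T_le_F b r hr
        have g4 := h'.G_le_T b r hr
        rcases lt_or_ge (m'.T b r) (m'.T (!b) r) with hlt | hge
        · obtain ⟨c, c1, c2⟩ := both (m'.T b r)
          have hrow := c2.row_eq_of h'.toIsLoose (r := r) (by omega) (by omega)
          have t1 := (c2.single b).2 (by rw [hrow]; exact ⟨hr, le_rfl, hlt⟩)
          have t2 := (c1.single b).1 t1
          rw [hrow] at t2
          omega
        · obtain ⟨c, c1, c2⟩ := both (m.T (!b) r)
          have hrow := c1.row_eq_of h.toIsLoose (r := r) (by omega) (by omega)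
          have t1 := (c1.single (!b)).2 (by
            rw [hrow, Bool.not_not]; exact ⟨hr, le_rfl, by omega⟩)
          have t2 := (c2.single (!b)).1 t1
          rw [hrow] at t2
          omega
      refine ⟨eF, eG, fun b r hr => ?_⟩
      have s1 := h.T_add' b hr
      have s2 := h'.T_add' b hr
      rw [eF, eG] at s1
      have l1 := le b r hr m m' h h' eF eG both
      have l2 := le (!b) r hr m m' h h' eF eG both
      have both' : ∀ j, ∃ c, m'.At n j c ∧ m.At n j c := fun j => by
        obtain ⟨c, h1, h2⟩ := both j; exact ⟨c, h2, h1⟩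
      have l3 := le b r hr m' m h' h eF.symm eG.symm both'
      have l4 := le (!b) r hr m' m h' h eF.symm eG.symm both'
      simp only [Bool.not_not] at l2 l4
      omega
  refine State.ext key.1 key.2.1 (funext fun b => funext fun r => ?_)
  by_cases hr : IsThin n r
  · exact key.2.2 b r hr
  · rw [h.T_eq_zero b r hr, h'.T_eq_zero b r hr]

/-! ### The chosen layers -/

theorem rearLow_eq_some {l : ℕ} {p : Layer → Prop} {C : Layers l} {b : Fin l}
    (h : IsRearLow p C b) : rearLow p C = some b := by
  have hex : ∃ b, IsRearLow p C b := ⟨b, h⟩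
  have h2 := hex.choose_spec
  rw [rearLow, dif_pos hex]
  congr 1
  have h3 := h.2 _ h2.1
  have h4 := h2.2 _ h.1
  apply le_antisymm <;> omega

theorem rearLow_eq_none {l : ℕ} {p : Layer → Prop} {C : Layers l} (h : ∀ b, ¬ p (C b)) :
    rearLow p C = none := dif_neg fun ⟨b, hb⟩ => h b hb.1

theorem foreHigh_eq_some {l : ℕ} {p : Layer → Prop} {C : Layers l} {b : Fin l}
    (h : IsForeHigh p C b) : foreHigh p C = some b := by
  have hex : ∃ b, IsForeHigh p C b := ⟨b, h⟩
  have h2 := hex.choose_spec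
  rw [foreHigh, dif_pos hex]
  congr 1
  have h3 := h.2 _ h2.1
  have h4 := h2.2 _ h.1
  apply le_antisymm <;> omega

theorem foreHigh_eq_none {l : ℕ} {p : Layer → Prop} {C : Layers l} (h : ∀ b, ¬ p (C b)) :
    foreHigh p C = none := dif_neg fun ⟨b, hb⟩ => h b hb.1

theorem exists_fin_congr {l : ℕ} (hl : 0 < l) (x : ℤ) : ∃ (b : Fin l) (k : ℤ), (b : ℤ) = x + k * l := by
  have hl' : (0 : ℤ) < l := by exact_mod_cast hl
  have h0 := Int.emod_nonneg x hl'.ne'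
  have h1 := Int.emod_lt_of_pos x hl'
  have h2 := Int.emod_add_mul_ediv x l
  obtain ⟨i, hi⟩ := Int.eq_ofNat_of_zero_le h0
  refine ⟨⟨i, by omega⟩, -(x / l), ?_⟩
  have : -(x / l) * (l : ℤ) = -(l * (x / l)) := by ring
  simp only
  omega

theorem eq_of_fin_congr {l : ℕ} {b b' : Fin l} {x k k' : ℤ} (h : (b : ℤ) = x + k * l)
    (h' : (b' : ℤ) = x + k' * l) : k = k' ∧ b = b' := by
  have h1 := b.2
  have h2 := b'.2
  have : k = k' := by
    rcases lt_trichotomy k k' with hk | hk | hk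
    · nlinarith
    · exact hk
    · nlinarith
  subst this
  exact ⟨rfl, Fin.ext (by omega)⟩

/-- The layers of type `p` are the translates of one interval `[lo, hi)` by multiples of `l`, the
translate number `k` lying `k` cycles higher. The slot chosen is the representative of `hi - 1`: it
is last in its translate, and a layer of a lower translate would have a negative index. -/
theorem rearLow_cyclic {n l : ℕ} (hn : 4 ≤ n) {p : Layer → Prop} {C : Layers l} {lo hi r₀ : ℤ}
    (h1 : lo < hi) (h2 : hi ≤ lo + l)
    (hp : ∀ j : Fin l, p (C j) ↔ ∃ k : ℤ, lo + k * l ≤ j ∧ (j : ℤ) < hi + k * l)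
    (hrow : ∀ (j : Fin l) (k : ℤ), lo + k * l ≤ j → (j : ℤ) < hi + k * l →
      (C j).row = r₀ + k * period n) :
    ∃ (b : Fin l) (k : ℤ), (b : ℤ) = hi - 1 + k * l ∧ rearLow p C = some b := by
  obtain ⟨b, k, hb⟩ := exists_fin_congr (show 0 < l by omega) (hi - 1)
  have hP := period_pos hn
  refine ⟨b, k, hb, rearLow_eq_some ⟨(hp b).2 ⟨k, by omega, by omega⟩, fun b' hb' => ?_⟩⟩
  obtain ⟨k', h3, h4⟩ := (hp b').1 hb'
  rw [hrow b k (by omega) (by omega), hrow b' k' h3 h4]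
  have := b.2
  have := b'.2
  rcases lt_trichotomy k k' with hk | hk | hk
  · left; nlinarith
  · subst hk; right; exact ⟨rfl, by rw [Fin.le_def]; omega⟩
  · exfalso; nlinarith

/-- Dual to `rearLow_cyclic`: the representative of `lo` is first in its translate, and a layer of a
higher translate would have an index of at least `l`. -/
theorem foreHigh_cyclic {n l : ℕ} (hn : 4 ≤ n) {p : Layer → Prop} {C : Layers l} {lo hi r₀ : ℤ}
    (h1 : lo < hi) (h2 : hi ≤ lo + l)
    (hp : ∀ j : Fin l, p (C j) ↔ ∃ k : ℤ, lo + k * l ≤ j ∧ (j : ℤ) < hi + k * l)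
    (hrow : ∀ (j : Fin l) (k : ℤ), lo + k * l ≤ j → (j : ℤ) < hi + k * l →
      (C j).topRow = r₀ + k * period n) :
    ∃ (b : Fin l) (k : ℤ), (b : ℤ) = lo + k * l ∧ foreHigh p C = some b := by
  obtain ⟨b, k, hb⟩ := exists_fin_congr (show 0 < l by omega) lo
  have hP := period_pos hn
  refine ⟨b, k, hb, foreHigh_eq_some ⟨(hp b).2 ⟨k, by omega, by omega⟩, fun b' hb' => ?_⟩⟩
  obtain ⟨k', h3, h4⟩ := (hp b').1 hb'
  rw [hrow b k (by omega) (by omega), hrow b' k' h3 h4]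
  have := b.2
  have := b'.2
  rcases lt_trichotomy k k' with hk | hk | hk
  · exfalso; nlinarith
  · subst hk; right; exact ⟨rfl, by rw [Fin.le_def]; omega⟩
  · left; nlinarith

theorem State.Encodes.update {n l : ℕ} {m' : State} {C : Layers l} {b : Fin l} {c : Layer}
    (h : ∀ j, j ≠ b → m'.At n j (C j)) (hb : m'.At n b c) :
    m'.Encodes n (Function.update C b c) := by
  intro j
  by_cases hj : j = b
  · subst hj; simpa using hb
  · simpa [hj] using h j hj

/-! ### Moving one boundary -/

/-- The boundary `F`, in the rows at the position of `r`, moves by `d`. -/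
noncomputable def State.addF (n : ℕ) (m : State) (r d : ℤ) : State :=
  { m with F := fun x => m.F x + d * ind n r x }

/-- The boundary `G`, in the rows at the position of `r`, moves by `d`. -/
noncomputable def State.addG (n : ℕ) (m : State) (r d : ℤ) : State :=
  { m with G := fun x => m.G x + d * ind n r x }

theorem QuasiPeriodic.add_ind {n l : ℕ} {f : ℤ → ℤ} (h : QuasiPeriodic n l f) (r d : ℤ) :
    QuasiPeriodic n l (fun x => f x + d * ind n r x) := by
  intro x
  show f (x + period n) + d * ind n r (x + period n) = f x + d * ind n r x + l
  rw [h, ind_add_period]; ring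

theorem QuasiPeriodic.eq_add {n l : ℕ} {f : ℤ → ℤ} (h : QuasiPeriodic n l f) {x r : ℤ}
    (hd : period n ∣ x - r) : ∃ k, x = r + k * period n ∧ f x = f r + k * l := by
  obtain ⟨k, hk⟩ := hd
  have hx : x = r + k * period n := by linarith
  exact ⟨k, hx, by rw [hx, h.add_mul]⟩

namespace IsLoose

variable {n l : ℕ} {m : State}

theorem lt_G_of_dvd (h : IsLoose n l m) {r x : ℤ} (hd : period n ∣ x - r) :
    m.F (r - 1) - m.G r = m.F (x - 1) - m.G x :=
  ((h.perF.shift (-1)).of_dvd h.perG hd).symm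

theorem lt_F_of_dvd (h : IsLoose n l m) {r x : ℤ} (hd : period n ∣ x - r) :
    m.G r - m.F r = m.G x - m.F x :=
  (h.perG.of_dvd h.perF hd).symm

theorem addG_neg (h : IsLoose n l m) {r : ℤ} (hr : m.F (r - 1) < m.G r) :
    IsLoose n l (m.addG n r (-1)) where
  perF := h.perF
  perG := h.perG.add_ind _ _
  perT := h.perT
  F_le_G x := by
    have := h.F_le_G x
    simp only [State.addG]
    rcases ind_cases (n := n) r x with ⟨hd, hi⟩ | ⟨hd, hi⟩ <;> rw [hi]
    · have := h.lt_G_of_dvd hd; omega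
    · omega
  G_le_F x := by
    have := h.G_le_F x
    simp only [State.addG]
    rcases ind_cases (n := n) r x with ⟨hd, hi⟩ | ⟨hd, hi⟩ <;> rw [hi] <;> omega
  G_le_T b x hx := by
    have := h.G_le_T b x hx
    simp only [State.addG]
    rcases ind_cases (n := n) r x with ⟨hd, hi⟩ | ⟨hd, hi⟩ <;> rw [hi] <;> omega
  T_le_F := h.T_le_F

/-- In a thin row `G` has to stay below the thresholds `T` as well, so that `G < F` would leave too
little room; hence the restriction to unit rows. -/
theorem addG_pos (hn : 4 ≤ n) (h : IsLoose n l m) {r : ℤ} (ht : ¬ IsThin n r) (hr : m.G r < m.F r) :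
    IsLoose n l (m.addG n r 1) where
  perF := h.perF
  perG := h.perG.add_ind _ _
  perT := h.perT
  F_le_G x := by
    have := h.F_le_G x
    simp only [State.addG]
    rcases ind_cases (n := n) r x with ⟨hd, hi⟩ | ⟨hd, hi⟩ <;> rw [hi] <;> omega
  G_le_F x := by
    have := h.G_le_F x
    simp only [State.addG]
    rcases ind_cases (n := n) r x with ⟨hd, hi⟩ | ⟨hd, hi⟩ <;> rw [hi]
    · have := h.lt_F_of_dvd hd; omega
    · omega
  G_le_T b x hx := by
    have := h.G_le_T b x hx
    simp only [State.addG]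
    rcases ind_cases (n := n) r x with ⟨hd, hi⟩ | ⟨hd, hi⟩ <;> rw [hi]
    · exact (ht ((isThin_congr hn hd).1 hx)).elim
    · omega
  T_le_F := h.T_le_F

theorem addF_neg (hn : 4 ≤ n) (h : IsLoose n l m) {r : ℤ} (ht : ¬ IsThin n r) (hr : m.G r < m.F r) :
    IsLoose n l (m.addF n r (-1)) where
  perF := h.perF.add_ind _ _
  perG := h.perG
  perT := h.perT
  F_le_G x := by
    have := h.F_le_G x
    simp only [State.addF]
    rcases ind_cases (n := n) r (x - 1) with ⟨hd, hi⟩ | ⟨hd, hi⟩ <;> rw [hi] <;> omega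
  G_le_F x := by
    have := h.G_le_F x
    simp only [State.addF]
    rcases ind_cases (n := n) r x with ⟨hd, hi⟩ | ⟨hd, hi⟩ <;> rw [hi]
    · have := h.lt_F_of_dvd hd; omega
    · omega
  G_le_T := h.G_le_T
  T_le_F b x hx := by
    have := h.T_le_F b x hx
    simp only [State.addF]
    rcases ind_cases (n := n) r x with ⟨hd, hi⟩ | ⟨hd, hi⟩ <;> rw [hi]
    · exact (ht ((isThin_congr hn hd).1 hx)).elim
    · omega

theorem addF_pos (h : IsLoose n l m) {r : ℤ} (hr : m.F r < m.G (r + 1)) :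
    IsLoose n l (m.addF n r 1) where
  perF := h.perF.add_ind _ _
  perG := h.perG
  perT := h.perT
  F_le_G x := by
    have := h.F_le_G x
    simp only [State.addF]
    rcases ind_cases (n := n) r (x - 1) with ⟨hd, hi⟩ | ⟨hd, hi⟩ <;> rw [hi]
    · have := h.lt_G_of_dvd (r := r + 1) (x := x) (by convert hd using 1; ring)
      rw [add_sub_cancel_right] at this
      omega
    · omega
  G_le_F x := by
    have := h.G_le_F x
    simp only [State.addF]
    rcases ind_cases (n := n) r x with ⟨hd, hi⟩ | ⟨hd, hi⟩ <;> rw [hi] <;> omega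
  G_le_T := h.G_le_T
  T_le_F b x hx := by
    have := h.T_le_F b x hx
    simp only [State.addF]
    rcases ind_cases (n := n) r x with ⟨hd, hi⟩ | ⟨hd, hi⟩ <;> rw [hi] <;> omega

end IsLoose

namespace State.Encodes

variable {n l : ℕ} {m : State} {C : Layers l}

/-- A half block is put in a whole slot. -/
theorem put_whole (h : IsLoose n l m) (hC : m.Encodes n C) {r k : ℤ} {b : Fin l}
    (hr : m.F (r - 1) < m.G r) (hb : (b : ℤ) = m.G r - 1 + k * l) :
    C b = ⟨r + k * period n, .flat⟩ ∧
      (m.addG n r (-1)).Encodes n (Function.update C b (C b).putHalf) := by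
  have hd : period n ∣ r + k * period n - r := by simp
  have eG := h.perG.add_mul r k
  have eF := (h.perF.shift (-1)).add_mul r k
  simp only [← sub_eq_add_neg] at eF
  have hGF := h.G_le_F (r + k * period n)
  have hrow : (C b).row = r + k * period n :=
    (hC b).row_eq_of h (by rw [eF]; omega) (by omega)
  have htop : (C b).top = .flat := (hC b).flat.2 (by rw [hrow]; omega)
  have hCb : C b = ⟨r + k * period n, .flat⟩ := by rw [← hrow, ← htop]
  refine ⟨hCb, ?_⟩
  rw [hCb]
  refine State.Encodes.update (fun j hj => ?_) ?_
  · have hat := hC j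
    refine ⟨hat.ge, hat.lt, ?_, hat.single⟩
    rw [hat.flat]
    simp only [State.addG]
    rcases ind_cases (n := n) r (C j).row with ⟨hd, hi⟩ | ⟨hd, hi⟩ <;> rw [hi]
    · obtain ⟨k', -, hk'⟩ := h.perG.eq_add hd
      -- Moving the boundary by one only changes the comparison for indices congruent to `G r - 1`,
      -- and `b` is the only one among the `l` layers.
      have : (j : ℤ) ≠ m.G r - 1 + k' * l := fun he => hj (eq_of_fin_congr he hb).2
      omega
    · omega
  · refine ⟨?_, ?_, ?_, fun b' => ?_⟩ <;> simp only [Layer.putHalf, State.addG]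
    · rw [eF]; omega
    · omega
    · simp [ind_of_dvd hd]; omega
    · constructor
      · cases b' <;> simp [YoungWallD.single]
      · rintro ⟨ht, h1, -⟩
        have := h.G_le_T b' _ ht
        omega

/-- A half block is put in a half slot. -/
theorem put_half (hn : 4 ≤ n) (h : IsLoose n l m) (hC : m.Encodes n C) {r k : ℤ} {b : Fin l}
    (ht : ¬ IsThin n r) (hr : m.G r < m.F r) (hb : (b : ℤ) = m.F r - 1 + k * l) :
    C b = ⟨r + k * period n, .half⟩ ∧
      (m.addF n r (-1)).Encodes n (Function.update C b (C b).putHalf) := by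
  have hd : period n ∣ r + k * period n - r := by simp
  have hnd : ¬ period n ∣ r + k * period n + 1 - r := by
    intro hh
    apply not_dvd_one hn
    have := dvd_sub hh hd
    rwa [sub_sub_sub_cancel_right, add_sub_cancel_left] at this
  have eG := h.perG.add_mul r k
  have eF := h.perF.add_mul r k
  have hFG := h.F_le_G (r + k * period n)
  have hFG' := h.F_succ (r + k * period n)
  have hGF' := h.G_le_F (r + k * period n + 1)
  have hrow : (C b).row = r + k * period n :=
    (hC b).row_eq_of h (by omega) (by omega)
  have htt : ¬ IsThin n (r + k * period n) := by rwa [isThin_congr hn hd]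
  have htop : (C b).top = .half := (hC b).top_half.2 ⟨by rw [hrow]; omega, by
    rw [hrow]; exact fun hh => (htt hh).elim⟩
  have hCb : C b = ⟨r + k * period n, .half⟩ := by rw [← hrow, ← htop]
  refine ⟨hCb, ?_⟩
  rw [hCb]
  refine State.Encodes.update (fun j hj => ?_) ?_
  · have hat := hC j
    refine ⟨?_, ?_, hat.flat, hat.single⟩ <;> simp only [State.addF]
    · have := hat.ge
      rcases ind_cases (n := n) r ((C j).row - 1) with ⟨hd, hi⟩ | ⟨hd, hi⟩ <;> rw [hi] <;> omega
    · have := hat.lt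
      rcases ind_cases (n := n) r (C j).row with ⟨hd, hi⟩ | ⟨hd, hi⟩ <;> rw [hi]
      · obtain ⟨k', -, hk'⟩ := h.perF.eq_add hd
        have : (j : ℤ) ≠ m.F r - 1 + k' * l := fun he => hj (eq_of_fin_congr he hb).2
        omega
      · omega
  · refine ⟨?_, ?_, ?_, fun b' => ?_⟩ <;> simp only [Layer.putHalf, State.addF]
    · rw [add_sub_cancel_right, ind_of_dvd hd]; omega
    · rw [ind_of_not_dvd hnd]; omega
    · simp; omega
    · constructor
      · cases b' <;> simp [YoungWallD.single]
      · rintro ⟨ht, h1, -⟩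
        have := h.G_le_T b' _ ht
        omega

/-- The upper half of a whole block is removed. -/
theorem take_whole (hn : 4 ≤ n) (h : IsLoose n l m) (hC : m.Encodes n C) {r k : ℤ} {b : Fin l}
    (hr : m.F r < m.G (r + 1)) (hb : (b : ℤ) = m.F r + k * l) :
    C b = ⟨r + k * period n + 1, .flat⟩ ∧
      (m.addF n r 1).Encodes n (Function.update C b (C b).takeHalf) := by
  have hd : period n ∣ r + k * period n - r := by simp
  have hnd : ¬ period n ∣ r + k * period n - 1 - r := by
    intro hh
    apply not_dvd_one hn
    have := dvd_sub hd hh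
    rwa [sub_sub_sub_cancel_right, sub_sub_cancel] at this
  have eG := h.perG.add_mul (r + 1) k
  have eF := h.perF.add_mul r k
  rw [add_right_comm] at eG
  have hFG := h.F_le_G (r + k * period n)
  have hFG' := h.F_succ (r + k * period n)
  have hGF := h.G_le_F (r + k * period n)
  have hGF' := h.G_le_F (r + k * period n + 1)
  have hrow : (C b).row = r + k * period n + 1 :=
    (hC b).row_eq_of h (by rw [add_sub_cancel_right]; omega) (by omega)
  have htop : (C b).top = .flat := (hC b).flat.2 (by rw [hrow]; omega)
  have hCb : C b = ⟨r + k * period n + 1, .flat⟩ := by rw [← hrow, ← htop]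
  refine ⟨hCb, ?_⟩
  rw [hCb]
  refine State.Encodes.update (fun j hj => ?_) ?_
  · have hat := hC j
    refine ⟨?_, ?_, hat.flat, hat.single⟩ <;> simp only [State.addF]
    · have := hat.ge
      rcases ind_cases (n := n) r ((C j).row - 1) with ⟨hd, hi⟩ | ⟨hd, hi⟩ <;> rw [hi]
      · obtain ⟨k', -, hk'⟩ := h.perF.eq_add hd
        have : (j : ℤ) ≠ m.F r + k' * l := fun he => hj (eq_of_fin_congr he hb).2
        omega
      · omega
    · have := hat.lt
      rcases ind_cases (n := n) r (C j).row with ⟨hd, hi⟩ | ⟨hd, hi⟩ <;> rw [hi] <;> omega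
  · refine ⟨?_, ?_, ?_, fun b' => ?_⟩ <;> simp only [Layer.takeHalf, State.addF, add_sub_cancel_right]
    · rw [ind_of_not_dvd hnd]; omega
    · rw [ind_of_dvd hd]; omega
    · simp; omega
    · constructor
      · cases b' <;> simp [YoungWallD.single]
      · rintro ⟨ht, h1, h2⟩
        have := h.T_le_F (!b') _ ht
        omega

/-- A half block is removed. -/
theorem take_half (hn : 4 ≤ n) (h : IsLoose n l m) (hC : m.Encodes n C) {r k : ℤ} {b : Fin l}
    (ht : ¬ IsThin n r) (hr : m.G r < m.F r) (hb : (b : ℤ) = m.G r + k * l) :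
    C b = ⟨r + k * period n, .half⟩ ∧
      (m.addG n r 1).Encodes n (Function.update C b (C b).takeHalf) := by
  have hd : period n ∣ r + k * period n - r := by simp
  have eG := h.perG.add_mul r k
  have eF := h.perF.add_mul r k
  have hFG := h.F_le_G (r + k * period n)
  have hGF := h.G_le_F (r + k * period n)
  have hrow : (C b).row = r + k * period n :=
    (hC b).row_eq_of h (by omega) (by omega)
  have htt : ¬ IsThin n (r + k * period n) := by rwa [isThin_congr hn hd]
  have htop : (C b).top = .half := (hC b).top_half.2 ⟨by rw [hrow]; omega, by
    rw [hrow]; exact fun hh => (htt hh).elim⟩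
  have hCb : C b = ⟨r + k * period n, .half⟩ := by rw [← hrow, ← htop]
  refine ⟨hCb, ?_⟩
  rw [hCb]
  refine State.Encodes.update (fun j hj => ?_) ?_
  · have hat := hC j
    refine ⟨hat.ge, hat.lt, ?_, hat.single⟩
    rw [hat.flat]
    simp only [State.addG]
    rcases ind_cases (n := n) r (C j).row with ⟨hd, hi⟩ | ⟨hd, hi⟩ <;> rw [hi]
    · obtain ⟨k', -, hk'⟩ := h.perG.eq_add hd
      have : (j : ℤ) ≠ m.G r + k' * l := fun he => hj (eq_of_fin_congr he hb).2
      omega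
    · omega
  · refine ⟨?_, ?_, ?_, fun b' => ?_⟩ <;> simp only [Layer.takeHalf, State.addG]
    · omega
    · omega
    · simp [ind_of_dvd hd]; omega
    · constructor
      · cases b' <;> simp [YoungWallD.single]
      · rintro ⟨ht, -⟩
        exact (htt ht).elim

end State.Encodes


/-- The layers with top in row `r` form the interval `[F (r - 1), F r)`; its length is at most `l`,
as `rearLow_cyclic` and `foreHigh_cyclic` require. -/
theorem IsLoose.F_le_F_sub {n l : ℕ} (hn : 4 ≤ n) {m : State} (h : IsLoose n l m) (r : ℤ) :
    m.F r ≤ m.F (r - 1) + l := by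
  rw [← h.perF]
  have := period_pos hn
  exact h.F_mono (by omega)

/-! ### The chosen slots and blocks in terms of boundaries -/

section Choice

variable {n l : ℕ} {m : State} {C : Layers l} {p : Layer → Prop} {r : ℤ}

/-- The layers that are flat in row `r` are `[F (r - 1), G r)`, and the chosen slot is the last of
them modulo `l`. -/
theorem rearLow_whole (hn : 4 ≤ n) (h : IsLoose n l m) (hC : m.Encodes n C)
    (hp : ∀ c, p c ↔ c.top = .flat ∧ period n ∣ c.row - r) :
    (m.F (r - 1) < m.G r → ∃ (b : Fin l) (k : ℤ), (b : ℤ) = m.G r - 1 + k * l ∧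
      rearLow p C = some b) ∧ (¬ m.F (r - 1) < m.G r → rearLow p C = none) := by
  have hF := (h.perF.shift (-1)).add_mul r
  simp only [← sub_eq_add_neg] at hF
  have hG := h.perG.add_mul r
  have hFl := h.F_le_F_sub hn r
  have hGF := h.G_le_F
  have hp' : ∀ j : Fin l, p (C j) ↔
      ∃ k : ℤ, m.F (r - 1) + k * l ≤ j ∧ (j : ℤ) < m.G r + k * l := by
    intro j
    rw [hp]
    have hat := hC j
    constructor
    · rintro ⟨h1, h2⟩
      obtain ⟨k, hk, -⟩ := h.perG.eq_add h2
      refine ⟨k, ?_, ?_⟩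
      · rw [← hF, ← hk]; exact hat.ge
      · rw [← hG, ← hk]; exact hat.flat.1 h1
    · rintro ⟨k, h1, h2⟩
      rw [← hF] at h1
      rw [← hG] at h2
      have hr := hat.row_eq_of h h1 (h2.trans_le (hGF _))
      refine ⟨hat.flat.2 (by rw [hr]; exact h2), by rw [hr]; simp⟩
  constructor
  · intro hlt
    refine rearLow_cyclic hn (r₀ := r) hlt (by have := hGF r; omega) hp' ?_
    intro j k h1 h2
    rw [← hF] at h1
    rw [← hG] at h2
    exact (hC j).row_eq_of h h1 (h2.trans_le (hGF _))
  · intro hlt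
    refine rearLow_eq_none fun j hj => ?_
    obtain ⟨k, h1, h2⟩ := (hp' j).1 hj
    omega

/-- A whole block of row `r` is on top of the layers that are flat in row `r + 1`, that is `[F r, G
(r + 1))`; the first of them is chosen. -/
theorem foreHigh_whole (hn : 4 ≤ n) (h : IsLoose n l m) (hC : m.Encodes n C)
    (hp : ∀ c, p c ↔ c.top = .flat ∧ period n ∣ c.row - 1 - r) :
    (m.F r < m.G (r + 1) → ∃ (b : Fin l) (k : ℤ), (b : ℤ) = m.F r + k * l ∧
      foreHigh p C = some b) ∧ (¬ m.F r < m.G (r + 1) → foreHigh p C = none) := by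
  have hF := h.perF.add_mul r
  have hG : ∀ k : ℤ, m.G (r + k * period n + 1) = m.G (r + 1) + k * l := fun k => by
    rw [← h.perG.add_mul]; congr 1; ring
  have hFl := h.F_le_F_sub hn (r + 1)
  rw [add_sub_cancel_right] at hFl
  have hGF := h.G_le_F
  have hp' : ∀ j : Fin l, p (C j) ↔
      ∃ k : ℤ, m.F r + k * l ≤ j ∧ (j : ℤ) < m.G (r + 1) + k * l := by
    intro j
    rw [hp]
    have hat := hC j
    constructor
    · rintro ⟨h1, h2⟩
      obtain ⟨k, hk, -⟩ := h.perG.eq_add h2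
      refine ⟨k, ?_, ?_⟩
      · rw [← hF, ← hk]; exact hat.ge
      · rw [← hG, ← hk, sub_add_cancel]; exact hat.flat.1 h1
    · rintro ⟨k, h1, h2⟩
      rw [← hF] at h1
      rw [← hG] at h2
      have hr := hat.row_eq_of h (r := r + k * period n + 1) (by rwa [add_sub_cancel_right])
        (h2.trans_le (hGF _))
      refine ⟨hat.flat.2 (by rw [hr]; exact h2), by rw [hr]; simp⟩
  constructor
  · intro hlt
    refine foreHigh_cyclic hn (r₀ := r) hlt (by have := hGF (r + 1); omega) hp' ?_
    intro j k h1 h2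
    have hpj := (hp _).1 ((hp' j).2 ⟨k, h1, h2⟩)
    rw [← hF] at h1
    rw [← hG] at h2
    have := (hC j).row_eq_of h (r := r + k * period n + 1) (by rwa [add_sub_cancel_right])
      (h2.trans_le (hGF _))
    simp [Layer.topRow, hpj.1, this]
  · intro hlt
    refine foreHigh_eq_none fun j hj => ?_
    obtain ⟨k, h1, h2⟩ := (hp' j).1 hj
    omega

/-- In a unit row whatever is neither empty nor full is a half, so that the halves fill the whole
interval `[G r, F r)`. -/
theorem half_iff (hn : 4 ≤ n) (h : IsLoose n l m) (hC : m.Encodes n C) (ht : ¬ IsThin n r)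
    (hp : ∀ c, p c ↔ c.top = .half ∧ period n ∣ c.row - r) (j : Fin l) :
    (p (C j) ↔ ∃ k : ℤ, m.G r + k * l ≤ j ∧ (j : ℤ) < m.F r + k * l) ∧
      ∀ k : ℤ, m.G r + k * l ≤ j → (j : ℤ) < m.F r + k * l → C j = ⟨r + k * period n, .half⟩ := by
  have hF := h.perF.add_mul r
  have hG := h.perG.add_mul r
  have hat := hC j
  have h2 : ∀ k : ℤ, m.G r + k * l ≤ j → (j : ℤ) < m.F r + k * l →
      C j = ⟨r + k * period n, .half⟩ := by
    intro k h1 h2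
    rw [← hG] at h1
    rw [← hF] at h2
    have hr := hat.row_eq_of h ((h.F_le_G _).trans h1) h2
    have : (C j).top = .half := hat.top_half.2 ⟨by rw [hr]; exact h1, fun hh => by
      rw [hr, isThin_congr hn (r := r) (by simp)] at hh
      exact (ht hh).elim⟩
    rw [← hr, ← this]
  refine ⟨?_, h2⟩
  rw [hp]
  constructor
  · rintro ⟨h1, h2⟩
    obtain ⟨k, hk, -⟩ := h.perG.eq_add h2
    refine ⟨k, ?_, ?_⟩
    · rw [← hG, ← hk]; exact (hat.top_half.1 h1).1
    · rw [← hF, ← hk]; exact hat.lt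
  · rintro ⟨k, h3, h4⟩
    rw [h2 k h3 h4]
    simp

theorem rearLow_half (hn : 4 ≤ n) (h : IsLoose n l m) (hC : m.Encodes n C) (ht : ¬ IsThin n r)
    (hp : ∀ c, p c ↔ c.top = .half ∧ period n ∣ c.row - r) :
    (m.G r < m.F r → ∃ (b : Fin l) (k : ℤ), (b : ℤ) = m.F r - 1 + k * l ∧
      rearLow p C = some b) ∧ (¬ m.G r < m.F r → rearLow p C = none) := by
  have hp' := half_iff hn h hC ht hp
  have hFl := h.F_le_F_sub hn r
  have hFG := h.F_le_G r
  constructor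
  · intro hlt
    refine rearLow_cyclic hn (r₀ := r) hlt (by omega) (fun j => (hp' j).1) ?_
    intro j k h1 h2
    rw [(hp' j).2 k h1 h2]
  · intro hlt
    refine rearLow_eq_none fun j hj => ?_
    obtain ⟨k, h1, h2⟩ := (hp' j).1.1 hj
    omega

theorem foreHigh_half (hn : 4 ≤ n) (h : IsLoose n l m) (hC : m.Encodes n C) (ht : ¬ IsThin n r)
    (hp : ∀ c, p c ↔ c.top = .half ∧ period n ∣ c.row - r) :
    (m.G r < m.F r → ∃ (b : Fin l) (k : ℤ), (b : ℤ) = m.G r + k * l ∧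
      foreHigh p C = some b) ∧ (¬ m.G r < m.F r → foreHigh p C = none) := by
  have hp' := half_iff hn h hC ht hp
  have hFl := h.F_le_F_sub hn r
  have hFG := h.F_le_G r
  constructor
  · intro hlt
    refine foreHigh_cyclic hn (r₀ := r) hlt (by omega) (fun j => (hp' j).1) ?_
    intro j k h1 h2
    rw [(hp' j).2 k h1 h2]
    rfl
  · intro hlt
    refine foreHigh_eq_none fun j hj => ?_
    obtain ⟨k, h1, h2⟩ := (hp' j).1.1 hj
    omega

end Choice

section Kinds

variable {n : ℕ} {t : ℕ}

theorem wholeSlot_iff (hn : 4 ≤ n) (ht : 1 ≤ t ∧ t ≤ n - 1) (s : Side) (c : Layer) :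
    WholeSlot n s t c ↔ c.top = .flat ∧ period n ∣ c.row - rowOf s t := by
  rw [WholeSlot, kind_side_iff hn]; simp [ht]

theorem wholeBlock_iff (hn : 4 ≤ n) (ht : 1 ≤ t ∧ t ≤ n - 1) (s : Side) (c : Layer) :
    WholeBlock n s t c ↔ c.top = .flat ∧ period n ∣ c.row - 1 - rowOf s t := by
  rw [WholeBlock, kind_side_iff hn]; simp [ht]

theorem halfPiece_iff (hn : 4 ≤ n) (ht : 1 ≤ t ∧ t ≤ n - 1) (s : Side) (c : Layer) :
    HalfPiece n s t c ↔ c.top = .half ∧ period n ∣ c.row - rowOf s t := by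
  rw [HalfPiece, kind_side_iff hn]; simp [ht]

end Kinds

/-! ### Splitting -/

/-- The boundaries after `d` splittings that break off whole blocks in the rows at the position
of `r`. -/
noncomputable def State.split (n : ℕ) (m : State) (r d : ℤ) : State :=
  (m.addF n r d).addG n (-r) (-d)

/-- One block can be split in the row `r`. -/
def State.CanSplit (m : State) (r : ℤ) : Prop := m.F r < m.G (r + 1) ∧ m.F (-r - 1) < m.G (-r)

theorem State.split_F {n : ℕ} (m : State) (r d x : ℤ) :
    (m.split n r d).F x = m.F x + d * ind n r x := rfl

theorem State.split_G {n : ℕ} (m : State) (r d x : ℤ) :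
    (m.split n r d).G x = m.G x + -d * ind n (-r) x := rfl

theorem State.split_T {n : ℕ} (m : State) (r d : ℤ) : (m.split n r d).T = m.T := rfl

/-- The block is taken from the first layer of `[F r, G (r + 1))`, so `F r` rises; the half is put
on the last layer of `[F (-r - 1), G (-r))`, so `G (-r)` falls. -/
theorem splitOnce_spec {n l : ℕ} (hn : 4 ≤ n) {m : State} (h : IsLoose n l m) {C : Layers l}
    (hC : m.Encodes n C) {s : Side} {t : ℕ} (ht : 1 ≤ t ∧ t ≤ n - 1) :
    (m.CanSplit (rowOf s t) → ∃ C', splitOnce n s t C = some C' ∧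
      (m.split n (rowOf s t) 1).Encodes n C') ∧
    (¬ m.CanSplit (rowOf s t) → splitOnce n s t C = none) := by
  have ha := foreHigh_whole hn h hC (wholeBlock_iff hn ht s)
  have hb := rearLow_whole hn h hC (wholeSlot_iff hn ht s.other)
  rw [rowOf_other] at hb
  set r := rowOf s t
  constructor
  · rintro ⟨h1, h2⟩
    obtain ⟨a, k, hak, ha⟩ := ha.1 h1
    obtain ⟨b, k', hbk, hb⟩ := hb.1 h2
    refine ⟨_, by rw [splitOnce, ha, hb], ?_⟩
    obtain ⟨hCa, he⟩ := hC.take_whole hn h h1 hak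
    obtain ⟨hCb, -⟩ := hC.put_whole h h2 hbk
    -- The two layers are flat in rows congruent to `r + 1` and `-r`; if they coincided, the even
    -- period would divide `2 * r + 1`.
    have hab : b ≠ a := by
      rintro rfl
      rw [hCa] at hCb
      simp only [Layer.mk.injEq, and_true] at hCb
      apply not_dvd_odd hn r
      exact ⟨k' - k, by linarith⟩
    have hi : ind n r (-r - 1) = 0 := ind_of_not_dvd (by
      rintro ⟨c, hc⟩
      exact not_dvd_odd hn r ⟨-c, by linarith⟩)
    obtain ⟨-, he2⟩ := he.put_whole (h.addF_pos h1) (r := -r) (k := k') (b := b)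
      (by simp only [State.addF, hi]; omega) hbk
    rwa [Function.update_of_ne hab] at he2
  · intro hno
    by_cases h1 : m.F r < m.G (r + 1)
    · have h2 : ¬ m.F (-r - 1) < m.G (-r) := fun h2 => hno ⟨h1, h2⟩
      rw [splitOnce, hb.2 h2]
      cases foreHigh (WholeBlock n s t) C <;> rfl
    · rw [splitOnce, ha.2 h1]

theorem splitOnce_eq_none {n l : ℕ} (hn : 4 ≤ n) {C : Layers l} {s : Side} {t : ℕ}
    (ht : ¬ (1 ≤ t ∧ t ≤ n - 1)) : splitOnce n s t C = none := by
  rw [splitOnce, foreHigh_eq_none]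
  intro b hb
  exact ht ((kind_side_iff hn _ _ _).1 hb.2).1

theorem IsLoose.canSplit_congr {n l : ℕ} {m : State} (h : IsLoose n l m) {r x : ℤ}
    (hd : period n ∣ x - r) : m.CanSplit x ↔ m.CanSplit r := by
  have h1 := h.lt_G_of_dvd (r := r + 1) (x := x + 1) (by simpa using hd)
  have h2 := h.lt_G_of_dvd (r := -r) (x := -x) (by
    have := dvd_neg.2 hd
    rwa [show -(x - r) = -x - -r by ring] at this)
  simp only [add_sub_cancel_right] at h1
  unfold State.CanSplit
  omega

theorem ind_congr {n : ℕ} {r r' : ℤ} (hd : period n ∣ r - r') (x : ℤ) : ind n r x = ind n r' x := by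
  have : period n ∣ x - r ↔ period n ∣ x - r' := by
    rw [← sub_add_sub_cancel x r r']
    exact (dvd_add_left hd).symm
  simp only [ind, this]

theorem State.split_congr {n : ℕ} (m : State) {r r' : ℤ} (hd : period n ∣ r - r') (d : ℤ) :
    m.split n r d = m.split n r' d := by
  have hd' : period n ∣ -r - -r' := by
    have := dvd_neg.2 hd
    rwa [show -(r - r') = -r - -r' by ring] at this
  ext x
  · simp only [split_F, ind_congr hd]
  · simp only [split_G, ind_congr hd']
  · rfl

theorem splitStep_spec {n l : ℕ} (hn : 4 ≤ n) {m : State} (h : IsLoose n l m) {C C' : Layers l}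
    (hC : m.Encodes n C) (hs : SplitStep n C C') :
    ∃ r, m.CanSplit r ∧ (m.split n r 1).Encodes n C' := by
  obtain ⟨s, t, hs⟩ := hs
  by_cases ht : 1 ≤ t ∧ t ≤ n - 1
  · have := splitOnce_spec hn h hC (s := s) ht
    by_cases hc : m.CanSplit (rowOf s t)
    · obtain ⟨C₁, h1, h2⟩ := this.1 hc
      rw [h1, Option.some_inj] at hs
      exact ⟨_, hc, hs ▸ h2⟩
    · rw [this.2 hc] at hs; cases hs
  · rw [splitOnce_eq_none hn ht] at hs; cases hs

theorem exists_splitStep {n l : ℕ} (hn : 4 ≤ n) {m : State} (h : IsLoose n l m) {C : Layers l}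
    (hC : m.Encodes n C) {r : ℤ} (hr : m.CanSplit r) :
    ∃ C', SplitStep n C C' ∧ (m.split n r 1).Encodes n C' := by
  obtain ⟨s, t, ht, hd⟩ := exists_rowOf hn r
  rw [h.canSplit_congr hd] at hr
  obtain ⟨C', h1, h2⟩ := (splitOnce_spec hn h hC ht).1 hr
  exact ⟨C', ⟨s, t, h1⟩, by rwa [State.split_congr m hd]⟩

/-- Splitting in row `r` needs flat layers in the rows `r + 1` and `-r`. The index shift by one
matches the two formulations; the reflection `r ↦ 1 - r` accounts for the two directions of
splitting. -/
theorem State.terminal_iff {m : State} (h : ∀ r, m.F (r - 1) ≤ m.G r) :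
    m.Terminal ↔ ∀ r, ¬ m.CanSplit r := by
  unfold State.Terminal State.CanSplit
  constructor
  · intro H r
    have h1 := H (r + 1)
    have h2 := h (r + 1)
    have h3 := h (-r)
    rw [show 1 - (r + 1) = -r by ring, show -(r + 1) = -r - 1 by ring] at h1
    rw [add_sub_cancel_right] at h1 h2
    omega
  · intro H r
    have h1 := H (r - 1)
    have h2 := h r
    have h3 := h (1 - r)
    rw [show -(r - 1) = 1 - r by ring, show r - 1 + 1 = r by ring,
      show 1 - r - 1 = -r by ring] at h1
    rw [show 1 - r - 1 = -r by ring] at h3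
    omega

/-- `F - G` changes by `d` times the sum of the indicators of `r` and `-r`, an even function, so
`mirror` persists. In a thin row the two indicators agree, so `F + G` is unchanged, which is
`T_add`. -/
theorem IsConfig.split {n l : ℕ} (hn : 4 ≤ n) {m : State} (h : IsConfig n l m) {r d : ℤ}
    (h0 : 0 ≤ d) (h1 : d ≤ m.G (r + 1) - m.F r) (h2 : d ≤ m.G (-r) - m.F (-r - 1)) :
    IsConfig n l (m.split n r d) where
  perF := h.perF.add_ind _ _
  perG := h.perG.add_ind _ _
  perT := h.perT
  F_le_G x := by
    have h3 := h.F_le_G x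
    rw [State.split_F, State.split_G]
    rcases ind_cases (n := n) r (x - 1) with ⟨hd, hi⟩ | ⟨hd, hi⟩ <;>
      rcases ind_cases (n := n) (-r) x with ⟨hd', hi'⟩ | ⟨hd', hi'⟩ <;> rw [hi, hi']
    · exfalso
      apply not_dvd_odd hn r
      have := dvd_sub hd' hd
      rwa [show x - -r - (x - 1 - r) = 2 * r + 1 by ring] at this
    · have := h.lt_G_of_dvd (r := r + 1) (x := x) (by convert hd using 1; ring)
      rw [add_sub_cancel_right] at this
      omega
    · have := h.lt_G_of_dvd hd'
      omega
    · omega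
  G_le_F x := by
    have h3 := h.G_le_F x
    rw [State.split_F, State.split_G]
    rcases ind_cases (n := n) r x with ⟨hd, hi⟩ | ⟨hd, hi⟩ <;>
      rcases ind_cases (n := n) (-r) x with ⟨hd', hi'⟩ | ⟨hd', hi'⟩ <;> rw [hi, hi'] <;> omega
  G_le_T b x hx := by
    have h3 := h.G_le_T b x hx
    rw [State.split_G, State.split_T]
    rcases ind_cases (n := n) (-r) x with ⟨hd', hi'⟩ | ⟨hd', hi'⟩ <;> rw [hi'] <;> omega
  T_le_F b x hx := by
    have h3 := h.T_le_F b x hx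
    rw [State.split_F, State.split_T]
    rcases ind_cases (n := n) r x with ⟨hd', hi'⟩ | ⟨hd', hi'⟩ <;> rw [hi'] <;> omega
  mirror x := by
    have h3 := h.mirror x
    simp only [State.split_F, State.split_G, ind_neg_right, neg_neg]
    linarith
  T_add x hx := by
    have h3 := h.T_add x hx
    rw [State.split_F, State.split_G, State.split_T, h3, ← ind_neg_right]
    have : ind n r (-x) = ind n r x := by
      have hd := dvd_of_isThin hn hx
      have : period n ∣ -x - r ↔ period n ∣ x - r := by
        rw [show -x - r = (-x - x) + (x - r) by ring]
        exact dvd_add_right hd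
      simp only [ind, this]
    rw [this]; ring
  T_eq_zero := h.T_eq_zero
  F_eq_zero hl x := by
    have e := h.F_eq_zero hl
    have a := h.G_le_F (r + 1)
    rw [e] at *
    rw [State.split_F, e]
    have : d = 0 := by omega
    rw [this]; ring

theorem exists_config_of_reachable {n l : ℕ} (hn : 4 ≤ n) {m : State} (h : IsConfig n l m)
    {D C : Layers l} (hD : m.Encodes n D) (hs : ReflTransGen (SplitStep n) D C) :
    ∃ m', IsConfig n l m' ∧ m'.Encodes n C := by
  induction hs with
  | refl => exact ⟨m, h, hD⟩
  | tail _ hs ih =>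
    obtain ⟨m₁, h1, hC⟩ := ih
    obtain ⟨r, hr, he⟩ := splitStep_spec hn h1.toIsLoose hC hs
    obtain ⟨ha, hb⟩ := hr
    exact ⟨_, h1.split hn zero_le_one (by omega) (by omega), he⟩

theorem terminal_iff_no_step {n l : ℕ} (hn : 4 ≤ n) {m : State} (h : IsLoose n l m) {C : Layers l}
    (hC : m.Encodes n C) : m.Terminal ↔ ∀ C', ¬ SplitStep n C C' := by
  rw [State.terminal_iff h.F_le_G]
  constructor
  · intro H C' hs
    obtain ⟨r, hr, -⟩ := splitStep_spec hn h hC hs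
    exact H r hr
  · intro H r hr
    obtain ⟨C', hs, -⟩ := exists_splitStep hn h hC hr
    exact H C' hs

/-! ### Splitting every block of a kind -/

theorem State.split_split {n : ℕ} (m : State) (r d d' : ℤ) :
    (m.split n r d).split n r d' = m.split n r (d + d') := by
  ext x
  · simp only [split_F]; ring
  · simp only [split_G]; ring
  · rfl

theorem State.split_zero {n : ℕ} (m : State) (r : ℤ) : m.split n r 0 = m := by
  ext x
  · simp [split_F]
  · simp [split_G]
  · rfl

/-- `d` is the smaller of the numbers of blocks and of slots available. Each splitting uses up one
of each and creates none in these two rows, so exactly `d` rounds take effect and the remaining ones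
do nothing. -/
theorem iterate_splitOnce {n l : ℕ} (hn : 4 ≤ n) {t : ℕ} (ht : 1 ≤ t ∧ t ≤ n - 1)
    (N : ℕ) {m : State} (h : IsConfig n l m) {C : Layers l} (hC : m.Encodes n C) {d : ℤ}
    (hd : d = min (m.G (rowOf .covering t + 1) - m.F (rowOf .covering t))
      (m.G (-rowOf .covering t) - m.F (-rowOf .covering t - 1))) (hN : d ≤ N) :
    (m.split n (rowOf .covering t) d).Encodes n
      ((fun X => (splitOnce n .covering t X).getD X)^[N] C) := by
  have spec {m : State} (h : IsConfig n l m) {C : Layers l} (hC : m.Encodes n C) :=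
    splitOnce_spec hn h.toIsLoose hC (s := .covering) ht
  generalize hr : rowOf .covering t = r at *
  induction N generalizing m C d with
  | zero =>
    have h1 := h.F_succ r
    have h2 := h.F_le_G (-r)
    have : d = 0 := by push_cast at hN; omega
    subst this
    simpa [State.split_zero] using hC
  | succ N ih =>
    have h1 := h.F_succ r
    have h2 := h.F_le_G (-r)
    rw [Function.iterate_succ_apply]
    by_cases hc : m.CanSplit r
    · obtain ⟨C', e, he⟩ := (spec h hC).1 hc
      have hc' := hc
      obtain ⟨ha, hb⟩ := hc
      rw [e, Option.getD_some]
      have h' := h.split hn (r := r) zero_le_one (by omega) (by omega)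
      have := ih (d := d - 1) h' he (by push_cast at hN; omega) (by
        have e1 : ind n r (-r - 1) = 0 := ind_of_not_dvd (by
          rintro ⟨c, hc⟩
          exact not_dvd_odd hn r ⟨-c, by linarith⟩)
        have e2 : ind n (-r) (r + 1) = 0 := ind_of_not_dvd (by
          rintro ⟨c, hc⟩
          exact not_dvd_odd hn r ⟨c, by linarith⟩)
        simp only [State.split_F, State.split_G, ind_self, e1, e2]
        omega)
      rwa [State.split_split, show 1 + (d - 1) = d by ring] at this
    · rw [(spec h hC).2 hc, Option.getD_none]
      have d0 : d = 0 := by unfold State.CanSplit at hc; omega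
      exact ih h hC (by rw [d0]; positivity) hd


/-! ### Un-splitting -/

/-- No block is broken. -/
structure State.IsWhole (n : ℕ) (m : State) : Prop where
  unit : ∀ r, ¬ IsThin n r → m.F r = m.G r
  thin : ∀ r, IsThin n r → m.G r = min (m.T true r) (m.T false r)

theorem IsConfig.min_add_max {n l : ℕ} {m : State} (h : IsConfig n l m) {r : ℤ} (hr : IsThin n r) :
    min (m.T true r) (m.T false r) - m.G r = m.F r - max (m.T true r) (m.T false r) := by
  have := h.T_add r hr
  omega

theorem IsConfig.G_le_min {n l : ℕ} {m : State} (h : IsConfig n l m) {r : ℤ} (hr : IsThin n r) :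
    m.G r ≤ min (m.T true r) (m.T false r) :=
  le_min (h.G_le_T _ _ hr) (h.G_le_T _ _ hr)

/-- In a unit row the bound on `d` is the number of halves, the same for `r` and `-r` by `mirror`.
In a thin row both boundaries move in the same row towards each other and must stop at the
thresholds; the upper one reaches its threshold together with the lower one by `min_add_max`. -/
theorem IsConfig.unsplit {n l : ℕ} (hn : 4 ≤ n) {m : State} (h : IsConfig n l m) {r d : ℤ}
    (h0 : 0 ≤ d) (h1 : d ≤ m.F r - m.G r)
    (h2 : IsThin n r → d ≤ min (m.T true r) (m.T false r) - m.G r) :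
    IsConfig n l (m.split n r (-d)) where
  perF := h.perF.add_ind _ _
  perG := h.perG.add_ind _ _
  perT := h.perT
  F_le_G x := by
    have h3 := h.F_le_G x
    rw [State.split_F, State.split_G]
    rcases ind_cases (n := n) r (x - 1) with ⟨hd, hi⟩ | ⟨hd, hi⟩ <;>
      rcases ind_cases (n := n) (-r) x with ⟨hd', hi'⟩ | ⟨hd', hi'⟩ <;> rw [hi, hi'] <;> omega
  G_le_F x := by
    have h3 := h.G_le_F x
    have hm := h.mirror r
    rw [State.split_F, State.split_G]
    rcases ind_cases (n := n) r x with ⟨hd, hi⟩ | ⟨hd, hi⟩ <;>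
      rcases ind_cases (n := n) (-r) x with ⟨hd', hi'⟩ | ⟨hd', hi'⟩ <;> rw [hi, hi']
    · have ht : IsThin n r := isThin_of_dvd_neg hn (by
        have := dvd_sub hd hd'
        rwa [show x - r - (x - -r) = -r - r by ring] at this)
      have e := h.lt_F_of_dvd hd
      have a := h2 ht
      have a2 := h.min_add_max ht
      have a3 := h.G_le_min ht
      omega
    · have e := h.lt_F_of_dvd hd
      omega
    · have e := h.lt_F_of_dvd hd'
      omega
    · omega
  G_le_T b x hx := by
    have h3 := h.G_le_T b x hx
    rw [State.split_G, State.split_T]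
    rcases ind_cases (n := n) (-r) x with ⟨hd', hi'⟩ | ⟨hd', hi'⟩ <;> rw [hi']
    · have hr : IsThin n r := by rwa [isThin_congr hn hd', isThin_neg hn] at hx
      have hd : period n ∣ x - r := by
        have := dvd_add hd' (dvd_of_isThin hn hr)
        rwa [show x - -r + (-r - r) = x - r by ring] at this
      obtain ⟨k, hk, e1⟩ := h.perG.eq_add hd
      have e2 := h.T_per_mul hn b hr k
      rw [← hk] at e2
      have a := h2 hr
      have a2 : min (m.T true r) (m.T false r) ≤ m.T b r := by cases b <;> simp
      omega
    · omega
  T_le_F b x hx := by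
    have h3 := h.T_le_F b x hx
    rw [State.split_F, State.split_T]
    rcases ind_cases (n := n) r x with ⟨hd, hi'⟩ | ⟨hd', hi'⟩ <;> rw [hi']
    · have hr : IsThin n r := by rwa [isThin_congr hn hd] at hx
      obtain ⟨k, hk, e1⟩ := h.perF.eq_add hd
      have e2 := h.T_per_mul hn b hr k
      rw [← hk] at e2
      have a := h2 hr
      rw [h.min_add_max hr] at a
      have a2 : m.T b r ≤ max (m.T true r) (m.T false r) := by cases b <;> simp
      omega
    · omega
  mirror x := by
    have h3 := h.mirror x
    simp only [State.split_F, State.split_G, ind_neg_right, neg_neg]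
    linarith
  T_add x hx := by
    have h3 := h.T_add x hx
    rw [State.split_F, State.split_G, State.split_T, h3, ← ind_neg_right]
    have : ind n r (-x) = ind n r x := by
      have hd := dvd_of_isThin hn hx
      have : period n ∣ -x - r ↔ period n ∣ x - r := by
        rw [show -x - r = (-x - x) + (x - r) by ring]
        exact dvd_add_right hd
      simp only [ind, this]
    rw [this]; ring
  T_eq_zero := h.T_eq_zero
  F_eq_zero hl x := by
    have e := h.F_eq_zero hl
    have a := h.F_le_G r
    rw [e] at *
    rw [State.split_F, e]
    have : d = 0 := by omega
    rw [this]; ring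

theorem sum_ind {n : ℕ} (hn : 4 ≤ n) (r : ℤ) : ∑ x ∈ Finset.Ico 0 (period n), ind n r x = 1 := by
  have hP := period_pos hn
  have h0 := Int.emod_nonneg r (show period n ≠ 0 by omega)
  have h1 := Int.emod_lt_of_pos r (show 0 < period n by omega)
  rw [Finset.sum_eq_single (r % period n)]
  · exact ind_of_dvd (by
      rw [← dvd_neg, neg_sub]; exact Int.dvd_self_sub_emod)
  · intro x hx hne
    refine ind_of_not_dvd fun hd => hne ?_
    rw [Finset.mem_Ico] at hx
    rw [← Int.emod_eq_of_lt hx.1 hx.2]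
    exact Int.emod_eq_emod_iff_emod_sub_eq_zero.2 (Int.emod_eq_zero_of_dvd hd)
  · intro hx
    exact (hx (Finset.mem_Ico.2 ⟨h0, h1⟩)).elim

theorem pos_congr {n : ℕ} {x r : ℤ} (h : period n ∣ x - r) : pos n x = pos n r := by
  unfold pos
  rw [Int.emod_eq_emod_iff_emod_sub_eq_zero.2 (Int.emod_eq_zero_of_dvd h)]

theorem pos_neg {n : ℕ} (hn : 4 ≤ n) {r : ℤ} (h : ¬ IsThin n r) :
    (pos n (-r) : ℤ) = period n - pos n r := by
  have h1 := pos_lt hn r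
  have h2 : pos n r ≠ 0 := fun h' => h (.inl h')
  rw [← dvd_sub_iff_pos hn _ _ (by omega) (by omega), pos_cast hn]
  have : period n ∣ r - r % period n := Int.dvd_self_sub_emod
  have h3 := dvd_neg.2 (dvd_add this (dvd_refl _))
  rwa [show -(r - r % period n + period n) = -r - (period n - r % period n) by ring] at h3

/-- Every configuration arises from a pre-slice by splitting; as many blocks as possible may be
taken to be covering in the pre-slice. -/
theorem exists_whole {n l : ℕ} (hn : 4 ≤ n) {m : State} (h : IsConfig n l m) {C : Layers l}
    (hC : m.Encodes n C) : ∃ (m₀ : State) (D : Layers l), IsConfig n l m₀ ∧ m₀.IsWhole n ∧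
      m₀.Encodes n D ∧ ReflTransGen (SplitStep n) D C ∧ m₀.T = m.T ∧
      (∀ r, ¬ IsThin n r → n - 2 < pos n r → m₀.G r = m.G r) ∧
      (∀ r, ¬ IsThin n r → pos n r < n - 2 → m₀.F r = m.F r) := by
  have hP := period_pos hn
  obtain ⟨N, hN⟩ : ∃ N : ℕ, ∑ x ∈ Finset.Ico 0 (period n), (m.F x - m.G x) ≤ N :=
    ⟨_, Int.self_le_toNat _⟩
  induction N using Nat.strong_induction_on generalizing m C with
  | _ N ih =>
  by_cases hw : m.IsWhole n
  · exact ⟨m, C, h, hw, hC, .refl, rfl, fun _ _ _ => rfl, fun _ _ _ => rfl⟩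
  -- As long as something is broken there is a broken pair in a thin row or a half in a covering
  -- unit row: a supporting half has a partner in the mirror row.
  have hx : ∃ x, m.G x < m.F x ∧ (IsThin n x → m.G x < min (m.T true x) (m.T false x)) ∧
      (¬ IsThin n x → n - 2 < pos n x) := by
    by_contra hcon
    push Not at hcon
    apply hw
    refine ⟨fun r hr => ?_, fun r hr => ?_⟩
    · by_contra hne
      have a := h.G_le_F r
      rcases lt_or_ge (n - 2) (pos n r) with hlt | hge
      · obtain ⟨-, h2⟩ := hcon r (by omega) (fun hh => (hr hh).elim)
        omega
      · have e := h.mirror r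
        have e2 := pos_neg hn hr
        have e3 : IsThin n (-r) ↔ IsThin n r := isThin_neg hn
        obtain ⟨-, h2⟩ := hcon (-r) (by omega) (fun hh => (hr (e3.1 hh)).elim)
        have e4 := period_eq hn
        have e5 : pos n r ≠ n - 2 := fun h' => hr (.inr h')
        omega
    · have a := h.G_le_min hr
      have a2 := h.min_add_max hr
      by_contra hne
      exact (hcon r (by omega) (fun _ => by omega)).1 hr
  obtain ⟨r, h1, h2, h3⟩ := hx
  have h' := h.unsplit hn (r := r) (d := 1) zero_le_one (by omega) (fun hh => by
    have := h2 hh; omega)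
  obtain ⟨C₁, hC₁⟩ := h'.exists_encodes
  have e1 : ind n r (-r - 1) = 0 := ind_of_not_dvd (by
    rintro ⟨c, hc⟩
    exact not_dvd_odd hn r ⟨-c, by linarith⟩)
  have e2 : ind n (-r) (r + 1) = 0 := ind_of_not_dvd (by
    rintro ⟨c, hc⟩
    exact not_dvd_odd hn r ⟨c, by linarith⟩)
  have hcs : (m.split n r (-1)).CanSplit r := by
    have a1 := h.F_succ r
    have a2 := h.F_le_G (-r)
    simp only [State.CanSplit, State.split_F, State.split_G, ind_self, e1, e2]
    omega
  -- Splitting again in the same row restores the state, hence the layers: the un-splitting is the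
  -- reverse of a genuine splitting step.
  obtain ⟨C', hs, hC'⟩ := exists_splitStep hn h'.toIsLoose hC₁ hcs
  rw [State.split_split, show (-1 : ℤ) + 1 = 0 by norm_num, State.split_zero] at hC'
  have hCC := State.Encodes.ext h.toIsLoose hC' hC
  subst hCC
  -- The induction is on the number of halves in a cycle, which drops by two: `F` falls at `r` and
  -- `G` rises at `-r`.
  have hsum : ∑ x ∈ Finset.Ico 0 (period n),
      ((m.split n r (-1)).F x - (m.split n r (-1)).G x) =
      ∑ x ∈ Finset.Ico 0 (period n), (m.F x - m.G x) - 2 := by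
    simp only [State.split_F, State.split_G]
    have s1 := sum_ind hn r
    have s2 := sum_ind hn (-r)
    simp only [Finset.sum_sub_distrib, Finset.sum_add_distrib, ← Finset.mul_sum, s1, s2]
    ring
  have hnn : 0 ≤ ∑ x ∈ Finset.Ico 0 (period n),
      ((m.split n r (-1)).F x - (m.split n r (-1)).G x) :=
    Finset.sum_nonneg fun x _ => sub_nonneg.2 (h'.G_le_F x)
  obtain ⟨m₀, D, a1, a2, a3, a4, a5, a6, a7⟩ := ih (N - 2) (by omega) h' hC₁ (by omega)
  refine ⟨m₀, D, a1, a2, a3, a4.tail hs, a5, fun x hx hp => ?_, fun x hx hp => ?_⟩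
  · rw [a6 x hx hp, State.split_G, ind_of_not_dvd, mul_zero, add_zero]
    intro hd
    have hxr : ¬ IsThin n r := by rwa [isThin_congr hn hd, isThin_neg hn] at hx
    have b1 := pos_neg hn hxr
    have b2 := pos_congr hd
    have b3 := h3 hxr
    have e4 := period_eq hn
    omega
  · rw [a7 x hx hp, State.split_F, ind_of_not_dvd, mul_zero, add_zero]
    intro hd
    have hxr : ¬ IsThin n r := by rwa [isThin_congr hn hd] at hx
    have b2 := pos_congr hd
    have b3 := h3 hxr
    omega

/-! ### Pre-slices -/

theorem IsConfig.whole_F {n l : ℕ} {m : State} (h : IsConfig n l m) (hw : m.IsWhole n) {r : ℤ}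
    (hr : IsThin n r) : m.F r = max (m.T true r) (m.T false r) := by
  have := h.min_add_max hr
  have := hw.thin r hr
  omega

theorem State.At.ne_half {n l : ℕ} {m : State} (h : IsConfig n l m) (hw : m.IsWhole n) {j : ℤ}
    {c : Layer} (hc : m.At n j c) : c.top ≠ .half := by
  intro htop
  have h1 := hc.top_half.1 htop
  have h2 := hc.lt
  by_cases hr : IsThin n c.row
  · have h3 := hw.thin _ hr
    have h4 := h.whole_F hw hr
    have h5 := h1.2 hr true
    have h6 := h1.2 hr false
    simp only [Bool.not_true, Bool.not_false] at h5 h6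
    omega
  · have := hw.unit _ hr
    omega

/-- Lower boundaries and larger indices both mean more blocks. For a single block in the same row,
`j` is past the threshold of that block but below `F`, which is the larger threshold as nothing is
broken; so the upper layer holds the same single block unless the lower one is flat. -/
theorem State.At.sub {n l : ℕ} {m m₀ : State} (h : IsConfig n l m) (hw : m.IsWhole n)
    (h₀ : IsConfig n l m₀) (hw₀ : m₀.IsWhole n) (hF : ∀ r, m.F r ≤ m₀.F r)
    (hT : ∀ b r, m.T b r ≤ m₀.T b r) {i j : ℤ} (hij : i ≤ j) {c c' : Layer} (hc : m₀.At n i c)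
    (hc' : m.At n j c') : c.Sub c' := by
  have hle : c.row ≤ c'.row :=
    (hc.row_le_iff h₀.toIsLoose _).2 (by have := hc'.lt; have := hF c'.row; omega)
  rcases hle.lt_or_eq with hlt | heq
  · exact .inl hlt
  refine .inr ⟨heq, ?_⟩
  by_cases hflat : c.top = .flat
  · exact .inl hflat
  right
  have hex : ∃ b, c.top = YoungWallD.single b := by
    have := hc.ne_half h₀ hw₀
    cases ht : c.top
    · exact (hflat ht).elim
    · exact ⟨true, rfl⟩
    · exact ⟨false, rfl⟩
    · exact (this ht).elim
  obtain ⟨b, hb⟩ := hex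
  have h1 := (hc.single b).1 hb
  rw [hb]
  symm
  rw [hc'.single b, ← heq]
  have h2 := hT b c.row
  have h3 := h.whole_F hw h1.1
  have h4 := hc'.lt
  rw [← heq] at h4
  refine ⟨h1.1, by omega, ?_⟩
  cases b <;> simp only [Bool.not_true, Bool.not_false] at * <;> omega

theorem IsConfig.isPreSlice {n l : ℕ} (hn : 4 ≤ n) {m : State} (h : IsConfig n l m)
    (hw : m.IsWhole n) {D : Layers l} (hD : m.Encodes n D) : IsPreSlice n D := by
  refine ⟨fun j => ⟨?_, (hD j).ne_half h hw⟩, fun i j hij => ⟨?_, ?_⟩⟩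
  · rintro (ht | ht)
    · exact (((hD j).single true).1 ht).1
    · exact (((hD j).single false).1 ht).1
  · exact (hD i).sub h hw h hw (fun _ => le_rfl) (fun _ _ => le_rfl)
      (by rw [Fin.le_def] at hij; omega) (hD j)
  · have := (hD i).shift hn h.toIsLoose 1
    rw [one_mul, one_mul] at this
    exact (hD j).sub h hw h hw (fun _ => le_rfl) (fun _ _ => le_rfl)
      (by have := j.2; omega) this

/-- The number of layers of the cyclic extension with `u ≤ x`, relative to the given `l` layers. -/
def cyclicCount {l : ℕ} (u : Fin l → ℤ) (p x : ℤ) : ℤ := ∑ j, ((x - u j) / p + 1)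

/-- If `u j ≤ x`, the summands up to `j` are at least `1` and the others at least `0`; otherwise the
summands before `j` are at most `1` and the others at most `0`. Both use that all values of `u` lie
within one period. -/
theorem lt_cyclicCount_iff {l : ℕ} {u : Fin l → ℤ} {p : ℤ} (hp : 0 < p) (hu : Monotone u)
    (hw : ∀ i j, u j ≤ u i + p) (j : Fin l) (x : ℤ) :
    (j : ℤ) < cyclicCount u p x ↔ u j ≤ x := by
  have step : ∀ i k, (x - u i) / p ≤ (x - u k) / p + 1 := fun i k => by
    have := Int.ediv_le_ediv hp (show x - u i ≤ x - u k + p by have := hw i k; omega)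
    rwa [Int.add_ediv_of_dvd_right (dvd_refl _), Int.ediv_self hp.ne'] at this
  have anti : ∀ i k, i ≤ k → (x - u k) / p ≤ (x - u i) / p := fun i k hik =>
    Int.ediv_le_ediv hp (by have := hu hik; omega)
  constructor
  · intro hlt
    by_contra hcon
    have hneg : (x - u j) / p ≤ -1 := by
      have := Int.ediv_lt_of_lt_mul hp (show x - u j < 0 * p by omega)
      omega
    have : cyclicCount u p x ≤ ∑ i : Fin l, if i < j then 1 else 0 := by
      apply Finset.sum_le_sum
      intro i _
      split_ifs with hij
      · have := step i j; omega
      · have := anti j i (not_lt.1 hij); omega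
    rw [Finset.sum_boole] at this
    simp only [Finset.filter_gt_eq_Iio, Fin.card_Iio] at this
    omega
  · intro hle
    have hpos : 0 ≤ (x - u j) / p := Int.ediv_nonneg (by omega) hp.le
    have : (∑ i : Fin l, if i ≤ j then 1 else 0) ≤ cyclicCount u p x := by
      apply Finset.sum_le_sum
      intro i _
      split_ifs with hij
      · have := anti i j hij; omega
      · have := step j i; omega
    rw [Finset.sum_boole] at this
    simp only [Finset.filter_ge_eq_Iic, Fin.card_Iic] at this
    push_cast at this
    omega

theorem cyclicCount_add {l : ℕ} {u : Fin l → ℤ} {p : ℤ} (hp : 0 < p) (x : ℤ) :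
    cyclicCount u p (x + p) = cyclicCount u p x + l := by
  have : ∀ j : Fin l, (x + p - u j) / p + 1 = ((x - u j) / p + 1) + 1 := fun j => by
    rw [show x + p - u j = x - u j + p by ring, Int.add_ediv_of_dvd_right (dvd_refl _),
      Int.ediv_self hp.ne']
  simp only [cyclicCount, this]
  rw [Finset.sum_add_distrib]
  simp

theorem cyclicCount_mono {l : ℕ} {u : Fin l → ℤ} {p : ℤ} (hp : 0 < p) :
    Monotone (cyclicCount u p) := fun _ _ h =>
  Finset.sum_le_sum fun j _ => by
    have := Int.ediv_le_ediv hp (sub_le_sub_right h (u j))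
    omega

/-- There is nothing to count between `x` and `y`. -/
theorem cyclicCount_eq {l : ℕ} {u : Fin l → ℤ} {p : ℤ} (hp : 0 < p) {x y : ℤ} (hxy : x ≤ y)
    (h : ∀ (j : Fin l) (k : ℤ), ¬ (x < u j + k * p ∧ u j + k * p ≤ y)) :
    cyclicCount u p x = cyclicCount u p y := by
  refine Finset.sum_congr rfl fun j _ => ?_
  have h1 : (x - u j) / p ≤ (y - u j) / p := Int.ediv_le_ediv hp (by omega)
  have h2 : (y - u j) / p ≤ (x - u j) / p := by
    by_contra hlt
    push Not at hlt
    refine h j ((y - u j) / p) ⟨?_, ?_⟩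
    · have := Int.lt_mul_of_ediv_lt hp hlt
      omega
    · have := Int.ediv_mul_le (y - u j) hp.ne'
      omega
  omega

open Classical in
/-- The height of the top of a layer, in quarters, for comparing layers. -/
noncomputable def Layer.code (c : Layer) : ℤ := 4 * c.row + (if c.top = .flat then 0 else 2)

/-- Layers are ordered by their height, flat ones getting the code `4 * row` and those with a single
block `4 * row + 2`. The boundaries count the layers of the cyclic extension up to suitable codes.
The thresholds `T` make sense because nested layers cannot show both kinds of single blocks in the
same row. -/
theorem IsPreSlice.exists_state {n l : ℕ} (hn : 4 ≤ n) {D : Layers l} (hD : IsPreSlice n D) :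
    ∃ m : State, IsConfig n l m ∧ m.Encodes n D := by
  classical
  have hP := period_pos hn
  have hp : (0 : ℤ) < 4 * period n := by omega
  have codele : ∀ c c' : Layer, c.Sub c' → c.code ≤ c'.code := by
    rintro c c' (h | ⟨h1, h2 | h2⟩) <;> unfold Layer.code
    · split_ifs <;> omega
    · simp only [h1, h2]; split_ifs <;> simp_all
    · rw [h1, h2]
  have hu : Monotone fun j => (D j).code := fun i j hij => codele _ _ (hD.2 i j hij).1
  have hw : ∀ i j, (D j).code ≤ (D i).code + 4 * period n := by
    intro i j
    rcases le_total i j with hij | hij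
    · have := codele _ _ (hD.2 i j hij).2
      refine this.trans (le_of_eq ?_)
      by_cases hf : (D i).top = .flat <;> simp [Layer.code, Layer.addDelta, hf] <;> ring
    · have := hu hij
      simp only at this
      omega
  set A := cyclicCount (fun j => (D j).code) (4 * period n) with hA
  have Alt : ∀ j x, ((j : Fin l) : ℤ) < A x ↔ (D j).code ≤ x := lt_cyclicCount_iff hp hu hw
  have Amono : Monotone A := cyclicCount_mono hp
  have Aper : ∀ x, A (x + 4 * period n) = A x + l := cyclicCount_add hp
  have code_cases : ∀ j k, (D j).code + k * (4 * period n) = 4 * ((D j).row + k * period n) ∨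
      (IsThin n ((D j).row + k * period n) ∧ (D j).top ≠ .flat ∧
        (D j).code + k * (4 * period n) = 4 * ((D j).row + k * period n) + 2) := by
    intro j k
    by_cases hf : (D j).top = .flat
    · left; simp only [Layer.code, hf, if_true]; ring
    · right
      have h1 := hD.1 j
      have ht : IsThin n (D j).row := by
        apply h1.1
        have := h1.2
        cases hh : (D j).top <;> simp_all
      refine ⟨(isThin_congr hn (by simp)).2 ht, hf, ?_⟩
      simp only [Layer.code, hf, if_false]; ring
  have Alow : ∀ r, A (4 * r) = A (4 * r + 1) := fun r => cyclicCount_eq hp (by omega) (by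
    rintro j k ⟨h1, h2⟩
    rcases code_cases j k with h | ⟨-, -, h⟩ <;> omega)
  have Ahigh : ∀ r, A (4 * r + 2) = A (4 * r + 3) := fun r => cyclicCount_eq hp (by omega) (by
    rintro j k ⟨h1, h2⟩
    rcases code_cases j k with h | ⟨-, -, h⟩ <;> omega)
  have Aunit : ∀ r, ¬ IsThin n r → A (4 * r) = A (4 * r + 3) := fun r hr =>
    cyclicCount_eq hp (by omega) (by
      rintro j k ⟨h1, h2⟩
      rcases code_cases j k with h | ⟨h0, -, h⟩
      · omega
      · have : (D j).row + k * period n = r := by omega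
        exact hr (this ▸ h0))
  -- in each row there are single blocks of one type only
  have same : ∀ i j, (D i).top ≠ .flat → (D j).top ≠ .flat →
      period n ∣ (D i).row - (D j).row → (D i).top = (D j).top := by
    have key : ∀ i j, i ≤ j → (D i).top ≠ .flat → (D j).top ≠ .flat →
        period n ∣ (D i).row - (D j).row → (D i).top = (D j).top := by
      intro i j hij hi hj ⟨c, hc⟩
      have h1 := hD.2 i j hij
      rcases h1.1 with h | ⟨-, h⟩
      · rcases h1.2 with h' | ⟨-, h'⟩
        · exfalso
          simp only [Layer.addDelta] at h'
          have : c < 0 := by by_contra hh; push Not at hh; nlinarith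
          have : -1 < c := by by_contra hh; push Not at hh; nlinarith
          omega
        · rcases h' with h' | h'
          · exact (hj h').elim
          · exact h'.symm
      · rcases h with h | h
        · exact (hi h).elim
        · exact h
    intro i j hi hj hd
    rcases le_total i j with hij | hij
    · exact key i j hij hi hj hd
    · refine (key j i hij hj hi ?_).symm
      rw [← dvd_neg, neg_sub]; exact hd
  -- Rows without single blocks are given the type front; the choice does not matter, as the two
  -- thresholds coincide there.
  let ty : ℤ → Bool := fun r => decide (∃ j, (D j).top = .rear ∧ period n ∣ (D j).row - r)
  have ty_per : ∀ r, ty (r + period n) = ty r := fun r => by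
    have : ∀ j, period n ∣ (D j).row - (r + period n) ↔ period n ∣ (D j).row - r := fun j => by
      rw [← sub_sub]; exact dvd_sub_self_right
    simp only [ty, this]
  have ty_at : ∀ j b, (D j).top ≠ .flat → ((D j).top = single b ↔ ty (D j).row = b) := by
    intro j b hj
    have hnh := (hD.1 j).2
    have hty : ty (D j).row = true ↔ (D j).top = .rear := by
      rw [decide_eq_true_iff]
      constructor
      · rintro ⟨i, hi, hd⟩
        rw [← hi]; exact same j i hj (by rw [hi]; simp) (by
          rw [← dvd_neg, neg_sub]; exact hd)
      · intro h; exact ⟨j, h, by simp⟩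
    cases b
    · rw [← Bool.not_eq_true, hty]
      cases hh : (D j).top <;> simp_all [single]
    · rw [hty]; rfl
  -- The block that is present in the single layers of row `r` starts right after the flat ones, at
  -- `A (4 * r + 1)`; the other one only after the single layers, at `A (4 * r + 2)`.
  let m : State := ⟨fun r => A (4 * r + 3), fun r => A (4 * r), fun b r =>
    if IsThin n r then (if ty r = b then A (4 * r + 1) else A (4 * r + 2)) else 0⟩
  have hthin_per : ∀ r, IsThin n (r + period n) ↔ IsThin n r := fun r => isThin_congr hn (by simp)
  refine ⟨m, ⟨⟨?_, ?_, ?_, ?_, ?_, ?_, ?_⟩, ?_, ?_, ?_, ?_⟩, ?_⟩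
  · intro r; show A _ = A _ + _
    rw [← Aper]; congr 1; ring
  · intro r; show A _ = A _ + _
    rw [← Aper]; congr 1; ring
  · intro b r hr
    simp only [m, hthin_per, hr, if_true, ty_per]
    split_ifs <;> rw [← Aper] <;> congr 1 <;> ring
  · intro r; exact Amono (by omega)
  · intro r; exact Amono (by omega)
  · intro b r hr
    simp only [m, hr, if_true]
    split_ifs <;> exact Amono (by omega)
  · intro b r hr
    simp only [m, hr, if_true]
    split_ifs <;> exact Amono (by omega)
  · intro r
    by_cases hr : IsThin n r
    · obtain ⟨k, hk⟩ := dvd_of_isThin hn hr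
      have e : -r = r + k * period n := by linarith
      have q1 : QuasiPeriodic n l m.F := fun r => by
        show A _ = A _ + _
        rw [← Aper]; congr 1; ring
      have q2 : QuasiPeriodic n l m.G := fun r => by
        show A _ = A _ + _
        rw [← Aper]; congr 1; ring
      rw [e, q1.add_mul, q2.add_mul]; ring
    · have hr' : ¬ IsThin n (-r) := by rwa [isThin_neg hn]
      have e1 := Aunit r hr
      have e2 := Aunit (-r) hr'
      simp only [m]
      omega
  · intro r hr
    have e1 := Alow r
    have e2 := Ahigh r
    simp only [m, hr, if_true]
    cases ty r <;> simp <;> omega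
  · intro b r hr
    simp [m, hr]
  · intro hl r
    subst hl
    simp [m, hA, cyclicCount]
  · intro j
    refine ⟨?_, ?_, ?_, fun b => ?_⟩
    · show A _ ≤ _
      rw [← not_lt, Alt, not_le, Layer.code]
      split_ifs <;> omega
    · show _ < A _
      rw [Alt, Layer.code]
      split_ifs <;> omega
    · show _ ↔ _ < A _
      rw [Alt, Layer.code]
      split_ifs with h <;> simp [h]
    · rcases code_cases j 0 with h | ⟨h1, h2, h3⟩
      · have hf : (D j).top = .flat := by
          by_contra hf
          simp [Layer.code, hf] at h
        have : ¬ ((D j).top = single b) := by rw [hf]; cases b <;> simp [single]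
        simp only [this, false_iff]
        rintro ⟨ht, h1, h2⟩
        simp only [m, ht, if_true] at h1
        have h3 : ¬ (j : ℤ) < A (4 * (D j).row + 1) := by
          have := Amono (show 4 * (D j).row + 1 ≤ 4 * (D j).row + 2 by omega)
          split_ifs at h1 <;> omega
        rw [Alt] at h3
        simp [Layer.code, hf] at h3
      · simp only [zero_mul, add_zero] at h1 h3
        have g1 : ¬ (j : ℤ) < A (4 * (D j).row + 1) := by rw [Alt]; omega
        have g2 : (j : ℤ) < A (4 * (D j).row + 2) := by rw [Alt]; omega
        rw [ty_at j b h2]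
        simp only [m, h1, if_true, true_and]
        cases b <;> cases ty (D j).row <;> simp <;> omega


/-! ### Slices -/

/-- The boundaries come from a slice. -/
structure IsSliceState (n l : ℕ) (m : State) : Prop extends IsConfig n l m where
  terminal : m.Terminal

/-- This replaces slices by their states for good: splitting stays within configurations, and
conversely each configuration un-splits to a pre-slice by `exists_whole`. -/
theorem isSlice_iff {n l : ℕ} (hn : 4 ≤ n) {C : Layers l} :
    IsSlice n C ↔ ∃ m, IsSliceState n l m ∧ m.Encodes n C := by
  constructor
  · rintro ⟨D, hD, hs, ht⟩
    obtain ⟨m, h, hm⟩ := hD.exists_state hn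
    obtain ⟨m', h', hm'⟩ := exists_config_of_reachable hn h hm hs
    exact ⟨m', ⟨h', (terminal_iff_no_step hn h'.toIsLoose hm').2 ht⟩, hm'⟩
  · rintro ⟨m, h, hC⟩
    obtain ⟨m₀, D, h1, h2, h3, h4, -⟩ := exists_whole hn h.toIsConfig hC
    exact ⟨D, h1.isPreSlice hn h2 h3, h4,
      (terminal_iff_no_step hn h.toIsLoose hC).1 h.terminal⟩

/-- A slice whose boundaries are below those of another one contains it before splitting. -/
theorem exists_splitForm_sub {n l : ℕ} (hn : 4 ≤ n) {m m' : State} (h : IsSliceState n l m)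
    (h' : IsSliceState n l m') {C C' : Layers l} (hC : m.Encodes n C) (hC' : m'.Encodes n C')
    (hF : ∀ r, m'.F r ≤ m.F r) (hG : ∀ r, m'.G r ≤ m.G r) (hT : ∀ b r, m'.T b r ≤ m.T b r) :
    ∃ D D' : Layers l, IsSplitForm n D C ∧ IsSplitForm n D' C' ∧ ∀ j, (D j).Sub (D' j) := by
  obtain ⟨m₀, D, h1, h2, h3, h4, h5, h6, h7⟩ := exists_whole hn h.toIsConfig hC
  obtain ⟨m₀', D', h1', h2', h3', h4', h5', h6', h7'⟩ := exists_whole hn h'.toIsConfig hC'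
  refine ⟨D, D', ⟨h1.isPreSlice hn h2 h3, h4,
    (terminal_iff_no_step hn h.toIsLoose hC).1 h.terminal⟩, ⟨h1'.isPreSlice hn h2' h3', h4',
    (terminal_iff_no_step hn h'.toIsLoose hC').1 h'.terminal⟩, fun j => ?_⟩
  refine (h3 j).sub h1' h2' h1 h2 (fun r => ?_) (fun b r => ?_) le_rfl (h3' j)
  -- The un-splitting of `exists_whole` depends monotonically on the state: its `F` is the larger
  -- threshold in thin rows, the old `G` in covering rows and the old `F` in supporting rows.
  · by_cases hr : IsThin n r
    · rw [h1.whole_F h2 hr, h1'.whole_F h2' hr, h5, h5']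
      exact max_le_max (hT _ _) (hT _ _)
    · rcases lt_or_ge (n - 2) (pos n r) with hp | hp
      · rw [h2.unit r hr, h2'.unit r hr, h6 r hr hp, h6' r hr hp]
        exact hG r
      · have hp : pos n r < n - 2 := lt_of_le_of_ne hp fun hh => hr (.inr hh)
        rw [h7 r hr hp, h7' r hr hp]
        exact hF r
  · rw [h5, h5']
    exact hT b r

/-- The boundaries after un-splitting in the thin row `r`. -/
noncomputable def State.glue (n : ℕ) (m : State) (r : ℤ) : State :=
  m.split n r (-(min (m.T true r) (m.T false r) - m.G r))

section Glue

variable {n l : ℕ} {m : State} {r : ℤ}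

theorem ind_neg_thin (hn : 4 ≤ n) (hr : IsThin n r) (x : ℤ) : ind n (-r) x = ind n r x :=
  ind_congr (dvd_of_isThin hn hr) x

theorem IsConfig.glue (hn : 4 ≤ n) (h : IsConfig n l m) (hr : IsThin n r) :
    IsConfig n l (m.glue n r) := by
  have a := h.G_le_min hr
  have b := h.min_add_max hr
  exact h.unsplit hn (by omega) (by omega) (fun _ => le_rfl)

theorem IsConfig.T_of_dvd (hn : 4 ≤ n) (h : IsConfig n l m) (hr : IsThin n r) {x : ℤ}
    (hd : period n ∣ x - r) (b : Bool) : m.T b x - m.G x = m.T b r - m.G r := by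
  obtain ⟨k, hk, e1⟩ := h.perG.eq_add hd
  have e2 := h.T_per_mul hn b hr k
  rw [← hk] at e2
  omega

theorem IsConfig.glue_at (hn : 4 ≤ n) (h : IsConfig n l m) (hr : IsThin n r) {x : ℤ}
    (hd : period n ∣ x - r) :
    (m.glue n r).F x = max (m.T true x) (m.T false x) ∧
      (m.glue n r).G x = min (m.T true x) (m.T false x) := by
  have hx : IsThin n x := (isThin_congr hn hd).2 hr
  have a := h.min_add_max hx
  have b1 := h.T_of_dvd hn hr hd true
  have b2 := h.T_of_dvd hn hr hd false
  rw [State.glue, State.split_F, State.split_G, ind_neg_thin hn hr, ind_of_dvd hd]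
  omega

theorem State.glue_F_of_not_dvd {x : ℤ} (hd : ¬ period n ∣ x - r) :
    (m.glue n r).F x = m.F x := by
  rw [State.glue, State.split_F, ind_of_not_dvd hd]; ring

theorem State.glue_G_of_not_dvd (hn : 4 ≤ n) (hr : IsThin n r) {x : ℤ}
    (hd : ¬ period n ∣ x - r) : (m.glue n r).G x = m.G x := by
  rw [State.glue, State.split_G, ind_neg_thin hn hr, ind_of_not_dvd hd]; ring

theorem not_dvd_succ (hn : 4 ≤ n) {x : ℤ} (hd : period n ∣ x - r) : ¬ period n ∣ x + 1 - r := by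
  intro hh
  have := dvd_sub hh hd
  rw [sub_sub_sub_cancel_right, add_sub_cancel_left] at this
  exact not_dvd_one hn this

theorem not_dvd_pred (hn : 4 ≤ n) {x : ℤ} (hd : period n ∣ x - r) : ¬ period n ∣ x - 1 - r := by
  intro hh
  have := dvd_sub hd hh
  rw [sub_sub_sub_cancel_right, sub_sub_cancel] at this
  exact not_dvd_one hn this

theorem thin_rowOf (hn : 4 ≤ n) {t : ℕ} (ht : t = 1 ∨ t = n - 1) :
    IsThin n (rowOf .covering t) := by
  rw [isThin_iff hn]
  rcases ht with rfl | rfl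
  · simp [rowOf]
  · exact ⟨-1, by simp only [rowOf]; omega⟩

theorem kind_of_thin (hn : 4 ≤ n) {x : ℤ} (hx : IsThin n x) :
    (kind n x = 1 ∨ kind n x = n - 1) ∧ period n ∣ x - rowOf .covering (kind n x) := by
  refine ⟨?_, ((kind_side_iff hn .covering _ x).1 ⟨rfl, ?_⟩).2⟩
  · simp only [kind]
    rcases hx with hx | hx <;> rw [hx] <;> split_ifs <;> omega
  · rcases hx with hx | hx
    · exact .inl hx
    · exact .inr hx.ge

/-- Un-splitting `e` pairs increases both numbers in the minimum by `e`. In the terminal state one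
of them was zero, so maximal splitting performs just these `e` splittings again. -/
theorem eq_glue_split (hn : 4 ≤ n) (h : IsSliceState n l m) (hr : IsThin n r) :
    let m₀ := m.glue n r
    let d := min (m₀.G (r + 1) - m₀.F r) (m₀.G (-r) - m₀.F (-r - 1))
    m₀.split n r d = m ∧ d ≤ l := by
  intro m₀ d
  have h₀ : IsConfig n l m₀ := h.toIsConfig.glue hn hr
  have hd0 : period n ∣ r - r := by simp
  have hdn := dvd_of_isThin hn hr
  have a1 := h.glue_at hn hr hd0
  have a2 := h.glue_at hn hr hdn
  have a3 : m₀.G (r + 1) = m.G (r + 1) :=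
    State.glue_G_of_not_dvd hn hr (not_dvd_succ hn hd0)
  have a4 : m₀.F (-r - 1) = m.F (-r - 1) := State.glue_F_of_not_dvd (not_dvd_pred hn hdn)
  have a5 := h.min_add_max hr
  have a6 := h.T_of_dvd hn hr hdn true
  have a7 := h.T_of_dvd hn hr hdn false
  have a8 := h.terminal (r + 1)
  have a9 := h.F_le_G (r + 1)
  have a10 := h.F_le_G (-r)
  rw [add_sub_cancel_right, show 1 - (r + 1) = -r by ring, neg_add, ← sub_eq_add_neg] at a8
  rw [add_sub_cancel_right] at a9
  have hd : d = min (m.T true r) (m.T false r) - m.G r := by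
    simp only [d, m₀] at *
    omega
  constructor
  · rw [hd]
    show (m.split n r _).split n r _ = m
    rw [State.split_split, neg_add_cancel, State.split_zero]
  · have b1 := h₀.F_le_F_sub hn (r + 1)
    have b2 := h₀.G_le_F (r + 1)
    rw [add_sub_cancel_right] at b1
    have : d ≤ m₀.G (r + 1) - m₀.F r := min_le_left _ _
    omega

/-- Un-splitting is unique: splitting does not affect `T`, and the absence of broken pairs of kind
`t` means that `G` is the smaller threshold in that row. Both together force the state before
splitting to be `m.glue`. -/
theorem isUnsplit_iff (hn : 4 ≤ n) (h : IsSliceState n l m) {C D : Layers l}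
    (hC : m.Encodes n C) {t : ℕ} (ht : t = 1 ∨ t = n - 1) :
    IsUnsplit n t C D ↔ (m.glue n (rowOf .covering t)).Encodes n D := by
  have hr := thin_rowOf hn ht
  have ht' : 1 ≤ t ∧ t ≤ n - 1 := by omega
  have hkind : ∀ x, IsThin n x → (kind n x = t ↔ period n ∣ x - rowOf .covering t) := by
    intro x hx
    have := kind_side_iff hn .covering t x
    have hs : OnSide n .covering x := by
      rcases hx with hx | hx
      · exact .inl hx
      · exact .inr hx.ge
    tauto
  have hkind' : ∀ x, kind n x = t → IsThin n x := by
    intro x hx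
    simp only [kind] at hx
    have := pos_lt hn x
    have := period_eq hn
    unfold IsThin
    split_ifs at hx <;> omega
  constructor
  · rintro ⟨⟨D₀, hD₀, hs⟩, hnh, hall⟩
    obtain ⟨m₁, h₁, hm₁⟩ := hD₀.exists_state hn
    obtain ⟨m₀, h₀, hm₀⟩ := exists_config_of_reachable hn h₁ hm₁ hs
    set r := rowOf .covering t with hr_def
    have hfl := h₀.F_le_F_sub hn (r + 1)
    have hgf := h₀.G_le_F (r + 1)
    have hsucc := h₀.F_succ r
    have hge := h₀.F_le_G (-r)
    rw [add_sub_cancel_right] at hfl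
    have he := iterate_splitOnce hn ht' l h₀ hm₀
      (d := min (m₀.G (r + 1) - m₀.F r) (m₀.G (-r) - m₀.F (-r - 1))) rfl (by omega)
    have hc := h₀.split hn (r := r)
      (d := min (m₀.G (r + 1) - m₀.F r) (m₀.G (-r) - m₀.F (-r - 1))) (by omega)
      (by omega) (by omega)
    have heq := State.Encodes.state_unique hn hc h.toIsConfig (hall ▸ he) hC
    set d := min (m₀.G (r + 1) - m₀.F r) (m₀.G (-r) - m₀.F (-r - 1))
    -- If `G r` were below both thresholds, the layer congruent to `G r` would show a broken half of
    -- kind `t`, contrary to `hnh`.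
    have hG₀ : m₀.G r = min (m₀.T true r) (m₀.T false r) := by
      have hle := h₀.G_le_min hr
      by_contra hne
      have hlt : m₀.G r < min (m₀.T true r) (m₀.T false r) := by omega
      have hl : 0 < l := by
        rcases Nat.eq_zero_or_pos l with hl | hl
        · have e1 := h₀.F_eq_zero hl r
          have e2 := h₀.F_eq_zero hl (r - 1)
          have e3 := h₀.F_le_G r
          have e4 := h₀.T_le_F true r hr
          omega
        · exact hl
      obtain ⟨j, k, hj⟩ := exists_fin_congr hl (m₀.G r)
      have e1 := h₀.perF.add_mul r k
      have e2 := h₀.perG.add_mul r k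
      have e3 := h₀.T_per_mul hn true hr k
      have e4 := h₀.T_per_mul hn false hr k
      have e5 := h₀.T_le_F true r hr
      have e6 := h₀.F_le_G (r + k * period n)
      have hrow := (hm₀ j).row_eq_of h₀.toIsLoose (r := r + k * period n) (by omega) (by omega)
      have hd : period n ∣ (D j).row - r := by rw [hrow]; simp
      have hthin : IsThin n (D j).row := (isThin_congr hn hd).2 hr
      refine hnh j ((hm₀ j).top_half.2 ?_) ((hkind _ hthin).2 hd)
      rw [hrow]
      exact ⟨by omega, fun _ b hb => by cases b <;> simp at * <;> omega⟩
    have : m.glue n r = m₀ := by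
      have e1 : m.T = m₀.T := by rw [← heq]; rfl
      have e2 : m.G r = m₀.G r + -d := by
        rw [← heq, State.split_G, ind_neg_thin hn hr, ind_self]; ring
      rw [State.glue, e1, e2, ← hG₀, ← heq, State.split_split,
        show d + -(m₀.G r - (m₀.G r + -d)) = 0 by ring, State.split_zero]
    rwa [this]
  · intro hD
    have h₀ := h.toIsConfig.glue hn hr
    refine ⟨?_, ?_, ?_⟩
    · obtain ⟨m₁, D₁, h1, h2, h3, h4, -⟩ := exists_whole hn h₀ hD
      exact ⟨D₁, h1.isPreSlice hn h2 h3, h4⟩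
    · intro j hj hk
      have hthin := hkind' _ hk
      have hd := (hkind _ hthin).1 hk
      have e := h.glue_at hn hr hd
      have h1 := (hD j).top_half.1 hj
      have h2 := (hD j).lt
      have h3 := h1.2 hthin true
      have h4 := h1.2 hthin false
      simp only [Bool.not_true, Bool.not_false, State.glue, State.split_T] at h1 h2 h3 h4 e
      omega
    · obtain ⟨e, hle⟩ := eq_glue_split hn h hr
      have := iterate_splitOnce hn ht' l h₀ hD rfl hle
      rw [e] at this
      exact State.Encodes.ext h.toIsLoose this hC

theorem unsplit_spec (hn : 4 ≤ n) (h : IsSliceState n l m) {C : Layers l}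
    (hC : m.Encodes n C) {t : ℕ} (ht : t = 1 ∨ t = n - 1) :
    ∃ D, unsplit n t C = some D ∧ (m.glue n (rowOf .covering t)).Encodes n D := by
  have hex : ∃ D, IsUnsplit n t C D := by
    obtain ⟨D, hD⟩ := (h.toIsConfig.glue hn (thin_rowOf hn ht)).exists_encodes
    exact ⟨D, (isUnsplit_iff hn h hC ht).2 hD⟩
  exact ⟨hex.choose, by rw [unsplit, dif_pos hex], (isUnsplit_iff hn h hC ht).1 hex.choose_spec⟩

/-- The halves of a thin row lie in `[G, min T)` and `[max T, F)`. Un-splitting empties the first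
interval and completes the second, so these are the upper and the lower halves. -/
theorem isUpperHalf_iff (hn : 4 ≤ n) (h : IsSliceState n l m) {C : Layers l}
    (hC : m.Encodes n C) {j : Fin l} (hj : IsThin n (C j).row) :
    IsUpperHalf n C j ↔ (j : ℤ) < min (m.T true (C j).row) (m.T false (C j).row) := by
  obtain ⟨hk, hd⟩ := kind_of_thin hn hj
  have hr := thin_rowOf hn hk
  have h₀ := h.toIsConfig.glue hn hr
  have e := h.glue_at hn hr hd
  unfold IsUpperHalf
  simp only [isUnsplit_iff hn h hC hk]
  rw [← e.2]
  constructor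
  · rintro ⟨D, hD, hDj⟩
    have := (hD j).flat
    simpa [hDj] using this
  · intro hlt
    obtain ⟨D, hD⟩ := h₀.exists_encodes
    refine ⟨D, hD, ?_⟩
    have hge := (hC j).ge
    rw [← State.glue_F_of_not_dvd (r := rowOf .covering (kind n (C j).row))
      (not_dvd_pred hn hd)] at hge
    have hrow := (hD j).row_eq_of h₀.toIsLoose hge (hlt.trans_le (h₀.G_le_F _))
    have htop := (hD j).flat.2 (by rwa [hrow])
    rw [← hrow, ← htop]

theorem isLowerHalf_iff (hn : 4 ≤ n) (h : IsSliceState n l m) {C : Layers l}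
    (hC : m.Encodes n C) {j : Fin l} (hj : IsThin n (C j).row) :
    IsLowerHalf n C j ↔ max (m.T true (C j).row) (m.T false (C j).row) ≤ j := by
  obtain ⟨hk, hd⟩ := kind_of_thin hn hj
  have hr := thin_rowOf hn hk
  have h₀ := h.toIsConfig.glue hn hr
  have e := h.glue_at hn hr hd
  unfold IsLowerHalf
  simp only [isUnsplit_iff hn h hC hk]
  rw [← e.1]
  constructor
  · rintro ⟨D, hD, hDj⟩
    have := (hD j).ge
    simpa [hDj] using this
  · intro hge
    obtain ⟨D, hD⟩ := h₀.exists_encodes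
    refine ⟨D, hD, ?_⟩
    have hlt := (hC j).lt.trans_le (h.F_succ _)
    rw [← State.glue_G_of_not_dvd hn hr (not_dvd_succ hn hd)] at hlt
    have hrow := (hD j).row_eq_of h₀.toIsLoose (r := (C j).row + 1) (by
      rwa [add_sub_cancel_right]) (hlt.trans_le (h₀.G_le_F _))
    have htop := (hD j).flat.2 (by rwa [hrow])
    rw [← hrow, ← htop]

end Glue

/-! ### Neighbouring columns -/

/-- The boundaries of a column `A` and of the column `B` to its right in a proper Young wall. -/
structure State.Rel (n : ℕ) (mA mB : State) : Prop where
  G_le : ∀ r, mB.G r ≤ mA.F (r - 1)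
  T_le : ∀ b r, IsThin n r → mB.T b r ≤ mA.T b r

theorem State.At.top_cases {n : ℕ} {m : State} {j : ℤ} {c : Layer} (hc : m.At n j c) :
    c.top = .flat ∨ c.top = .half ∨ ∃ b, c.top = YoungWallD.single b ∧ IsThin n c.row ∧
      m.T b c.row ≤ j ∧ j < m.T (!b) c.row := by
  have h1 := hc.single true
  have h2 := hc.single false
  cases ht : c.top
  · exact .inl rfl
  · exact .inr (.inr ⟨true, rfl, h1.1 ht⟩)
  · exact .inr (.inr ⟨false, rfl, h2.1 ht⟩)
  · exact .inr (.inl rfl)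

/-- Where `B` is flat in row `r`, properness and the absence of free space force the layer of `A` to
end strictly below; this is `G_le`. For `T_le` the layer congruent to the offending threshold of `A`
is inspected: `A` has block `b` there and `B` lacks it. -/
theorem rel_of_noFreeSpace {n l : ℕ} (hn : 4 ≤ n) {mA mB : State} (hA : IsSliceState n l mA)
    (hB : IsSliceState n l mB) {A B : Layers l} (eA : mA.Encodes n A) (eB : mB.Encodes n B)
    (H : ∀ j, NoFreeSpace n A B j ∧
      ¬ ((A j).top = .flat ∧ (B j).top = .flat ∧ (A j).row = (B j).row)) : mA.Rel n mB := by
  rcases Nat.eq_zero_or_pos l with hl | hl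
  · have a := hA.F_eq_zero hl
    have b := hB.F_eq_zero hl
    refine ⟨fun r => ?_, fun c r hr => ?_⟩
    · have := hB.G_le_F r
      rw [a]; rw [b] at this; exact this
    · have h1 := hA.F_le_G r
      have h2 := hA.G_le_T c r hr
      have h3 := hB.T_le_F c r hr
      rw [a] at h1
      rw [b] at h3
      omega
  have hG : ∀ r, mB.G r ≤ mA.F (r - 1) := by
    intro r
    by_contra hlt
    push Not at hlt
    obtain ⟨j, k, hj⟩ := exists_fin_congr hl (mA.F (r - 1))
    have e1 := hA.perF.add_mul (r - 1) k
    rw [sub_add_eq_add_sub] at e1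
    have e2 := hB.perG.add_mul r k
    have rA : ¬ (A j).row ≤ r + k * period n - 1 := by
      rw [(eA j).row_le_iff hA.toIsLoose]; omega
    have rB := ((eB j).lt_G_iff hB.toIsLoose (r + k * period n)).1 (by omega)
    obtain ⟨h1 | ⟨h1, h2⟩, h3⟩ := H j
    · omega
    · have hb : (B j).row = r + k * period n ∧ (B j).top = .flat := by
        rcases rB with rB | rB
        · omega
        · exact rB
      rw [hb.2] at h2
      apply h3
      refine ⟨?_, hb.2, h1⟩
      cases hh : (A j).top <;> simp_all
  refine ⟨hG, fun b r hr => ?_⟩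
  by_contra hlt
  push Not at hlt
  obtain ⟨j, k, hj⟩ := exists_fin_congr hl (mA.T b r)
  set x := r + k * period n with hx
  have hxr : IsThin n x := (isThin_congr hn (by simp [hx])).2 hr
  have e1 := hA.T_per_mul hn b hr k
  have e2 := hB.T_per_mul hn b hr k
  rw [← hx] at e1 e2
  have a1 := hA.G_le_T b x hxr
  have a2 := hA.F_le_G x
  have a3 := hB.T_le_F b x hxr
  have a4 := hA.T_add' b hxr
  have a5 := hB.T_add' b hxr
  have a6 := hG x
  have a7 := hG (x + 1)
  rw [add_sub_cancel_right] at a7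
  have a8 := hB.F_succ x
  have rA : ¬ (A j).row ≤ x - 1 := by
    rw [(eA j).row_le_iff hA.toIsLoose]; omega
  have rB : (B j).row ≤ x := by
    rw [(eB j).row_le_iff hB.toIsLoose]; omega
  obtain ⟨h1 | ⟨h1, h2⟩, h3⟩ := H j
  · omega
  have xA : (A j).row = x := by omega
  have xB : (B j).row = x := by omega
  have nA : (A j).top ≠ .flat := by
    rw [Ne, (eA j).flat, xA]; omega
  have uB := isUpperHalf_iff hn hA eA (j := j) (by rwa [xA])
  have lB := isLowerHalf_iff hn hB eB (j := j) (by rwa [xB])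
  rw [xA] at uB
  rw [xB] at lB
  rcases (eA j).top_cases with tA | tA | ⟨b1, tA, -, tA1, tA2⟩
  · exact nA tA
  · rcases (eB j).top_cases with tB | tB | ⟨b2, tB, -, tB1, tB2⟩
    · rw [tA, tB] at h2; exact h2
    -- Two broken halves are always allowed, so the contradiction is numerical: both thresholds of
    -- `A` would be at most `j` and both of `B` larger, while `F + G` of `A` is at least that of
    -- `B`.
    · have g1 := ((eA j).top_half.1 tA).2 (by rwa [xA]) b (by rw [xA]; omega)
      have g2 := ((eB j).top_half.1 tB).2 (by rwa [xB]) (!b)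
      rw [xA] at g1
      rw [xB, Bool.not_not] at g2
      omega
    · rw [xB] at tB1 tB2
      have : IsUpperHalf n A j := by
        rw [tA, tB] at h2; cases b2 <;> exact h2
      rw [uB] at this
      cases b <;> omega
  · rw [xA] at tA1 tA2
    have hb1 : b1 = b := by
      cases b <;> cases b1 <;> simp at * <;> omega
    subst hb1
    rcases (eB j).top_cases with tB | tB | ⟨b2, tB, -, tB1, tB2⟩
    · rw [tA, tB] at h2; cases b1 <;> exact h2
    · have : IsLowerHalf n B j := by
        rw [tA, tB] at h2; cases b1 <;> exact h2
      rw [lB] at this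
      cases b1 <;> omega
    · rw [xB] at tB1 tB2
      have hb2 : b2 = !b1 := by
        cases b1 <;> cases b2 <;> simp at * <;> omega
      rw [tA, tB, hb2] at h2
      cases b1 <;> exact h2

theorem State.Rel.F_le {n l : ℕ} {mA mB : State} (h : mA.Rel n mB) (hB : IsLoose n l mB)
    (r : ℤ) : mB.F r ≤ mA.F r := by
  have h1 := hB.F_succ r
  have h2 := h.G_le (r + 1)
  rw [add_sub_cancel_right] at h2
  omega

theorem State.Rel.noFreeSpace {n l : ℕ} (hn : 4 ≤ n) {mA mB : State} (hR : mA.Rel n mB)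
    (hA : IsSliceState n l mA) (hB : IsSliceState n l mB) {A B : Layers l}
    (eA : mA.Encodes n A) (eB : mB.Encodes n B) (j : Fin l) : NoFreeSpace n A B j := by
  have hle : (A j).row ≤ (B j).row := by
    rw [(eA j).row_le_iff hA.toIsLoose]
    exact (eB j).lt.trans_le (hR.F_le hB.toIsLoose _)
  rcases hle.lt_or_eq with hlt | heq
  · exact .inl hlt
  refine .inr ⟨heq, ?_⟩
  have nB : (B j).top ≠ .flat := by
    rw [Ne, (eB j).flat, ← heq]
    have := hR.G_le (A j).row
    have := (eA j).ge
    omega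
  rcases (eA j).top_cases with tA | tA | ⟨b1, tA, ht, tA1, tA2⟩
  · rw [tA]; trivial
  · rcases (eB j).top_cases with tB | tB | ⟨b2, tB, ht, tB1, tB2⟩
    · exact (nB tB).elim
    · rw [tA, tB]; trivial
    · rw [← heq] at ht tB1 tB2
      have h1 := hR.T_le (!b2) _ ht
      have h2 := ((eA j).top_half.1 tA).2 ht (!b2)
      have h3 := ((eA j).top_half.1 tA).2 ht b2
      rw [Bool.not_not] at h2
      have hu := isUpperHalf_iff hn hA eA ht
      have : IsUpperHalf n A j := by
        rw [hu]
        cases b2 <;> simp at * <;> omega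
      rw [tA, tB]
      cases b2 <;> exact this
  · have h1 := hR.T_le b1 _ ht
    rcases (eB j).top_cases with tB | tB | ⟨b2, tB, -, tB1, tB2⟩
    · exact (nB tB).elim
    · have h2 := ((eB j).top_half.1 tB).2 (heq ▸ ht) b1
      rw [← heq] at h2
      have hu := isLowerHalf_iff hn hB eB (heq ▸ ht)
      rw [← heq] at hu
      have : IsLowerHalf n B j := by
        rw [hu]
        cases b1 <;> simp at * <;> omega
      rw [tA, tB]
      cases b1 <;> exact this
    · have : b2 = b1 := by
        rw [← heq] at tB1 tB2
        cases b1 <;> cases b2 <;> simp at * <;> omega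
      rw [tA, tB, this]
      cases b1 <;> trivial


/-! ### Moving single blocks of half-unit depth -/

/-- The boundary of the blocks of type `b` in the thin row `r` moves by `d`, and the blocks of this
row are split again as far as possible. -/
noncomputable def State.thinMove (n : ℕ) (m : State) (r : ℤ) (b : Bool) (d : ℤ) : State := by
  classical exact
  { F := fun x => if period n ∣ x - r then
        min (m.G (x + 1)) (m.T true x + m.T false x + d - m.F (x - 1)) else m.F x
    G := fun x => if period n ∣ x - r then
        max (m.F (x - 1)) (m.T true x + m.T false x + d - m.G (x + 1)) else m.G x
    T := fun b' x => m.T b' x + if b' = b then d * ind n r x else 0 }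

/-- The same without splitting again. -/
noncomputable def State.thinShift (n : ℕ) (m : State) (r : ℤ) (b : Bool) (d : ℤ) : State := by
  classical exact
  { F := fun x => if period n ∣ x - r then
        max (m.T b x + d) (m.T (!b) x) else m.F x
    G := fun x => if period n ∣ x - r then
        min (m.T b x + d) (m.T (!b) x) else m.G x
    T := fun b' x => m.T b' x + if b' = b then d * ind n r x else 0 }

section Thin

variable {n l : ℕ} {m : State} {r : ℤ} {b : Bool} {d : ℤ}

theorem State.thinShift_of_dvd {x : ℤ} (hd : period n ∣ x - r) :
    (m.thinShift n r b d).F x = max (m.T b x + d) (m.T (!b) x) ∧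
    (m.thinShift n r b d).G x = min (m.T b x + d) (m.T (!b) x) ∧
    (m.thinShift n r b d).T b x = m.T b x + d ∧
    (m.thinShift n r b d).T (!b) x = m.T (!b) x := by
  simp [State.thinShift, hd, ind_of_dvd hd]

theorem State.thinShift_of_not_dvd {x : ℤ} (hd : ¬ period n ∣ x - r) :
    (m.thinShift n r b d).F x = m.F x ∧ (m.thinShift n r b d).G x = m.G x ∧
    ∀ b', (m.thinShift n r b d).T b' x = m.T b' x := by
  simp [State.thinShift, hd, ind_of_not_dvd hd]

theorem State.thinMove_of_dvd {x : ℤ} (hd : period n ∣ x - r) :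
    (m.thinMove n r b d).F x = min (m.G (x + 1)) (m.T b x + m.T (!b) x + d - m.F (x - 1)) ∧
    (m.thinMove n r b d).G x = max (m.F (x - 1)) (m.T b x + m.T (!b) x + d - m.G (x + 1)) ∧
    (m.thinMove n r b d).T b x = m.T b x + d ∧
    (m.thinMove n r b d).T (!b) x = m.T (!b) x := by
  cases b <;> simp [State.thinMove, hd, ind_of_dvd hd, add_comm (m.T false x)]

theorem State.thinMove_of_not_dvd {x : ℤ} (hd : ¬ period n ∣ x - r) :
    (m.thinMove n r b d).F x = m.F x ∧ (m.thinMove n r b d).G x = m.G x ∧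
    ∀ b', (m.thinMove n r b d).T b' x = m.T b' x := by
  simp [State.thinMove, hd, ind_of_not_dvd hd]

theorem bool_or (b b' : Bool) : b' = b ∨ b' = !b := by cases b <;> cases b' <;> simp

theorem dvd_add_period_iff {x : ℤ} : period n ∣ x + period n - r ↔ period n ∣ x - r := by
  rw [add_sub_right_comm]; exact dvd_add_self_right

theorem IsConfig.thinShift (hn : 4 ≤ n) (h : IsConfig n l m) (hr : IsThin n r)
    (h1 : m.F (r - 1) ≤ m.T b r + d) (h2 : m.T b r + d ≤ m.G (r + 1)) :
    IsConfig n l (m.thinShift n r b d) := by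
  have range : ∀ x, period n ∣ x - r →
      m.F (x - 1) ≤ m.T b x + d ∧ m.T b x + d ≤ m.G (x + 1) := by
    intro x hd
    have e1 := h.T_of_dvd hn hr hd b
    have e2 := h.lt_G_of_dvd hd
    have e3 := h.lt_G_of_dvd (r := r + 1) (x := x + 1) (by simpa using hd)
    have e4 := h.lt_F_of_dvd hd
    simp only [add_sub_cancel_right] at e3
    omega
  have per : ∀ x, (m.thinShift n r b d).F (x + period n) = (m.thinShift n r b d).F x + l ∧
      (m.thinShift n r b d).G (x + period n) = (m.thinShift n r b d).G x + l ∧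
      (∀ b', IsThin n x →
        (m.thinShift n r b d).T b' (x + period n) = (m.thinShift n r b d).T b' x + l) := by
    intro x
    by_cases hd : period n ∣ x - r
    · have hx : IsThin n x := (isThin_congr hn hd).2 hr
      obtain ⟨e1, e2, e3, e4⟩ := State.thinShift_of_dvd (m := m) (b := b) (d := d) hd
      obtain ⟨f1, f2, f3, f4⟩ := State.thinShift_of_dvd (m := m) (b := b) (d := d)
        (dvd_add_period_iff.2 hd)
      have p1 := h.perT b x hx
      have p2 := h.perT (!b) x hx
      refine ⟨by omega, by omega, fun b' _ => ?_⟩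
      rcases bool_or b b' with rfl | rfl <;> omega
    · obtain ⟨e1, e2, e3⟩ := State.thinShift_of_not_dvd (m := m) (b := b) (d := d) hd
      obtain ⟨f1, f2, f3⟩ := State.thinShift_of_not_dvd (m := m) (b := b) (d := d)
        (mt dvd_add_period_iff.1 hd)
      refine ⟨by rw [e1, f1, h.perF], by rw [e2, f2, h.perG], fun b' hx => ?_⟩
      rw [e3, f3, h.perT _ _ hx]
  have perF : QuasiPeriodic n l (m.thinShift n r b d).F := fun x => (per x).1
  have perG : QuasiPeriodic n l (m.thinShift n r b d).G := fun x => (per x).2.1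
  refine ⟨⟨perF, perG, fun b' x hx => (per x).2.2 b' hx, fun x => ?_, fun x => ?_,
    fun b' x hx => ?_, fun b' x hx => ?_⟩, fun x => ?_, fun x hx => ?_, fun b' x hx => ?_,
    fun hl x => ?_⟩
  · have e := h.F_le_G x
    by_cases hd : period n ∣ x - r
    · have hx : IsThin n x := (isThin_congr hn hd).2 hr
      rw [(State.thinShift_of_dvd hd).2.1, (State.thinShift_of_not_dvd (not_dvd_pred hn hd)).1]
      have := range x hd
      have := h.G_le_T (!b) x hx
      omega
    · rw [(State.thinShift_of_not_dvd hd).2.1]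
      by_cases hd' : period n ∣ x - 1 - r
      · rw [(State.thinShift_of_dvd hd').1]
        have hx : IsThin n (x - 1) := (isThin_congr hn hd').2 hr
        have e1 := range _ hd'
        have e2 := h.T_le_F (!b) _ hx
        rw [sub_add_cancel] at e1
        omega
      · rw [(State.thinShift_of_not_dvd hd').1]; exact e
  · by_cases hd : period n ∣ x - r
    · have := State.thinShift_of_dvd (m := m) (b := b) (d := d) hd
      omega
    · have := State.thinShift_of_not_dvd (m := m) (b := b) (d := d) hd
      rw [this.1, this.2.1]
      exact h.G_le_F x
  · by_cases hd : period n ∣ x - r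
    · have := State.thinShift_of_dvd (m := m) (b := b) (d := d) hd
      rcases bool_or b b' with rfl | rfl <;> omega
    · have := State.thinShift_of_not_dvd (m := m) (b := b) (d := d) hd
      rw [this.2.1, this.2.2]
      exact h.G_le_T b' x hx
  · by_cases hd : period n ∣ x - r
    · have := State.thinShift_of_dvd (m := m) (b := b) (d := d) hd
      rcases bool_or b b' with rfl | rfl <;> omega
    · have := State.thinShift_of_not_dvd (m := m) (b := b) (d := d) hd
      rw [this.1, this.2.2]
      exact h.T_le_F b' x hx
  · by_cases hx : IsThin n x
    · exact perF.of_dvd perG (dvd_of_isThin hn hx)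
    · have hd : ¬ period n ∣ x - r := fun hd => hx ((isThin_congr hn hd).2 hr)
      have hd' : ¬ period n ∣ -x - r := fun hd => hx ((isThin_neg hn).1 ((isThin_congr hn hd).2 hr))
      have e := State.thinShift_of_not_dvd (m := m) (b := b) (d := d) hd
      have e' := State.thinShift_of_not_dvd (m := m) (b := b) (d := d) hd'
      rw [e.1, e.2.1, e'.1, e'.2.1]
      exact h.mirror x
  · by_cases hd : period n ∣ x - r
    · have := State.thinShift_of_dvd (m := m) (b := b) (d := d) hd
      cases b <;> simp only [Bool.not_true, Bool.not_false] at this <;> omega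
    · have := State.thinShift_of_not_dvd (m := m) (b := b) (d := d) hd
      rw [this.1, this.2.1, this.2.2, this.2.2]
      exact h.T_add x hx
  · have hd : ¬ period n ∣ x - r := fun hd => hx ((isThin_congr hn hd).2 hr)
    rw [(State.thinShift_of_not_dvd hd).2.2]
    exact h.T_eq_zero b' x hx
  · have e := h.F_eq_zero hl
    by_cases hd : period n ∣ x - r
    · have hx : IsThin n x := (isThin_congr hn hd).2 hr
      have e1 := range x hd
      have e2 := h.G_le_F (x + 1)
      have e3 := h.T_le_F (!b) x hx
      have e4 := h.G_le_T (!b) x hx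
      have e5 := h.F_le_G x
      rw [(State.thinShift_of_dvd hd).1]
      simp only [e] at *
      omega
    · rw [(State.thinShift_of_not_dvd hd).1, e]

/-- Un-splitting, shifting one threshold and splitting again has a closed form. `F + G` must equal
the new sum of thresholds, and splitting moves `F` up and `G` down until `F` meets `G (x + 1)` or
`G` meets `F (x - 1)`. -/
theorem thinShift_glue_split (hn : 4 ≤ n) (h : IsConfig n l m) (hr : IsThin n r)
    (h1 : m.F (r - 1) ≤ m.T b r + d) (h2 : m.T b r + d ≤ m.G (r + 1)) :
    let m₁ := (m.glue n r).thinShift n r b d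
    let e := min (m₁.G (r + 1) - m₁.F r) (m₁.G (-r) - m₁.F (-r - 1))
    m₁.split n r e = m.thinMove n r b d ∧ 0 ≤ e ∧ e ≤ l ∧ e ≤ m₁.G (r + 1) - m₁.F r ∧
      e ≤ m₁.G (-r) - m₁.F (-r - 1) := by
  intro m₁ e
  have h₀ : IsConfig n l (m.glue n r) := h.glue hn hr
  have hd0 : period n ∣ r - r := by simp
  have h1' : (m.glue n r).F (r - 1) ≤ (m.glue n r).T b r + d := by
    rw [State.glue_F_of_not_dvd (not_dvd_pred hn hd0)]; exact h1
  have h2' : (m.glue n r).T b r + d ≤ (m.glue n r).G (r + 1) := by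
    rw [State.glue_G_of_not_dvd hn hr (not_dvd_succ hn hd0)]; exact h2
  have hm₁ : IsConfig n l m₁ := h₀.thinShift hn hr h1' h2'
  have hGT : ∀ b' x, (m.glue n r).T b' x = m.T b' x := fun b' x => rfl
  have hdn := dvd_of_isThin hn hr
  have val : ∀ x, period n ∣ x - r → m₁.F x = max (m.T b x + d) (m.T (!b) x) ∧
      m₁.G x = min (m.T b x + d) (m.T (!b) x) ∧ m₁.G (x + 1) = m.G (x + 1) ∧
      m₁.F (x - 1) = m.F (x - 1) := by
    intro x hd
    have e1 := State.thinShift_of_dvd (m := m.glue n r) (b := b) (d := d) hd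
    have e2 := State.thinShift_of_not_dvd (m := m.glue n r) (b := b) (d := d) (not_dvd_succ hn hd)
    have e3 := State.thinShift_of_not_dvd (m := m.glue n r) (b := b) (d := d) (not_dvd_pred hn hd)
    exact ⟨e1.1, e1.2.1, e2.2.1.trans (State.glue_G_of_not_dvd hn hr (not_dvd_succ hn hd)),
      e3.1.trans (State.glue_F_of_not_dvd (not_dvd_pred hn hd))⟩
  have a1 := hm₁.F_succ r
  have a2 := hm₁.F_le_G (-r)
  have a3 := hm₁.F_le_F_sub hn (r + 1)
  have a4 := hm₁.G_le_F (r + 1)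
  rw [add_sub_cancel_right] at a3
  refine ⟨?_, by omega, by omega, by omega, by omega⟩
  have key : ∀ x, period n ∣ x - r →
      e = min (m₁.G (x + 1) - m₁.F x) (m₁.G x - m₁.F (x - 1)) := by
    intro x hd
    have e1 := hm₁.lt_G_of_dvd (r := r + 1) (x := x + 1) (by simpa using hd)
    have e2 := hm₁.lt_G_of_dvd (r := -r) (x := x) (by
      have := dvd_sub hd hdn
      rwa [show x - r - (-r - r) = x - -r by ring] at this)
    simp only [add_sub_cancel_right] at e1
    omega
  ext x
  · rw [State.split_F]
    by_cases hd : period n ∣ x - r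
    · rw [ind_of_dvd hd, (State.thinMove_of_dvd hd).1]
      have := key x hd
      have := val x hd
      omega
    · rw [ind_of_not_dvd hd, (State.thinMove_of_not_dvd hd).1,
        (State.thinShift_of_not_dvd hd).1, State.glue_F_of_not_dvd hd]
      ring
  · rw [State.split_G, ind_neg_thin hn hr]
    by_cases hd : period n ∣ x - r
    · rw [ind_of_dvd hd, (State.thinMove_of_dvd hd).2.1]
      have := key x hd
      have := val x hd
      omega
    · rw [ind_of_not_dvd hd, (State.thinMove_of_not_dvd hd).2.1,
        (State.thinShift_of_not_dvd hd).2.1, State.glue_G_of_not_dvd hn hr hd]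
      ring
  · rfl

theorem IsConfig.thinMove (hn : 4 ≤ n) (h : IsConfig n l m) (hr : IsThin n r)
    (h1 : m.F (r - 1) ≤ m.T b r + d) (h2 : m.T b r + d ≤ m.G (r + 1)) :
    IsConfig n l (m.thinMove n r b d) := by
  have hd0 : period n ∣ r - r := by simp
  obtain ⟨e1, e2, -, e3, e4⟩ := thinShift_glue_split hn h hr h1 h2
  rw [← e1]
  refine IsConfig.split hn ((h.glue hn hr).thinShift hn hr ?_ ?_) e2 e3 e4
  · rw [State.glue_F_of_not_dvd (not_dvd_pred hn hd0)]; exact h1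
  · rw [State.glue_G_of_not_dvd hn hr (not_dvd_succ hn hd0)]; exact h2

/-- A thin row is its own mirror image, so termination concerns only the two gaps `F (x - 1) ≤ G x`
and `F x ≤ G (x + 1)`; the minimum and maximum in `thinMove` close one of them. The remaining
conditions are untouched. -/
theorem IsSliceState.thinMove (hn : 4 ≤ n) (h : IsSliceState n l m) (hr : IsThin n r)
    (h1 : m.F (r - 1) ≤ m.T b r + d) (h2 : m.T b r + d ≤ m.G (r + 1)) :
    IsSliceState n l (m.thinMove n r b d) := by
  have hc := h.toIsConfig.thinMove hn hr h1 h2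
  refine ⟨hc, fun x => ?_⟩
  have main : ∀ x, period n ∣ x - r →
      (m.thinMove n r b d).G (x + 1) = (m.thinMove n r b d).F x ∨
      (m.thinMove n r b d).G (-x) = (m.thinMove n r b d).F (-x - 1) := by
    intro x hd
    have hx : IsThin n x := (isThin_congr hn hd).2 hr
    have e := hc.lt_G_of_dvd (r := x) (x := -x) (dvd_of_isThin hn hx)
    have e1 := State.thinMove_of_dvd (m := m) (b := b) (d := d) hd
    have e2 := State.thinMove_of_not_dvd (m := m) (b := b) (d := d) (not_dvd_succ hn hd)
    have e3 := State.thinMove_of_not_dvd (m := m) (b := b) (d := d) (not_dvd_pred hn hd)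
    omega
  by_cases hd : period n ∣ x - r
  · have hx : IsThin n x := (isThin_congr hn hd).2 hr
    have := main (-x) (by
      have := dvd_add hd (dvd_of_isThin hn hx)
      rwa [show x - r + (-x - x) = -x - r by ring] at this)
    rw [neg_neg, show -x + 1 = 1 - x by ring] at this
    tauto
  · by_cases hd' : period n ∣ x - 1 - r
    · have := main _ hd'
      rw [sub_add_cancel, show -(x - 1) = 1 - x by ring, show 1 - x - 1 = -x by ring] at this
      tauto
    · have hrn := dvd_of_isThin hn hr
      have h3 : ¬ period n ∣ 1 - x - r := fun hh => hd' (by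
        have := dvd_add (dvd_neg.2 hh) hrn
        rwa [show -(1 - x - r) + (-r - r) = x - 1 - r by ring] at this)
      have h4 : ¬ period n ∣ -x - r := fun hh => hd (by
        have := dvd_add (dvd_neg.2 hh) hrn
        rwa [show -(-x - r) + (-r - r) = x - r by ring] at this)
      rw [(State.thinMove_of_not_dvd hd).2.1, (State.thinMove_of_not_dvd hd').1,
        (State.thinMove_of_not_dvd h3).2.1, (State.thinMove_of_not_dvd h4).1]
      exact h.terminal x

/-- Layers other than the one that is changed keep their places. -/
theorem State.At.thinShift (hr : IsThin n r) (hn : 4 ≤ n) (h : IsConfig n l m)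
    (hw : ∀ x, period n ∣ x - r → m.G x = min (m.T true x) (m.T false x)) {j : ℤ} {c : Layer}
    (hc : m.At n j c) (hj : ∀ x, period n ∣ x - r → (j < m.T b x + d ↔ j < m.T b x)) :
    (m.thinShift n r b d).At n j c := by
  have hval : ∀ x, period n ∣ x - r → m.G x = min (m.T b x) (m.T (!b) x) ∧
      m.F x = max (m.T b x) (m.T (!b) x) := by
    intro x hd
    have e1 := hw x hd
    have e2 := h.min_add_max ((isThin_congr hn hd).2 hr)
    cases b <;> simp only [Bool.not_true, Bool.not_false] <;> omega
  refine ⟨?_, ?_, ?_, fun b' => ?_⟩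
  · have := hc.ge
    by_cases hd : period n ∣ c.row - 1 - r
    · have := hval _ hd
      have := hj _ hd
      rw [(State.thinShift_of_dvd hd).1]
      omega
    · rw [(State.thinShift_of_not_dvd hd).1]; exact this
  · have := hc.lt
    by_cases hd : period n ∣ c.row - r
    · have := hval _ hd
      have := hj _ hd
      rw [(State.thinShift_of_dvd hd).1]
      omega
    · rw [(State.thinShift_of_not_dvd hd).1]; exact this
  · rw [hc.flat]
    by_cases hd : period n ∣ c.row - r
    · have := hval _ hd
      have := hj _ hd
      rw [(State.thinShift_of_dvd hd).2.1]
      omega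
    · rw [(State.thinShift_of_not_dvd hd).2.1]
  · rw [hc.single]
    by_cases hd : period n ∣ c.row - r
    · have h1 := hj _ hd
      have h2 : m.T b c.row + d ≤ j ↔ m.T b c.row ≤ j := by omega
      have := State.thinShift_of_dvd (m := m) (b := b) (d := d) hd
      rcases bool_or b b' with rfl | rfl
      · rw [this.2.2.1, this.2.2.2, h2]
      · rw [Bool.not_not, this.2.2.1, this.2.2.2, h1]
    · rw [(State.thinShift_of_not_dvd hd).2.2, (State.thinShift_of_not_dvd hd).2.2]

theorem single_inj {b b' : Bool} : single b = single b' ↔ b = b' := by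
  cases b <;> cases b' <;> simp [single]

theorem single_ne_flat (b : Bool) : single b ≠ .flat := by cases b <;> simp [single]

/-- After un-splitting, a layer lacks block `b` if it is flat or holds only the other block. The
slots are therefore the full interval `[F (r - 1), T b r)`. -/
theorem thinSlot_cyclic (hn : 4 ≤ n) (h : IsConfig n l m) (hr : IsThin n r)
    (hw : ∀ x, period n ∣ x - r → m.G x = min (m.T true x) (m.T false x)) {D : Layers l}
    (hD : m.Encodes n D) {p : Layer → Prop}
    (hp : ∀ c, p c ↔ period n ∣ c.row - r ∧ (c.top = .flat ∨ c.top = single (!b))) (j : Fin l) :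
    (p (D j) ↔ ∃ k : ℤ, m.F (r - 1) + k * l ≤ j ∧ (j : ℤ) < m.T b r + k * l) ∧
    ∀ k : ℤ, m.F (r - 1) + k * l ≤ j → (j : ℤ) < m.T b r + k * l →
      (D j).row = r + k * period n := by
  have hF := (h.perF.shift (-1)).add_mul r
  simp only [← sub_eq_add_neg] at hF
  have hT := h.T_per_mul hn b hr
  have hat := hD j
  have hrow : ∀ k : ℤ, m.F (r - 1) + k * l ≤ j → (j : ℤ) < m.T b r + k * l →
      (D j).row = r + k * period n := by
    intro k h1 h2
    rw [← hF] at h1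
    rw [← hT] at h2
    exact hat.row_eq_of h.toIsLoose h1 (h2.trans_le (h.T_le_F b _
      ((isThin_congr hn (by simp)).2 hr)))
  refine ⟨?_, hrow⟩
  rw [hp]
  constructor
  · rintro ⟨hd, h1⟩
    obtain ⟨k, hk, -⟩ := h.perG.eq_add hd
    refine ⟨k, ?_, ?_⟩
    · rw [← hF, ← hk]; exact hat.ge
    · rw [← hT, ← hk]
      rcases h1 with h1 | h1
      · exact (hat.flat.1 h1).trans_le (h.G_le_T b _ ((isThin_congr hn hd).2 hr))
      · have := ((hat.single _).1 h1).2.2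
        rwa [Bool.not_not] at this
  · rintro ⟨k, h1, h2⟩
    have hk := hrow k h1 h2
    have hd : period n ∣ (D j).row - r := by rw [hk]; simp
    refine ⟨hd, ?_⟩
    rw [← hT, ← hk] at h2
    rw [hat.flat, hat.single, Bool.not_not, isThin_congr hn hd]
    have := hw _ hd
    cases b <;> simp [hr] <;> omega

/-- A block `b` can be removed if it stands alone in row `r` or if the layer is flat in row `r + 1`;
together these layers form `[T b r, G (r + 1))`. -/
theorem thinBlock_cyclic (hn : 4 ≤ n) (h : IsConfig n l m) (hr : IsThin n r)
    (hw : ∀ x, period n ∣ x - r → m.G x = min (m.T true x) (m.T false x)) {D : Layers l}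
    (hD : m.Encodes n D) {p : Layer → Prop}
    (hp : ∀ c, p c ↔ period n ∣ c.topRow - r ∧ (c.top = .flat ∨ c.top = single b)) (j : Fin l) :
    (p (D j) ↔ ∃ k : ℤ, m.T b r + k * l ≤ j ∧ (j : ℤ) < m.G (r + 1) + k * l) ∧
    ∀ k : ℤ, m.T b r + k * l ≤ j → (j : ℤ) < m.G (r + 1) + k * l →
      (D j).topRow = r + k * period n ∧ (D j = ⟨r + k * period n + 1, .flat⟩ ∨
        D j = ⟨r + k * period n, single b⟩) := by
  have hG : ∀ k : ℤ, m.G (r + k * period n + 1) = m.G (r + 1) + k * l := fun k => by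
    rw [← h.perG.add_mul]; congr 1; ring
  have hT := h.T_per_mul hn b hr
  have hat := hD j
  have hrow : ∀ k : ℤ, m.T b r + k * l ≤ j → (j : ℤ) < m.G (r + 1) + k * l →
      (D j).topRow = r + k * period n ∧ (D j = ⟨r + k * period n + 1, .flat⟩ ∨
        D j = ⟨r + k * period n, single b⟩) := by
    intro k h1 h2
    rw [← hG] at h2
    rw [← hT] at h1
    set x := r + k * period n
    have hd : period n ∣ x - r := by simp [x]
    have hx : IsThin n x := (isThin_congr hn hd).2 hr
    by_cases hj : m.F x ≤ j
    · have hk := hat.row_eq_of h.toIsLoose (r := x + 1) (by rwa [add_sub_cancel_right])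
        (h2.trans_le (h.G_le_F _))
      have ht := hat.flat.2 (by rwa [hk])
      have : D j = ⟨x + 1, .flat⟩ := by rw [← hk, ← ht]
      rw [this]
      exact ⟨by simp [Layer.topRow], .inl rfl⟩
    · have e1 := h.F_le_G x
      have e2 := h.G_le_T b x hx
      have hk := hat.row_eq_of h.toIsLoose (r := x) (by omega) (by omega)
      have e3 := hw x hd
      have e4 := h.min_add_max hx
      have ht := (hat.single b).2 (by
        rw [hk]; exact ⟨hx, h1, by cases b <;> simp at * <;> omega⟩)
      have : D j = ⟨x, single b⟩ := by rw [← hk, ← ht]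
      rw [this]
      refine ⟨?_, .inr rfl⟩
      cases b <;> rfl
  refine ⟨?_, hrow⟩
  rw [hp]
  constructor
  · rintro ⟨hd, h1⟩
    obtain ⟨k, hk, -⟩ := h.perG.eq_add hd
    have hx : IsThin n (D j).topRow := (isThin_congr hn hd).2 hr
    refine ⟨k, ?_, ?_⟩
    · rw [← hT, ← hk]
      rcases h1 with h1 | h1
      · have e1 := hat.ge
        have e2 : (D j).topRow = (D j).row - 1 := by simp [Layer.topRow, h1]
        rw [e2] at hx ⊢
        exact (h.T_le_F b _ hx).trans e1
      · have e2 : (D j).topRow = (D j).row := by cases b <;> simp [Layer.topRow, h1, single]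
        rw [e2]
        exact ((hat.single _).1 h1).2.1
    · rw [← hG, ← hk]
      rcases h1 with h1 | h1
      · have e2 : (D j).topRow = (D j).row - 1 := by simp [Layer.topRow, h1]
        rw [e2, sub_add_cancel]
        exact hat.flat.1 h1
      · have e2 : (D j).topRow = (D j).row := by cases b <;> simp [Layer.topRow, h1, single]
        rw [e2]
        exact hat.lt.trans_le (h.F_succ _)
  · rintro ⟨k, h1, h2⟩
    obtain ⟨h3, h4⟩ := hrow k h1 h2
    refine ⟨by rw [h3]; simp, ?_⟩
    rcases h4 with h4 | h4 <;> simp [h4]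

open Classical in
/-- A single block is put. -/
theorem thin_put (hn : 4 ≤ n) (h : IsConfig n l m) (hr : IsThin n r)
    (hw : ∀ x, period n ∣ x - r → m.G x = min (m.T true x) (m.T false x)) {D : Layers l}
    (hD : m.Encodes n D) {k : ℤ} {a : Fin l} (ha : (a : ℤ) = m.T b r - 1 + k * l)
    (hlt : m.F (r - 1) < m.T b r) {c : Layer}
    (hc : c = if (D a).top = .flat then ⟨(D a).row, single b⟩ else ⟨(D a).row + 1, .flat⟩) :
    (m.thinShift n r b (-1)).Encodes n (Function.update D a c) := by
  refine State.Encodes.update (fun j hj => ?_) ?_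
  · refine (hD j).thinShift hr hn h hw fun x hd => ?_
    obtain ⟨k', hk', -⟩ := h.perG.eq_add hd
    have e := h.T_per_mul hn b hr k'
    rw [← hk'] at e
    have : (j : ℤ) ≠ m.T b r - 1 + k' * l := fun hh => hj (eq_of_fin_congr hh ha).2
    omega
  · have hat := hD a
    set x := r + k * period n with hx_def
    have hd : period n ∣ x - r := by simp [x]
    have hx : IsThin n x := (isThin_congr hn hd).2 hr
    have e1 := h.T_per_mul hn b hr k
    have e2 := (h.perF.shift (-1)).add_mul r k
    simp only [← sub_eq_add_neg] at e2
    rw [← hx_def] at e1 e2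
    have e3 := h.T_le_F b x hx
    have hrow := hat.row_eq_of h.toIsLoose (r := x) (by omega) (by omega)
    have hf := hat.flat
    rw [hrow] at hf hc
    have e4 := hw x hd
    have e5 := h.F_succ x
    have e6 := h.G_le_F (x + 1)
    have e7 := State.thinShift_of_dvd (m := m) (b := b) (d := -1) hd
    have e8 := State.thinShift_of_not_dvd (m := m) (b := b) (d := -1) (not_dvd_pred hn hd)
    have e9 := State.thinShift_of_not_dvd (m := m) (b := b) (d := -1) (not_dvd_succ hn hd)
    have e4' : m.G x = min (m.T b x) (m.T (!b) x) := by
      cases b <;> simp only [Bool.not_true, Bool.not_false] <;> omega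
    by_cases ht : (D a).top = .flat
    · rw [if_pos ht] at hc
      have := hf.1 ht
      subst hc
      refine ⟨?_, ?_, ?_, fun b' => ?_⟩
      · rw [e8.1]; omega
      · rw [e7.1]; omega
      · rw [e7.2.1]; simp [single_ne_flat]; omega
      · simp only [single_inj]
        rcases bool_or b b' with rfl | rfl
        · rw [e7.2.2.1, e7.2.2.2]; simp [hx]; omega
        · rw [Bool.not_not, e7.2.2.1, e7.2.2.2]; simp [hx]; omega
    · rw [if_neg ht] at hc
      have : ¬ (a : ℤ) < m.G x := fun hh => ht (hf.2 hh)
      subst hc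
      refine ⟨?_, ?_, ?_, fun b' => ?_⟩
      · simp only [add_sub_cancel_right]; rw [e7.1]; omega
      · simp only; rw [e9.1]; omega
      · simp only [true_iff]; rw [e9.2.1]; omega
      · simp only [(single_ne_flat b').symm, false_iff]
        rintro ⟨hx1, h1, -⟩
        rw [e9.2.2] at h1
        have := h.G_le_T b' _ hx1
        omega

open Classical in
/-- A single block is taken away. -/
theorem thin_take (hn : 4 ≤ n) (h : IsConfig n l m) (hr : IsThin n r)
    (hw : ∀ x, period n ∣ x - r → m.G x = min (m.T true x) (m.T false x)) {D : Layers l}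
    (hD : m.Encodes n D) {k : ℤ} {a : Fin l} (ha : (a : ℤ) = m.T b r + k * l)
    (hlt : m.T b r < m.G (r + 1)) {c : Layer}
    (hc : c = if (D a).top = .flat then ⟨(D a).row - 1, single (!b)⟩ else ⟨(D a).row, .flat⟩) :
    (m.thinShift n r b 1).Encodes n (Function.update D a c) := by
  refine State.Encodes.update (fun j hj => ?_) ?_
  · refine (hD j).thinShift hr hn h hw fun x hd => ?_
    obtain ⟨k', hk', -⟩ := h.perG.eq_add hd
    have e := h.T_per_mul hn b hr k'
    rw [← hk'] at e
    have : (j : ℤ) ≠ m.T b r + k' * l := fun hh => hj (eq_of_fin_congr hh ha).2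
    omega
  · have hcyc := ((thinBlock_cyclic hn h hr hw hD (b := b) (p := fun c => _)
      (fun c => Iff.rfl) a).2 k (by omega) (by omega)).2
    set x := r + k * period n with hx_def
    have hd : period n ∣ x - r := by simp [x]
    have hx : IsThin n x := (isThin_congr hn hd).2 hr
    have e1 := h.T_per_mul hn b hr k
    rw [← hx_def] at e1
    have e3 := h.T_le_F b x hx
    have e4 := hw x hd
    have e5 := h.F_succ x
    have e6 := h.F_le_G x
    have e10 := h.G_le_T b x hx
    have e11 := h.T_le_F (!b) x hx
    have e7 := State.thinShift_of_dvd (m := m) (b := b) (d := 1) hd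
    have e8 := State.thinShift_of_not_dvd (m := m) (b := b) (d := 1) (not_dvd_pred hn hd)
    have e9 := State.thinShift_of_not_dvd (m := m) (b := b) (d := 1) (not_dvd_succ hn hd)
    have e4' : m.G x = min (m.T b x) (m.T (!b) x) := by
      cases b <;> simp only [Bool.not_true, Bool.not_false] <;> omega
    have hat := hD a
    rcases hcyc with hDa | hDa
    · rw [hDa] at hc hat
      have hge := hat.ge
      simp only [add_sub_cancel_right, if_true] at hc hge
      subst hc
      refine ⟨?_, ?_, ?_, fun b' => ?_⟩
      · rw [e8.1]; omega
      · rw [e7.1]; omega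
      · rw [e7.2.1]; simp [single_ne_flat]; omega
      · simp only [single_inj]
        rcases bool_or b b' with rfl | rfl
        · rw [e7.2.2.1, e7.2.2.2]; simp [hx]; omega
        · rw [Bool.not_not, e7.2.2.1, e7.2.2.2]; simp [hx]; omega
    · rw [hDa] at hc hat
      have hs := (hat.single b).1 rfl
      simp only [single_ne_flat, if_false] at hc hs
      subst hc
      refine ⟨?_, ?_, ?_, fun b' => ?_⟩
      · rw [e8.1]; omega
      · rw [e7.1]; omega
      · rw [e7.2.1]; simp; omega
      · simp only [(single_ne_flat b').symm, false_iff]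
        rcases bool_or b b' with rfl | rfl
        · rw [e7.2.2.1]; omega
        · rw [e7.2.2.2]; omega

end Thin


/-! ### The operators for the colours `0, 1, n - 1, n` -/

/-- In column `k`, the blocks of colour `i` are in the rear. -/
def rearBit (n k i : ℕ) : Bool := decide ((i = 0 ∨ i = n - 1) ↔ Even k)

/-- A thin row with blocks of colour `i`. -/
def thinRow (n i : ℕ) : ℤ := rowOf .covering (thinKind n i)

theorem thinKind_cases {n : ℕ} (i : ℕ) : thinKind n i = 1 ∨ thinKind n i = n - 1 := by
  unfold thinKind; split_ifs <;> simp

theorem isThin_thinRow {n : ℕ} (hn : 4 ≤ n) (i : ℕ) : IsThin n (thinRow n i) :=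
  thin_rowOf hn (thinKind_cases i)

theorem color_iff {n : ℕ} (hn : 4 ≤ n) {k i : ℕ} (hi : i ≤ 1 ∨ (n - 1 ≤ i ∧ i ≤ n)) {x : ℤ}
    (hx : IsThin n x) :
    (i = rearColor n k x ↔ period n ∣ x - thinRow n i ∧ rearBit n k i = true) ∧
    (i = frontColor n k x ↔ period n ∣ x - thinRow n i ∧ rearBit n k i = false) := by
  have hs : OnSide n .covering x := by
    rcases hx with hx | hx
    · exact .inl hx
    · exact .inr hx.ge
  have hk := kind_side_iff hn .covering (thinKind n i) x
  have ht := thinKind_cases (n := n) i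
  have hdvd : period n ∣ x - thinRow n i ↔ kind n x = thinKind n i := by
    unfold thinRow
    have : 1 ≤ thinKind n i ∧ thinKind n i ≤ n - 1 := by omega
    tauto
  rw [hdvd]
  simp only [rearColor, frontColor, rearBit, kind, thinKind, decide_eq_true_eq,
    decide_eq_false_iff_not]
  rcases hx with hx | hx <;> rw [hx] <;> by_cases hev : Even k <;>
    simp only [hev, if_true, if_false, iff_true, iff_false] <;> split_ifs <;> omega

section ThinOps

variable {n l k i : ℕ} {m : State}

theorem thinSlot_iff (hn : 4 ≤ n) (hi : i ≤ 1 ∨ (n - 1 ≤ i ∧ i ≤ n)) (c : Layer) :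
    ThinSlot n k i c ↔ period n ∣ c.row - thinRow n i ∧
      (c.top = .flat ∨ c.top = single (!rearBit n k i)) := by
  by_cases hx : IsThin n c.row
  · obtain ⟨h1, h2⟩ := color_iff hn (k := k) hi hx
    unfold ThinSlot
    cases ht : c.top <;> cases hb : rearBit n k i <;> simp_all [single]
  · have : ¬ period n ∣ c.row - thinRow n i := fun hd =>
      hx ((isThin_congr hn hd).2 (isThin_thinRow hn i))
    simp [ThinSlot, hx, this]

theorem thinBlock_iff (hn : 4 ≤ n) (hi : i ≤ 1 ∨ (n - 1 ≤ i ∧ i ≤ n)) (c : Layer) :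
    ThinBlock n k i c ↔ period n ∣ c.topRow - thinRow n i ∧
      (c.top = .flat ∨ c.top = single (rearBit n k i)) := by
  by_cases hx : IsThin n c.topRow
  · obtain ⟨h1, h2⟩ := color_iff hn (k := k) hi hx
    unfold ThinBlock
    cases ht : c.top <;> cases hb : rearBit n k i <;> simp_all [single]
  · have : ¬ period n ∣ c.topRow - thinRow n i := fun hd =>
      hx ((isThin_congr hn hd).2 (isThin_thinRow hn i))
    simp [ThinBlock, hx, this]

theorem glue_whole (hn : 4 ≤ n) (h : IsConfig n l m) {r : ℤ} (hr : IsThin n r) (x : ℤ)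
    (hd : period n ∣ x - r) :
    (m.glue n r).G x = min ((m.glue n r).T true x) ((m.glue n r).T false x) :=
  (h.glue_at hn hr hd).2

theorem splitAll_thinShift (hn : 4 ≤ n) (h : IsConfig n l m) {b : Bool} {d : ℤ}
    (h1 : m.F (thinRow n i - 1) ≤ m.T b (thinRow n i) + d)
    (h2 : m.T b (thinRow n i) + d ≤ m.G (thinRow n i + 1)) {D : Layers l}
    (hD : ((m.glue n (thinRow n i)).thinShift n (thinRow n i) b d).Encodes n D) :
    (m.thinMove n (thinRow n i) b d).Encodes n (splitAll n (thinKind n i) D) := by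
  have hr := isThin_thinRow hn i
  have hd0 : period n ∣ thinRow n i - thinRow n i := by simp
  obtain ⟨e1, e2, e3, -, -⟩ := thinShift_glue_split hn h hr h1 h2
  rw [← e1]
  have ht := thinKind_cases (n := n) i
  refine iterate_splitOnce hn (by omega) l ((h.glue hn hr).thinShift hn hr ?_ ?_) hD rfl e3
  · rw [State.glue_F_of_not_dvd (not_dvd_pred hn hd0)]; exact h1
  · rw [State.glue_G_of_not_dvd hn hr (not_dvd_succ hn hd0)]; exact h2

/-- Filling the last slot of `[F (r - 1), T b r)` lowers the threshold by one, and
`splitAll_thinShift` accounts for the splitting that follows. -/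
theorem fThin_spec (hn : 4 ≤ n) (hi : i ≤ 1 ∨ (n - 1 ≤ i ∧ i ≤ n)) (h : IsSliceState n l m)
    {C : Layers l} (hC : m.Encodes n C) :
    (m.F (thinRow n i - 1) < m.T (rearBit n k i) (thinRow n i) → ∃ C', fThin n k i C = some C' ∧
      (m.thinMove n (thinRow n i) (rearBit n k i) (-1)).Encodes n C') ∧
    (¬ m.F (thinRow n i - 1) < m.T (rearBit n k i) (thinRow n i) → fThin n k i C = none) := by
  have hr := isThin_thinRow hn i
  obtain ⟨D, hu, hD⟩ := unsplit_spec hn h hC (thinKind_cases (n := n) i)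
  change (m.glue n (thinRow n i)).Encodes n D at hD
  have h₀ := h.toIsConfig.glue hn hr
  have hd0 : period n ∣ thinRow n i - thinRow n i := by simp
  have hcyc := thinSlot_cyclic hn h₀ hr (glue_whole hn h.toIsConfig hr) hD (thinSlot_iff hn hi (k := k))
  have eF : (m.glue n (thinRow n i)).F (thinRow n i - 1) = m.F (thinRow n i - 1) :=
    State.glue_F_of_not_dvd (not_dvd_pred hn hd0)
  rw [eF] at hcyc
  have eT : (m.glue n (thinRow n i)).T = m.T := rfl
  rw [eT] at hcyc
  generalize hb : rearBit n k i = b at *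
  have hbound : m.T b (thinRow n i) ≤ m.F (thinRow n i - 1) + l :=
    (h.T_le_F b _ hr).trans (h.F_le_F_sub hn _)
  have hG := (h.T_le_F b _ hr).trans (h.F_succ _)
  constructor
  · intro hlt
    obtain ⟨a, k', ha, hsel⟩ := rearLow_cyclic hn hlt hbound (fun j => (hcyc j).1)
      (fun j => (hcyc j).2)
    refine ⟨_, by rw [fThin, hu, Option.bind_some, hsel, Option.map_some], ?_⟩
    apply splitAll_thinShift hn h.toIsConfig (by omega) (by omega)
    refine thin_put hn h₀ hr (glue_whole hn h.toIsConfig hr) hD ha (by rw [eF, eT]; exact hlt) ?_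
    have hp := (thinSlot_iff hn hi (k := k) _).1 (((hcyc a).1).2 ⟨k', by omega, by omega⟩)
    obtain ⟨c1, c2⟩ := color_iff hn (k := k) hi ((isThin_congr hn hp.1).2 hr)
    rw [hb] at c1 hp
    cases ht : (D a).top <;> cases b <;> simp_all [Layer.putThin, single]
  · intro hlt
    rw [fThin, hu, Option.bind_some, rearLow_eq_none, Option.map_none]
    intro j hj
    obtain ⟨k', h1, h2⟩ := (hcyc j).1.1 hj
    omega

theorem eThin_spec (hn : 4 ≤ n) (hi : i ≤ 1 ∨ (n - 1 ≤ i ∧ i ≤ n)) (h : IsSliceState n l m)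
    {C : Layers l} (hC : m.Encodes n C) :
    (m.T (rearBit n k i) (thinRow n i) < m.G (thinRow n i + 1) → ∃ C', eThin n k i C = some C' ∧
      (m.thinMove n (thinRow n i) (rearBit n k i) 1).Encodes n C') ∧
    (¬ m.T (rearBit n k i) (thinRow n i) < m.G (thinRow n i + 1) → eThin n k i C = none) := by
  have hr := isThin_thinRow hn i
  obtain ⟨D, hu, hD⟩ := unsplit_spec hn h hC (thinKind_cases (n := n) i)
  change (m.glue n (thinRow n i)).Encodes n D at hD
  have h₀ := h.toIsConfig.glue hn hr
  have hd0 : period n ∣ thinRow n i - thinRow n i := by simp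
  have hcyc := thinBlock_cyclic hn h₀ hr (glue_whole hn h.toIsConfig hr) hD
    (thinBlock_iff hn hi (k := k))
  have eG : (m.glue n (thinRow n i)).G (thinRow n i + 1) = m.G (thinRow n i + 1) :=
    State.glue_G_of_not_dvd hn hr (not_dvd_succ hn hd0)
  rw [eG] at hcyc
  have eT : (m.glue n (thinRow n i)).T = m.T := rfl
  rw [eT] at hcyc
  generalize hb : rearBit n k i = b at *
  have hbound : m.G (thinRow n i + 1) ≤ m.T b (thinRow n i) + l := by
    have e1 := h.perG (thinRow n i)
    have e2 := h.G_le_T b _ hr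
    -- The row `r + 1` is still at least one row below the next row congruent to `r`; so the
    -- interval of removable blocks has length at most `l`.
    have e3 := h.F_mono (show thinRow n i + 1 ≤ thinRow n i + period n - 1 by
      have := period_pos hn; omega)
    have e4 := h.F_le_G (thinRow n i + period n)
    have e5 := h.G_le_F (thinRow n i + 1)
    omega
  have hG := (h.F_le_G _).trans (h.G_le_T b _ hr)
  constructor
  · intro hlt
    obtain ⟨a, k', ha, hsel⟩ := foreHigh_cyclic hn hlt hbound (fun j => (hcyc j).1)
      (fun j k' h1 h2 => ((hcyc j).2 k' h1 h2).1)
    refine ⟨_, by rw [eThin, hu, Option.bind_some, hsel, Option.map_some], ?_⟩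
    apply splitAll_thinShift hn h.toIsConfig (by omega) (by omega)
    refine thin_take hn h₀ hr (glue_whole hn h.toIsConfig hr) hD ha (by rw [eG, eT]; exact hlt) ?_
    have hp := (thinBlock_iff hn hi (k := k) _).1 (((hcyc a).1).2 ⟨k', by omega, by omega⟩)
    obtain ⟨c1, c2⟩ := color_iff hn (k := k) hi ((isThin_congr hn hp.1).2 hr)
    rw [hb] at c1 hp
    cases ht : (D a).top <;> cases b <;> simp_all [Layer.takeThin, single, Layer.topRow]
  · intro hlt
    rw [eThin, hu, Option.bind_some, foreHigh_eq_none, Option.map_none]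
    intro j hj
    obtain ⟨k', h1, h2⟩ := (hcyc j).1.1 hj
    omega

end ThinOps

/-! ### The operators for the colours `2, ..., n - 2` -/

/-- The boundaries in the mirror rows `r` and `-r` move. -/
noncomputable def State.move (n : ℕ) (m : State) (r α β γ δ : ℤ) : State where
  F x := m.F x + α * ind n r x + β * ind n (-r) x
  G x := m.G x + γ * ind n r x + δ * ind n (-r) x
  T := m.T

section Unit

variable {n l : ℕ} {m : State} {r α β γ δ : ℤ}

theorem ind_mirror (hn : 4 ≤ n) (hr : ¬ IsThin n r) :
    ind n r r = 1 ∧ ind n (-r) (-r) = 1 ∧ ind n r (-r) = 0 ∧ ind n (-r) r = 0 ∧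
    ind n r (r + 1) = 0 ∧ ind n (-r) (r + 1) = 0 ∧ ind n r (r - 1) = 0 ∧
    ind n (-r) (r - 1) = 0 ∧ ind n r (-r + 1) = 0 ∧ ind n (-r) (-r + 1) = 0 ∧
    ind n r (-r - 1) = 0 ∧ ind n (-r) (-r - 1) = 0 := by
  have h1 : ¬ period n ∣ -r - r := fun h => hr (isThin_of_dvd_neg hn h)
  have h2 : ¬ period n ∣ r - -r := fun h => h1 (by
    have := dvd_neg.2 h
    rwa [neg_sub] at this)
  have h3 := not_dvd_one hn
  have h3' : ¬ period n ∣ -1 := by rwa [dvd_neg]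
  refine ⟨ind_self _, ind_self _, ind_of_not_dvd h1, ind_of_not_dvd h2, ind_of_not_dvd ?_,
    ind_of_not_dvd ?_, ind_of_not_dvd ?_, ind_of_not_dvd ?_, ind_of_not_dvd ?_,
    ind_of_not_dvd ?_, ind_of_not_dvd ?_, ind_of_not_dvd ?_⟩
  · rwa [add_sub_cancel_left]
  · have := not_dvd_odd hn r
    rwa [show r + 1 - -r = 2 * r + 1 by ring]
  · rwa [show r - 1 - r = -1 by ring]
  · have := not_dvd_odd hn (r - 1)
    rwa [show r - 1 - -r = 2 * (r - 1) + 1 by ring]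
  · have := not_dvd_odd hn (-r)
    rwa [show -r + 1 - r = 2 * (-r) + 1 by ring]
  · rwa [show -r + 1 - -r = 1 by ring]
  · have := not_dvd_odd hn (-r - 1)
    rwa [show -r - 1 - r = 2 * (-r - 1) + 1 by ring]
  · rwa [show -r - 1 - -r = -1 by ring]

theorem State.move_apply (hn : 4 ≤ n) (hr : ¬ IsThin n r) :
    (m.move n r α β γ δ).F r = m.F r + α ∧ (m.move n r α β γ δ).F (-r) = m.F (-r) + β ∧
    (m.move n r α β γ δ).G r = m.G r + γ ∧ (m.move n r α β γ δ).G (-r) = m.G (-r) + δ ∧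
    (m.move n r α β γ δ).F (r - 1) = m.F (r - 1) ∧
    (m.move n r α β γ δ).F (-r - 1) = m.F (-r - 1) ∧
    (m.move n r α β γ δ).G (r + 1) = m.G (r + 1) ∧
    (m.move n r α β γ δ).G (-r + 1) = m.G (-r + 1) := by
  obtain ⟨h1, h2, h3, h4, h5, h6, h7, h8, h9, h10, h11, h12⟩ := ind_mirror hn hr
  simp [State.move, *]

theorem State.move_of_not_dvd {x : ℤ} (h1 : ¬ period n ∣ x - r) (h2 : ¬ period n ∣ x - -r) :
    (m.move n r α β γ δ).F x = m.F x ∧ (m.move n r α β γ δ).G x = m.G x := by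
  simp only [State.move, ind_of_not_dvd h1, ind_of_not_dvd h2]
  constructor <;> ring

theorem State.move_of_dvd (hn : 4 ≤ n) (hr : ¬ IsThin n r) {x : ℤ} (h1 : period n ∣ x - r) :
    (m.move n r α β γ δ).F x = m.F x + α ∧ (m.move n r α β γ δ).G x = m.G x + γ := by
  have h2 : ¬ period n ∣ x - -r := fun h2 => hr (isThin_of_dvd_neg hn (by
    have := dvd_sub h1 h2
    rwa [show x - r - (x - -r) = -r - r by ring] at this))
  simp only [State.move, ind_of_dvd h1, ind_of_not_dvd h2]
  constructor <;> ring

theorem State.move_of_dvd_neg (hn : 4 ≤ n) (hr : ¬ IsThin n r) {x : ℤ}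
    (h1 : period n ∣ x - -r) :
    (m.move n r α β γ δ).F x = m.F x + β ∧ (m.move n r α β γ δ).G x = m.G x + δ := by
  have h2 : ¬ period n ∣ x - r := fun h2 => hr (isThin_of_dvd_neg hn (by
    have := dvd_sub h2 h1
    rwa [show x - r - (x - -r) = -r - r by ring] at this))
  simp only [State.move, ind_of_dvd h1, ind_of_not_dvd h2]
  constructor <;> ring

theorem IsConfig.move (hn : 4 ≤ n) (h : IsConfig n l m) (hr : ¬ IsThin n r) (hl : 0 < l)
    (h1 : α - γ = β - δ) (h2 : 0 ≤ m.F r - m.G r + α - γ) (h3 : 0 ≤ m.G r - m.F (r - 1) + γ)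
    (h4 : 0 ≤ m.G (-r) - m.F (-r - 1) + δ) (h5 : 0 ≤ m.G (r + 1) - m.F r - α)
    (h6 : 0 ≤ m.G (-r + 1) - m.F (-r) - β) : IsConfig n l (m.move n r α β γ δ) where
  perF := (h.perF.add_ind r α).add_ind (-r) β
  perG := (h.perG.add_ind r γ).add_ind (-r) δ
  perT := h.perT
  F_le_G x := by
    have e := h.F_le_G x
    by_cases d1 : period n ∣ x - r
    · have d2 := not_dvd_pred hn d1
      have d3 : ¬ period n ∣ x - 1 - -r := fun hh => not_dvd_odd hn (-r) (by
        have := dvd_sub d1 hh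
        rwa [show x - r - (x - 1 - -r) = 2 * -r + 1 by ring] at this)
      rw [(State.move_of_not_dvd d2 d3).1, (State.move_of_dvd hn hr d1).2]
      have := h.lt_G_of_dvd d1
      omega
    by_cases d1' : period n ∣ x - -r
    · have d2 := not_dvd_pred hn d1'
      have d3 : ¬ period n ∣ x - 1 - r := fun hh => not_dvd_odd hn r (by
        have := dvd_sub d1' hh
        rwa [show x - -r - (x - 1 - r) = 2 * r + 1 by ring] at this)
      rw [(State.move_of_not_dvd d3 d2).1, (State.move_of_dvd_neg hn hr d1').2]
      have := h.lt_G_of_dvd d1'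
      omega
    rw [(State.move_of_not_dvd d1 d1').2]
    by_cases d2 : period n ∣ x - 1 - r
    · rw [(State.move_of_dvd hn hr d2).1]
      have := h.lt_G_of_dvd (r := r + 1) (x := x) (by
        rwa [show x - (r + 1) = x - 1 - r by ring])
      rw [add_sub_cancel_right] at this
      omega
    by_cases d2' : period n ∣ x - 1 - -r
    · rw [(State.move_of_dvd_neg hn hr d2').1]
      have := h.lt_G_of_dvd (r := -r + 1) (x := x) (by
        rwa [show x - (-r + 1) = x - 1 - -r by ring])
      rw [add_sub_cancel_right] at this
      omega
    rw [(State.move_of_not_dvd d2 d2').1]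
    exact e
  G_le_F x := by
    have e := h.G_le_F x
    by_cases d1 : period n ∣ x - r
    · have := State.move_of_dvd (m := m) (α := α) (β := β) (γ := γ) (δ := δ) hn hr d1
      have := h.lt_F_of_dvd d1
      omega
    by_cases d1' : period n ∣ x - -r
    · have := State.move_of_dvd_neg (m := m) (α := α) (β := β) (γ := γ) (δ := δ) hn hr d1'
      have := h.lt_F_of_dvd d1'
      have := h.mirror r
      omega
    have := State.move_of_not_dvd (m := m) (α := α) (β := β) (γ := γ) (δ := δ) d1 d1'
    omega
  G_le_T b x hx := by
    have d1 : ¬ period n ∣ x - r := fun hd => hr ((isThin_congr hn hd).1 hx)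
    have d2 : ¬ period n ∣ x - -r := fun hd =>
      hr ((isThin_neg hn).1 ((isThin_congr hn hd).1 hx))
    rw [(State.move_of_not_dvd d1 d2).2]
    exact h.G_le_T b x hx
  T_le_F b x hx := by
    have d1 : ¬ period n ∣ x - r := fun hd => hr ((isThin_congr hn hd).1 hx)
    have d2 : ¬ period n ∣ x - -r := fun hd =>
      hr ((isThin_neg hn).1 ((isThin_congr hn hd).1 hx))
    rw [(State.move_of_not_dvd d1 d2).1]
    exact h.T_le_F b x hx
  mirror x := by
    have e := h.mirror x
    simp only [State.move, ind_neg_right, neg_neg]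
    rw [show m.F (-x) + α * ind n (-r) x + β * ind n r x -
      (m.G (-x) + γ * ind n (-r) x + δ * ind n r x) =
      m.F (-x) - m.G (-x) + (α - γ) * ind n (-r) x + (β - δ) * ind n r x by ring, e, h1]
    linear_combination (-h1) * ind n r x
  T_add x hx := by
    have d1 : ¬ period n ∣ x - r := fun hd => hr ((isThin_congr hn hd).1 hx)
    have d2 : ¬ period n ∣ x - -r := fun hd =>
      hr ((isThin_neg hn).1 ((isThin_congr hn hd).1 hx))
    rw [(State.move_of_not_dvd d1 d2).1, (State.move_of_not_dvd d1 d2).2]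
    exact h.T_add x hx
  T_eq_zero := h.T_eq_zero
  F_eq_zero hl' := by omega

/-- There are whole slots in the row `x`. -/
noncomputable def State.hasSlot (m : State) (x : ℤ) : ℤ := by
  classical exact if m.F (x - 1) < m.G x then 1 else 0

theorem State.hasSlot_cases (m : State) (x : ℤ) :
    (m.F (x - 1) < m.G x ∧ m.hasSlot x = 1) ∨ (¬ m.F (x - 1) < m.G x ∧ m.hasSlot x = 0) := by
  unfold State.hasSlot; split_ifs <;> tauto

/-- The boundaries after adding two half blocks in the rows `r` and `-r`. -/
noncomputable def State.unitF (n : ℕ) (m : State) (r : ℤ) : State :=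
  m.move n r (m.hasSlot (-r) - 1) (m.hasSlot r - 1) (-m.hasSlot r) (-m.hasSlot (-r))

/-- The boundaries after removing two half blocks in the rows `r` and `-r`. -/
noncomputable def State.unitE (n : ℕ) (m : State) (r : ℤ) : State :=
  m.move n r (m.hasSlot (r + 1)) (m.hasSlot (-r + 1)) (1 - m.hasSlot (-r + 1))
    (1 - m.hasSlot (r + 1))

/-- The number of ways to add two half blocks. -/
def State.unitPhi (m : State) (r : ℤ) : ℤ :=
  (m.G r - m.F (r - 1)) + (m.G (-r) - m.F (-r - 1)) + (m.F r - m.G r)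

/-- The number of ways to remove two half blocks. -/
def State.unitEps (m : State) (r : ℤ) : ℤ :=
  (m.G (r + 1) - m.F r) + (m.G (-r + 1) - m.F (-r)) + (m.F r - m.G r)

end Unit

section UnitOps

variable {n l i : ℕ} {m : State} {C : Layers l}

theorem addG_addG (m : State) (r a b : ℤ) :
    (m.addG n (-r) a).addG n r b = m.move n r 0 0 b a := by
  ext x <;> simp only [State.addG, State.move] <;> ring

theorem addG_addF_neg (m : State) (r a b : ℤ) :
    (m.addG n (-r) a).addF n (-r) b = m.move n r 0 b 0 a := by
  ext x <;> simp only [State.addG, State.addF, State.move] <;> ring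

theorem addG_addF (m : State) (r a b : ℤ) :
    (m.addG n r a).addF n r b = m.move n r b 0 a 0 := by
  ext x <;> simp only [State.addG, State.addF, State.move] <;> ring

theorem addF_addF (m : State) (r a b : ℤ) :
    (m.addF n (-r) a).addF n r b = m.move n r b a 0 0 := by
  ext x <;> simp only [State.addF, State.move] <;> ring

theorem addF_addG_neg (m : State) (r a b : ℤ) :
    (m.addF n (-r) a).addG n (-r) b = m.move n r 0 a 0 b := by
  ext x <;> simp only [State.addG, State.addF, State.move] <;> ring

theorem addF_addG (m : State) (r a b : ℤ) :
    (m.addF n r a).addG n r b = m.move n r a 0 b 0 := by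
  ext x <;> simp only [State.addG, State.addF, State.move] <;> ring

theorem unit_not_thin (hn : 4 ≤ n) (hi : 2 ≤ i ∧ i ≤ n - 2) : ¬ IsThin n ((i : ℤ) - 1) := by
  rw [isThin_iff hn]
  rintro ⟨c, hc⟩
  have hq : 0 < ((n - 2 : ℕ) : ℤ) := by omega
  have h1 : 0 < c := by by_contra hh; push Not at hh; nlinarith
  have h2 : c < 1 := by by_contra hh; push Not at hh; nlinarith
  omega

/-- All cases of `fUnit` are covered by `unitF`: `G` falls on a side that has full slots, and `F`
falls on a side whose mirror side has none. The number `unitPhi` (full slots on both sides plus half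
slots of one side) is positive exactly if some case applies. -/
theorem fUnit_spec (hn : 4 ≤ n) (hi : 2 ≤ i ∧ i ≤ n - 2) (h : IsSliceState n l m)
    (hC : m.Encodes n C) :
    (0 < m.unitPhi ((i : ℤ) - 1) → ∃ C', fUnit n i C = some C' ∧
      (m.unitF n ((i : ℤ) - 1)).Encodes n C') ∧
    (¬ 0 < m.unitPhi ((i : ℤ) - 1) → fUnit n i C = none) := by
  have ht : 1 ≤ i ∧ i ≤ n - 1 := by omega
  have hrt := unit_not_thin hn hi
  have hrt' : ¬ IsThin n (-((i : ℤ) - 1)) := by rwa [isThin_neg hn]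
  have hrc : rowOf .covering i = -((i : ℤ) - 1) := by simp [rowOf]
  have hrs : rowOf .supporting i = (i : ℤ) - 1 := rfl
  have wc := rearLow_whole hn h.toIsLoose hC (wholeSlot_iff hn ht .covering)
  have ws := rearLow_whole hn h.toIsLoose hC (wholeSlot_iff hn ht .supporting)
  have hc := rearLow_half hn h.toIsLoose hC (hrc ▸ hrt') (halfPiece_iff hn ht .covering)
  have hs := rearLow_half hn h.toIsLoose hC (hrs ▸ hrt) (halfPiece_iff hn ht .supporting)
  rw [hrc] at wc hc
  rw [hrs] at ws hs
  generalize (i : ℤ) - 1 = r at *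
  have e1 := h.F_le_G r
  have e2 := h.F_le_G (-r)
  have e3 := h.G_le_F r
  have e4 := h.G_le_F (-r)
  have e5 := h.mirror r
  obtain ⟨i1, i2, i3, i4, i5, i6, i7, i8, i9, i10, i11, i12⟩ := ind_mirror hn hrt
  have ne_rows : ∀ (a b : Fin l) (k k' : ℤ) (t t' : Top), C a = ⟨-r + k * period n, t⟩ →
      C b = ⟨r + k' * period n, t'⟩ → b ≠ a := by
    rintro a b k k' t t' ha hb rfl
    rw [ha, Layer.mk.injEq] at hb
    exact hrt (isThin_of_dvd_neg hn ⟨k' - k, by linarith⟩)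
  rcases m.hasSlot_cases (-r) with ⟨p1, q1⟩ | ⟨p1, q1⟩ <;>
    rcases m.hasSlot_cases r with ⟨p2, q2⟩ | ⟨p2, q2⟩
  · obtain ⟨a, k, ha, sa⟩ := wc.1 p1
    obtain ⟨b, k', hb, sb⟩ := ws.1 p2
    refine ⟨fun _ => ⟨_, by rw [fUnit]; simp only [sa, sb]; rfl, ?_⟩, fun hh => ?_⟩
    · obtain ⟨ca, ea⟩ := hC.put_whole h.toIsLoose p1 ha
      obtain ⟨cb, -⟩ := hC.put_whole h.toIsLoose p2 hb
      have hne := ne_rows _ _ _ _ _ _ ca cb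
      obtain ⟨-, eb⟩ := ea.put_whole (h.addG_neg p1) (r := r) (k := k') (b := b)
        (by simp only [State.addG, i4]; omega) (by simp only [State.addG, i4]; omega)
      rw [Function.update_of_ne hne, addG_addG] at eb
      rw [State.unitF, q1, q2]
      exact eb
    · unfold State.unitPhi at hh; omega
  · obtain ⟨a, k, ha, sa⟩ := wc.1 p1
    obtain ⟨ca, ea⟩ := hC.put_whole h.toIsLoose p1 ha
    have hL := h.addG_neg p1
    -- The half just placed leaves a half slot in this row, so the second choice cannot fail.
    obtain ⟨b, k', hb, sb⟩ := (rearLow_half hn hL ea hrt' (hrc ▸ halfPiece_iff hn ht .covering)).1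
      (by simp only [State.addG, i2]; omega)
    refine ⟨fun _ => ⟨_, by
      rw [fUnit]; simp only [sa, ws.2 p2, sb, Option.map_some]; rfl, ?_⟩, fun hh => ?_⟩
    · obtain ⟨-, eb⟩ := ea.put_half hn hL hrt' (by simp only [State.addG, i2]; omega) hb
      rw [addG_addF_neg] at eb
      rw [State.unitF, q1, q2]
      exact eb
    · unfold State.unitPhi at hh; omega
  · obtain ⟨a, k, ha, sa⟩ := ws.1 p2
    obtain ⟨ca, ea⟩ := hC.put_whole h.toIsLoose p2 ha
    have hL := h.addG_neg p2
    obtain ⟨b, k', hb, sb⟩ := (rearLow_half hn hL ea hrt (hrs ▸ halfPiece_iff hn ht .supporting)).1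
      (by simp only [State.addG, i1]; omega)
    refine ⟨fun _ => ⟨_, by
      rw [fUnit]; simp only [sa, wc.2 p1, sb, Option.map_some]; rfl, ?_⟩, fun hh => ?_⟩
    · obtain ⟨-, eb⟩ := ea.put_half hn hL hrt (by simp only [State.addG, i1]; omega) hb
      rw [addG_addF] at eb
      rw [State.unitF, q1, q2]
      exact eb
    · unfold State.unitPhi at hh; omega
  · by_cases hh : m.G r < m.F r
    · obtain ⟨a, k, ha, sa⟩ := hc.1 (by omega)
      obtain ⟨b, k', hb, sb⟩ := hs.1 hh
      refine ⟨fun _ => ⟨_, by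
        rw [fUnit]; simp only [wc.2 p1, ws.2 p2, sa, sb]; rfl, ?_⟩, fun hh => ?_⟩
      · obtain ⟨ca, ea⟩ := hC.put_half hn h.toIsLoose hrt' (by omega) ha
        obtain ⟨cb, -⟩ := hC.put_half hn h.toIsLoose hrt hh hb
        have hne := ne_rows _ _ _ _ _ _ ca cb
        obtain ⟨-, eb⟩ := ea.put_half hn (h.addF_neg hn hrt' (by omega)) hrt (k := k') (b := b)
          (by simp only [State.addF, i4]; omega) (by simp only [State.addF, i4]; omega)
        rw [Function.update_of_ne hne, addF_addF] at eb
        rw [State.unitF, q1, q2]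
        exact eb
      · unfold State.unitPhi at hh; omega
    · refine ⟨fun h0 => ?_, fun _ => ?_⟩
      · unfold State.unitPhi at h0; omega
      · rw [fUnit]; simp only [wc.2 p1, ws.2 p2, hs.2 hh]
        cases rearLow (HalfPiece n .covering i) C <;> rfl

theorem eUnit_spec (hn : 4 ≤ n) (hi : 2 ≤ i ∧ i ≤ n - 2) (h : IsSliceState n l m)
    (hC : m.Encodes n C) :
    (0 < m.unitEps ((i : ℤ) - 1) → ∃ C', eUnit n i C = some C' ∧
      (m.unitE n ((i : ℤ) - 1)).Encodes n C') ∧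
    (¬ 0 < m.unitEps ((i : ℤ) - 1) → eUnit n i C = none) := by
  have ht : 1 ≤ i ∧ i ≤ n - 1 := by omega
  have hrt := unit_not_thin hn hi
  have hrt' : ¬ IsThin n (-((i : ℤ) - 1)) := by rwa [isThin_neg hn]
  have hrc : rowOf .covering i = -((i : ℤ) - 1) := by simp [rowOf]
  have hrs : rowOf .supporting i = (i : ℤ) - 1 := rfl
  have wc := foreHigh_whole hn h.toIsLoose hC (wholeBlock_iff hn ht .covering)
  have ws := foreHigh_whole hn h.toIsLoose hC (wholeBlock_iff hn ht .supporting)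
  have hc := foreHigh_half hn h.toIsLoose hC (hrc ▸ hrt') (halfPiece_iff hn ht .covering)
  have hs := foreHigh_half hn h.toIsLoose hC (hrs ▸ hrt) (halfPiece_iff hn ht .supporting)
  rw [hrc] at wc hc
  rw [hrs] at ws hs
  generalize (i : ℤ) - 1 = r at *
  have e1 := h.F_succ r
  have e2 := h.F_succ (-r)
  have e3 := h.G_le_F r
  have e4 := h.G_le_F (-r)
  have e5 := h.mirror r
  obtain ⟨i1, i2, i3, i4, i5, i6, i7, i8, i9, i10, i11, i12⟩ := ind_mirror hn hrt
  have ne_rows : ∀ (a b : Fin l) (k k' : ℤ) (t t' : Top) (d : ℤ),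
      C a = ⟨-r + k * period n + d, t⟩ → C b = ⟨r + k' * period n + d, t'⟩ → b ≠ a := by
    rintro a b k k' t t' d ha hb rfl
    rw [ha, Layer.mk.injEq] at hb
    exact hrt (isThin_of_dvd_neg hn ⟨k' - k, by linarith⟩)
  have c1 := m.hasSlot_cases (-r + 1)
  have c2 := m.hasSlot_cases (r + 1)
  rw [add_sub_cancel_right] at c1 c2
  rcases c1 with ⟨p1, q1⟩ | ⟨p1, q1⟩ <;> rcases c2 with ⟨p2, q2⟩ | ⟨p2, q2⟩
  · obtain ⟨a, k, ha, sa⟩ := wc.1 p1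
    obtain ⟨b, k', hb, sb⟩ := ws.1 p2
    refine ⟨fun _ => ⟨_, by rw [eUnit]; simp only [sa, sb]; rfl, ?_⟩, fun hh => ?_⟩
    · obtain ⟨ca, ea⟩ := hC.take_whole hn h.toIsLoose p1 ha
      obtain ⟨cb, -⟩ := hC.take_whole hn h.toIsLoose p2 hb
      have hne := ne_rows _ _ _ _ _ _ _ ca cb
      obtain ⟨-, eb⟩ := ea.take_whole hn (h.addF_pos p1) (r := r) (k := k') (b := b)
        (by simp only [State.addF, i4]; omega) (by simp only [State.addF, i4]; omega)
      rw [Function.update_of_ne hne, addF_addF] at eb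
      rw [State.unitE, q1, q2]
      exact eb
    · unfold State.unitEps at hh; omega
  · obtain ⟨a, k, ha, sa⟩ := wc.1 p1
    obtain ⟨ca, ea⟩ := hC.take_whole hn h.toIsLoose p1 ha
    have hL := h.addF_pos p1
    -- The lower half that stays after removing the upper one guarantees a half block to remove.
    obtain ⟨b, k', hb, sb⟩ := (foreHigh_half hn hL ea hrt' (hrc ▸ halfPiece_iff hn ht .covering)).1
      (by simp only [State.addF, i2]; omega)
    refine ⟨fun _ => ⟨_, by
      rw [eUnit]; simp only [sa, ws.2 p2, sb, Option.map_some]; rfl, ?_⟩, fun hh => ?_⟩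
    · obtain ⟨-, eb⟩ := ea.take_half hn hL hrt' (by simp only [State.addF, i2]; omega) hb
      rw [addF_addG_neg] at eb
      rw [State.unitE, q1, q2]
      exact eb
    · unfold State.unitEps at hh; omega
  · obtain ⟨a, k, ha, sa⟩ := ws.1 p2
    obtain ⟨ca, ea⟩ := hC.take_whole hn h.toIsLoose p2 ha
    have hL := h.addF_pos p2
    obtain ⟨b, k', hb, sb⟩ := (foreHigh_half hn hL ea hrt (hrs ▸ halfPiece_iff hn ht .supporting)).1
      (by simp only [State.addF, i1]; omega)
    refine ⟨fun _ => ⟨_, by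
      rw [eUnit]; simp only [sa, wc.2 p1, sb, Option.map_some]; rfl, ?_⟩, fun hh => ?_⟩
    · obtain ⟨-, eb⟩ := ea.take_half hn hL hrt (by simp only [State.addF, i1]; omega) hb
      rw [addF_addG] at eb
      rw [State.unitE, q1, q2]
      exact eb
    · unfold State.unitEps at hh; omega
  · by_cases hh : m.G r < m.F r
    · obtain ⟨a, k, ha, sa⟩ := hc.1 (by omega)
      obtain ⟨b, k', hb, sb⟩ := hs.1 hh
      refine ⟨fun _ => ⟨_, by
        rw [eUnit]; simp only [wc.2 p1, ws.2 p2, sa, sb]; rfl, ?_⟩, fun hh => ?_⟩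
      · obtain ⟨ca, ea⟩ := hC.take_half hn h.toIsLoose hrt' (by omega) ha
        obtain ⟨cb, -⟩ := hC.take_half hn h.toIsLoose hrt hh hb
        have hne := ne_rows a b k k' .half .half 0 (by rw [add_zero]; exact ca)
          (by rw [add_zero]; exact cb)
        obtain ⟨-, eb⟩ := ea.take_half hn (h.addG_pos hn hrt' (by omega)) hrt (k := k') (b := b)
          (by simp only [State.addG, i4]; omega) (by simp only [State.addG, i4]; omega)
        rw [Function.update_of_ne hne, addG_addG] at eb
        rw [State.unitE, q1, q2]
        exact eb
      · unfold State.unitEps at hh; omega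
    · refine ⟨fun h0 => ?_, fun _ => ?_⟩
      · unfold State.unitEps at h0; omega
      · rw [eUnit]; simp only [wc.2 p1, ws.2 p2, hs.2 hh]
        cases foreHigh (HalfPiece n .covering i) C <;> rfl

end UnitOps


/-! ### The operators on boundaries -/

section UnitState

variable {n l : ℕ} {m : State} {r : ℤ}

theorem State.move_move (m : State) (r α β γ δ α' β' γ' δ' : ℤ) :
    (m.move n r α β γ δ).move n r α' β' γ' δ' = m.move n r (α + α') (β + β') (γ + γ') (δ + δ') := by
  ext x <;> simp only [State.move] <;> ring

theorem State.move_zero (m : State) (r : ℤ) : m.move n r 0 0 0 0 = m := by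
  ext x <;> simp only [State.move] <;> ring

theorem IsSliceState.terminal_succ (h : IsSliceState n l m) (r : ℤ) :
    m.G (-r) = m.F (-r - 1) ∨ m.G (r + 1) = m.F r := by
  have := h.terminal (-r)
  rwa [sub_neg_eq_add, neg_neg, add_comm 1 r] at this

theorem IsSliceState.terminal_neg (h : IsSliceState n l m) (r : ℤ) :
    m.G r = m.F (r - 1) ∨ m.G (-r + 1) = m.F (-r) := by
  have := h.terminal r
  rwa [show 1 - r = -r + 1 by ring] at this

theorem IsSliceState.move (hn : 4 ≤ n) (h : IsSliceState n l m) {α β γ δ : ℤ}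
    (hr : ¬ IsThin n r) (hc : IsConfig n l (m.move n r α β γ δ))
    (h1 : m.G r + γ = m.F (r - 1) ∨ m.G (-r + 1) = m.F (-r) + β)
    (h2 : m.G (-r) + δ = m.F (-r - 1) ∨ m.G (r + 1) = m.F r + α) :
    IsSliceState n l (m.move n r α β γ δ) := by
  refine ⟨hc, ?_⟩
  obtain ⟨e1, e2, e3, e4, e5, e6, e7, e8⟩ :=
    State.move_apply (m := m) (α := α) (β := β) (γ := γ) (δ := δ) hn hr
  set m' := m.move n r α β γ δ with hm'
  have key : ∀ x, period n ∣ x - r ∨ period n ∣ x - -r →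
      m'.G x = m'.F (x - 1) ∨ m'.G (1 - x) = m'.F (-x) := by
    rintro x (hd | hd)
    · have d1 := hc.lt_G_of_dvd hd
      have d2 := hc.lt_G_of_dvd (r := -r + 1) (x := 1 - x) (by
        rw [show 1 - x - (-r + 1) = -(x - r) by ring]; exact (dvd_neg).2 hd)
      rw [show 1 - x - 1 = -x by ring, add_sub_cancel_right] at d2
      omega
    · have d1 := hc.lt_G_of_dvd hd
      have d2 := hc.lt_G_of_dvd (r := r + 1) (x := 1 - x) (by
        rw [show 1 - x - (r + 1) = -(x - -r) by ring]; exact (dvd_neg).2 hd)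
      rw [show 1 - x - 1 = -x by ring, add_sub_cancel_right] at d2
      omega
  intro x
  by_cases a1 : period n ∣ x - r ∨ period n ∣ x - -r
  · exact key x a1
  by_cases a2 : period n ∣ 1 - x - r ∨ period n ∣ 1 - x - -r
  · have := key (1 - x) a2
    rw [show 1 - x - 1 = -x by ring, show 1 - (1 - x) = x by ring,
      show -(1 - x) = x - 1 by ring] at this
    exact this.symm
  rw [not_or] at a1 a2
  have b1 : ¬ period n ∣ x - 1 - r := fun hd => a2.2 (by
    rw [show 1 - x - -r = -(x - 1 - r) by ring]; exact dvd_neg.2 hd)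
  have b2 : ¬ period n ∣ x - 1 - -r := fun hd => a2.1 (by
    rw [show 1 - x - r = -(x - 1 - -r) by ring]; exact dvd_neg.2 hd)
  have b3 : ¬ period n ∣ -x - r := fun hd => a1.2 (by
    rw [show x - -r = -(-x - r) by ring]; exact dvd_neg.2 hd)
  have b4 : ¬ period n ∣ -x - -r := fun hd => a1.1 (by
    rw [show x - r = -(-x - -r) by ring]; exact dvd_neg.2 hd)
  rw [hm', (State.move_of_not_dvd a1.1 a1.2).2, (State.move_of_not_dvd a2.1 a2.2).2,
    (State.move_of_not_dvd b1 b2).1, (State.move_of_not_dvd b3 b4).1]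
  exact h.terminal x

theorem IsConfig.level_pos (h : IsConfig n l m) {x y : ℤ} (hxy : m.F x ≠ m.G y) : 0 < l := by
  by_contra hl
  have hz := h.F_eq_zero (by omega)
  have h1 := h.F_le_G y
  have h2 := h.G_le_F y
  rw [hz] at hxy h1 h2
  omega

theorem IsConfig.level_pos_of_unitPhi (h : IsConfig n l m) (h0 : 0 < m.unitPhi r) : 0 < l := by
  by_contra hl
  have hz : ∀ x y, m.F x = m.G y := fun x y => by
    by_contra hh
    exact hl (h.level_pos hh)
  unfold State.unitPhi at h0
  have := hz r r
  have := hz (r - 1) r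
  have := hz (-r - 1) (-r)
  omega

theorem IsConfig.level_pos_of_unitEps (h : IsConfig n l m) (h0 : 0 < m.unitEps r) : 0 < l := by
  by_contra hl
  have hz : ∀ x y, m.F x = m.G y := fun x y => by
    by_contra hh
    exact hl (h.level_pos hh)
  unfold State.unitEps at h0
  have := hz r r
  have := hz r (r + 1)
  have := hz (-r) (-r + 1)
  omega

/-- By terminality, full slots in `-r` exclude whole blocks of row `r` on top. Hence after the step
there are whole blocks of row `r` exactly if there was no full slot in `-r`, and likewise with signs
exchanged; so `unitE` makes the choices that undo the step. -/
theorem IsSliceState.unitF (hn : 4 ≤ n) (h : IsSliceState n l m) (hr : ¬ IsThin n r)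
    (h0 : 0 < m.unitPhi r) : IsSliceState n l (m.unitF n r) ∧
      (m.unitF n r).unitPhi r = m.unitPhi r - 1 ∧ (m.unitF n r).unitEps r = m.unitEps r + 1 ∧
      (m.unitF n r).unitE n r = m := by
  have hl := h.level_pos_of_unitPhi h0
  have t1 := h.terminal_succ r
  have t2 := h.terminal_neg r
  have q1 := m.hasSlot_cases r
  have q2 := m.hasSlot_cases (-r)
  have s1 := h.F_le_G r
  have s2 := h.F_le_G (-r)
  have s3 := h.F_succ r
  have s4 := h.F_succ (-r)
  have s5 := h.mirror r
  have s6 := h.G_le_F r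
  unfold State.unitPhi at h0
  have hc : IsConfig n l (m.unitF n r) := h.toIsConfig.move hn hr hl (by omega) (by omega)
    (by omega) (by omega) (by omega) (by omega)
  obtain ⟨e1, e2, e3, e4, e5, e6, e7, e8⟩ := State.move_apply (m := m) (α := m.hasSlot (-r) - 1)
    (β := m.hasSlot r - 1) (γ := -m.hasSlot r) (δ := -m.hasSlot (-r)) hn hr
  change (m.unitF n r).F r = _ at e1
  change (m.unitF n r).F (-r) = _ at e2
  change (m.unitF n r).G r = _ at e3
  change (m.unitF n r).G (-r) = _ at e4
  change (m.unitF n r).F (r - 1) = _ at e5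
  change (m.unitF n r).F (-r - 1) = _ at e6
  change (m.unitF n r).G (r + 1) = _ at e7
  change (m.unitF n r).G (-r + 1) = _ at e8
  refine ⟨h.move hn hr hc (by omega) (by omega), ?_, ?_, ?_⟩
  · simp only [State.unitPhi, e1, e3, e4, e5, e6]; omega
  · simp only [State.unitEps, e1, e2, e3, e7, e8]; omega
  · have p1 := (m.unitF n r).hasSlot_cases (r + 1)
    have p2 := (m.unitF n r).hasSlot_cases (-r + 1)
    rw [add_sub_cancel_right] at p1 p2
    rw [e7, e1] at p1
    rw [e8, e2] at p2
    have f1 : (m.unitF n r).hasSlot (r + 1) = 1 - m.hasSlot (-r) := by omega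
    have f2 : (m.unitF n r).hasSlot (-r + 1) = 1 - m.hasSlot r := by omega
    rw [State.unitE, f1, f2, State.unitF, State.move_move]
    convert State.move_zero m r using 2 <;> ring

theorem IsSliceState.unitE (hn : 4 ≤ n) (h : IsSliceState n l m) (hr : ¬ IsThin n r)
    (h0 : 0 < m.unitEps r) : IsSliceState n l (m.unitE n r) ∧
      (m.unitE n r).unitPhi r = m.unitPhi r + 1 ∧ (m.unitE n r).unitEps r = m.unitEps r - 1 ∧
      (m.unitE n r).unitF n r = m := by
  have hl := h.level_pos_of_unitEps h0
  have t1 := h.terminal_succ r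
  have t2 := h.terminal_neg r
  have q1 := m.hasSlot_cases (r + 1)
  have q2 := m.hasSlot_cases (-r + 1)
  rw [add_sub_cancel_right] at q1 q2
  have s1 := h.F_le_G r
  have s2 := h.F_le_G (-r)
  have s3 := h.F_succ r
  have s4 := h.F_succ (-r)
  have s5 := h.mirror r
  have s6 := h.G_le_F r
  unfold State.unitEps at h0
  have hc : IsConfig n l (m.unitE n r) := h.toIsConfig.move hn hr hl (by omega) (by omega)
    (by omega) (by omega) (by omega) (by omega)
  obtain ⟨e1, e2, e3, e4, e5, e6, e7, e8⟩ := State.move_apply (m := m) (α := m.hasSlot (r + 1))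
    (β := m.hasSlot (-r + 1)) (γ := 1 - m.hasSlot (-r + 1)) (δ := 1 - m.hasSlot (r + 1)) hn hr
  change (m.unitE n r).F r = _ at e1
  change (m.unitE n r).F (-r) = _ at e2
  change (m.unitE n r).G r = _ at e3
  change (m.unitE n r).G (-r) = _ at e4
  change (m.unitE n r).F (r - 1) = _ at e5
  change (m.unitE n r).F (-r - 1) = _ at e6
  change (m.unitE n r).G (r + 1) = _ at e7
  change (m.unitE n r).G (-r + 1) = _ at e8
  refine ⟨h.move hn hr hc (by omega) (by omega), ?_, ?_, ?_⟩
  · simp only [State.unitPhi, e1, e3, e4, e5, e6]; omega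
  · simp only [State.unitEps, e1, e2, e3, e7, e8]; omega
  · have p1 := (m.unitE n r).hasSlot_cases r
    have p2 := (m.unitE n r).hasSlot_cases (-r)
    rw [e3, e5] at p1
    rw [e4, e6] at p2
    have f1 : (m.unitE n r).hasSlot r = 1 - m.hasSlot (-r + 1) := by omega
    have f2 : (m.unitE n r).hasSlot (-r) = 1 - m.hasSlot (r + 1) := by omega
    rw [State.unitF, f1, f2, State.unitE, State.move_move]
    convert State.move_zero m r using 2 <;> ring

end UnitState

section ThinState

variable {n l : ℕ} {m : State} {r : ℤ} {b : Bool} {d : ℤ}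

theorem State.thinMove_T_self : (m.thinMove n r b d).T b r = m.T b r + d := by
  simp [State.thinMove, ind_self]

theorem State.thinMove_F_pred (hn : 4 ≤ n) : (m.thinMove n r b d).F (r - 1) = m.F (r - 1) :=
  (State.thinMove_of_not_dvd (not_dvd_pred hn (by simp))).1

theorem State.thinMove_G_succ (hn : 4 ≤ n) : (m.thinMove n r b d).G (r + 1) = m.G (r + 1) :=
  (State.thinMove_of_not_dvd (not_dvd_succ hn (by simp))).2.1

/-- In a slice state the thin values of `F` and `G` are functions of the thresholds and of the
neighbouring rows. Restoring a threshold therefore restores the state. -/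
theorem IsSliceState.F_thin (hn : 4 ≤ n) (h : IsSliceState n l m) {x : ℤ} (hx : IsThin n x) :
    m.F x = min (m.G (x + 1)) (m.T true x + m.T false x - m.F (x - 1)) ∧
    m.G x = max (m.F (x - 1)) (m.T true x + m.T false x - m.G (x + 1)) := by
  have e := h.lt_G_of_dvd (r := x) (x := -x) (dvd_of_isThin hn hx)
  have t := h.terminal_succ x
  have := h.T_add x hx
  have := h.F_le_G x
  have := h.F_succ x
  omega

theorem IsSliceState.thinMove_thinMove (hn : 4 ≤ n) (h : IsSliceState n l m) (hr : IsThin n r) :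
    (m.thinMove n r b d).thinMove n r b (-d) = m := by
  have hT : ∀ b' x, (m.thinMove n r b d).T b' x + (if b' = b then -d * ind n r x else 0) =
      m.T b' x := by
    intro b' x
    simp only [State.thinMove]
    split_ifs <;> ring
  have hsum : ∀ x, period n ∣ x - r → (m.thinMove n r b d).T b x +
      (m.thinMove n r b d).T (!b) x + -d = m.T true x + m.T false x := by
    intro x hd
    simp only [State.thinMove, ind_of_dvd hd]
    cases b <;> simp <;> ring
  ext1
  · ext x
    by_cases hd : period n ∣ x - r
    · rw [(State.thinMove_of_dvd hd).1, hsum x hd,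
        (State.thinMove_of_not_dvd (not_dvd_succ hn hd)).2.1,
        (State.thinMove_of_not_dvd (not_dvd_pred hn hd)).1]
      exact ((h.F_thin hn ((isThin_congr hn hd).2 hr)).1).symm
    · rw [(State.thinMove_of_not_dvd hd).1, (State.thinMove_of_not_dvd hd).1]
  · ext x
    by_cases hd : period n ∣ x - r
    · rw [(State.thinMove_of_dvd hd).2.1, hsum x hd,
        (State.thinMove_of_not_dvd (not_dvd_succ hn hd)).2.1,
        (State.thinMove_of_not_dvd (not_dvd_pred hn hd)).1]
      exact ((h.F_thin hn ((isThin_congr hn hd).2 hr)).2).symm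
    · rw [(State.thinMove_of_not_dvd hd).2.1, (State.thinMove_of_not_dvd hd).2.1]
  · ext b' x
    exact hT b' x

end ThinState

/-! ### The operators for all colours -/

variable {n l k i : ℕ} {m : State} {C : Layers l}

open Classical in
/-- `φ_i` in terms of boundaries. -/
noncomputable def State.phi (n k i : ℕ) (m : State) : ℤ :=
  if 2 ≤ i ∧ i ≤ n - 2 then m.unitPhi ((i : ℤ) - 1)
  else m.T (rearBit n k i) (thinRow n i) - m.F (thinRow n i - 1)

open Classical in
/-- `ε_i` in terms of boundaries. -/
noncomputable def State.eps (n k i : ℕ) (m : State) : ℤ :=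
  if 2 ≤ i ∧ i ≤ n - 2 then m.unitEps ((i : ℤ) - 1)
  else m.G (thinRow n i + 1) - m.T (rearBit n k i) (thinRow n i)

open Classical in
/-- `f̃_i` in terms of boundaries. -/
noncomputable def State.f (n k i : ℕ) (m : State) : State :=
  if 2 ≤ i ∧ i ≤ n - 2 then m.unitF n ((i : ℤ) - 1)
  else m.thinMove n (thinRow n i) (rearBit n k i) (-1)

open Classical in
/-- `ẽ_i` in terms of boundaries. -/
noncomputable def State.e (n k i : ℕ) (m : State) : State :=
  if 2 ≤ i ∧ i ≤ n - 2 then m.unitE n ((i : ℤ) - 1)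
  else m.thinMove n (thinRow n i) (rearBit n k i) 1

theorem IsSliceState.phi_nonneg (hn : 4 ≤ n) (h : IsSliceState n l m) : 0 ≤ m.phi n k i := by
  unfold State.phi
  split_ifs
  · generalize (i : ℤ) - 1 = r
    have := h.F_le_G r
    have := h.F_le_G (-r)
    have := h.G_le_F r
    unfold State.unitPhi; omega
  · have := h.F_le_G (thinRow n i)
    have := h.G_le_T (rearBit n k i) _ (isThin_thinRow hn i)
    omega

theorem IsSliceState.eps_nonneg (hn : 4 ≤ n) (h : IsSliceState n l m) : 0 ≤ m.eps n k i := by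
  unfold State.eps
  split_ifs
  · generalize (i : ℤ) - 1 = r
    have := h.F_succ r
    have := h.F_succ (-r)
    have := h.G_le_F r
    unfold State.unitEps; omega
  · have := h.F_succ (thinRow n i)
    have := h.T_le_F (rearBit n k i) _ (isThin_thinRow hn i)
    omega

theorem IsSliceState.f (hn : 4 ≤ n) (h : IsSliceState n l m) (h0 : 0 < m.phi n k i) :
    IsSliceState n l (m.f n k i) ∧ (m.f n k i).phi n k i = m.phi n k i - 1 ∧
      (m.f n k i).eps n k i = m.eps n k i + 1 ∧ (m.f n k i).e n k i = m := by
  unfold State.phi at h0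
  unfold State.phi State.eps State.f State.e
  by_cases hi : 2 ≤ i ∧ i ≤ n - 2
  · simp only [if_pos hi] at h0 ⊢
    exact h.unitF hn (unit_not_thin hn hi) h0
  · simp only [if_neg hi] at h0 ⊢
    have hr := isThin_thinRow hn i
    have h1 := h.F_succ (thinRow n i)
    have h2 := h.T_le_F (rearBit n k i) _ hr
    rw [State.thinMove_T_self, State.thinMove_F_pred hn, State.thinMove_G_succ hn]
    refine ⟨h.thinMove hn hr (by omega) (by omega), by omega, by omega, ?_⟩
    have := h.thinMove_thinMove (b := rearBit n k i) (d := -1) hn hr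
    rwa [neg_neg] at this

theorem IsSliceState.e (hn : 4 ≤ n) (h : IsSliceState n l m) (h0 : 0 < m.eps n k i) :
    IsSliceState n l (m.e n k i) ∧ (m.e n k i).phi n k i = m.phi n k i + 1 ∧
      (m.e n k i).eps n k i = m.eps n k i - 1 ∧ (m.e n k i).f n k i = m := by
  unfold State.eps at h0
  unfold State.phi State.eps State.f State.e
  by_cases hi : 2 ≤ i ∧ i ≤ n - 2
  · simp only [if_pos hi] at h0 ⊢
    exact h.unitE hn (unit_not_thin hn hi) h0
  · simp only [if_neg hi] at h0 ⊢
    have hr := isThin_thinRow hn i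
    have h1 := h.F_le_G (thinRow n i)
    have h2 := h.G_le_T (rearBit n k i) _ hr
    rw [State.thinMove_T_self, State.thinMove_F_pred hn, State.thinMove_G_succ hn]
    exact ⟨h.thinMove hn hr (by omega) (by omega), by omega, by omega,
      h.thinMove_thinMove (b := rearBit n k i) (d := 1) hn hr⟩

theorem sliceF_spec (hn : 4 ≤ n) (hi : i ≤ n) (h : IsSliceState n l m) (hC : m.Encodes n C) :
    (0 < m.phi n k i → ∃ C', sliceF n k i C = some C' ∧ (m.f n k i).Encodes n C') ∧
    (¬ 0 < m.phi n k i → sliceF n k i C = none) := by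
  unfold State.phi State.f sliceF
  by_cases hu : 2 ≤ i ∧ i ≤ n - 2
  · simp only [if_pos hu]
    exact fUnit_spec hn hu h hC
  · simp only [if_neg hu, sub_pos]
    exact fThin_spec hn (by omega) h hC

theorem sliceE_spec (hn : 4 ≤ n) (hi : i ≤ n) (h : IsSliceState n l m) (hC : m.Encodes n C) :
    (0 < m.eps n k i → ∃ C', sliceE n k i C = some C' ∧ (m.e n k i).Encodes n C') ∧
    (¬ 0 < m.eps n k i → sliceE n k i C = none) := by
  unfold State.eps State.e sliceE
  by_cases hu : 2 ≤ i ∧ i ≤ n - 2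
  · simp only [if_pos hu]
    exact eUnit_spec hn hu h hC
  · simp only [if_neg hu, sub_pos]
    exact eThin_spec hn (by omega) h hC

theorem iterate_bind_none {α : Type*} (g : α → Option α) (t : ℕ) :
    (fun x : Option α => x.bind g)^[t] none = none := by
  induction t with
  | zero => rfl
  | succ t ih => rw [Function.iterate_succ_apply]; exact ih

/-- Here `p x d` stands for an invariant saying that exactly `d` further steps from `x` are
possible; it is used with the numbers `phi` and `eps` of the state. -/
theorem sSup_iterate {α : Type*} (g : α → Option α) (p : α → ℕ → Prop)
    (h : ∀ x d, p x d → (0 < d → ∃ y, g x = some y ∧ p y (d - 1)) ∧ (d = 0 → g x = none))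
    {x : α} {d : ℕ} (hx : p x d) :
    sSup {t : ℕ | (fun y : Option α => y.bind g)^[t] (some x) ≠ none} = d := by
  have key : ∀ t x d, p x d → ((fun y : Option α => y.bind g)^[t] (some x) ≠ none ↔ t ≤ d) := by
    intro t
    induction t with
    | zero => intro x d _; simp
    | succ t ih =>
      intro x d hx
      rw [Function.iterate_succ_apply, Option.bind_some]
      rcases Nat.eq_zero_or_pos d with rfl | hd
      · rw [(h x 0 hx).2 rfl, iterate_bind_none]; simp
      · obtain ⟨y, e, hy⟩ := (h x d hx).1 hd
        rw [e, ih y _ hy]; omega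
  have : {t : ℕ | (fun y : Option α => y.bind g)^[t] (some x) ≠ none} = Set.Iic d := by
    ext t; exact key t x d hx
  rw [this, csSup_Iic]

theorem slicePhi_eq (hn : 4 ≤ n) (hi : i ≤ n) (h : IsSliceState n l m) (hC : m.Encodes n C) :
    (slicePhi n k i C : ℤ) = m.phi n k i := by
  have := sSup_iterate (sliceF n k i (l := l))
    (fun C d => ∃ m, IsSliceState n l m ∧ m.Encodes n C ∧ m.phi n k i = d) (by
      rintro C d ⟨m, h, hC, hd⟩
      obtain ⟨h1, h2⟩ := sliceF_spec (k := k) hn hi h hC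
      refine ⟨fun h0 => ?_, fun h0 => h2 (by omega)⟩
      obtain ⟨C', e, hC'⟩ := h1 (by omega)
      obtain ⟨g1, g2, -⟩ := h.f (k := k) (i := i) hn (by omega)
      exact ⟨C', e, _, g1, hC', by omega⟩) (x := C) (d := (m.phi n k i).toNat)
    ⟨m, h, hC, by have := h.phi_nonneg (k := k) (i := i) hn; omega⟩
  rw [slicePhi, this]
  exact Int.toNat_of_nonneg (h.phi_nonneg hn)

theorem sliceEps_eq (hn : 4 ≤ n) (hi : i ≤ n) (h : IsSliceState n l m) (hC : m.Encodes n C) :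
    (sliceEps n k i C : ℤ) = m.eps n k i := by
  have := sSup_iterate (sliceE n k i (l := l))
    (fun C d => ∃ m, IsSliceState n l m ∧ m.Encodes n C ∧ m.eps n k i = d) (by
      rintro C d ⟨m, h, hC, hd⟩
      obtain ⟨h1, h2⟩ := sliceE_spec (k := k) hn hi h hC
      refine ⟨fun h0 => ?_, fun h0 => h2 (by omega)⟩
      obtain ⟨C', e, hC'⟩ := h1 (by omega)
      obtain ⟨g1, g2, g3, -⟩ := h.e (k := k) (i := i) hn (by omega)
      exact ⟨C', e, _, g1, hC', by omega⟩) (x := C) (d := (m.eps n k i).toNat)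
    ⟨m, h, hC, by have := h.eps_nonneg (k := k) (i := i) hn; omega⟩
  rw [sliceEps, this]
  exact Int.toNat_of_nonneg (h.eps_nonneg hn)


/-! ### Adjacent columns under the operators -/

variable {n l k i : ℕ} {mA mB : State} {r : ℤ}

theorem rearBit_succ (n k i : ℕ) : rearBit n (k + 1) i = !rearBit n k i := by
  unfold rearBit
  by_cases h : Even k
  · have : ¬ Even (k + 1) := by rwa [Nat.even_add_one, not_not]
    simp [h, this]
  · have : Even (k + 1) := by rwa [Nat.even_add_one]
    simp [h, this]

theorem gap_congr (hA : IsLoose n l mA) (hB : IsLoose n l mB) {x : ℤ} (hd : period n ∣ x - r) :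
    mB.G x - mA.F (x - 1) = mB.G r - mA.F (r - 1) := by
  have h := hA.perF.shift (-1)
  exact hB.perG.of_dvd h hd

theorem gap_succ_congr (hA : IsLoose n l mA) (hB : IsLoose n l mB) {x : ℤ}
    (hd : period n ∣ x - 1 - r) : mB.G x - mA.F (x - 1) = mB.G (r + 1) - mA.F r := by
  have := gap_congr hA hB (x := x) (r := r + 1) (by rwa [show x - (r + 1) = x - 1 - r by ring])
  rwa [add_sub_cancel_right] at this

/-- Apart from the thresholds, `Rel` involves only `F` of the left column and `G` of the right one;
so just two classes of rows have to be checked. -/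
theorem State.Rel.unit_left (hn : 4 ≤ n) (h : mA.Rel n mB) {mA' : State} {α β γ δ : ℤ}
    (hr : ¬ IsThin n r) (e : mA' = mA.move n r α β γ δ) (hA : IsLoose n l mA')
    (hB : IsLoose n l mB) (h1 : mB.G (r + 1) ≤ mA.F r + α)
    (h2 : mB.G (-r + 1) ≤ mA.F (-r) + β) : mA'.Rel n mB := by
  obtain ⟨e1, e2, -⟩ := State.move_apply (m := mA) (α := α) (β := β) (γ := γ) (δ := δ) hn hr
  rw [← e] at e1 e2
  refine ⟨fun x => ?_, fun b x hx => by subst e; exact h.T_le b x hx⟩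
  by_cases d1 : period n ∣ x - 1 - r
  · have := gap_succ_congr hA hB d1; omega
  by_cases d2 : period n ∣ x - 1 - -r
  · have := gap_succ_congr hA hB d2; omega
  rw [e, (State.move_of_not_dvd d1 d2).1]
  exact h.G_le x

theorem State.Rel.unit_right (hn : 4 ≤ n) (h : mA.Rel n mB) {mB' : State} {α β γ δ : ℤ}
    (hr : ¬ IsThin n r) (e : mB' = mB.move n r α β γ δ) (hA : IsLoose n l mA)
    (hB : IsLoose n l mB') (h1 : mB.G r + γ ≤ mA.F (r - 1))
    (h2 : mB.G (-r) + δ ≤ mA.F (-r - 1)) : mA.Rel n mB' := by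
  obtain ⟨-, -, e1, e2, -⟩ := State.move_apply (m := mB) (α := α) (β := β) (γ := γ) (δ := δ) hn hr
  rw [← e] at e1 e2
  refine ⟨fun x => ?_, fun b x hx => by subst e; exact h.T_le b x hx⟩
  by_cases d1 : period n ∣ x - r
  · have := gap_congr hA hB d1; omega
  by_cases d2 : period n ∣ x - -r
  · have := gap_congr hA hB d2; omega
  rw [e, (State.move_of_not_dvd d1 d2).2]
  exact h.G_le x

theorem thinMove_T_le {b : Bool} {d : ℤ} {m m' : State} (hn : 4 ≤ n) (hm : IsLoose n l m)
    (hm' : IsLoose n l m') (hr : IsThin n r) (b' : Bool) {x : ℤ} (hx : IsThin n x)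
    (h : m'.T b' x ≤ m.T b' x) (h1 : b' = b → m'.T b r ≤ m.T b r + d) :
    m'.T b' x ≤ (m.thinMove n r b d).T b' x := by
  simp only [State.thinMove]
  split_ifs with hb
  · subst hb
    rcases ind_cases (n := n) r x with ⟨⟨c, hc⟩, e⟩ | ⟨-, e⟩ <;> rw [e]
    · obtain rfl : x = r + c * period n := by linarith
      have := h1 rfl
      rw [hm.T_per_mul hn _ hr, hm'.T_per_mul hn _ hr]
      omega
    · omega
  · omega

theorem le_thinMove_T {b : Bool} {d : ℤ} {m m' : State} (hn : 4 ≤ n) (hm : IsLoose n l m)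
    (hm' : IsLoose n l m') (hr : IsThin n r) (b' : Bool) {x : ℤ} (hx : IsThin n x)
    (h : m.T b' x ≤ m'.T b' x) (h1 : b' = b → m.T b r + d ≤ m'.T b r) :
    (m.thinMove n r b d).T b' x ≤ m'.T b' x := by
  simp only [State.thinMove]
  split_ifs with hb
  · subst hb
    rcases ind_cases (n := n) r x with ⟨⟨c, hc⟩, e⟩ | ⟨-, e⟩ <;> rw [e]
    · obtain rfl : x = r + c * period n := by linarith
      have := h1 rfl
      rw [hm.T_per_mul hn _ hr, hm'.T_per_mul hn _ hr]
      omega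
    · omega
  · omega

theorem State.Rel.thin_left (hn : 4 ≤ n) (h : mA.Rel n mB) {b : Bool} {d : ℤ} (hr : IsThin n r)
    (hA₀ : IsLoose n l mA) (hA : IsLoose n l (mA.thinMove n r b d))
    (hB : IsLoose n l mB) (h1 : mB.G (r + 1) ≤ (mA.thinMove n r b d).F r)
    (h2 : mB.T b r ≤ mA.T b r + d) : (mA.thinMove n r b d).Rel n mB := by
  refine ⟨fun x => ?_, fun b' x hx => thinMove_T_le hn hA₀ hB hr b' hx (h.T_le b' x hx)
    (fun _ => h2)⟩
  by_cases d1 : period n ∣ x - 1 - r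
  · have := gap_succ_congr hA hB d1; omega
  rw [(State.thinMove_of_not_dvd d1).1]
  exact h.G_le x

theorem State.Rel.thin_right (hn : 4 ≤ n) (h : mA.Rel n mB) {b : Bool} {d : ℤ} (hr : IsThin n r)
    (hB₀ : IsLoose n l mB) (hB : IsLoose n l (mB.thinMove n r b d))
    (hA : IsLoose n l mA) (h1 : (mB.thinMove n r b d).G r ≤ mA.F (r - 1))
    (h2 : mB.T b r + d ≤ mA.T b r) : mA.Rel n (mB.thinMove n r b d) := by
  refine ⟨fun x => ?_, fun b' x hx => le_thinMove_T hn hB₀ hA hr b' hx (h.T_le b' x hx)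
    (fun _ => h2)⟩
  by_cases d1 : period n ∣ x - r
  · have := gap_congr hA hB d1; omega
  rw [(State.thinMove_of_not_dvd d1).2.1]
  exact h.G_le x

theorem thinMove_apply (m : State) (n : ℕ) (r : ℤ) (b : Bool) (d : ℤ) :
    (m.thinMove n r b d).F r = min (m.G (r + 1)) (m.T true r + m.T false r + d - m.F (r - 1)) ∧
    (m.thinMove n r b d).G r = max (m.F (r - 1)) (m.T true r + m.T false r + d - m.G (r + 1)) := by
  constructor <;> simp [State.thinMove]

section

variable (hn : 4 ≤ n) (hA : IsSliceState n l mA) (hB : IsSliceState n l mB) (h : mA.Rel n mB)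
include hn hA hB h

/-- `Rel` bounds the right column above and the left column below. Adding blocks lowers boundaries
and removing blocks raises them, so `f̃` on the right column and `ẽ` on the left one never do harm.
-/
theorem State.Rel.f_right {k' : ℕ} (h0 : 0 < mB.phi n k' i) : mA.Rel n (mB.f n k' i) := by
  have hB' := (hB.f hn h0).1
  revert hB'
  unfold State.f
  by_cases hu : 2 ≤ i ∧ i ≤ n - 2
  · simp only [if_pos hu]
    intro hB'
    refine h.unit_right hn (unit_not_thin hn hu) rfl hA.toIsLoose hB'.toIsLoose ?_ ?_
    · have := h.G_le ((i : ℤ) - 1)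
      have := mB.hasSlot_cases ((i : ℤ) - 1)
      omega
    · have := h.G_le (-((i : ℤ) - 1))
      have := mB.hasSlot_cases (-((i : ℤ) - 1))
      omega
  · simp only [if_neg hu]
    intro hB'
    have hr := isThin_thinRow hn i
    refine h.thin_right hn hr hB.toIsLoose hB'.toIsLoose hA.toIsLoose ?_ ?_
    · rw [(thinMove_apply _ _ _ _ _).2]
      have := (hB.F_thin hn hr).2
      have := h.G_le (thinRow n i)
      omega
    · have := h.T_le (rearBit n k' i) _ hr
      omega

theorem State.Rel.e_left {k' : ℕ} (h0 : 0 < mA.eps n k' i) : (mA.e n k' i).Rel n mB := by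
  have hA' := (hA.e hn h0).1
  revert hA'
  unfold State.e
  by_cases hu : 2 ≤ i ∧ i ≤ n - 2
  · simp only [if_pos hu]
    intro hA'
    refine h.unit_left hn (unit_not_thin hn hu) rfl hA'.toIsLoose hB.toIsLoose ?_ ?_
    · have := h.G_le ((i : ℤ) - 1 + 1)
      rw [add_sub_cancel_right] at this
      have := mA.hasSlot_cases ((i : ℤ) - 1 + 1)
      omega
    · have := h.G_le (-((i : ℤ) - 1) + 1)
      rw [add_sub_cancel_right] at this
      have := mA.hasSlot_cases (-((i : ℤ) - 1) + 1)
      omega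
  · simp only [if_neg hu]
    intro hA'
    have hr := isThin_thinRow hn i
    refine h.thin_left hn hr hA.toIsLoose hA'.toIsLoose hB.toIsLoose ?_ ?_
    · rw [(thinMove_apply _ _ _ _ _).1]
      have := (hA.F_thin hn hr).1
      have := h.G_le (thinRow n i + 1)
      rw [add_sub_cancel_right] at this
      omega
    · have := h.T_le (rearBit n k' i) _ hr
      omega

/-- For a unit row, if `F_A r` has to fall while `F_A r = G_B (r + 1)`, there is no full slot in
`-r` and `φ(A) = F_A r - F_A (r - 1) ≤ G_B (r + 1) - G_B r ≤ ε(B)`. For a thin row, the colour is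
rear in one column and front in the other, and `φ(A) > ε(B)` with `T_add` for `B` makes both
required inequalities strict enough. -/
theorem State.Rel.f_left (h0 : mB.eps n k i < mA.phi n (k + 1) i) :
    (mA.f n (k + 1) i).Rel n mB := by
  have hA' := (hA.f (k := k + 1) (i := i) hn ((hB.eps_nonneg hn).trans_lt h0)).1
  revert hA' h0
  unfold State.f State.phi State.eps
  by_cases hu : 2 ≤ i ∧ i ≤ n - 2
  · simp only [if_pos hu]
    intro h0 hA'
    refine h.unit_left hn (unit_not_thin hn hu) rfl hA'.toIsLoose hB.toIsLoose ?_ ?_ <;>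
      generalize (i : ℤ) - 1 = r at * <;> unfold State.unitEps State.unitPhi at h0
    · have := h.G_le (r + 1)
      rw [add_sub_cancel_right] at this
      have := h.G_le r
      have := hB.F_succ (-r)
      have := mA.hasSlot_cases (-r)
      have := hA.F_le_G (-r)
      omega
    · have := h.G_le (-r + 1)
      rw [add_sub_cancel_right] at this
      have := h.G_le (-r)
      have := hB.F_succ r
      have := mA.hasSlot_cases r
      have := hA.F_le_G r
      have := hA.mirror r
      have := hB.mirror r
      omega
  · simp only [if_neg hu]
    intro h0 hA'
    have hr := isThin_thinRow hn i
    rw [rearBit_succ] at *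
    generalize rearBit n k i = b at *
    generalize thinRow n i = r at *
    have a1 := h.G_le (r + 1)
    rw [add_sub_cancel_right] at a1
    have a2 := h.G_le r
    have a3 := hA.T_add' b hr
    have a4 := hB.T_add' b hr
    have a5 := hA.T_add r hr
    have a6 := hA.F_succ r
    have a7 := hB.F_succ r
    have a8 := h.T_le b r hr
    refine h.thin_left hn hr hA.toIsLoose hA'.toIsLoose hB.toIsLoose ?_ (by omega)
    rw [(thinMove_apply _ _ _ _ _).1]
    omega

/-- The mirror image of `State.Rel.f_left`: if `G_B` must rise although it already equals `F_A` one
row lower, the same chain of inequalities gives `ε(B) ≤ φ(A)`. -/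
theorem State.Rel.e_right (h0 : mA.phi n (k + 1) i < mB.eps n k i) :
    mA.Rel n (mB.e n k i) := by
  have hB' := (hB.e (k := k) (i := i) hn ((hA.phi_nonneg hn).trans_lt h0)).1
  revert hB' h0
  unfold State.e State.phi State.eps
  by_cases hu : 2 ≤ i ∧ i ≤ n - 2
  · simp only [if_pos hu]
    intro h0 hB'
    refine h.unit_right hn (unit_not_thin hn hu) rfl hA.toIsLoose hB'.toIsLoose ?_ ?_ <;>
      generalize (i : ℤ) - 1 = r at * <;> unfold State.unitEps State.unitPhi at h0
    · have := h.G_le (r + 1)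
      rw [add_sub_cancel_right] at this
      have := h.G_le r
      have := hA.F_le_G (-r)
      have := mB.hasSlot_cases (-r + 1)
      rw [add_sub_cancel_right] at this
      have := hB.F_succ (-r)
      omega
    · have := h.G_le (-r + 1)
      rw [add_sub_cancel_right] at this
      have := h.G_le (-r)
      have := hA.F_le_G r
      have := mB.hasSlot_cases (r + 1)
      rw [add_sub_cancel_right] at this
      have := hB.F_succ r
      have := hA.mirror r
      have := hB.mirror r
      omega
  · simp only [if_neg hu]
    intro h0 hB'
    have hr := isThin_thinRow hn i
    rw [rearBit_succ] at *
    generalize rearBit n k i = b at *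
    generalize thinRow n i = r at *
    have a1 := h.G_le (r + 1)
    rw [add_sub_cancel_right] at a1
    have a2 := h.G_le r
    have a3 := hA.T_add' b hr
    have a4 := hB.T_add' b hr
    have a5 := hB.T_add r hr
    have a6 := hA.F_le_G r
    have a7 := hB.F_le_G r
    have a8 := h.T_le (!b) r hr
    refine h.thin_right hn hr hB.toIsLoose hB'.toIsLoose hA.toIsLoose ?_ (by omega)
    rw [(thinMove_apply _ _ _ _ _).2]
    omega

end


/-! ### Signatures -/

section Signature

variable {ε φ : ℕ → ℕ}

/-- The number of letters `0` minus the number of letters `1` to the right of the letters `1` of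
column `k`. -/
def height (ε φ : ℕ → ℕ) (k : ℕ) : ℤ :=
  ∑ i ∈ Finset.range (k + 1), (φ i : ℤ) - ∑ i ∈ Finset.range k, (ε i : ℤ)

theorem height_zero : height ε φ 0 = φ 0 := by simp [height]

theorem height_succ (k : ℕ) : height ε φ (k + 1) = height ε φ k - ε k + φ (k + 1) := by
  simp only [height, Finset.sum_range_succ]; ring

/-- The height reached by the letter `0` at the place `p`. -/
def zeroHeight (ε φ : ℕ → ℕ) (p : Place) : ℤ := height ε φ p.1 - (p.2 - ε p.1)

/-- The height left by the letter `1` at the place `p`. -/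
def oneHeight (ε φ : ℕ → ℕ) (p : Place) : ℤ := height ε φ p.1 + p.2 - ε p.1 + 1

/-- The letters `0` at `p` and `1` at `q` cancel each other. -/
structure Match (ε φ : ℕ → ℕ) (p q : Place) : Prop where
  zero : IsZero ε φ p
  one : IsOne ε q
  lt : q.1 < p.1
  eq : zeroHeight ε φ p = oneHeight ε φ q
  between : ∀ j, q.1 < j → j < p.1 → height ε φ j < zeroHeight ε φ p

theorem zeroHeight_le {p : Place} (hp : IsZero ε φ p) :
    zeroHeight ε φ p ≤ height ε φ p.1 ∧ height ε φ p.1 - φ p.1 < zeroHeight ε φ p := by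
  obtain ⟨h1, h2⟩ := hp
  unfold zeroHeight; omega

theorem oneHeight_le {q : Place} (hq : IsOne ε q) :
    oneHeight ε φ q ≤ height ε φ q.1 ∧ height ε φ q.1 - ε q.1 < oneHeight ε φ q := by
  unfold IsOne at hq
  unfold oneHeight; omega

theorem exists_zero {k : ℕ} {v : ℤ} (h1 : v ≤ height ε φ k) (h2 : height ε φ k - φ k < v) :
    ∃ p, p.1 = k ∧ IsZero ε φ p ∧ zeroHeight ε φ p = v := by
  refine ⟨(k, ε k + (height ε φ k - v).toNat), rfl, ⟨by simp, ?_⟩, ?_⟩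
  · simp only; omega
  · simp only [zeroHeight]; omega

theorem exists_one {k : ℕ} {v : ℤ} (h1 : v ≤ height ε φ k) (h2 : height ε φ k - ε k < v) :
    ∃ q, q.1 = k ∧ IsOne ε q ∧ oneHeight ε φ q = v := by
  refine ⟨(k, (v - height ε φ k + ε k - 1).toNat), rfl, ?_, ?_⟩
  · simp only [IsOne]; omega
  · simp only [oneHeight]; omega

theorem zero_ext {p q : Place} (h1 : p.1 = q.1) (h : zeroHeight ε φ p = zeroHeight ε φ q) :
    p = q := by
  obtain ⟨a, s⟩ := p
  obtain ⟨b, t⟩ := q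
  obtain rfl : a = b := h1
  simp only [zeroHeight] at h
  congr 1; omega

theorem one_ext {p q : Place} (h1 : p.1 = q.1) (h : oneHeight ε φ p = oneHeight ε φ q) :
    p = q := by
  obtain ⟨a, s⟩ := p
  obtain ⟨b, t⟩ := q
  obtain rfl : a = b := h1
  simp only [oneHeight] at h
  congr 1; omega

/-- The bottom of the ascent in column `j` is the end of the descent in the column before. -/
theorem height_sub (j : ℕ) : height ε φ (j + 1) - φ (j + 1) = height ε φ j - ε j := by
  rw [height_succ]; ring

/-- The partner lies in the nearest column to the right whose height reaches the level of `p`. The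
next column to the left starts below that level, so the descent between them passes through it. -/
theorem exists_match_zero {p : Place} (hp : IsZero ε φ p) :
    (∃ q, Match ε φ p q) ↔ ∃ j < p.1, zeroHeight ε φ p ≤ height ε φ j := by
  classical
  constructor
  · rintro ⟨q, hq⟩
    exact ⟨q.1, hq.lt, hq.eq.trans_le (oneHeight_le hq.one).1⟩
  · rintro ⟨j, hj, hv⟩
    obtain ⟨h1, h2⟩ := zeroHeight_le hp
    let P : ℕ → Prop := fun j => j < p.1 ∧ zeroHeight ε φ p ≤ height ε φ j
    have hP : P (Nat.findGreatest P p.1) := Nat.findGreatest_spec (P := P) hj.le ⟨hj, hv⟩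
    have hmax : ∀ i, Nat.findGreatest P p.1 < i → i < p.1 → height ε φ i < zeroHeight ε φ p := by
      intro i hi hi'
      by_contra hh
      exact Nat.findGreatest_is_greatest hi hi'.le ⟨hi', not_lt.1 hh⟩
    set k := Nat.findGreatest P p.1 with hk
    obtain ⟨q, hq1, hq2, hq3⟩ := exists_one (ε := ε) (φ := φ) (k := k) hP.2 (by
      have e := height_sub (ε := ε) (φ := φ) k
      rcases Nat.lt_or_ge (k + 1) p.1 with hlt | hge
      · have := hmax _ (Nat.lt_succ_self k) hlt
        rw [Nat.succ_eq_add_one] at this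
        omega
      · have : k + 1 = p.1 := by have := hP.1; omega
        rw [this] at e; omega)
    exact ⟨q, hp, hq2, hq1.trans_lt hP.1, hq3.symm, fun i hi => hmax i (hq1 ▸ hi)⟩

/-- Dually, the partner lies in the nearest column to the left whose height reaches the level; the
walk was below it before, so an ascent passes through it. -/
theorem exists_match_one {q : Place} (hq : IsOne ε q) :
    (∃ p, Match ε φ p q) ↔ ∃ j > q.1, oneHeight ε φ q ≤ height ε φ j := by
  classical
  constructor
  · rintro ⟨p, hp⟩
    exact ⟨p.1, hp.lt, hp.eq.symm.trans_le (zeroHeight_le hp.zero).1⟩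
  · intro hex
    obtain ⟨h1, h2⟩ := oneHeight_le (φ := φ) hq
    have hP := Nat.find_spec hex
    have hmin : ∀ i, i < Nat.find hex → q.1 < i → height ε φ i < oneHeight ε φ q := by
      intro i hi hi'
      by_contra hh
      exact Nat.find_min hex hi ⟨hi', not_lt.1 hh⟩
    set k := Nat.find hex with hk
    obtain ⟨j, hj⟩ : ∃ j, k = j + 1 := ⟨k - 1, by have := hP.1; omega⟩
    obtain ⟨p, hp1, hp2, hp3⟩ := exists_zero (ε := ε) (φ := φ) (k := k) hP.2 (by
      have e := height_sub (ε := ε) (φ := φ) j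
      rw [← hj] at e
      rcases Nat.lt_or_ge q.1 j with hlt | hge
      · have := hmin j (by omega) hlt
        omega
      · have : j = q.1 := by have := hP.1; omega
        rw [this] at e; omega)
    exact ⟨p, hp2, hq, hP.1.trans_eq hp1.symm, hp3,
      fun i h1 h2 => by rw [hp3]; exact hmin i (hp1 ▸ h2) h1⟩

theorem Match.right_unique {p q q' : Place} (h : Match ε φ p q) (h' : Match ε φ p q') : q = q' := by
  have key : ∀ {q q' : Place}, Match ε φ p q → Match ε φ p q' → ¬ q.1 < q'.1 := by
    intro q q' h h' hlt
    have h1 := h.between _ hlt h'.lt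
    have h2 := (oneHeight_le (φ := φ) h'.one).1
    rw [h'.eq] at h1
    omega
  have h1 := key h h'
  have h2 := key h' h
  exact one_ext (by omega) (h.eq.symm.trans h'.eq)

theorem Match.left_unique {p p' q : Place} (h : Match ε φ p q) (h' : Match ε φ p' q) : p = p' := by
  have key : ∀ {p p' : Place}, Match ε φ p q → Match ε φ p' q → ¬ p.1 < p'.1 := by
    intro p p' h h' hlt
    have h1 := h'.between _ h.lt hlt
    have h2 := (zeroHeight_le (φ := φ) h.zero).1
    rw [h'.eq, ← h.eq] at h1
    omega
  have h1 := key h h'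
  have h2 := key h' h
  exact zero_ext (by omega) (h.eq.trans h'.eq.symm)

theorem LeftOf.not_symm {p q : Place} (h : LeftOf p q) : ¬ LeftOf q p := by
  unfold LeftOf at *; omega

theorem LeftOf.trichotomy (p q : Place) : LeftOf p q ∨ p = q ∨ LeftOf q p := by
  obtain ⟨a, s⟩ := p
  obtain ⟨b, t⟩ := q
  simp only [LeftOf, Prod.mk.injEq]
  omega

theorem IsZero.not_isOne {p : Place} (h : IsZero ε φ p) : ¬ IsOne ε p := by
  obtain ⟨h1, h2⟩ := h
  unfold IsOne; omega

/-- Brackets are nested: between the partners the walk stays below their level, so a letter there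
finds its own partner between them. -/
theorem Match.zero_between {p q r : Place} (h : Match ε φ p q) (hr : IsZero ε φ r)
    (h1 : LeftOf p r) (h2 : LeftOf r q) : ∃ r', Match ε φ r r' ∧ LeftOf p r' ∧ LeftOf r' q := by
  have hlt : q.1 < r.1 := by
    rcases h2 with h2 | ⟨h2, h3⟩
    · exact h2
    · have e1 := h.one; have e2 := hr.1
      unfold IsOne at e1; rw [h2] at e2; omega
  have hv : zeroHeight ε φ r < zeroHeight ε φ p := by
    rcases h1 with h1 | ⟨h1, h3⟩
    · exact (zeroHeight_le hr).1.trans_lt (h.between _ hlt h1)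
    · simp only [zeroHeight, h1]; omega
  have hq := (oneHeight_le (φ := φ) h.one).1
  have he := h.eq
  obtain ⟨r', hr'⟩ := (exists_match_zero hr).2 ⟨q.1, hlt, by omega⟩
  refine ⟨r', hr', .inl ?_, ?_⟩
  · have := hr'.lt
    unfold LeftOf at h1; omega
  · have h4 : q.1 ≤ r'.1 := by
      by_contra hh
      have := hr'.between q.1 (by omega) hlt
      omega
    rcases h4.lt_or_eq with h4 | h4
    · exact .inl h4
    · refine .inr ⟨h4.symm, ?_⟩
      have e := hr'.eq
      simp only [oneHeight, h4] at he e; omega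

theorem Match.one_between {p q r : Place} (h : Match ε φ p q) (hr : IsOne ε r)
    (h1 : LeftOf p r) (h2 : LeftOf r q) : ∃ r', Match ε φ r' r ∧ LeftOf p r' ∧ LeftOf r' q := by
  have hlt : r.1 < p.1 := by
    rcases h1 with h1 | ⟨h1, h3⟩
    · exact h1
    · have e1 := h.zero.1; unfold IsOne at hr; rw [h1] at e1; omega
  have hv : oneHeight ε φ r < zeroHeight ε φ p := by
    rcases h2 with h2 | ⟨h2, h3⟩
    · exact (oneHeight_le hr).1.trans_lt (h.between _ h2 hlt)
    · rw [h.eq]; simp only [oneHeight, h2]; omega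
  have hp := (zeroHeight_le (φ := φ) h.zero).1
  obtain ⟨r', hr'⟩ := (exists_match_one hr).2 ⟨p.1, hlt, (hv.trans_le hp).le⟩
  refine ⟨r', hr', ?_, .inl ?_⟩
  · have h4 : r'.1 ≤ p.1 := by
      by_contra hh
      have := hr'.between p.1 hlt (by omega)
      have := hr'.eq
      omega
    rcases h4.lt_or_eq with h4 | h4
    · exact .inl h4
    · refine .inr ⟨h4.symm, ?_⟩
      have e := hr'.eq
      simp only [zeroHeight, h4] at hv e; omega
  · have := hr'.lt
    unfold LeftOf at h2; omega

/-- A set of letters from which only pairs of matching letters have been removed. -/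
structure MatchClosed (ε φ : ℕ → ℕ) (S : Set Place) : Prop where
  letter : ∀ p ∈ S, IsOne ε p ∨ IsZero ε φ p
  mem_iff : ∀ p q, Match ε φ p q → (p ∈ S ↔ q ∈ S)
  zero : ∀ p, IsZero ε φ p → (¬ ∃ q, Match ε φ p q) → p ∈ S
  one : ∀ q, IsOne ε q → (¬ ∃ p, Match ε φ p q) → q ∈ S

/-- If `p` or `q` had a different partner, nesting would put a remaining letter between them or give
a partner to the other one. If neither had a partner, the height at `q` would be less than the level
of `p`, hence than the height at `p`, which is less than the level of `q`, hence than the height at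
`q`. -/
theorem MatchClosed.match_of_isPair {S : Set Place} (hS : MatchClosed ε φ S) {p q : Place}
    (h : IsPair ε φ S p q) : Match ε φ p q := by
  obtain ⟨hp, hq, h0, h1, hlt, hno⟩ := h
  by_cases hm : ∃ q', Match ε φ p q'
  · obtain ⟨q', hm⟩ := hm
    have hq' : q' ∈ S := (hS.mem_iff _ _ hm).1 hp
    rcases LeftOf.trichotomy q' q with h | rfl | h
    · exact absurd ⟨.inl hm.lt, h⟩ (hno q' hq')
    · exact hm
    · obtain ⟨r, hr, hr1, hr2⟩ := hm.one_between h1 hlt h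
      exact absurd ⟨hr1, .inl hr.lt⟩ (hno r ((hS.mem_iff _ _ hr).2 hq))
  by_cases hm' : ∃ p', Match ε φ p' q
  · obtain ⟨p', hm'⟩ := hm'
    have hp' : p' ∈ S := (hS.mem_iff _ _ hm').2 hq
    rcases LeftOf.trichotomy p p' with h | rfl | h
    · exact absurd ⟨h, .inl hm'.lt⟩ (hno p' hp')
    · exact hm'
    · obtain ⟨r, hr, -⟩ := hm'.zero_between h0 h hlt
      exact absurd ⟨r, hr⟩ hm
  have hc : q.1 < p.1 := by
    rcases hlt with h | ⟨h, h'⟩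
    · exact h
    · have e := h0.1; unfold IsOne at h1; rw [h] at e; omega
  rw [exists_match_zero h0] at hm
  rw [exists_match_one h1] at hm'
  push Not at hm hm'
  have e1 := hm _ hc
  have e2 := hm' _ hc
  have e3 := (zeroHeight_le h0).1
  have e4 := (oneHeight_le (φ := φ) h1).1
  omega

theorem matchClosed_remaining (m : ℕ) : MatchClosed ε φ (remaining ε φ m) := by
  induction m with
  | zero => exact ⟨fun p hp => hp, fun p q h => ⟨fun _ => .inl h.one, fun _ => .inr h.zero⟩,
      fun p hp _ => .inr hp, fun q hq _ => .inl hq⟩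
  | succ m ih =>
    have key := fun p q => ih.match_of_isPair (p := p) (q := q)
    refine ⟨fun p hp => ih.letter p hp.1, fun p q h => ⟨fun hp => ⟨(ih.mem_iff p q h).1 hp.1, ?_⟩,
      fun hq => ⟨(ih.mem_iff p q h).2 hq.1, ?_⟩⟩, fun p hp hm => ⟨ih.zero p hp hm, ?_⟩,
      fun q hq hm => ⟨ih.one q hq hm, ?_⟩⟩
    · intro r
      refine ⟨fun hr => hr.2.2.1.not_isOne h.one, fun hr => ?_⟩
      obtain rfl := h.left_unique (key _ _ hr)
      exact (hp.2 q).1 hr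
    · intro r
      refine ⟨fun hr => ?_, fun hr => h.zero.not_isOne hr.2.2.2.1⟩
      obtain rfl := h.right_unique (key _ _ hr)
      exact (hq.2 p).2 hr
    · exact fun r => ⟨fun hr => hm ⟨r, key _ _ hr⟩, fun hr => hp.not_isOne hr.2.2.2.1⟩
    · exact fun r => ⟨fun hr => hr.2.2.1.not_isOne hq, fun hr => hm ⟨r, key _ _ hr⟩⟩

theorem remaining_antitone : Antitone (remaining ε φ) :=
  antitone_nat_of_succ_le fun _ _ hp => hp.1

/-- Induction on the distance of the two columns and then on the number of letters of the column of
`p` from `p` on. The letters between the partners are finitely many and matched among themselves, so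
they vanish first; then the partners are adjacent and cancel in the next round. -/
theorem eventually_removed {p q : Place} (h : Match ε φ p q) :
    ∀ᶠ m in Filter.atTop, p ∉ remaining ε φ m := by
  obtain ⟨d, hd⟩ : ∃ d, p.1 - q.1 = d := ⟨_, rfl⟩
  obtain ⟨c, hc⟩ : ∃ c, ε p.1 + φ p.1 - p.2 = c := ⟨_, rfl⟩
  induction d using Nat.strong_induction_on generalizing p q c with
  | _ d ihd =>
  induction c using Nat.strong_induction_on generalizing p q with
  | _ c ihc =>
  have inner : ∀ r r', Match ε φ r r' → LeftOf p r → LeftOf r' q →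
      ∀ᶠ m in Filter.atTop, r ∉ remaining ε φ m := by
    intro r r' hm h1 h2
    have hlt := hm.lt
    have hlt' := h.lt
    by_cases hd' : r.1 - r'.1 < d
    · exact ihd _ hd' hm rfl _ rfl
    -- A nested pair spanning as many columns occupies the same two columns, so its `0` lies further
    -- to the right in the column of `p`.
    · obtain ⟨e1, e2, e3⟩ : p.1 = r.1 ∧ p.2 < r.2 ∧ q.1 = r'.1 := by
        unfold LeftOf at h1 h2; omega
      refine ihc _ ?_ hm (by omega) rfl
      have := hm.zero.2
      rw [← hc, e1]
      omega
  have hfin : {r : Place | (IsOne ε r ∨ IsZero ε φ r) ∧ LeftOf p r ∧ LeftOf r q}.Finite := by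
    refine Set.Finite.subset (((Set.finite_Iic p.1).biUnion fun a _ =>
      ((Set.finite_singleton a).prod (Set.finite_Iio (ε a + φ a))))) ?_
    rintro r ⟨h1, h2, -⟩
    simp only [Set.mem_iUnion, Set.mem_prod, Set.mem_singleton_iff, Set.mem_Iio, Set.mem_Iic]
    refine ⟨r.1, ?_, rfl, ?_⟩
    · unfold LeftOf at h2; omega
    · rcases h1 with h1 | h1
      · unfold IsOne at h1; omega
      · exact h1.2
  have hall : ∀ᶠ m in Filter.atTop, ∀ r ∈ {r : Place | (IsOne ε r ∨ IsZero ε φ r) ∧ LeftOf p r ∧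
      LeftOf r q}, r ∉ remaining ε φ m := by
    rw [Filter.eventually_all_finite hfin]
    rintro r ⟨hr, h1, h2⟩
    rcases hr with hr | hr
    · obtain ⟨r', hm, e1, e2⟩ := h.one_between hr h1 h2
      filter_upwards [inner r' r hm e1 h2] with m hm'
      rwa [← (matchClosed_remaining m).mem_iff _ _ hm]
    · obtain ⟨r', hm, e1, e2⟩ := h.zero_between hr h1 h2
      exact inner r r' hm h1 e2
  obtain ⟨m, hm⟩ := hall.exists
  rw [Filter.eventually_atTop]
  refine ⟨m + 1, fun m' hm' hp => ?_⟩
  have hp' := remaining_antitone hm' hp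
  have hpm := hp'.1
  refine (hp'.2 q).1 ⟨hpm, ((matchClosed_remaining m).mem_iff _ _ h).1 hpm, h.zero, h.one,
    .inl h.lt, fun r hr hb => hm r ⟨(matchClosed_remaining m).letter r hr, hb⟩ hr⟩

/-! ### Surviving letters as records of the walk -/

/-- The places of the letters `0` that are never cancelled. -/
def survivingZeros (ε φ : ℕ → ℕ) : Set Place :=
  {p | IsZero ε φ p ∧ ∀ m, p ∈ remaining ε φ m}

/-- The places of the letters `1` that are never cancelled. -/
def survivingOnes (ε φ : ℕ → ℕ) : Set Place :=
  {p | IsOne ε p ∧ ∀ m, p ∈ remaining ε φ m}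

theorem mem_survivingZeros {p : Place} : p ∈ survivingZeros ε φ ↔
    IsZero ε φ p ∧ ∀ j < p.1, height ε φ j < zeroHeight ε φ p := by
  have : ∀ hp : IsZero ε φ p, (∀ m, p ∈ remaining ε φ m) ↔
      ∀ j < p.1, height ε φ j < zeroHeight ε φ p := by
    intro hp
    have e := not_congr (exists_match_zero hp)
    push Not at e
    rw [← e]
    refine ⟨fun hm q hq => ?_, fun hq m => (matchClosed_remaining m).zero p hp (by
      push Not; exact hq)⟩
    obtain ⟨m, hm'⟩ := (eventually_removed hq).exists
    exact hm' (hm m)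
  exact and_congr_right this

theorem mem_survivingOnes {q : Place} : q ∈ survivingOnes ε φ ↔
    IsOne ε q ∧ ∀ j > q.1, height ε φ j < oneHeight ε φ q := by
  have : ∀ hq : IsOne ε q, (∀ m, q ∈ remaining ε φ m) ↔
      ∀ j > q.1, height ε φ j < oneHeight ε φ q := by
    intro hq
    have e := not_congr (exists_match_one (φ := φ) hq)
    push Not at e
    rw [← e]
    refine ⟨fun hm p hp => ?_, fun hp m => (matchClosed_remaining m).one q hq (by
      push Not; exact hp)⟩
    obtain ⟨m, hm'⟩ := (eventually_removed hp).exists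
    exact hm' ((matchClosed_remaining m).mem_iff _ _ hp |>.2 (hm m))
  exact and_congr_right this

/-- The surviving `0`s are the letters at which the walk enters a level for the first time. Each
level from `1` up to the maximum is entered once. -/
theorem bijOn_survivingZeros {k : ℕ} (hk : ∀ j, height ε φ j ≤ height ε φ k) :
    Set.BijOn (zeroHeight ε φ) (survivingZeros ε φ) (Set.Icc 1 (height ε φ k)) := by
  classical
  refine ⟨fun p hp => ?_, fun p hp q hq he => ?_, fun v hv => ?_⟩
  · obtain ⟨h0, h1⟩ := mem_survivingZeros.1 hp
    have e := zeroHeight_le h0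
    refine ⟨?_, e.1.trans (hk _)⟩
    rcases Nat.eq_zero_or_pos p.1 with hz | hz
    · rw [hz, height_zero] at e; omega
    · have := h1 0 hz
      rw [height_zero] at this; omega
  · obtain ⟨h0, h1⟩ := mem_survivingZeros.1 hp
    obtain ⟨g0, g1⟩ := mem_survivingZeros.1 hq
    have e := (zeroHeight_le h0).1
    have e' := (zeroHeight_le g0).1
    refine zero_ext ?_ he
    rcases lt_trichotomy p.1 q.1 with h | h | h
    · have := g1 _ h; omega
    · exact h
    · have := h1 _ h; omega
  · have hex : ∃ j, v ≤ height ε φ j := ⟨k, hv.2⟩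
    have hmin : ∀ i < Nat.find hex, height ε φ i < v := fun i hi => not_le.1 (Nat.find_min hex hi)
    obtain ⟨p, hp1, hp2, hp3⟩ := exists_zero (Nat.find_spec hex) (by
      rcases hj : Nat.find hex with _ | j
      · rw [height_zero]; have := hv.1; omega
      · rw [height_sub]
        have := hmin j (by omega)
        omega)
    refine ⟨p, mem_survivingZeros.2 ⟨hp2, fun j hj => ?_⟩, hp3⟩
    rw [hp3]; exact hmin j (hp1 ▸ hj)

/-- The surviving `1`s leave a level for the last time. This happens once for every level above the
final height, up to the maximum. -/
theorem bijOn_survivingOnes {k K : ℕ} (hk : ∀ j, height ε φ j ≤ height ε φ k)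
    (hK : ∀ j ≥ K, height ε φ j = height ε φ K) :
    Set.BijOn (oneHeight ε φ) (survivingOnes ε φ)
      (Set.Icc (height ε φ K + 1) (height ε φ k)) := by
  classical
  refine ⟨fun p hp => ?_, fun p hp q hq he => ?_, fun v hv => ?_⟩
  · obtain ⟨h0, h1⟩ := mem_survivingOnes.1 hp
    have e := oneHeight_le (φ := φ) h0
    refine ⟨?_, e.1.trans (hk _)⟩
    have := h1 (K + p.1 + 1) (by omega)
    rw [hK _ (by omega)] at this
    omega
  · obtain ⟨h0, h1⟩ := mem_survivingOnes.1 hp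
    obtain ⟨g0, g1⟩ := mem_survivingOnes.1 hq
    have e := (oneHeight_le (φ := φ) h0).1
    have e' := (oneHeight_le (φ := φ) g0).1
    refine one_ext ?_ he
    rcases lt_trichotomy p.1 q.1 with h | h | h
    · have := h1 _ h; omega
    · exact h
    · have := g1 _ h; omega
  · let P : ℕ → Prop := fun j => v ≤ height ε φ j
    have hle : ∀ j, P j → j ≤ K := by
      intro j hj
      by_contra hh
      have := hK j (by omega)
      have := hv.1
      simp only [P] at hj
      omega
    have hP : P (Nat.findGreatest P K) := Nat.findGreatest_spec (P := P) (hle k hv.2) hv.2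
    have hmax : ∀ i, Nat.findGreatest P K < i → height ε φ i < v := by
      intro i hi
      by_contra hh
      exact Nat.findGreatest_is_greatest hi (hle i (not_lt.1 hh)) (not_lt.1 hh)
    obtain ⟨p, hp1, hp2, hp3⟩ := exists_one hP (by
      rw [← height_sub]
      have := hmax (Nat.findGreatest P K + 1) (by omega)
      omega)
    refine ⟨p, mem_survivingOnes.2 ⟨hp2, fun j hj => ?_⟩, hp3⟩
    rw [hp3]; exact hmax j (hp1 ▸ hj)

theorem card_of_bijOn {S : Set Place} {g : Place → ℤ} {x y : ℤ} (h : Set.BijOn g S (Set.Icc x y))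
    (hxy : x ≤ y + 1) : S.Finite ∧ (S.ncard : ℤ) = y + 1 - x := by
  refine ⟨h.finite_iff_finite.2 (Set.finite_Icc x y), ?_⟩
  rw [h.ncard_eq, Set.ncard_eq_toFinset_card', Set.toFinset_Icc, Int.card_Icc]
  omega

theorem height_nonneg_of_max {k : ℕ} (hk : ∀ j, height ε φ j ≤ height ε φ k) :
    0 ≤ height ε φ k := by
  have := hk 0
  rw [height_zero] at this
  omega

theorem card_survivingZeros {k : ℕ} (hk : ∀ j, height ε φ j ≤ height ε φ k) :
    (survivingZeros ε φ).Finite ∧ ((survivingZeros ε φ).ncard : ℤ) = height ε φ k := by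
  have := card_of_bijOn (bijOn_survivingZeros hk) (by have := height_nonneg_of_max hk; omega)
  exact ⟨this.1, by rw [this.2]; ring⟩

theorem card_survivingOnes {k K : ℕ} (hk : ∀ j, height ε φ j ≤ height ε φ k)
    (hK : ∀ j ≥ K, height ε φ j = height ε φ K) :
    (survivingOnes ε φ).Finite ∧
      ((survivingOnes ε φ).ncard : ℤ) = height ε φ k - height ε φ K := by
  have := card_of_bijOn (bijOn_survivingOnes hk hK) (by have := hk K; omega)
  exact ⟨this.1, by rw [this.2]; ring⟩

/-! ### The columns of maximal height -/

/-- `k` is the first column of maximal height. -/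
structure IsFirstMax (ε φ : ℕ → ℕ) (k : ℕ) : Prop where
  le : ∀ j, height ε φ j ≤ height ε φ k
  lt : ∀ j < k, height ε φ j < height ε φ k

/-- `k` is the last column of maximal height. -/
structure IsLastMax (ε φ : ℕ → ℕ) (k : ℕ) : Prop where
  le : ∀ j, height ε φ j ≤ height ε φ k
  lt : ∀ j > k, height ε φ j < height ε φ k

theorem height_stable {K : ℕ} (hK : ∀ k ≥ K, φ (k + 1) = ε k) :
    ∀ j ≥ K, height ε φ j = height ε φ K := by
  intro j hj
  induction j, hj using Nat.le_induction with
  | base => rfl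
  | succ j hj ih => rw [height_succ, hK j hj, ih]; ring

theorem exists_max {K : ℕ} (hK : ∀ k ≥ K, φ (k + 1) = ε k) :
    ∃ k, ∀ j, height ε φ j ≤ height ε φ k := by
  obtain ⟨k, -, hk⟩ := Finset.exists_max_image (Finset.range (K + 1)) (height ε φ) ⟨0, by simp⟩
  refine ⟨k, fun j => ?_⟩
  rcases le_total j K with h | h
  · exact hk j (by simp; omega)
  · rw [height_stable hK j h]
    exact hk K (by simp)

theorem exists_firstMax {K : ℕ} (hK : ∀ k ≥ K, φ (k + 1) = ε k) : ∃ k, IsFirstMax ε φ k := by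
  classical
  have hex := exists_max hK
  refine ⟨Nat.find hex, Nat.find_spec hex, fun j hj => ?_⟩
  have h1 := Nat.find_min hex hj
  have h2 := Nat.find_spec hex
  push Not at h1
  obtain ⟨i, hi⟩ := h1
  exact hi.trans_le (h2 i)

theorem exists_lastMax {K k : ℕ} (hK : ∀ k ≥ K, φ (k + 1) = ε k)
    (hk : ∀ j, height ε φ j ≤ height ε φ k) (hlt : height ε φ K < height ε φ k) :
    ∃ k, IsLastMax ε φ k := by
  classical
  let P : ℕ → Prop := fun j => height ε φ k ≤ height ε φ j
  have hle : ∀ j, P j → j ≤ K := by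
    intro j hj
    by_contra hh
    have := height_stable hK j (by omega)
    simp only [P] at hj
    omega
  have hP : P (Nat.findGreatest P K) := Nat.findGreatest_spec (P := P) (hle k le_rfl) le_rfl
  refine ⟨Nat.findGreatest P K, fun j => (hk j).trans hP, fun i hi => ?_⟩
  by_contra hh
  exact Nat.findGreatest_is_greatest (P := P) hi (hle i (hP.trans (not_lt.1 hh)))
    (hP.trans (not_lt.1 hh))

/-- The highest level is first entered in the column `k`, and the last ascent there is its left-most
letter `0`, at position `ε k` after the letters `1`. If the maximum is zero no `0` survives. -/
theorem leftmost_iff {k : ℕ} (h : IsFirstMax ε φ k) {p : Place} :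
    (p ∈ survivingZeros ε φ ∧ ∀ q ∈ survivingZeros ε φ, q ≠ p → LeftOf p q) ↔
      0 < φ k ∧ 0 < height ε φ k ∧ p = (k, ε k) := by
  have key : 0 < height ε φ k → (0 < φ k ∧ (k, ε k) ∈ survivingZeros ε φ ∧
      ∀ q ∈ survivingZeros ε φ, q ≠ (k, ε k) → LeftOf (k, ε k) q) := by
    intro hpos
    have hφ : 0 < φ k := by
      rcases k with _ | j
      · rw [height_zero] at hpos; omega
      · have := h.lt j (by omega)
        have := height_sub (ε := ε) (φ := φ) j
        omega
    refine ⟨hφ, mem_survivingZeros.2 ⟨⟨le_rfl, by simp only; omega⟩, ?_⟩, ?_⟩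
    · simpa [zeroHeight] using h.lt
    · intro q hq hne
      obtain ⟨h0, h1⟩ := mem_survivingZeros.1 hq
      rcases lt_trichotomy k q.1 with hlt | rfl | hlt
      · have := h1 _ hlt
        have := (zeroHeight_le h0).1
        have := h.le q.1
        omega
      · refine .inr ⟨rfl, lt_of_le_of_ne h0.1 fun he => hne ?_⟩
        ext
        · rfl
        · exact he.symm
      · exact .inl hlt
  constructor
  · rintro ⟨hp, hq⟩
    have hpos : 0 < height ε φ k := by
      have := (bijOn_survivingZeros h.le).mapsTo hp
      exact zero_lt_one.trans_le (this.1.trans this.2)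
    obtain ⟨k1, k2, k3⟩ := key hpos
    refine ⟨k1, hpos, ?_⟩
    by_contra hne
    exact (k3 p hp hne).not_symm (hq _ k2 (Ne.symm hne))
  · rintro ⟨-, hpos, rfl⟩
    exact (key hpos).2

theorem rightmost_iff {k : ℕ} (h : IsLastMax ε φ k) {p : Place} :
    (p ∈ survivingOnes ε φ ∧ ∀ q ∈ survivingOnes ε φ, q ≠ p → LeftOf q p) ↔
      0 < ε k ∧ p = (k, ε k - 1) := by
  have hpos : 0 < ε k := by
    have := h.lt (k + 1) (by omega)
    rw [height_succ] at this
    omega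
  have k2 : (k, ε k - 1) ∈ survivingOnes ε φ := by
    refine mem_survivingOnes.2 ⟨by simp only [IsOne]; omega, fun j hj => ?_⟩
    have := h.lt j hj
    simp only [oneHeight]; omega
  have k3 : ∀ q ∈ survivingOnes ε φ, q ≠ (k, ε k - 1) → LeftOf q (k, ε k - 1) := by
    intro q hq hne
    obtain ⟨h0, h1⟩ := mem_survivingOnes.1 hq
    rcases lt_trichotomy k q.1 with hlt | rfl | hlt
    · exact .inl hlt
    · refine .inr ⟨rfl, ?_⟩
      unfold IsOne at h0
      have : q.2 ≠ ε q.1 - 1 := fun he => hne (by ext <;> simp [he])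
      simp only; omega
    · have := h1 _ hlt
      have := (oneHeight_le (φ := φ) h0).1
      have := h.le q.1
      omega
  constructor
  · rintro ⟨hp, hq⟩
    refine ⟨hpos, ?_⟩
    by_contra hne
    exact (k3 p hp hne).not_symm (hq _ k2 (Ne.symm hne))
  · rintro ⟨-, rfl⟩
    exact ⟨k2, k3⟩

/-- Moving one unit between `ε` and `φ` in the column `k`. -/
theorem height_update {k : ℕ} {ε' φ' : ℕ → ℕ} {d : ℤ} (hε : ∀ j ≠ k, ε' j = ε j)
    (hφ : ∀ j ≠ k, φ' j = φ j) (h1 : (ε' k : ℤ) = ε k - d) (h2 : (φ' k : ℤ) = φ k + d) (j : ℕ) :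
    height ε' φ' j = height ε φ j + if j < k then 0 else if j = k then d else 2 * d := by
  induction j with
  | zero =>
    rcases Nat.eq_zero_or_pos k with rfl | hk
    · simp [height_zero, h2]
    · simp [height_zero, hφ 0 hk.ne, hk]
  | succ j ih =>
    rw [height_succ, height_succ, ih]
    rcases lt_trichotomy (j + 1) k with h | h | h
    · rw [hε j (by omega), hφ (j + 1) (by omega), if_pos (by omega), if_pos h]; ring
    · rw [hε j (by omega), h, h2, if_pos (by omega), if_neg (by omega), if_pos rfl]; ring
    · rw [hφ (j + 1) (by omega), if_neg (c := j + 1 < k) (by omega),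
        if_neg (c := j + 1 = k) (by omega), if_neg (c := j < k) (by omega)]
      rcases eq_or_ne j k with rfl | hne
      · rw [if_pos rfl, h1]; ring
      · rw [if_neg hne, hε j hne]; ring

/-- Heights stay the same before `k`, drop by one at `k` and by two afterwards. So the strict
inequalities before `k` become weak and the weak ones after `k` become strict. -/
theorem IsFirstMax.isLastMax {k : ℕ} {ε' φ' : ℕ → ℕ} (h : IsFirstMax ε φ k)
    (hε : ∀ j ≠ k, ε' j = ε j) (hφ : ∀ j ≠ k, φ' j = φ j)
    (h1 : (ε' k : ℤ) = ε k + 1) (h2 : (φ' k : ℤ) = φ k - 1) : IsLastMax ε' φ' k := by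
  have e := height_update (d := -1) hε hφ (by omega) (by omega)
  have ek := e k
  simp only [lt_irrefl, if_false, if_true] at ek
  constructor
  · intro j
    rw [e, ek]
    have := h.le j
    split_ifs with hj hj
    · have := h.lt j hj; omega
    · omega
    · omega
  · intro j hj
    rw [e, ek]
    have := h.le j
    rw [if_neg (by omega), if_neg (by omega)]
    omega

theorem IsLastMax.isFirstMax {k : ℕ} {ε' φ' : ℕ → ℕ} (h : IsLastMax ε φ k)
    (hε : ∀ j ≠ k, ε' j = ε j) (hφ : ∀ j ≠ k, φ' j = φ j)
    (h1 : (ε' k : ℤ) = ε k - 1) (h2 : (φ' k : ℤ) = φ k + 1) : IsFirstMax ε' φ' k := by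
  have e := height_update (d := 1) hε hφ (by omega) (by omega)
  have ek := e k
  simp only [lt_irrefl, if_false, if_true] at ek
  constructor
  · intro j
    rw [e, ek]
    have := h.le j
    split_ifs with hj hj
    · omega
    · omega
    · have := h.lt j (by omega); omega
  · intro j hj
    rw [e, ek]
    have := h.le j
    rw [if_pos hj]
    omega

end Signature


/-! ### Counting blocks by boundaries -/

/-- A form of Hermite's identity. When `y` is raised by one the change of the sum telescopes to `y /
l - (y - l) / l = 1`. -/
theorem sum_div_add_one {l : ℕ} (hl : 0 < l) (y : ℤ) :
    ∑ j : Fin l, ((y - 1 - (j : ℤ)) / l + 1) = y := by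
  rw [Fin.sum_univ_eq_sum_range (fun j : ℕ => (y - 1 - (j : ℤ)) / (l : ℤ) + 1)]
  have hl' : (0 : ℤ) < l := by exact_mod_cast hl
  have step : ∀ y : ℤ, ∑ j ∈ Finset.range l, ((y + 1 - 1 - (j : ℤ)) / l + 1) =
      ∑ j ∈ Finset.range l, ((y - 1 - (j : ℤ)) / l + 1) + 1 := by
    intro y
    rw [← sub_eq_iff_eq_add', ← Finset.sum_sub_distrib]
    have := Finset.sum_range_sub' (fun j : ℕ => (y - (j : ℤ)) / (l : ℤ)) l
    rw [Nat.cast_zero, sub_zero, show (y - (l : ℤ)) = y + l * (-1) by ring,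
      Int.add_mul_ediv_left _ _ hl'.ne'] at this
    rw [show y / (l : ℤ) - (y / l + -1) = 1 by ring] at this
    refine (Finset.sum_congr rfl fun j _ => ?_).trans this
    rw [show y + 1 - 1 - (j : ℤ) = y - j by ring,
      show y - 1 - (j : ℤ) = y - ((j + 1 : ℕ) : ℤ) by push_cast; ring]
    ring
  induction y using Int.induction_on with
  | zero =>
    refine Finset.sum_eq_zero fun j hj => ?_
    have hj' : (j : ℤ) < l := by exact_mod_cast Finset.mem_range.1 hj
    have : (0 - 1 - (j : ℤ)) / l = -1 := by
      rw [Int.ediv_eq_iff_of_pos hl']; constructor <;> omega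
    omega
  | succ i ih => rw [step, ih]
  | pred i ih =>
    have := step (-(i : ℤ) - 1)
    rw [sub_add_cancel, ih] at this
    linarith

/-- The number of rows below `ρ` and not below row `0` that are congruent to `r`. -/
def below (n : ℕ) (r ρ : ℤ) : ℤ := -((r - ρ) / period n)

theorem sum_ind_Ico {n : ℕ} (hn : 4 ≤ n) {r : ℤ} (h0 : 0 ≤ r) (h1 : r < period n) (ρ : ℕ) :
    ∑ x ∈ Finset.Ico (0 : ℤ) ρ, ind n r x = below n r ρ := by
  have hP := period_pos hn
  unfold below
  induction ρ with
  | zero =>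
    simp only [Nat.cast_zero, sub_zero, Finset.Ico_self, Finset.sum_empty]
    rw [Int.ediv_eq_zero_of_lt h0 h1, neg_zero]
  | succ ρ ih =>
    have e : Finset.Ico (0 : ℤ) ((ρ + 1 : ℕ) : ℤ) = insert (ρ : ℤ) (Finset.Ico (0 : ℤ) ρ) := by
      ext x; simp only [Finset.mem_Ico, Finset.mem_insert]; omega
    rw [e, Finset.sum_insert (by simp), ih]
    have a1 := Int.ediv_mul_add_emod (r - ρ) (period n)
    have a2 := Int.emod_nonneg (r - ρ) (b := period n) (by omega)
    have a3 := Int.emod_lt_of_pos (r - ρ) (b := period n) (by omega)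
    have hdvd : period n ∣ (ρ : ℤ) - r ↔ (r - ρ) % period n = 0 := by
      rw [← Int.dvd_iff_emod_eq_zero, ← dvd_neg, neg_sub]
    rcases ind_cases (n := n) r ρ with ⟨hd, e⟩ | ⟨hd, e⟩ <;> rw [hdvd] at hd <;> rw [e]
    · have : (r - ((ρ + 1 : ℕ) : ℤ)) / period n = (r - ρ) / period n - 1 := by
        rw [Int.ediv_eq_iff_of_pos (by omega)]
        push_cast
        rw [sub_mul]
        constructor <;> linarith
      omega
    · have : (r - ((ρ + 1 : ℕ) : ℤ)) / period n = (r - ρ) / period n := by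
        rw [Int.ediv_eq_iff_of_pos (by omega)]
        push_cast
        have : 0 < (r - ρ) % period n := by omega
        constructor <;> linarith
      omega

/-- The number `-((X - 1 - j) / l)` counts the `k ≥ 0` with `X + k * l ≤ j`, that is the rows
congruent to `r` whose copy of the boundary `X` has been passed by `j` (with sign). Rows below the
top row always count; the top row counts if the layer is past its boundary. -/
theorem neg_div_boundary {n l : ℕ} {m : State} (hn : 4 ≤ n) (hl : 0 < l) (h : IsLoose n l m)
    {j : ℤ} {c : Layer} (hc : m.At n j c) {r X : ℤ} (h1 : m.F (r - 1) ≤ X) (h2 : X ≤ m.F r) :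
    ((period n ∣ c.row - r ∧ ¬ j < X + below n r c.row * l) ∧
      -((X - 1 - j) / l) = below n r c.row + 1) ∨
    (¬ (period n ∣ c.row - r ∧ ¬ j < X + below n r c.row * l) ∧
      -((X - 1 - j) / l) = below n r c.row) := by
  have hP := period_pos hn
  have hl' : (0 : ℤ) < l := by exact_mod_cast hl
  have a1 := Int.ediv_mul_add_emod (r - c.row) (period n)
  have a2 := Int.emod_nonneg (r - c.row) (b := period n) (by omega)
  have a3 := Int.emod_lt_of_pos (r - c.row) (b := period n) (by omega)
  obtain ⟨q, hq⟩ : ∃ q, below n r c.row = q := ⟨_, rfl⟩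
  have hq' : (r - c.row) / period n = -q := by unfold below at hq; omega
  rw [hq'] at a1
  rw [hq]
  have hdvd : period n ∣ c.row - r ↔ (r - c.row) % period n = 0 := by
    rw [← Int.dvd_iff_emod_eq_zero, ← dvd_neg, neg_sub]
  rw [hdvd]
  have key : ∀ q' : ℤ, j < X + q' * l → X + (q' - 1) * l ≤ j → (X - 1 - j) / l = -q' := by
    intro q' g1 g2
    rw [Int.ediv_eq_iff_of_pos hl']
    rw [sub_mul, one_mul] at g2
    constructor <;> linarith
  have hFq := h.perF.add_mul r q
  have hFq1 := h.perF.add_mul r (q - 1)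
  have hF1q := h.perF.add_mul (r - 1) q
  have hF1q1 := h.perF.add_mul (r - 1) (q + 1)
  have hlt := hc.lt
  have hge := hc.ge
  rcases a2.eq_or_lt with hz | hz
  · have hrow : c.row = r + q * period n := by rw [← hz] at a1; linarith
    have e1 : m.F (r + (q - 1) * period n) ≤ m.F (c.row - 1) :=
      h.F_mono (by rw [hrow, sub_mul]; linarith)
    have e2 : m.F c.row ≤ m.F (r - 1 + (q + 1) * period n) :=
      h.F_mono (by rw [hrow, add_mul]; linarith)
    by_cases hj : j < X + q * l
    · exact .inr ⟨fun hh => hh.2 hj, by rw [key q hj (by linarith), neg_neg]⟩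
    · refine .inl ⟨⟨hz.symm, hj⟩, ?_⟩
      rw [key (q + 1) (by linarith) (by rw [add_sub_cancel_right]; exact not_lt.1 hj), neg_neg]
  · have e1 : m.F c.row ≤ m.F (r - 1 + q * period n) := h.F_mono (by linarith)
    have e2 : m.F (r + (q - 1) * period n) ≤ m.F (c.row - 1) :=
      h.F_mono (by rw [sub_mul]; linarith)
    exact .inr ⟨fun hh => hz.ne' hh.1, by rw [key q (by linarith) (by linarith), neg_neg]⟩

theorem sum_neg_div {n l : ℕ} {m : State} (h : IsConfig n l m) {r X : ℤ}
    (h1 : m.F (r - 1) ≤ X) (h2 : X ≤ m.F r) :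
    ∑ j : Fin l, -((X - 1 - (j : ℤ)) / l) = l - X := by
  rcases Nat.eq_zero_or_pos l with rfl | hl
  · have e1 := h.F_eq_zero rfl (r - 1)
    have e2 := h.F_eq_zero rfl r
    simp; omega
  · have := sum_div_add_one hl X
    rw [Finset.sum_add_distrib] at this
    simp only [Finset.sum_const, Finset.card_univ, Fintype.card_fin, nsmul_eq_mul, mul_one] at this
    rw [Finset.sum_neg_distrib]
    linarith

variable {n l k i : ℕ} {m : State} {C : Layers l}

theorem row_below {r ρ : ℤ} (hd : period n ∣ ρ - r) (hP : 0 < period n) :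
    ρ = r + below n r ρ * period n := by
  obtain ⟨c, hc⟩ := hd
  have : r - ρ = period n * (-c) := by linarith
  rw [below, this, Int.mul_ediv_cancel_left _ hP.ne']
  linarith

theorem rowCount_thin (hn : 4 ≤ n) (hi : i ≤ 1 ∨ (n - 1 ≤ i ∧ i ≤ n)) (x : ℤ) :
    (rowCount n i x : ℤ) = ind n (-thinRow n i) x := by
  have e : -thinRow n i = ((thinKind n i - 1 : ℕ) : ℤ) := by
    have := thinKind_cases (n := n) i
    unfold thinRow rowOf
    simp only
    omega
  have hP : period n = 2 * (n : ℤ) - 4 := rfl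
  have hk : thinKind n i = if i ≤ 1 then 1 else n - 1 := rfl
  have hd := dvd_sub_iff_pos hn x (-thinRow n i) (by omega) (by
    have := thinKind_cases (n := n) i; omega)
  rw [e] at hd ⊢
  have hlt := pos_lt hn x
  rcases ind_cases (n := n) ((thinKind n i - 1 : ℕ) : ℤ) x with ⟨h, h'⟩ | ⟨h, h'⟩ <;>
    rw [h'] <;> rw [hd] at h <;> unfold rowCount kind <;> split_ifs at hk ⊢ <;> omega

theorem rowCount_unit (hn : 4 ≤ n) (hi : 2 ≤ i ∧ i ≤ n - 2) (x : ℤ) :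
    (rowCount n i x : ℤ) =
      ind n ((i : ℤ) - 1) x + ind n (period n - ((i : ℤ) - 1)) x := by
  have hP : period n = 2 * (n : ℤ) - 4 := rfl
  have hd := dvd_sub_iff_pos hn x ((i : ℤ) - 1) (by omega) (by omega)
  have hd' := dvd_sub_iff_pos hn x (period n - ((i : ℤ) - 1)) (by omega) (by omega)
  have hlt := pos_lt hn x
  rcases ind_cases (n := n) ((i : ℤ) - 1) x with ⟨h, h'⟩ | ⟨h, h'⟩ <;> rw [h'] <;> rw [hd] at h <;>
  rcases ind_cases (n := n) (period n - ((i : ℤ) - 1)) x with ⟨g, g'⟩ | ⟨g, g'⟩ <;>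
    rw [g'] <;> rw [hd'] at g <;> unfold rowCount kind <;> split_ifs <;> omega

open Classical in
/-- The number of layers without a block of colour `i` in one cycle, up to a constant. -/
noncomputable def State.missing (n k i : ℕ) (m : State) : ℤ :=
  if 2 ≤ i ∧ i ≤ n - 2 then m.F ((i : ℤ) - 1) + m.G (-((i : ℤ) - 1))
  else m.T (rearBit n k i) (-thinRow n i)

/-- Passing `G`, `F` or the threshold of colour `i` counts `1`, passing the other threshold `-1`. A
full row thus counts `2`, a broken half of either type `1`, a single block of colour `i` counts `2`
and the other one `0`. -/
theorem layerHalves_thin (hn : 4 ≤ n) (hl : 0 < l) (hi : i ≤ 1 ∨ (n - 1 ≤ i ∧ i ≤ n))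
    (h : IsConfig n l m) {j : ℤ} {c : Layer} (hc : m.At n j c) (h0 : 0 ≤ c.row) :
    layerHalves n k i c = -((m.F (-thinRow n i) - 1 - j) / l) - (m.G (-thinRow n i) - 1 - j) / l
      - (m.T (rearBit n k i) (-thinRow n i) - 1 - j) / l
      + (m.T (!rearBit n k i) (-thinRow n i) - 1 - j) / l := by
  classical
  have hr : IsThin n (-thinRow n i) := (isThin_neg hn).2 (isThin_thinRow hn i)
  have hP : period n = 2 * (n : ℤ) - 4 := rfl
  have hb : 0 ≤ -thinRow n i ∧ -thinRow n i < period n := by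
    have := thinKind_cases (n := n) i
    unfold thinRow rowOf; simp only; omega
  obtain ⟨ρ, hρ⟩ := Int.eq_ofNat_of_zero_le h0
  have hs : ∑ x ∈ Finset.Ico 0 c.row, (rowCount n i x : ℤ) = below n (-thinRow n i) c.row := by
    rw [Finset.sum_congr rfl fun x _ => rowCount_thin hn hi x, hρ, sum_ind_Ico hn hb.1 hb.2]
  have hdr : period n ∣ c.row - -thinRow n i ↔ period n ∣ c.row - thinRow n i := by
    have := dvd_of_isThin hn (isThin_thinRow hn i)
    rw [← dvd_add_left this]
    ring_nf
  generalize hb' : rearBit n k i = b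
  have f1 := neg_div_boundary hn hl h.toIsLoose hc (r := -thinRow n i) (X := m.F (-thinRow n i))
    (by have := h.F_le_G (-thinRow n i); have := h.G_le_F (-thinRow n i); omega) le_rfl
  have f2 := neg_div_boundary hn hl h.toIsLoose hc (r := -thinRow n i) (X := m.G (-thinRow n i))
    (h.F_le_G _) (h.G_le_F _)
  have f3 := fun b => neg_div_boundary hn hl h.toIsLoose hc (r := -thinRow n i)
    (X := m.T b (-thinRow n i)) ((h.F_le_G _).trans (h.G_le_T b _ hr)) (h.T_le_F b _ hr)
  unfold layerHalves
  rw [hs]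
  by_cases hd : period n ∣ c.row - -thinRow n i
  · have hx : IsThin n c.row := (isThin_congr hn hd).2 hr
    obtain ⟨c1, c2⟩ := color_iff hn (k := k) hi hx
    have hrow := row_below hd (by omega)
    have e1 := h.perF.add_mul (-thinRow n i) (below n (-thinRow n i) c.row)
    have e2 := h.perG.add_mul (-thinRow n i) (below n (-thinRow n i) c.row)
    have e3 := fun b => h.T_per_mul hn b hr (below n (-thinRow n i) c.row)
    rw [← hrow] at e1 e2 e3
    simp only [hd, true_and, ← e1, ← e2, ← e3] at f1 f2 f3
    have s1 := hc.single b
    have s2 := hc.single (!b)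
    rw [Bool.not_not] at s2
    have s3 := hc.flat
    have s4 := hc.lt
    have g1 := f3 b
    have g2 := f3 (!b)
    have g3 := h.T_add' b hx
    have g4 := h.G_le_T b _ hx
    have g5 := h.G_le_T (!b) _ hx
    have hrc : (rowCount n i c.row : ℤ) = 1 := by rw [rowCount_thin hn hi, ind_of_dvd hd]
    rw [hb', ← hdr] at c1 c2
    have hd' := hd
    rw [sub_neg_eq_add] at hd'
    cases ht : c.top <;> cases b <;>
      simp [ht, single, hd', hx, c1, c2, hrc] at s1 s2 s3 c1 c2 g1 g2 g3 g4 g5 ⊢ <;> omega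
  · have hz : (match c.top with
        | .flat => 0
        | .rear => if i = rearColor n k c.row then 2 else 0
        | .front => if i = frontColor n k c.row then 2 else 0
        | .half => (rowCount n i c.row : ℤ)) = 0 := by
      have hv : ∀ b, c.top = single b → IsThin n c.row := fun b hb => ((hc.single b).1 hb).1
      cases ht : c.top <;> simp only
      · rw [if_neg fun hh => hd (hdr.2 ((color_iff hn (k := k) hi (hv true ht)).1.1 hh).1)]
      · rw [if_neg fun hh => hd (hdr.2 ((color_iff hn (k := k) hi (hv false ht)).2.1 hh).1)]
      · rw [rowCount_thin hn hi, ind_of_not_dvd hd]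
    refine (congrArg (fun z => 2 * below n (-thinRow n i) c.row + z) hz).trans ?_
    have g1 := f3 b
    have g2 := f3 (!b)
    simp only [hd, false_and, not_false_eq_true, true_and, false_or] at f1 f2 g1 g2
    omega

/-- Colour `i` occurs in two rows of a cycle. In each of them a layer past `G` has a first half and
a layer past `F` also the second. -/
theorem layerHalves_unit (hn : 4 ≤ n) (hl : 0 < l) (hi : 2 ≤ i ∧ i ≤ n - 2)
    (h : IsConfig n l m) {j : ℤ} {c : Layer} (hc : m.At n j c) (h0 : 0 ≤ c.row) :
    layerHalves n k i c = -((m.F ((i : ℤ) - 1) - 1 - j) / l) - (m.G ((i : ℤ) - 1) - 1 - j) / l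
      - (m.F (period n - ((i : ℤ) - 1)) - 1 - j) / l
      - (m.G (period n - ((i : ℤ) - 1)) - 1 - j) / l := by
  classical
  have hP : period n = 2 * (n : ℤ) - 4 := rfl
  have hr := unit_not_thin hn hi
  have hdr : ¬ period n ∣ (i : ℤ) - 1 - (period n - ((i : ℤ) - 1)) := by
    intro hd
    refine hr (isThin_of_dvd_neg hn ?_)
    have := (dvd_add_right (dvd_refl (period n))).2 hd
    rw [← dvd_neg]
    convert this using 1
    ring
  have hr' : ¬ IsThin n (period n - ((i : ℤ) - 1)) := by
    rw [isThin_congr hn (r := -((i : ℤ) - 1)) (by ring_nf; rfl), isThin_neg hn]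
    exact hr
  have hb : 0 ≤ (i : ℤ) - 1 ∧ (i : ℤ) - 1 < period n ∧ 0 ≤ period n - ((i : ℤ) - 1) ∧
    period n - ((i : ℤ) - 1) < period n := by omega
  have hs : ∑ x ∈ Finset.Ico 0 c.row, (rowCount n i x : ℤ) =
      below n ((i : ℤ) - 1) c.row + below n (period n - ((i : ℤ) - 1)) c.row := by
    obtain ⟨ρ, hρ⟩ := Int.eq_ofNat_of_zero_le h0
    rw [Finset.sum_congr rfl fun x _ => rowCount_unit hn hi x, hρ, Finset.sum_add_distrib,
      sum_ind_Ico hn hb.1 hb.2.1, sum_ind_Ico hn hb.2.2.1 hb.2.2.2]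
  have hrc := rowCount_unit hn hi c.row
  have hrear : i ≠ rearColor n k c.row := by unfold rearColor; split_ifs <;> omega
  have hfront : i ≠ frontColor n k c.row := by unfold frontColor; split_ifs <;> omega
  unfold layerHalves
  rw [hs]
  generalize (i : ℤ) - 1 = r at *
  generalize hr₂ : period n - r = r₂ at *
  have f := fun r => neg_div_boundary hn hl h.toIsLoose hc (r := r) (X := m.F r)
    (by have := h.F_le_G r; have := h.G_le_F r; omega) le_rfl
  have g := fun r => neg_div_boundary hn hl h.toIsLoose hc (r := r) (X := m.G r)
    (h.F_le_G _) (h.G_le_F _)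
  have key : ∀ r, ¬ IsThin n r →
      -((m.F r - 1 - j) / l) - (m.G r - 1 - j) / l = 2 * below n r c.row +
        if c.top = .half then ind n r c.row else 0 := by
    intro r hr
    have f1 := f r
    have g1 := g r
    by_cases hd : period n ∣ c.row - r
    · have hrow := row_below hd (by omega)
      have e1 := h.perF.add_mul r (below n r c.row)
      have e2 := h.perG.add_mul r (below n r c.row)
      rw [← hrow] at e1 e2
      simp only [hd, true_and, ← e1, ← e2] at f1 g1
      have s4 := hc.lt
      have hhalf : c.top = .half ↔ ¬ j < m.G c.row := by
        rw [← hc.flat]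
        rcases hc.top_cases with h | h | ⟨b, -, h, -⟩
        · simp [h]
        · simp [h]
        · exact absurd ((isThin_congr hn hd).1 h) hr
      rw [ind_of_dvd hd]
      split_ifs with hh <;> rw [hhalf] at hh <;> omega
    · simp only [hd, false_and, not_false_eq_true, true_and, false_or] at f1 g1
      rw [ind_of_not_dvd hd, ite_self]
      omega
  have k1 := key r hr
  have k2 := key r₂ hr'
  have k3 : ∀ x y : ℤ, (if c.top = .half then x + y else 0) =
    (if c.top = .half then x else 0) + (if c.top = .half then y else 0) := by
      intro x y; split_ifs <;> rfl
  have k4 : (match c.top with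
        | .flat => 0
        | .rear => if i = rearColor n k c.row then 2 else 0
        | .front => if i = frontColor n k c.row then 2 else 0
        | .half => (rowCount n i c.row : ℤ)) =
      if c.top = .half then (ind n r c.row + ind n r₂ c.row) else 0 := by
    cases ht : c.top <;> simp [hrear, hfront, hrc]
  refine (congrArg (fun z => 2 * (below n r c.row + below n r₂ c.row) + z) k4).trans ?_
  rw [k3]
  omega

/-- By Hermite's identity the sum over the layers is linear in the boundaries; `mirror` and `T_add`
reduce it to `missing`. The condition on `F (-1)` says that no layer ends below the ground level,
where blocks are not counted. -/
theorem sum_layerHalves (hn : 4 ≤ n) (hi : i ≤ n) (h : IsConfig n l m) (hC : m.Encodes n C)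
    (h0 : m.F (-1) ≤ 0) :
    ∑ j, layerHalves n k i (C j) = 2 * l - 2 * m.missing n k i := by
  rcases Nat.eq_zero_or_pos l with rfl | hl
  · have hz := h.F_eq_zero rfl
    have hg : ∀ r, m.G r = 0 := fun r => by
      have := h.F_le_G r; have := h.G_le_F r; rw [hz] at *; omega
    have hr : IsThin n (-thinRow n i) := (isThin_neg hn).2 (isThin_thinRow hn i)
    have h1 := h.G_le_T (rearBit n k i) _ hr
    have h2 := h.T_le_F (rearBit n k i) _ hr
    rw [hz] at h2
    rw [hg] at h1
    unfold State.missing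
    split_ifs
    · simp [hz, hg]
    · simp; omega
  have hrow : ∀ j, 0 ≤ (C j).row := by
    intro j
    have := (State.At.row_le_iff h.toIsLoose (hC j) (-1)).not
    have : ¬ (C j).row ≤ -1 := this.2 (by have : (0 : ℤ) ≤ ((j : ℕ) : ℤ) := by positivity
                                          omega)
    omega
  unfold State.missing
  by_cases hu : 2 ≤ i ∧ i ≤ n - 2
  · rw [if_pos hu, Finset.sum_congr rfl fun j _ => layerHalves_unit hn hl hu h (hC j) (hrow j)]
    simp only [sub_eq_add_neg _ (_ / _), Finset.sum_add_distrib]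
    rw [sum_neg_div h (h.F_le_G _ |>.trans (h.G_le_F _)) le_rfl, sum_neg_div h (h.F_le_G _) (h.G_le_F _),
      sum_neg_div h (h.F_le_G _ |>.trans (h.G_le_F _)) le_rfl, sum_neg_div h (h.F_le_G _) (h.G_le_F _)]
    have e1 := h.perF (-((i : ℤ) - 1))
    have e2 := h.perG (-((i : ℤ) - 1))
    rw [neg_add_eq_sub] at e1 e2
    have e3 := h.mirror ((i : ℤ) - 1)
    linarith
  · rw [if_neg hu, Finset.sum_congr rfl fun j _ =>
      layerHalves_thin hn hl (by omega) h (hC j) (hrow j)]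
    have hr : IsThin n (-thinRow n i) := (isThin_neg hn).2 (isThin_thinRow hn i)
    have e3 := fun b => sum_neg_div h ((h.F_le_G _).trans (h.G_le_T b _ hr)) (h.T_le_F b _ hr)
    have e4 := sum_neg_div h (h.F_le_G _) (h.G_le_F (-thinRow n i))
    have e5 := sum_neg_div h (h.F_le_G _ |>.trans (h.G_le_F _)) (le_refl (m.F (-thinRow n i)))
    have g3 := h.T_add' (rearBit n k i) hr
    have e6 := e3 (rearBit n k i)
    have e7 := e3 (!rearBit n k i)
    rw [Finset.sum_neg_distrib] at e4 e5 e6 e7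
    simp only [Finset.sum_add_distrib, Finset.sum_sub_distrib, Finset.sum_neg_distrib]
    linarith


/-! ### Weights -/

theorem sum_cartan {n i : ℕ} (hi : i ≤ n) (S : List ℕ) (hS : S.Nodup) (hiS : i ∉ S)
    (hSn : ∀ c ∈ S, c ≤ n)
    (h : ∀ j ≤ n, j ≠ i → (Edge n i j ∨ Edge n j i ↔ j ∈ S)) (x : ℕ → ℤ) :
    ∑ j ∈ Finset.range (n + 1), cartan n i j * x j = 2 * x i - (S.map x).sum := by
  have e : ∀ j ∈ Finset.range (n + 1), cartan n i j * x j = (if j = i then 2 * x i else 0) -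
      if j ∈ S.toFinset then x j else 0 := by
    intro j hj
    simp only [cartan, List.mem_toFinset]
    by_cases hji : j = i
    · subst hji
      simp [hiS]
    · simp only [if_neg (Ne.symm hji), if_neg hji, h j (by simpa [Nat.lt_succ_iff] using hj) hji]
      split_ifs <;> simp
  rw [Finset.sum_congr rfl e, Finset.sum_sub_distrib, Finset.sum_ite_eq',
    if_pos (by simp; omega), ← List.sum_toFinset _ hS, Finset.sum_ite_mem]
  congr 1
  refine Finset.sum_congr (Finset.inter_eq_right.2 fun c hc => ?_) fun _ _ => rfl
  have := hSn c (List.mem_toFinset.1 hc)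
  simp; omega

variable {n l k i : ℕ} {m : State}

theorem thinRow_of_le (hi : i ≤ 1) : thinRow n i = 0 := by
  simp [thinRow, rowOf, thinKind, hi]

theorem thinRow_of_ge (hn : 4 ≤ n) (hi : n - 1 ≤ i) : thinRow n i = 2 - n := by
  simp only [thinRow, rowOf, thinKind]
  rw [if_neg (by omega)]
  omega

theorem missing_unit (hi : 2 ≤ i ∧ i ≤ n - 2) :
    m.missing n k i = m.F ((i : ℤ) - 1) + m.G (-((i : ℤ) - 1)) := by
  rw [State.missing, if_pos hi]

theorem missing_thin (hi : ¬ (2 ≤ i ∧ i ≤ n - 2)) :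
    m.missing n k i = m.T (rearBit n k i) (-thinRow n i) := by
  rw [State.missing, if_neg hi]

theorem missing_low (hn : 4 ≤ n) (h : IsConfig n l m) :
    m.missing n k 0 + m.missing n k 1 = m.F 0 + m.G 0 := by
  have hr : IsThin n 0 := .inl (by simp [pos])
  have hb : rearBit n k 1 = !rearBit n k 0 := by
    unfold rearBit
    by_cases hk : Even k <;> simp [hk] <;> omega
  rw [missing_thin (by omega), missing_thin (by omega), thinRow_of_le (by omega),
    thinRow_of_le le_rfl, hb, neg_zero]
  exact h.T_add' _ hr

theorem missing_high (hn : 4 ≤ n) (h : IsConfig n l m) :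
    m.missing n k (n - 1) + m.missing n k n = m.F (n - 2) + m.G (n - 2) := by
  have hr : IsThin n (-thinRow n n) := (isThin_neg hn).2 (isThin_thinRow hn n)
  have hb : rearBit n k n = !rearBit n k (n - 1) := by
    unfold rearBit
    have : ¬ (n = 0 ∨ n = n - 1) := by omega
    by_cases hk : Even k <;> simp [hk, this]
  have := h.T_add' (rearBit n k (n - 1)) hr
  rw [missing_thin (by omega), missing_thin (by omega), hb, thinRow_of_ge hn le_rfl]
  rwa [thinRow_of_ge hn (by omega), show -(2 - (n : ℤ)) = n - 2 by ring] at *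

/-- The constant in `phi_sub_eps`. -/
def cartanShift (n l i : ℕ) : ℤ := if n - 1 ≤ i then -l else if i = n - 2 then l else 0

/-- `φ - ε` only involves boundaries in the rows of colour `i` and in the adjacent rows, which
contain the neighbours of `i` in the Dynkin diagram; pairs of thin colours enter through `T_add`.
The constant arises because `missing` uses the row `n - 2` and `φ`, `ε` of the last colours use `2 -
n`, one period apart. It cancels when two states are compared. -/
theorem phi_sub_eps (hn : 4 ≤ n) (hi : i ≤ n) (h : IsConfig n l m) :
    m.phi n k i - m.eps n k i =
      ∑ j ∈ Finset.range (n + 1), cartan n i j * m.missing n k j + cartanShift n l i := by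
  have hP : period n = 2 * (n : ℤ) - 4 := rfl
  have hlow := missing_low (k := k) hn h
  have hhigh := missing_high (k := k) hn h
  have hper := h.perG (2 - n)
  rw [show 2 - (n : ℤ) + period n = n - 2 by omega] at hper
  unfold State.phi State.eps
  by_cases hu : 2 ≤ i ∧ i ≤ n - 2
  · rw [if_pos hu, if_pos hu]
    have e0 := missing_unit (m := m) (k := k) hu
    have hm := h.mirror ((i : ℤ) - 1)
    have h1 := h.mirror ((i : ℤ) - 2)
    unfold State.unitPhi State.unitEps cartanShift
    rw [if_neg (by omega)]
    rw [show (i : ℤ) - 1 - 1 = i - 2 by ring, show -((i : ℤ) - 1) - 1 = -i by ring,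
      show (i : ℤ) - 1 + 1 = i by ring, show -((i : ℤ) - 1) + 1 = -(i - 2) by ring]
    by_cases h2 : i = 2 <;> by_cases h3 : i = n - 2
    · rw [if_pos h3, sum_cartan hi [0, 1, n - 1, n] (by simp; omega) (by simp; omega)
        (by simp; omega) (by intro j hj hji; simp [Edge]; omega)]
      simp only [List.map_cons, List.map_nil, List.sum_cons, List.sum_nil]
      have e1 : (i : ℤ) - 2 = 0 := by omega
      have e2 : (n : ℤ) - 2 = i := by omega
      have e3 : 2 - (n : ℤ) = -i := by omega
      rw [e1] at h1 ⊢
      rw [e2] at hhigh hper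
      rw [e3] at hper
      have := h.mirror i
      simp only [neg_zero] at *
      omega
    · rw [if_neg h3, sum_cartan hi [0, 1, i + 1] (by simp; omega) (by simp; omega)
        (by simp; omega) (by intro j hj hji; simp [Edge]; omega)]
      simp only [List.map_cons, List.map_nil, List.sum_cons, List.sum_nil]
      have e1 : (i : ℤ) - 2 = 0 := by omega
      rw [e1] at h1 ⊢
      have e4 := missing_unit (m := m) (k := k) (n := n) (i := i + 1) (by omega)
      rw [show ((i + 1 : ℕ) : ℤ) - 1 = i by push_cast; ring] at e4
      have := h.mirror i
      simp only [neg_zero] at *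
      omega
    · rw [if_pos h3, sum_cartan hi [i - 1, n - 1, n] (by simp; omega) (by simp; omega)
        (by simp; omega) (by intro j hj hji; simp [Edge]; omega)]
      simp only [List.map_cons, List.map_nil, List.sum_cons, List.sum_nil]
      have e2 : (n : ℤ) - 2 = i := by omega
      have e3 : 2 - (n : ℤ) = -i := by omega
      rw [e2] at hhigh hper
      rw [e3] at hper
      have e4 := missing_unit (m := m) (k := k) (n := n) (i := i - 1) (by omega)
      rw [show ((i - 1 : ℕ) : ℤ) - 1 = i - 2 by omega] at e4
      have := h.mirror i
      omega
    · rw [if_neg h3, sum_cartan hi [i - 1, i + 1] (by simp) (by simp; omega)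
        (by simp; omega) (by intro j hj hji; simp [Edge]; omega)]
      simp only [List.map_cons, List.map_nil, List.sum_cons, List.sum_nil]
      have e4 := missing_unit (m := m) (k := k) (n := n) (i := i - 1) (by omega)
      rw [show ((i - 1 : ℕ) : ℤ) - 1 = i - 2 by omega] at e4
      have e5 := missing_unit (m := m) (k := k) (n := n) (i := i + 1) (by omega)
      rw [show ((i + 1 : ℕ) : ℤ) - 1 = i by push_cast; ring] at e5
      have := h.mirror i
      omega
  · rw [if_neg hu, if_neg hu]
    have e0 := missing_thin (m := m) (k := k) hu
    unfold cartanShift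
    by_cases h1 : i ≤ 1
    · rw [if_neg (by omega), if_neg (by omega), sum_cartan hi [2] (by simp) (by simp; omega)
        (by simp; omega) (by intro j hj hji; simp [Edge]; omega)]
      simp only [List.map_cons, List.map_nil, List.sum_cons, List.sum_nil]
      have e4 := missing_unit (m := m) (k := k) (n := n) (i := 2) (by omega)
      have := h.mirror 1
      rw [thinRow_of_le h1] at *
      norm_num at *
      omega
    · rw [if_pos (by omega), sum_cartan hi [n - 2] (by simp) (by simp; omega)
        (by simp) (by intro j hj hji; simp [Edge]; omega)]
      simp only [List.map_cons, List.map_nil, List.sum_cons, List.sum_nil]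
      have e4 := missing_unit (m := m) (k := k) (n := n) (i := n - 2) (by omega)
      have hr := isThin_thinRow hn i
      have e5 := h.perT (rearBit n k i) _ hr
      have e6 := h.perF (thinRow n i - 1)
      rw [thinRow_of_ge hn (by omega)] at *
      rw [show ((n - 2 : ℕ) : ℤ) - 1 = n - 3 by omega, show -((n : ℤ) - 3) = 2 - n + 1 by ring] at e4
      rw [show 2 - (n : ℤ) - 1 + period n = n - 3 by omega] at e6
      rw [show 2 - (n : ℤ) + period n = -(2 - n) by omega] at e5
      omega

theorem eq_of_rearBit (hn : 4 ≤ n) {j : ℕ} (hi : i ≤ n) (hj : j ≤ n)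
    (hu : ¬ (2 ≤ i ∧ i ≤ n - 2)) (hv : ¬ (2 ≤ j ∧ j ≤ n - 2))
    (h1 : rearBit n k i = rearBit n k j) (h2 : thinRow n i = thinRow n j) : i = j := by
  have h3 : i ≤ 1 ↔ j ≤ 1 := by
    constructor <;> intro h <;> by_contra hh
    · rw [thinRow_of_le h, thinRow_of_ge hn (by omega)] at h2; omega
    · rw [thinRow_of_le h, thinRow_of_ge hn (by omega)] at h2; omega
  unfold rearBit at h1
  rw [decide_eq_decide] at h1
  by_cases hk : Even k <;> simp only [hk, iff_true, iff_false] at h1 <;> omega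

/-- For a unit colour the changes of `F` at `r` and of `G` at `-r` add up to `-1` in each of the
cases of `unitF`; for a thin colour exactly one threshold moves. -/
theorem missing_f (hn : 4 ≤ n) (hi : i ≤ n) (m : State) {j : ℕ} (hj : j ≤ n) :
    (m.f n k i).missing n k j = m.missing n k j - if i = j then 1 else 0 := by
  have hP : period n = 2 * (n : ℤ) - 4 := rfl
  unfold State.f
  by_cases hu : 2 ≤ i ∧ i ≤ n - 2
  · rw [if_pos hu]
    by_cases hv : 2 ≤ j ∧ j ≤ n - 2
    · rw [missing_unit hv, missing_unit hv]
      split_ifs with hij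
      · subst hij
        have hr := unit_not_thin hn hu
        obtain ⟨e1, -, -, e2, -⟩ := State.move_apply (m := m)
          (α := m.hasSlot (-((i : ℤ) - 1)) - 1) (β := m.hasSlot ((i : ℤ) - 1) - 1)
          (γ := -m.hasSlot ((i : ℤ) - 1)) (δ := -m.hasSlot (-((i : ℤ) - 1))) hn hr
        unfold State.unitF
        rw [e1, e2]; ring
      · have d1 : ¬ period n ∣ ((j : ℤ) - 1) - ((i : ℤ) - 1) := fun hd => by
          have h1 := Int.eq_zero_of_abs_lt_dvd hd (by rw [abs_lt]; constructor <;> omega)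
          omega
        have d2 : ¬ period n ∣ ((j : ℤ) - 1) - -((i : ℤ) - 1) := fun hd => by
          have h1 := Int.eq_zero_of_abs_lt_dvd hd (by rw [abs_lt]; constructor <;> omega)
          omega
        have d3 : ¬ period n ∣ -((j : ℤ) - 1) - ((i : ℤ) - 1) := fun hd => d2 (by
          rwa [← dvd_neg, show -((j : ℤ) - 1 - -((i : ℤ) - 1)) = -((j : ℤ) - 1) - ((i : ℤ) - 1) by
            ring])
        have d4 : ¬ period n ∣ -((j : ℤ) - 1) - -((i : ℤ) - 1) := fun hd => d1 (by
          rwa [← dvd_neg, show -((j : ℤ) - 1 - ((i : ℤ) - 1)) = -((j : ℤ) - 1) - -((i : ℤ) - 1) by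
            ring])
        unfold State.unitF
        rw [(State.move_of_not_dvd d1 d2).1, (State.move_of_not_dvd d3 d4).2, sub_zero]
    · rw [missing_thin hv, missing_thin hv, if_neg (by rintro rfl; exact hv hu), sub_zero]
      rfl
  · rw [if_neg hu]
    have hr := isThin_thinRow hn i
    by_cases hv : 2 ≤ j ∧ j ≤ n - 2
    · have hr' := unit_not_thin hn hv
      rw [missing_unit hv, missing_unit hv, if_neg (by rintro rfl; exact hu hv), sub_zero,
        (State.thinMove_of_not_dvd fun hd => hr' ((isThin_congr hn hd).2 hr)).1,
        (State.thinMove_of_not_dvd fun hd =>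
          hr' ((isThin_neg hn).1 ((isThin_congr hn hd).2 hr))).2.1]
    · rw [missing_thin hv, missing_thin hv]
      simp only [State.thinMove]
      by_cases hij : i = j
      · subst hij
        rw [if_pos rfl, if_pos rfl, ind_of_dvd (dvd_of_isThin hn hr)]; ring
      · rw [if_neg hij]
        by_cases hb : rearBit n k j = rearBit n k i
        · have hne : thinRow n j ≠ thinRow n i := fun hh => hij
            (eq_of_rearBit hn hi hj hu hv hb.symm hh.symm)
          rw [if_pos hb, ind_of_not_dvd, mul_zero, add_zero, sub_zero]
          intro hd
          have hd' : period n ∣ thinRow n j - thinRow n i := by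
            have := dvd_of_isThin hn (isThin_thinRow hn j)
            have := dvd_sub hd this
            rwa [show -thinRow n j - thinRow n i - (-thinRow n j - thinRow n j) =
              thinRow n j - thinRow n i by ring] at this
          have h0 : ∀ i : ℕ, thinRow n i = 0 ∨ thinRow n i = 2 - n := fun i => by
            have := thinKind_cases (n := n) i
            unfold thinRow rowOf; simp only; omega
          have h1 := h0 i
          have h2 := h0 j
          have := Int.eq_zero_of_abs_lt_dvd hd' (by rw [abs_lt]; constructor <;> omega)
          omega
        · rw [if_neg hb]; ring

theorem missing_mono {m' : State} (hn : 4 ≤ n) (hF : ∀ r, m'.F r ≤ m.F r) (hG : ∀ r, m'.G r ≤ m.G r)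
    (hT : ∀ b r, IsThin n r → m'.T b r ≤ m.T b r) : m'.missing n k i ≤ m.missing n k i := by
  by_cases hu : 2 ≤ i ∧ i ≤ n - 2
  · rw [missing_unit hu, missing_unit hu]
    exact add_le_add (hF _) (hG _)
  · rw [missing_thin hu, missing_thin hu]
    exact hT _ _ ((isThin_neg hn).2 (isThin_thinRow hn i))


/-! ### Ground states -/

section Run

variable {n : ℕ} {m : State}

/-- The layers `L` have the numbers `s, ..., e - 1`. -/
def Run (n : ℕ) (m : State) (s e : ℤ) (L : List Layer) : Prop :=
  s + (L.length : ℤ) = e ∧ ∀ (j : ℕ) (h : j < L.length), m.At n (s + j) L[j]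

theorem Run.append {s e e' : ℤ} {L L' : List Layer} (h : Run n m s e L) (h' : Run n m e e' L') :
    Run n m s e' (L ++ L') := by
  refine ⟨by rw [List.length_append, ← h'.1, ← h.1]; push_cast; ring, fun j hj => ?_⟩
  rw [List.getElem_append]
  split_ifs with hlt
  · exact h.2 j hlt
  · rw [List.length_append] at hj
    have := h'.2 (j - L.length) (by omega)
    rw [← h.1] at this
    rwa [show s + (L.length : ℤ) + ((j - L.length : ℕ) : ℤ) = s + j by omega] at this

theorem Run.replicate {s e : ℤ} {c : Layer} {k : ℕ} (he : s + k = e)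
    (h : ∀ j, s ≤ j → j < e → m.At n j c) : Run n m s e (List.replicate k c) := by
  refine ⟨by simpa using he, fun j hj => ?_⟩
  rw [List.getElem_replicate]
  rw [List.length_replicate] at hj
  exact h _ (by omega) (by omega)

theorem Run.nil (s : ℤ) : Run n m s s [] := ⟨by simp, fun j hj => by simp at hj⟩

theorem Run.flatMap_range {S : ℕ → ℤ} {g : ℕ → List Layer} {K : ℕ}
    (h : ∀ y < K, Run n m (S y) (S (y + 1)) (g y)) :
    Run n m (S 0) (S K) ((List.range K).flatMap g) := by
  induction K with
  | zero => exact Run.nil _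
  | succ K ih =>
    rw [List.range_succ, List.flatMap_append, List.flatMap_singleton]
    exact (ih fun y hy => h y (by omega)).append (h K (by omega))

theorem Run.flatMap_range_reverse {S : ℕ → ℤ} {g : ℕ → List Layer} {K : ℕ}
    (h : ∀ y < K, Run n m (S (y + 1)) (S y) (g y)) :
    Run n m (S K) (S 0) ((List.range K).reverse.flatMap g) := by
  induction K with
  | zero => exact Run.nil _
  | succ K ih =>
    rw [List.range_succ, List.reverse_append, List.reverse_singleton, List.singleton_append,
      List.flatMap_cons]
    exact (h K (by omega)).append (ih fun y hy => h y (by omega))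

end Run

variable {n : ℕ} (a : Fin (n + 1) → ℕ)

/-- The number of layers of a ground-state column whose top is in the row `y`. -/
def groundWidth (y : ℕ) : ℕ :=
  if y = 0 then coeff a 0 + coeff a 1
  else if y = n - 2 then coeff a (n - 1) + coeff a n
  else if y < n - 2 then coeff a (y + 1) else coeff a (2 * n - 3 - y)

/-- The number of layers of a ground-state column whose top is below the row `y`. -/
def groundSum (y : ℕ) : ℕ := ∑ x ∈ Finset.range y, groundWidth a x

/-- The number of layers with the top in a thin row that are in front of the rear or front blocks. -/
def groundThin (b : Bool) (y : ℕ) : ℕ :=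
  if y = 0 then (if b then coeff a 0 else coeff a 1)
  else (if b then coeff a (n - 1) else coeff a n)

theorem groundWidth_zero : groundWidth a 0 = coeff a 0 + coeff a 1 := rfl

theorem groundWidth_mid (hn : 4 ≤ n) : groundWidth a (n - 2) = coeff a (n - 1) + coeff a n := by
  rw [groundWidth, if_neg (by omega : ¬ n - 2 = 0), if_pos rfl]

theorem groundWidth_low {y : ℕ} (h0 : 0 < y) (h : y < n - 2) :
    groundWidth a y = coeff a (y + 1) := by
  rw [groundWidth, if_neg h0.ne', if_neg h.ne, if_pos h]

theorem groundWidth_high {y : ℕ} (h : n - 2 < y) : groundWidth a y = coeff a (2 * n - 3 - y) := by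
  rw [groundWidth, if_neg (by omega : ¬ y = 0), if_neg h.ne', if_neg h.not_gt]

theorem groundSum_succ (y : ℕ) : groundSum a (y + 1) = groundSum a y + groundWidth a y :=
  Finset.sum_range_succ _ _

theorem groundSum_period (hn : 4 ≤ n) : groundSum a (2 * n - 4) = level a := by
  obtain ⟨m, rfl⟩ : ∃ m, n = m + 4 := ⟨n - 4, by omega⟩
  have h : ∑ i ∈ Finset.Icc 2 (m + 4 - 2), coeff a i = ∑ i ∈ Finset.range (m + 1),
      coeff a (i + 2) := by
    rw [Finset.range_eq_Ico, Finset.sum_Ico_add' (fun i => coeff a i) 0 (m + 1) 2]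
    rfl
  have e1 : groundSum a (1 + (m + 1)) =
      groundWidth a 0 + ∑ i ∈ Finset.range (m + 1), coeff a (i + 2) := by
    rw [groundSum, Finset.sum_range_add, Finset.sum_range_one]
    congr 1
    refine Finset.sum_congr rfl fun i hi => ?_
    have := Finset.mem_range.1 hi
    rw [groundWidth_low a (by omega) (by omega)]
    congr 1; omega
  have e2 : groundSum a (m + 3 + (m + 1)) =
      groundSum a (m + 3) + ∑ i ∈ Finset.range (m + 1), coeff a (i + 2) := by
    rw [groundSum, Finset.sum_range_add]
    congr 1
    rw [← Finset.sum_range_reflect]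
    refine Finset.sum_congr rfl fun i hi => ?_
    have := Finset.mem_range.1 hi
    rw [groundWidth_high a (by omega)]
    congr 1; omega
  have e3 := groundSum_succ a (m + 2)
  rw [show 2 * (m + 4) - 4 = m + 3 + (m + 1) by omega, e2, e3,
    show m + 2 = 1 + (m + 1) by ring, e1, level, h]
  have e4 := groundWidth_mid a hn
  rw [show m + 4 - 2 = 1 + (m + 1) by omega] at e4
  rw [e4, groundWidth_zero]
  ring

theorem groundWidth_symm (hn : 4 ≤ n) {y : ℕ} (h0 : 0 < y) (h : y < 2 * n - 4) :
    groundWidth a (2 * n - 4 - y) = groundWidth a y := by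
  rcases lt_trichotomy y (n - 2) with h1 | rfl | h1
  · rw [groundWidth_high a (by omega), groundWidth_low a h0 h1]; congr 1; omega
  · congr 1; omega
  · rw [groundWidth_low a (by omega) (by omega), groundWidth_high a h1]; congr 1; omega

theorem groundThin_add (hn : 4 ≤ n) {y : ℕ} (hy : y = 0 ∨ y = n - 2) :
    groundThin a true y + groundThin a false y = groundWidth a y := by
  rcases hy with rfl | rfl
  · simp [groundThin, groundWidth]
  · have : n - 2 ≠ 0 := by omega
    simp [groundThin, groundWidth, this]

open Classical in
/-- The boundaries of the ground-state columns. -/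
noncomputable def groundState : State where
  F r := level a * (r / period n) + groundSum a (pos n r + 1)
  G r := level a * (r / period n) + groundSum a (pos n r)
  T b r := if IsThin n r then level a * (r / period n) + groundSum a (pos n r) +
    groundThin a b (pos n r) else 0

/-- No layer of a ground-state column is flat, so every row starts where the previous one ends.
Termination is then obvious, and so is the equality of `φ` and `ε` for adjacent columns. -/
theorem groundState_F_pred (hn : 4 ≤ n) (r : ℤ) :
    (groundState a).F (r - 1) = (groundState a).G r := by
  have hP : period n = 2 * (n : ℤ) - 4 := rfl
  have h1 := Int.ediv_mul_add_emod r (period n)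
  have h2 := pos_cast hn r
  have h3 := pos_lt hn r
  have h4 := pos_cast hn (r - 1)
  have hS := groundSum_period a hn
  unfold groundState
  simp only
  rcases Nat.eq_zero_or_pos (pos n r) with hz | hz
  · have e1 : (r - 1) / period n = r / period n - 1 := by
      rw [Int.ediv_eq_iff_of_pos (by omega), sub_mul]
      constructor <;> omega
    have e2 := Int.ediv_mul_add_emod (r - 1) (period n)
    rw [e1, sub_mul] at e2
    have e3 : pos n (r - 1) + 1 = 2 * n - 4 := by omega
    rw [e1, e3, hS, hz]
    simp only [groundSum, Finset.range_zero, Finset.sum_empty]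
    push_cast; ring
  · have e1 : (r - 1) / period n = r / period n := by
      rw [Int.ediv_eq_iff_of_pos (by omega)]
      constructor <;> omega
    have e2 := Int.ediv_mul_add_emod (r - 1) (period n)
    rw [e1] at e2
    have e3 : pos n (r - 1) + 1 = pos n r := by omega
    rw [e1, e3]

theorem groundState_F (r : ℤ) :
    (groundState a).F r = (groundState a).G r + groundWidth a (pos n r) := by
  simp only [groundState, groundSum_succ]
  push_cast; ring

theorem groundState_T (b : Bool) {r : ℤ} (hr : IsThin n r) :
    (groundState a).T b r = (groundState a).G r + groundThin a b (pos n r) := by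
  simp only [groundState, if_pos hr]

theorem groundThin_le (hn : 4 ≤ n) (b : Bool) {r : ℤ} (hr : IsThin n r) :
    groundThin a b (pos n r) ≤ groundWidth a (pos n r) := by
  rw [← groundThin_add a hn hr]
  cases b <;> omega

theorem add_period_ediv (hn : 4 ≤ n) (r : ℤ) :
    (r + period n) / period n = r / period n + 1 ∧ pos n (r + period n) = pos n r := by
  have := period_pos hn
  exact ⟨Int.add_ediv_of_dvd_right (dvd_refl _) |>.trans (by rw [Int.ediv_self (by omega)]),
    by simp [pos]⟩

theorem groundState_isSliceState (hn : 4 ≤ n) : IsSliceState n (level a) (groundState a) := by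
  have hP : period n = 2 * (n : ℤ) - 4 := rfl
  have hG : QuasiPeriodic n (level a) (groundState a).G := fun r => by
    obtain ⟨h1, h2⟩ := add_period_ediv hn r
    simp only [groundState, h1, h2]; ring
  -- The multiplicity `a_i` of halves in the supporting and in the covering row of colour `i` is the
  -- same; this gives `mirror`.
  have hw : ∀ r, groundWidth a (pos n (-r)) = groundWidth a (pos n r) := by
    intro r
    have h1 := pos_cast hn r
    have h2 := pos_cast hn (-r)
    have h3 := pos_lt hn r
    have h4 := pos_lt hn (-r)
    have h5 : (period n) ∣ (pos n r : ℤ) + pos n (-r) := by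
      rw [h1, h2]
      have e1 := Int.ediv_mul_add_emod r (period n)
      have e2 := Int.ediv_mul_add_emod (-r) (period n)
      exact ⟨-(r / period n) - (-r / period n), by linear_combination e1 + e2⟩
    obtain ⟨q, hq⟩ := h5
    have hq0 : 0 ≤ q := by by_contra hh; push Not at hh; nlinarith
    have hq2 : q < 2 := by by_contra hh; push Not at hh; nlinarith
    interval_cases q
    · congr 1; omega
    · rcases Nat.eq_zero_or_pos (pos n r) with hz | hz
      · omega
      · rw [← groundWidth_symm a hn hz (by omega)]
        congr 1; omega
  refine ⟨⟨⟨fun r => ?_, hG, fun b r hr => ?_, fun r => (groundState_F_pred a hn r).le,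
    fun r => ?_, fun b r hr => ?_, fun b r hr => ?_⟩, fun r => ?_, fun r hr => ?_, fun b r hr => ?_,
    fun hl r => ?_⟩, fun r => .inl (groundState_F_pred a hn r).symm⟩
  · rw [groundState_F, groundState_F, hG, (add_period_ediv hn r).2]; ring
  · have hr' : IsThin n (r + period n) := (isThin_congr hn (by simp)).2 hr
    rw [groundState_T a b hr, groundState_T a b hr', hG, (add_period_ediv hn r).2]; ring
  · rw [groundState_F]; omega
  · rw [groundState_T a b hr]; omega
  · rw [groundState_T a b hr, groundState_F]
    have := groundThin_le a hn b hr
    omega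
  · rw [groundState_F, groundState_F, hw]; ring
  · rw [groundState_T a _ hr, groundState_T a _ hr, groundState_F]
    have := groundThin_add a hn hr
    omega
  · simp only [groundState, if_neg hr]
  · have h1 : groundSum a (pos n r + 1) ≤ groundSum a (2 * n - 4) :=
      Finset.sum_le_sum_of_subset (Finset.range_mono (by have := pos_lt hn r; omega))
    rw [groundSum_period a hn, hl] at h1
    simp only [groundState, hl]
    omega

theorem pos_natCast (hn : 4 ≤ n) {y : ℕ} (hy : y < 2 * n - 4) : pos n y = y := by
  have hP : period n = 2 * (n : ℤ) - 4 := rfl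
  have := pos_cast hn (y : ℤ)
  rw [Int.emod_eq_of_lt (by omega) (by omega)] at this
  exact_mod_cast this

theorem groundState_G_nat (hn : 4 ≤ n) {y : ℕ} (hy : y < 2 * n - 4) :
    (groundState a).G y = groundSum a y := by
  have hP : period n = 2 * (n : ℤ) - 4 := rfl
  simp only [groundState, pos_natCast hn hy]
  rw [Int.ediv_eq_zero_of_lt (by omega) (by omega)]
  simp

theorem groundState_at (hn : 4 ≤ n) {y : ℕ} (hy : y < 2 * n - 4) {t : Top} (ht : t ≠ .flat) {j : ℤ}
    (h1 : groundSum a y ≤ j) (h2 : j < groundSum a (y + 1))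
    (h3 : ∀ b, t = single b ↔ (y = 0 ∨ y = n - 2) ∧ (groundSum a y : ℤ) + groundThin a b y ≤ j ∧
      j < groundSum a y + groundThin a (!b) y) {r : ℤ} (hr : r = y) :
    (groundState a).At n j ⟨r, t⟩ := by
  subst hr
  have hG := groundState_G_nat a hn hy
  have hF := groundState_F a (n := n) y
  rw [hG, pos_natCast hn hy] at hF
  rw [groundSum_succ] at h2
  push_cast at h2
  refine ⟨?_, ?_, ?_, fun b => ?_⟩
  · simp only [groundState_F_pred a hn, hG]; exact h1
  · simp only [hF]; exact h2
  · simp only [hG]; exact ⟨fun h => absurd h ht, fun h => by omega⟩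
  · have hthin : IsThin n (y : ℤ) ↔ y = 0 ∨ y = n - 2 := by rw [IsThin, pos_natCast hn hy]
    rw [h3 b]
    simp only
    by_cases hth : IsThin n (y : ℤ)
    · rw [groundState_T a b hth, groundState_T a (!b) hth, hG, pos_natCast hn hy, hthin]
    · rw [hthin] at hth
      rw [hthin]
      tauto

theorem run_unit (hn : 4 ≤ n) {y : ℕ} (hy : y < 2 * n - 4) (h0 : y ≠ 0) (h1 : y ≠ n - 2) {K : ℕ}
    (hK : K = groundWidth a y) {r : ℤ} (hr : r = y) :
    Run n (groundState a) (groundSum a y) (groundSum a (y + 1)) (List.replicate K ⟨r, .half⟩) := by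
  refine Run.replicate (by rw [groundSum_succ, hK]; push_cast; ring) fun j hj hj' => ?_
  refine groundState_at a hn hy (by simp) hj hj' (fun b => ?_) hr
  cases b <;> simp [single, h0, h1]

theorem run_thin (hn : 4 ≤ n) {y : ℕ} (hy : y = 0 ∨ y = n - 2) {p q : ℕ}
    (hp : p = groundThin a true y) (hq : q = groundThin a false y) {r : ℤ} (hr : r = y) :
    Run n (groundState a) (groundSum a y) (groundSum a (y + 1))
      (List.replicate (min p q) ⟨r, .half⟩ ++ (if p ≤ q then List.replicate (q - p) ⟨r, .rear⟩
        else List.replicate (p - q) ⟨r, .front⟩) ++ List.replicate (min p q) ⟨r, .half⟩) := by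
  have hy' : y < 2 * n - 4 := by omega
  have hw := groundThin_add a hn hy
  have hs := groundSum_succ a y
  refine (Run.append (e := groundSum a y + min p q) (e' := groundSum a y + max p q)
    (Run.replicate (by push_cast; ring) ?_) ?_).append (Run.replicate (by omega) ?_)
  · intro j h1 h2
    refine groundState_at a hn hy' (by simp) h1 (by omega) (fun b => ?_) hr
    cases b <;> simp [single] <;> omega
  · split_ifs with hpq <;> refine Run.replicate (by omega) fun j h1 h2 =>
      groundState_at a hn hy' (by simp) (by omega) (by omega) (fun b => ?_) hr <;>
      cases b <;> simp [single] <;> omega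
  · intro j h1 h2
    refine groundState_at a hn hy' (by simp) (by omega) h2 (fun b => ?_) hr
    cases b <;> simp [single] <;> omega

theorem run_groundList (hn : 4 ≤ n) :
    Run n (groundState a) 0 (level a) (groundList a) := by
  -- One of the two truncated differences vanishes, so that the order of the rear and front pieces
  -- in the list is immaterial.
  have e1 : ∀ (p q : ℕ) (r : ℤ), List.replicate (q - p) (⟨r, .rear⟩ : Layer) ++
      List.replicate (p - q) ⟨r, .front⟩ = if p ≤ q then List.replicate (q - p) ⟨r, .rear⟩
        else List.replicate (p - q) ⟨r, .front⟩ := by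
    intro p q r
    split_ifs with h
    · rw [show p - q = 0 by omega]; simp
    · rw [show q - p = 0 by omega]; simp
  have e2 : ∀ (p q : ℕ) (r : ℤ), List.replicate (p - q) (⟨r, .front⟩ : Layer) ++
      List.replicate (q - p) ⟨r, .rear⟩ = if p ≤ q then List.replicate (q - p) ⟨r, .rear⟩
        else List.replicate (p - q) ⟨r, .front⟩ := by
    intro p q r
    split_ifs with h
    · rw [show p - q = 0 by omega]; simp
    · rw [show q - p = 0 by omega]; simp
  have h1 := run_thin a hn (y := 0) (.inl rfl) (p := coeff a 0) (q := coeff a 1) rfl rfl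
    (r := 0) rfl
  have hne : n - 2 ≠ 0 := by omega
  have h3 := run_thin a hn (y := n - 2) (.inr rfl) (p := coeff a (n - 1)) (q := coeff a n)
    (by simp [groundThin, hne]) (by simp [groundThin, hne]) (r := (n : ℤ) - 2) (by omega)
  have h2 := Run.flatMap_range (n := n) (m := groundState a) (S := fun y => groundSum a (y + 1))
    (g := fun m => List.replicate (coeff a (m + 2)) ⟨(m : ℤ) + 1, .half⟩) (K := n - 3)
    fun y hy => run_unit a hn (y := y + 1) (by omega) (by omega) (by omega)
      (groundWidth_low a (by omega) (by omega)).symm (by push_cast; ring)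
  have h4 := Run.flatMap_range_reverse (n := n) (m := groundState a)
    (S := fun y => groundSum a (2 * n - 4 - y))
    (g := fun m => List.replicate (coeff a (m + 2)) ⟨2 * (n : ℤ) - 5 - (m : ℤ), .half⟩) (K := n - 3)
    fun y hy => by
      have := run_unit a hn (y := 2 * n - 4 - (y + 1)) (by omega) (by omega) (by omega)
        (K := coeff a (y + 2)) (by rw [groundWidth_high a (by omega)]; congr 1; omega)
        (r := 2 * (n : ℤ) - 5 - (y : ℤ)) (by omega)
      rwa [show 2 * n - 4 - (y + 1) + 1 = 2 * n - 4 - y by omega] at this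
  simp only [zero_add, Nat.sub_zero, groundSum_period a hn] at h1 h2 h4
  rw [show n - 3 + 1 = n - 2 by omega] at h2
  rw [show n - 2 + 1 = 2 * n - 4 - (n - 3) by omega] at h3
  have h0 : groundSum a 0 = 0 := rfl
  rw [h0, Nat.cast_zero] at h1
  have := ((h1.append h2).append h3).append h4
  rw [← e1, ← e2] at this
  rw [groundList]
  simpa only [List.append_assoc] using this

theorem encodes_groundWall (hn : 4 ≤ n) (k : ℕ) :
    (groundState a).Encodes n (groundWall (level a) a k) := by
  intro j
  obtain ⟨h1, h2⟩ := run_groundList a hn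
  have hj : (j : ℕ) < (groundList a).length := by have := j.2; omega
  have := h2 j hj
  rw [zero_add] at this
  simpa [groundWall, hj] using this

/-- In the signature of the ground state the letters of adjacent columns cancel, and only the `a_i`
zeros of column `0` remain. For thin colours the second threshold enters because the bit alternates,
and `T_add` balances it. -/
theorem groundState_phi_eps (hn : 4 ≤ n) {i : ℕ} (hi : i ≤ n) (k : ℕ) :
    (groundState a).phi n (k + 1) i = (groundState a).eps n k i ∧
    (groundState a).phi n 0 i = coeff a i := by
  have hP : period n = 2 * (n : ℤ) - 4 := rfl
  have hs := groundState_isSliceState a hn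
  unfold State.phi State.eps
  by_cases hu : 2 ≤ i ∧ i ≤ n - 2
  · simp only [if_pos hu]
    have hp : pos n ((i : ℤ) - 1) = i - 1 := by
      rw [show (i : ℤ) - 1 = ((i - 1 : ℕ) : ℤ) by omega]
      exact pos_natCast hn (by omega)
    have hw := groundState_F a ((i : ℤ) - 1)
    rw [hp, groundWidth_low a (by omega) (by omega), show i - 1 + 1 = i by omega] at hw
    have e1 := groundState_F_pred a hn ((i : ℤ) - 1)
    have e2 := groundState_F_pred a hn (-((i : ℤ) - 1))
    have e3 := groundState_F_pred a hn ((i : ℤ) - 1 + 1)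
    have e4 := groundState_F_pred a hn (-((i : ℤ) - 1) + 1)
    rw [add_sub_cancel_right] at e3 e4
    unfold State.unitPhi State.unitEps
    omega
  · simp only [if_neg hu]
    have hr := isThin_thinRow hn i
    have e1 := groundState_F_pred a hn (thinRow n i)
    have e3 := groundState_F_pred a hn (thinRow n i + 1)
    rw [add_sub_cancel_right] at e3
    have hT := fun b => groundState_T a b hr
    have hF := groundState_F a (thinRow n i)
    have hadd := hs.T_add' (rearBit n k i) hr
    rw [rearBit_succ]
    refine ⟨by omega, ?_⟩
    rw [hT, e1]
    by_cases h1 : i ≤ 1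
    · rw [thinRow_of_le h1, show pos n 0 = 0 by simp [pos]]
      have : i = 0 ∨ i = 1 := by omega
      have hn1 : ¬ 1 = n - 1 := by omega
      rcases this with rfl | rfl <;> simp [groundThin, rearBit, hn1]
    · have hp : pos n (2 - n) = n - 2 := by
        rw [pos_congr (r := ((n - 2 : ℕ) : ℤ)) ⟨-1, by omega⟩]
        exact pos_natCast hn (by omega)
      rw [thinRow_of_ge hn (by omega), hp]
      have hn2 : n - 2 ≠ 0 := by omega
      have : i = n - 1 ∨ i = n := by omega
      rcases this with rfl | rfl
      · simp [groundThin, rearBit, hn2]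
      · have : ¬ (i = 0 ∨ i = i - 1) := by omega
        simp [groundThin, rearBit, hn2, this]


/-! ### Walls -/

/-- The columns `Y` have the boundaries `M`, and form a proper Young wall built on the ground-state
wall. -/
structure IsWall {n : ℕ} (a : Fin (n + 1) → ℕ) (M : ℕ → State) (Y : Columns (level a)) : Prop where
  slice : ∀ k, IsSliceState n (level a) (M k)
  encodes : ∀ k, (M k).Encodes n (Y k)
  rel : ∀ k, (M (k + 1)).Rel n (M k)
  stable : ∃ K, ∀ k ≥ K, M k = groundState a

section

variable {n i : ℕ} {a : Fin (n + 1) → ℕ} {M : ℕ → State} {Y : Columns (level a)}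

theorem IsWall.F_mono (h : IsWall a M Y) (r : ℤ) : Monotone fun k => (M k).F r :=
  monotone_nat_of_le_succ fun k => (h.rel k).F_le (h.slice k).toIsLoose r

theorem IsWall.G_mono (h : IsWall a M Y) (r : ℤ) : Monotone fun k => (M k).G r :=
  monotone_nat_of_le_succ fun k => ((h.rel k).G_le r).trans ((h.slice (k + 1)).F_le_G r)

theorem IsWall.T_mono (h : IsWall a M Y) (b : Bool) (r : ℤ) : Monotone fun k => (M k).T b r :=
  monotone_nat_of_le_succ fun k => by
    by_cases hr : IsThin n r
    · exact (h.rel k).T_le b r hr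
    · rw [(h.slice k).T_eq_zero b r hr, (h.slice (k + 1)).T_eq_zero b r hr]

theorem IsWall.le_ground (h : IsWall a M Y) (k : ℕ) : (∀ r, (M k).F r ≤ (groundState a).F r) ∧
    (∀ r, (M k).G r ≤ (groundState a).G r) ∧ ∀ b r, (M k).T b r ≤ (groundState a).T b r := by
  obtain ⟨K, hK⟩ := h.stable
  rw [← hK (max k K) (le_max_right _ _)]
  exact ⟨fun r => h.F_mono r (le_max_left _ _), fun r => h.G_mono r (le_max_left _ _),
    fun b r => h.T_mono b r (le_max_left _ _)⟩

/-- `Rel` makes all boundaries weakly increase with the column number up to those of the ground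
state. So a column always contains the ground-state column, and finiteness of the change is all that
has to be known about the far columns. -/
theorem mem_properWallsOn (hn : 4 ≤ n) :
    Y ∈ ProperWallsOn (level a) a ↔ ∃ M, IsWall a M Y := by
  have hg := groundState_isSliceState a hn
  have eg := encodes_groundWall a hn
  constructor
  · rintro ⟨⟨⟨h1, h2⟩, h3⟩, h4, -⟩
    choose M hM eM using fun k => (isSlice_iff hn).1 (h1 k)
    refine ⟨M, hM, eM, fun k => rel_of_noFreeSpace hn (hM _) (hM _) (eM _) (eM _) fun j =>
      ⟨h2 k j, fun ⟨t1, t2, t3⟩ => h3 j (k + 1) k (by omega) t1 t2 t3⟩, ?_⟩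
    obtain ⟨K, hK⟩ := h4.bddAbove
    refine ⟨K + 1, fun k hk => ?_⟩
    have hY : Y k = groundWall (level a) a k := by
      by_contra hh
      have := hK hh
      omega
    exact State.Encodes.state_unique hn (hM k).toIsConfig hg.toIsConfig (eM k) (hY ▸ eg k)
  · rintro ⟨M, h⟩
    -- Properness for distant columns follows from adjacent ones: `G` of column `k` is bounded by
    -- `F` of column `k + 1` one row lower, and `F` increases with the column number.
    have key : ∀ j k k', k < k' → (Y k j).top = Top.flat → (Y k' j).top = Top.flat →
        (Y k j).row ≠ (Y k' j).row := by
      intro j k k' hlt t1 _ hrow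
      have e1 := (h.encodes k j).flat.1 t1
      have e2 := (h.encodes k' j).ge
      have e3 := (h.rel k).G_le (Y k j).row
      have e4 := h.F_mono ((Y k j).row - 1) (show k + 1 ≤ k' from hlt)
      simp only at e4
      rw [hrow] at e1 e3 e4
      omega
    refine ⟨⟨⟨fun k => (isSlice_iff hn).2 ⟨M k, h.slice k, h.encodes k⟩, fun k j =>
      (h.rel k).noFreeSpace hn (h.slice _) (h.slice _) (h.encodes _) (h.encodes _) j⟩,
      fun j k k' hne t1 t2 => ?_⟩, ?_, fun k => ?_⟩
    · rcases lt_or_gt_of_ne hne with hlt | hlt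
      · exact key j k k' hlt t1 t2
      · exact (key j k' k hlt t2 t1).symm
    · obtain ⟨K, hK⟩ := h.stable
      refine (Set.finite_Iio K).subset fun k hk => ?_
      by_contra hh
      have hh' : K ≤ k := not_lt.1 hh
      have := h.encodes k
      rw [hK k hh'] at this
      exact hk (State.Encodes.ext hg.toIsLoose this (eg k))
    · obtain ⟨l1, l2, l3⟩ := h.le_ground k
      exact exists_splitForm_sub hn hg (h.slice k) (eg k) (h.encodes k) l1 l2 l3

/-! ### Counting blocks of walls -/

/-- The number of blocks of colour `i` added in the columns `0, ..., K - 1`. -/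
noncomputable def added (a : Fin (n + 1) → ℕ) (M : ℕ → State) (K i : ℕ) : ℤ :=
  ∑ k ∈ Finset.range K, ((groundState a).missing n k i - (M k).missing n k i)

theorem IsWall.addedHalves_eq (hn : 4 ≤ n) (h : IsWall a M Y) (hi : i ≤ n) {K : ℕ}
    (hK : ∀ k ≥ K, M k = groundState a) : addedHalves a i Y = 2 * added a M K i := by
  have hg := groundState_isSliceState a hn
  have hz : (groundState a).F (-1) = 0 := by
    have := groundState_F_pred a hn 0
    rw [zero_sub] at this
    rw [this]
    have := groundState_G_nat a hn (y := 0) (by omega)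
    simpa [groundSum] using this
  have e : ∀ k, ∑ j, (layerHalves n k i (Y k j) - layerHalves n k i (groundWall (level a) a k j)) =
      2 * ((groundState a).missing n k i - (M k).missing n k i) := by
    intro k
    rw [Finset.sum_sub_distrib, sum_layerHalves hn hi (h.slice k).toIsConfig (h.encodes k)
      (((h.le_ground k).1 _).trans hz.le), sum_layerHalves hn hi hg.toIsConfig
      (encodes_groundWall a hn k) hz.le]
    ring
  rw [addedHalves, added, Finset.mul_sum]
  simp only [e]
  refine finsum_eq_sum_of_support_subset _ fun k hk => ?_
  rw [Finset.coe_range]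
  by_contra hh
  rw [Function.mem_support, hK k (not_lt.1 hh)] at hk
  simp at hk

theorem IsWall.added_nonneg (hn : 4 ≤ n) (h : IsWall a M Y) (K : ℕ) : 0 ≤ added a M K i := by
  refine Finset.sum_nonneg fun k _ => sub_nonneg.2 ?_
  obtain ⟨l1, l2, l3⟩ := h.le_ground k
  exact missing_mono hn l1 l2 fun b r _ => l3 b r

/-- The number of `i`-blocks that have been added. -/
noncomputable def blockCount (a : Fin (n + 1) → ℕ) (Y : Columns (level a)) (i : ℕ) : ℕ :=
  (addedHalves a i Y / 2).toNat

theorem IsWall.blockCount_eq (hn : 4 ≤ n) (h : IsWall a M Y) (hi : i ≤ n) {K : ℕ}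
    (hK : ∀ k ≥ K, M k = groundState a) : (blockCount a Y i : ℤ) = added a M K i := by
  have := h.addedHalves_eq hn hi hK
  have := h.added_nonneg (i := i) hn K
  unfold blockCount
  omega

theorem added_update_f (hn : 4 ≤ n) (hi : i ≤ n) {j : ℕ} (hj : j ≤ n) {k K : ℕ} (hk : k < K) :
    added a (Function.update M k ((M k).f n k i)) K j =
      added a M K j + if i = j then 1 else 0 := by
  have hk' : k ∈ Finset.range K := Finset.mem_range.2 hk
  rw [added, added, ← Finset.add_sum_erase _ _ hk', ← Finset.add_sum_erase (Finset.range K)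
    (fun k => (groundState a).missing n k j - (M k).missing n k j) hk']
  rw [Finset.sum_congr rfl (g := fun k => (groundState a).missing n k j - (M k).missing n k j)
    fun x hx => by rw [Function.update_of_ne (Finset.ne_of_mem_erase hx)]]
  rw [Function.update_self, missing_f hn hi _ hj]
  ring

/-! ### Signatures of walls -/

theorem IsWall.eps_eq (hn : 4 ≤ n) (h : IsWall a M Y) (hi : i ≤ n) (k : ℕ) :
    (sliceEps n k i (Y k) : ℤ) = (M k).eps n k i :=
  sliceEps_eq hn hi (h.slice k) (h.encodes k)

theorem IsWall.phi_eq (hn : 4 ≤ n) (h : IsWall a M Y) (hi : i ≤ n) (k : ℕ) :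
    (slicePhi n k i (Y k) : ℤ) = (M k).phi n k i :=
  slicePhi_eq hn hi (h.slice k) (h.encodes k)

theorem IsWall.eventually (hn : 4 ≤ n) (h : IsWall a M Y) (hi : i ≤ n) {K : ℕ}
    (hK : ∀ k ≥ K, M k = groundState a) :
    ∀ k ≥ K, slicePhi n (k + 1) i (Y (k + 1)) = sliceEps n k i (Y k) := by
  intro k hk
  have e1 := h.eps_eq hn hi k
  have e2 := h.phi_eq hn hi (k + 1)
  rw [hK k hk] at e1
  rw [hK (k + 1) (by omega)] at e2
  have := (groundState_phi_eps a hn hi k).1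
  omega

/-- The heights in the `i`-signature. -/
noncomputable abbrev wallHeight (n i : ℕ) {l : ℕ} (Y : Columns l) : ℕ → ℤ :=
  height (fun k => sliceEps n k i (Y k)) (fun k => slicePhi n k i (Y k))

/-- The height changes from column to column by `phi_sub_eps`, up to the telescoping terms `φ`. For
the ground state the same sum is `a_i` throughout, and the difference of the two is the Cartan
combination of the added blocks. -/
theorem IsWall.height_eq (hn : 4 ≤ n) (h : IsWall a M Y) (hi : i ≤ n) {K : ℕ}
    (hK : ∀ k ≥ K, M k = groundState a) : wallHeight n i Y K =
      coeff a i - ∑ j ∈ Finset.range (n + 1), cartan n i j * added a M K j := by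
  have hg := groundState_isSliceState a hn
  have key : ∀ k, wallHeight n i Y k - (M k).phi n k i =
      coeff a i - (groundState a).phi n k i -
        ∑ j ∈ Finset.range (n + 1), cartan n i j * added a M k j := by
    intro k
    induction k with
    | zero =>
      rw [wallHeight, height_zero, h.phi_eq hn hi, (groundState_phi_eps a hn hi 0).2]
      simp [added]
    | succ k ih =>
      rw [wallHeight, height_succ, h.phi_eq hn hi, h.eps_eq hn hi]
      have e1 := phi_sub_eps (k := k) hn hi (h.slice k).toIsConfig
      have e2 := phi_sub_eps (k := k) hn hi hg.toIsConfig
      have e3 := (groundState_phi_eps a hn hi k).1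
      have e4 : ∑ j ∈ Finset.range (n + 1), cartan n i j * added a M (k + 1) j =
          ∑ j ∈ Finset.range (n + 1), cartan n i j * added a M k j +
          (∑ j ∈ Finset.range (n + 1), cartan n i j * (groundState a).missing n k j -
            ∑ j ∈ Finset.range (n + 1), cartan n i j * (M k).missing n k j) := by
        rw [← Finset.sum_sub_distrib, ← Finset.sum_add_distrib]
        refine Finset.sum_congr rfl fun j _ => ?_
        rw [added, added, Finset.sum_range_succ]
        ring
      rw [e4]
      unfold wallHeight at ih
      linarith
  have := key K
  rw [hK K le_rfl] at this
  linarith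

theorem IsWall.card_sig (hn : 4 ≤ n) (h : IsWall a M Y) (hi : i ≤ n) {k K : ℕ}
    (hk : ∀ j, wallHeight n i Y j ≤ wallHeight n i Y k) (hK : ∀ k ≥ K, M k = groundState a) :
    ((sigZeros n i Y).Finite ∧ ((sigZeros n i Y).ncard : ℤ) = wallHeight n i Y k) ∧
    ((sigOnes n i Y).Finite ∧
      ((sigOnes n i Y).ncard : ℤ) = wallHeight n i Y k - wallHeight n i Y K) :=
  ⟨card_survivingZeros hk, card_survivingOnes hk (height_stable (h.eventually hn hi hK))⟩

theorem wallF_eq {l : ℕ} {Y : Columns l} {k : ℕ}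
    (hk : IsFirstMax (fun k => sliceEps n k i (Y k)) (fun k => slicePhi n k i (Y k)) k) :
    (0 < slicePhi n k i (Y k) ∧ 0 < wallHeight n i Y k →
      wallF n i Y = (sliceF n k i (Y k)).map (Function.update Y k)) ∧
    (¬ (0 < slicePhi n k i (Y k) ∧ 0 < wallHeight n i Y k) → wallF n i Y = none) := by
  have hp := fun p => leftmost_iff hk (p := p)
  unfold wallF
  constructor
  · intro h0
    have hex : ∃ p ∈ sigZeros n i Y, ∀ q ∈ sigZeros n i Y, q ≠ p → LeftOf p q :=
      ⟨_, (hp _).2 ⟨h0.1, h0.2, rfl⟩⟩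
    have e := ((hp _).1 hex.choose_spec).2.2
    rw [dif_pos hex]
    generalize hex.choose = p at e
    subst e
    rfl
  · intro h0
    rw [dif_neg]
    rintro ⟨p, h⟩
    have := (hp p).1 h
    exact h0 ⟨this.1, this.2.1⟩

theorem wallE_eq {l : ℕ} {Y : Columns l} {k : ℕ}
    (hk : IsLastMax (fun k => sliceEps n k i (Y k)) (fun k => slicePhi n k i (Y k)) k) :
    0 < sliceEps n k i (Y k) ∧ wallE n i Y = (sliceE n k i (Y k)).map (Function.update Y k) := by
  have hp := fun p => rightmost_iff hk (p := p)
  have hpos : 0 < sliceEps n k i (Y k) := by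
    have := hk.lt (k + 1) (by omega)
    rw [height_succ] at this
    omega
  refine ⟨hpos, ?_⟩
  unfold wallE
  have hex : ∃ p ∈ sigOnes n i Y, ∀ q ∈ sigOnes n i Y, q ≠ p → LeftOf q p :=
    ⟨_, (hp _).2 ⟨hpos, rfl⟩⟩
  have e := ((hp _).1 hex.choose_spec).2
  rw [dif_pos hex]
  generalize hex.choose = p at e
  subst e
  rfl

theorem wallE_eq_none {l : ℕ} {Y : Columns l} (h : sigOnes n i Y = ∅) : wallE n i Y = none := by
  unfold wallE
  rw [dif_neg]
  rintro ⟨p, hp, -⟩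
  rw [h] at hp
  exact hp

/-! ### The operators on walls -/

theorem IsWall.update (h : IsWall a M Y) {k : ℕ} {m : State} {C : Layers (level a)}
    (hm : IsSliceState n (level a) m) (hC : m.Encodes n C) (h1 : (M (k + 1)).Rel n m)
    (h2 : ∀ j, j + 1 = k → m.Rel n (M j)) :
    IsWall a (Function.update M k m) (Function.update Y k C) where
  slice j := by
    rcases eq_or_ne j k with rfl | hj
    · rwa [Function.update_self]
    · rw [Function.update_of_ne hj]; exact h.slice j
  encodes j := by
    rcases eq_or_ne j k with rfl | hj
    · rwa [Function.update_self, Function.update_self]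
    · rw [Function.update_of_ne hj, Function.update_of_ne hj]; exact h.encodes j
  rel j := by
    rcases eq_or_ne j k with rfl | hj
    · rwa [Function.update_self, Function.update_of_ne (by omega)]
    · rw [Function.update_of_ne hj]
      rcases eq_or_ne (j + 1) k with rfl | hj'
      · rw [Function.update_self]; exact h2 j rfl
      · rw [Function.update_of_ne hj']; exact h.rel j
  stable := by
    obtain ⟨K, hK⟩ := h.stable
    exact ⟨max K (k + 1), fun j hj => by
      rw [Function.update_of_ne (by omega), hK j (by omega)]⟩

/-- `Y'` is obtained from `Y` by acting with `f̃_i` on the column `k`. -/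
structure WallStep (n i k : ℕ) (a : Fin (n + 1) → ℕ) (M M' : ℕ → State)
    (Y Y' : Columns (level a)) : Prop where
  wall : IsWall a M Y
  wall' : IsWall a M' Y'
  state : M' = Function.update M k ((M k).f n k i)
  left : wallF n i Y = some Y'
  right : wallE n i Y' = some Y
  first : IsFirstMax (fun k => sliceEps n k i (Y k)) (fun k => slicePhi n k i (Y k)) k
  last : IsLastMax (fun k => sliceEps n k i (Y' k)) (fun k => slicePhi n k i (Y' k)) k
  heights : ∀ j, wallHeight n i Y' j = wallHeight n i Y j -
    if j < k then 0 else if j = k then 1 else 2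

/-- A step on the level of boundaries is a step on the level of walls. -/
theorem wallStep_of_state (hn : 4 ≤ n) (hi : i ≤ n) {M' : ℕ → State} {Y' : Columns (level a)}
    (h : IsWall a M Y) (h' : IsWall a M' Y') {k : ℕ} (h0 : 0 < (M k).phi n k i)
    (hM : M' = Function.update M k ((M k).f n k i)) (hY : ∀ j ≠ k, Y' j = Y j)
    (hmax : IsFirstMax (fun k => sliceEps n k i (Y k)) (fun k => slicePhi n k i (Y k)) k ∨
      IsLastMax (fun k => sliceEps n k i (Y' k)) (fun k => slicePhi n k i (Y' k)) k) :
    WallStep n i k a M M' Y Y' := by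
  obtain ⟨g1, g2, g3, g4⟩ := (h.slice k).f hn h0
  have hMk : M' k = (M k).f n k i := by rw [hM, Function.update_self]
  have hε : ∀ j ≠ k, sliceEps n j i (Y' j) = sliceEps n j i (Y j) := fun j hj => by rw [hY j hj]
  have hφ : ∀ j ≠ k, slicePhi n j i (Y' j) = slicePhi n j i (Y j) := fun j hj => by rw [hY j hj]
  have d1 := h.eps_eq hn hi k
  have d2 := h.phi_eq hn hi k
  have d3 := h'.eps_eq hn hi k
  have d4 := h'.phi_eq hn hi k
  rw [hMk] at d3 d4
  have hfirst : IsFirstMax (fun k => sliceEps n k i (Y k)) (fun k => slicePhi n k i (Y k)) k :=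
    hmax.elim id fun hl => hl.isFirstMax (fun j hj => (hε j hj).symm) (fun j hj => (hφ j hj).symm)
      (by omega) (by omega)
  have hlast : IsLastMax (fun k => sliceEps n k i (Y' k)) (fun k => slicePhi n k i (Y' k)) k :=
    hfirst.isLastMax hε hφ (by omega) (by omega)
  have hheights : ∀ j, wallHeight n i Y' j = wallHeight n i Y j -
      if j < k then 0 else if j = k then 1 else 2 := by
    intro j
    rw [wallHeight, height_update (k := k) (d := -1) hε hφ (by omega)
      (by omega)]
    split_ifs <;> ring
  have hYk : Y' = Function.update Y k (Y' k) := by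
    ext1 j
    rcases eq_or_ne j k with rfl | hj
    · rw [Function.update_self]
    · rw [Function.update_of_ne hj, hY j hj]
  have hYk' : Y = Function.update Y' k (Y k) := by
    ext1 j
    rcases eq_or_ne j k with rfl | hj
    · rw [Function.update_self]
    · rw [Function.update_of_ne hj, hY j hj]
  refine ⟨h, h', hM, ?_, ?_, hfirst, hlast, hheights⟩
  -- After the step the maximum is one less and still non-negative, as the maximum of every such
  -- walk is.
  · have hpos : 0 < wallHeight n i Y k := by
      have := height_nonneg_of_max hlast.le
      have e := hheights k
      rw [if_neg (lt_irrefl k), if_pos rfl] at e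
      unfold wallHeight at e ⊢
      omega
    rw [(wallF_eq hfirst).1 ⟨by omega, hpos⟩]
    obtain ⟨C, hC, eC⟩ := (sliceF_spec (k := k) hn hi (h.slice k) (h.encodes k)).1 h0
    have := h'.encodes k
    rw [hMk] at this
    rw [hC, Option.map_some, State.Encodes.ext g1.toIsLoose eC this, ← hYk]
  · rw [(wallE_eq hlast).2]
    have henc := h'.encodes k
    rw [hMk] at henc
    obtain ⟨C, hC, eC⟩ := (sliceE_spec (k := k) hn hi g1 henc).1 (by
      have := (h.slice k).eps_nonneg (k := k) (i := i) hn
      omega)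
    rw [g4] at eC
    rw [hC, Option.map_some, State.Encodes.ext (h.slice k).toIsLoose eC (h.encodes k), ← hYk']

theorem IsWall.wallF_cases (hn : 4 ≤ n) (hi : i ≤ n) (h : IsWall a M Y) :
    wallF n i Y = none ∨ ∃ k M' Y', WallStep n i k a M M' Y Y' := by
  obtain ⟨K, hK⟩ := h.stable
  obtain ⟨k, hk⟩ := exists_firstMax (ε := fun k => sliceEps n k i (Y k))
    (φ := fun k => slicePhi n k i (Y k)) (h.eventually hn hi hK)
  by_cases h0 : 0 < slicePhi n k i (Y k) ∧ 0 < wallHeight n i Y k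
  swap
  · exact .inl ((wallF_eq hk).2 h0)
  have e0 := h.phi_eq hn hi k
  have hpos : 0 < (M k).phi n k i := by omega
  obtain ⟨g1, -⟩ := (h.slice k).f hn hpos
  obtain ⟨C, -, hC⟩ := (sliceF_spec (k := k) hn hi (h.slice k) (h.encodes k)).1 hpos
  have hw := h.update (k := k) g1 hC
    ((h.rel k).f_right hn (h.slice _) (h.slice _) hpos) (by
      rintro j rfl
      refine (h.rel j).f_left hn (h.slice _) (h.slice _) ?_
      -- That column `j` just before the first maximum is strictly lower means `ε` of `j` is less
      -- than `φ` of `j + 1`, the condition of `State.Rel.f_left`.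
      have := hk.lt j (by omega)
      rw [height_succ] at this
      have := h.eps_eq hn hi j
      omega)
  exact .inr ⟨k, _, _, wallStep_of_state hn hi h hw hpos rfl
    (fun j hj => Function.update_of_ne hj _ _) (.inl hk)⟩

theorem IsWall.wallE_cases (hn : 4 ≤ n) (hi : i ≤ n) (h : IsWall a M Y) :
    wallE n i Y = none ∨ ∃ k M' Y', WallStep n i k a M' M Y' Y := by
  obtain ⟨K, hK⟩ := h.stable
  obtain ⟨k₀, hk₀⟩ := exists_max (ε := fun k => sliceEps n k i (Y k))
    (φ := fun k => slicePhi n k i (Y k)) (h.eventually hn hi hK)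
  have hev := h.eventually hn hi hK
  rcases (hk₀ K).lt_or_eq with hlt | heq
  swap
  -- If the maximum equals the final height, no letter `1` survives.
  · refine .inl (wallE_eq_none ?_)
    obtain ⟨-, c1, c2⟩ := h.card_sig hn hi hk₀ hK
    rw [← Set.ncard_eq_zero c1]
    unfold wallHeight at c2
    omega
  obtain ⟨k, hk⟩ := exists_lastMax hev hk₀ hlt
  have e0 := h.eps_eq hn hi k
  have hpos : 0 < (M k).eps n k i := by have := (wallE_eq hk).1; omega
  obtain ⟨g1, g2, -, g4⟩ := (h.slice k).e hn hpos
  obtain ⟨C, -, hC⟩ := (sliceE_spec (k := k) hn hi (h.slice k) (h.encodes k)).1 hpos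
  have hw := h.update (k := k) g1 hC
    ((h.rel k).e_right hn (h.slice _) (h.slice _) (by
      -- Dually, the strict descent after the last maximum is the condition of `State.Rel.e_right`.
      have := hk.lt (k + 1) (by omega)
      rw [height_succ] at this
      have := h.phi_eq hn hi (k + 1)
      omega)) (by
      rintro j rfl
      exact (h.rel j).e_left hn (h.slice _) (h.slice _) hpos)
  refine .inr ⟨k, _, _, wallStep_of_state hn hi hw h (k := k) ?_ ?_
    (fun j hj => (Function.update_of_ne hj _ _).symm) (.inr hk)⟩
  · rw [Function.update_self, g2]
    have := (h.slice k).phi_nonneg (k := k) (i := i) hn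
    omega
  · rw [Function.update_self, g4, Function.update_idem, Function.update_eq_self]

theorem WallStep.card (hn : 4 ≤ n) (hi : i ≤ n) {k : ℕ} {M' : ℕ → State} {Y' : Columns (level a)}
    (s : WallStep n i k a M M' Y Y') :
    (sigZeros n i Y').ncard + 1 = (sigZeros n i Y).ncard ∧
    (sigOnes n i Y').ncard = (sigOnes n i Y).ncard + 1 := by
  obtain ⟨K, hK⟩ := s.wall.stable
  obtain ⟨K', hK'⟩ := s.wall'.stable
  have c1 := s.wall.card_sig hn hi s.first.le (K := K + K' + k + 1) fun j hj => hK j (by omega)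
  have c2 := s.wall'.card_sig hn hi s.last.le (K := K + K' + k + 1) fun j hj => hK' j (by omega)
  have e1 := s.heights k
  have e2 := s.heights (K + K' + k + 1)
  rw [if_neg (lt_irrefl k), if_pos rfl] at e1
  rw [if_neg (by omega), if_neg (by omega)] at e2
  obtain ⟨⟨-, c1⟩, -, c1'⟩ := c1
  obtain ⟨⟨-, c2⟩, -, c2'⟩ := c2
  omega

theorem WallStep.blockCount (hn : 4 ≤ n) (hi : i ≤ n) {k : ℕ} {M' : ℕ → State}
    {Y' : Columns (level a)} (s : WallStep n i k a M M' Y Y') {j : ℕ} (hj : j ≤ n) :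
    (blockCount a Y' j : ℤ) = blockCount a Y j + if i = j then 1 else 0 := by
  obtain ⟨K, hK⟩ := s.wall.stable
  obtain ⟨K', hK'⟩ := s.wall'.stable
  rw [s.wall.blockCount_eq hn hj (K := K + K' + k + 1) fun j hj => hK j (by omega),
    s.wall'.blockCount_eq hn hj (K := K + K' + k + 1) fun j hj => hK' j (by omega), s.state,
    added_update_f hn hi hj (by omega)]

end


theorem exists_subtype_option {α : Type*} {p : α → Prop} {x : Option α} (h : ∀ y, x = some y → p y) :
    ∃ o : Option {y // p y}, o.map Subtype.val = x := by
  cases x with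
  | none => exact ⟨none, rfl⟩
  | some y => exact ⟨some ⟨y, h y rfl⟩, rfl⟩

theorem eq_some_iff_of_map {α : Type*} {p : α → Prop} {o : Option {y // p y}} {x : Option α}
    (h : o.map Subtype.val = x) (y : {y // p y}) : o = some y ↔ x = some y.1 := by
  subst h
  cases o with
  | none => simp
  | some z => simp [Subtype.ext_iff]

end YoungWallD

open YoungWallD in
theorem mainTheorem5 (n l : ℕ) (hn : 4 ≤ n) (a : Fin (n + 1) → ℕ)
    (hl : l = YoungWallD.level a) :
    ∃ (k : YoungWallD.ProperWallsOn l a → Fin (n + 1) → ℕ)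
      (B : YoungWallD.AffineCrystal n (YoungWallD.ProperWallsOn l a)),
      (∀ Y i, 2 * (k Y i : ℤ) = YoungWallD.addedHalves a i Y.1) ∧
      (∀ Y, B.wt Y =
        YoungWallD.dominantWeight a - ∑ i, (k Y i : ℤ) • YoungWallD.simpleRoot n i) ∧
      (∀ (i : Fin (n + 1)) Y, (B.e i Y).map Subtype.val = YoungWallD.wallE n i Y.1) ∧
      (∀ (i : Fin (n + 1)) Y, (B.f i Y).map Subtype.val = YoungWallD.wallF n i Y.1) ∧
      (∀ (i : Fin (n + 1)) Y, (YoungWallD.sigOnes n i Y.1).Finite ∧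
        B.eps i Y = (((YoungWallD.sigOnes n i Y.1).ncard : ℤ) : WithBot ℤ)) ∧
      (∀ (i : Fin (n + 1)) Y, (YoungWallD.sigZeros n i Y.1).Finite ∧
        B.phi i Y = (((YoungWallD.sigZeros n i Y.1).ncard : ℤ) : WithBot ℤ)) := by
  subst hl
  have hi : ∀ i : Fin (n + 1), (i : ℕ) ≤ n := fun i => Nat.lt_succ_iff.1 i.2
  have wall : ∀ Y : ProperWallsOn (level a) a, ∃ M, IsWall a M Y.1 := fun Y =>
    (mem_properWallsOn hn).1 Y.2
  have fstep : ∀ (i : Fin (n + 1)) (Y : ProperWallsOn (level a) a) (Z : Columns (level a)),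
      wallF n i Y.1 = some Z → ∃ k M M', WallStep n i k a M M' Y.1 Z := by
    intro i Y Z hZ
    obtain ⟨M, hM⟩ := wall Y
    rcases hM.wallF_cases hn (hi i) with h | ⟨k, M', Z', h⟩
    · rw [h] at hZ; cases hZ
    · rw [h.left, Option.some.injEq] at hZ
      subst hZ
      exact ⟨k, M, M', h⟩
  have estep : ∀ (i : Fin (n + 1)) (Y : ProperWallsOn (level a) a) (Z : Columns (level a)),
      wallE n i Y.1 = some Z → ∃ k M M', WallStep n i k a M M' Z Y.1 := by
    intro i Y Z hZ
    obtain ⟨M, hM⟩ := wall Y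
    rcases hM.wallE_cases hn (hi i) with h | ⟨k, M', Z', h⟩
    · rw [h] at hZ; cases hZ
    · rw [h.right, Option.some.injEq] at hZ
      subst hZ
      exact ⟨k, M', M, h⟩
  choose f hf using fun (i : Fin (n + 1)) (Y : ProperWallsOn (level a) a) =>
    exists_subtype_option (p := (· ∈ ProperWallsOn (level a) a)) (x := wallF n i Y.1) fun Z hZ => by
      obtain ⟨k, M, M', h⟩ := fstep i Y Z hZ
      exact (mem_properWallsOn hn).2 ⟨M', h.wall'⟩
  choose e he using fun (i : Fin (n + 1)) (Y : ProperWallsOn (level a) a) =>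
    exists_subtype_option (p := (· ∈ ProperWallsOn (level a) a)) (x := wallE n i Y.1) fun Z hZ => by
      obtain ⟨k, M, M', h⟩ := estep i Y Z hZ
      exact (mem_properWallsOn hn).2 ⟨M, h.wall⟩
  have hf' := fun i Y Z => eq_some_iff_of_map (hf i Y) Z
  have he' := fun i Y Z => eq_some_iff_of_map (he i Y) Z
  have hfe : ∀ (i : Fin (n + 1)) (Y Z : ProperWallsOn (level a) a),
      f i Y = some Z ↔ e i Z = some Y := by
    intro i Y Z
    rw [hf', he']
    constructor
    · intro h
      obtain ⟨k, M, M', s⟩ := fstep i Y _ h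
      exact s.right
    · intro h
      obtain ⟨k, M, M', s⟩ := estep i Z _ h
      exact s.left
  let wt : ProperWallsOn (level a) a → Weight n := fun Y =>
    dominantWeight a - ∑ i : Fin (n + 1), (blockCount a Y.1 i : ℤ) • simpleRoot n i
  have wtf : ∀ (i : Fin (n + 1)) (Y Z : ProperWallsOn (level a) a), f i Y = some Z →
      wt Z = wt Y - simpleRoot n i := by
    intro i Y Z h
    rw [hf'] at h
    obtain ⟨k, M, M', s⟩ := fstep i Y _ h
    have e : ∀ j : Fin (n + 1), (blockCount a Z.1 j : ℤ) • simpleRoot n j =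
        (blockCount a Y.1 j : ℤ) • simpleRoot n j + if i = j then simpleRoot n j else 0 := by
      intro j
      rw [s.blockCount hn (hi i) (hi j), add_smul]
      congr 1
      by_cases hij : i = j
      · subst hij; simp
      · have : (i : ℕ) ≠ j := fun h => hij (Fin.ext h)
        simp [hij, this]
    simp only [wt, e, Finset.sum_add_distrib, Finset.sum_ite_eq, Finset.mem_univ, if_true]
    abel
  have cardf : ∀ (i : Fin (n + 1)) (Y Z : ProperWallsOn (level a) a), f i Y = some Z →
      (sigZeros n i Z.1).ncard + 1 = (sigZeros n i Y.1).ncard ∧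
      (sigOnes n i Z.1).ncard = (sigOnes n i Y.1).ncard + 1 := by
    intro i Y Z h
    rw [hf'] at h
    obtain ⟨k, M, M', s⟩ := fstep i Y _ h
    exact s.card hn (hi i)
  have fin : ∀ (i : Fin (n + 1)) (Y : ProperWallsOn (level a) a),
      (sigZeros n i Y.1).Finite ∧ (sigOnes n i Y.1).Finite ∧
      ((sigZeros n i Y.1).ncard : ℤ) = (sigOnes n i Y.1).ncard + pairing i (wt Y) := by
    intro i Y
    obtain ⟨M, hM⟩ := wall Y
    obtain ⟨K, hK⟩ := hM.stable
    obtain ⟨k, hk⟩ := exists_max (ε := fun k => sliceEps n k i (Y.1 k))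
      (φ := fun k => slicePhi n k i (Y.1 k)) (hM.eventually hn (hi i) hK)
    obtain ⟨⟨c1, c2⟩, c3, c4⟩ := hM.card_sig hn (hi i) hk hK
    refine ⟨c1, c3, ?_⟩
    -- The number of surviving `0`s minus that of surviving `1`s is the final height of the walk,
    -- which is the pairing with the weight.
    have e := hM.height_eq hn (hi i) hK
    have e' : pairing i (wt Y) = coeff a i -
        ∑ j ∈ Finset.range (n + 1), cartan n i j * added a M K j := by
      have h1 : coeff a i = a i := dif_pos i.2
      rw [h1, ← Fin.sum_univ_eq_sum_range (fun j => cartan n i j * added a M K j)]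
      simp only [pairing, wt, dominantWeight, simpleRoot, Prod.fst_sub, Prod.fst_sum, Prod.smul_mk,
        Pi.sub_apply, Finset.sum_apply, Pi.smul_apply, smul_eq_mul]
      congr 1
      refine Finset.sum_congr rfl fun j _ => ?_
      rw [hM.blockCount_eq hn (hi j) hK, mul_comm]
    rw [e', ← e]
    omega
  refine ⟨fun Y i => blockCount a Y.1 i, ⟨wt, e, f,
    fun i Y => (((sigOnes n i Y.1).ncard : ℤ) : WithBot ℤ),
    fun i Y => (((sigZeros n i Y.1).ncard : ℤ) : WithBot ℤ), ?_, ?_, wtf, ?_, ?_, ?_, ?_, hfe, ?_⟩,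
    ?_, fun Y => rfl, he, hf, fun i Y => ⟨(fin i Y).2.1, rfl⟩, fun i Y => ⟨(fin i Y).1, rfl⟩⟩
  · intro i Y
    exact_mod_cast (fin i Y).2.2
  · intro i Y Z h
    rw [wtf i Z Y ((hfe _ _ _).2 h), sub_add_cancel]
  · intro i Y Z h
    exact_mod_cast (cardf i Z Y ((hfe _ _ _).2 h)).2.symm
  · intro i Y Z h
    exact_mod_cast (cardf i Z Y ((hfe _ _ _).2 h)).1.symm
  · intro i Y Z h
    exact_mod_cast (cardf i Y Z h).2
  · intro i Y Z h
    exact_mod_cast (cardf i Y Z h).1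
  · intro i Y h
    exact absurd h WithBot.coe_ne_bot
  · intro Y i
    obtain ⟨M, hM⟩ := wall Y
    obtain ⟨K, hK⟩ := hM.stable
    rw [hM.blockCount_eq hn (hi i) hK, hM.addedHalves_eq hn (hi i) hK]
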